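/- For a finite simple graph $G$ and a map $\phi:V(G)\to\{1,2\}$ (a 2-coloring, not necessarily proper), the monochromatic components of $\phi$ are the vertex sets of the connected components of $G[\phi^{-1}(1)]$ and of $G[\phi^{-1}(2)]$, and the cost of $\phi$ is $\sum_X(|X|-1)$, the sum being over all monochromatic components $X$ of $\phi$. For disjoint $T_1,T_2\subseteq V(G)$, a $(T_1,T_2)$-extension is a 2-coloring $\phi$ with $\phi=1$ on $T_1$ and $\phi=2$ on $T_2$. An instance of Cheap Coloring Extension consists of a finite simple bipartite graph $G$ on the vertices $0,\dots,n-1$, integers $k,t\ge 0$, and disjoint sets $T_1,T_2\subseteq V(G)$ with $|T_1|+|T_2|\le t$; the task is to output a $(T_1,T_2)$-extension of cost at most $k$, or to report that none exists. Theorem. Cheap Coloring Extension can be solved in time $f(k,t)\cdot n^{O(1)}$. That is, there are a single algorithm, a computable function $f:\mathbb N^2\to\mathbb N$ and a constant $c$ such that on every instance $(G,k,t,T_1,T_2)$ with $n$ vertices the algorithm halts within $f(k,t)\cdot\max(n,1)^c$ steps with a correct answer. Here an algorithm is a program of a random access machine with unit-cost addition, truncated subtraction, constants, indirect loads and stores,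 conditionals, loops and procedure calls (and no multiplication), and $G$ is given by its adjacency matrix. -/

import Mathlib

/-! ### Colorings, cost and extensions -/

/-- A `2`-coloring of a graph on `V`: any map from `V` to the two colors, not necessarily proper.
The colors called `1` and `2` in the text are the elements `0` and `1` of `Fin 2`. -/
abbrev TwoColoring (V : Type*) : Type _ := V → Fin 2

open Classical in
/-- The cost of a `2`-coloring `φ` of `G`: the sum of `|X| - 1` over all monochromatic components
`X` of `φ`, that is, over the connected components `X` of the two subgraphs of `G` that are induced
by the two color classes. -/
noncomputable def TwoColoring.cost {V : Type*} [Fintype V] (G : SimpleGraph V)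
    (φ : TwoColoring V) : ℕ :=
  ∑ c : Fin 2, ∑ X : (G.induce {v | φ v = c}).ConnectedComponent, (Nat.card X.supp - 1)

/-- `φ` is a `(T₁, T₂)`-extension: every vertex of `T₁` has color `1` and every vertex of `T₂` has
color `2`. -/
def TwoColoring.IsExtension {V : Type*} (T₁ T₂ : Finset V) (φ : TwoColoring V) : Prop :=
  (∀ v ∈ T₁, φ v = 0) ∧ (∀ v ∈ T₂, φ v = 1)

/-- An instance `(G, k, t, T₁, T₂)` of Cheap Coloring Extension. The vertices of the input graph
are numbered `0, …, n - 1`. -/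
structure CheapColoringExtension where
  n : ℕ
  G : SimpleGraph (Fin n)
  k : ℕ
  t : ℕ
  T₁ : Finset (Fin n)
  T₂ : Finset (Fin n)
  bipartite : G.IsBipartite
  disjoint : Disjoint T₁ T₂
  card_le : T₁.card + T₂.card ≤ t

/-- `φ` is a solution of the instance: a `(T₁, T₂)`-extension of cost at most `k`. -/
def CheapColoringExtension.IsSolution (I : CheapColoringExtension)
    (φ : TwoColoring (Fin I.n)) : Prop :=
  φ.IsExtension I.T₁ I.T₂ ∧ φ.cost I.G ≤ I.k

/-! ### Random access machines

The machine has registers, addressed directly by the program, and a memory, addressed indirectly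
through registers; both hold natural numbers. Every elementary operation costs one step. There is
addition and truncated subtraction, but no multiplication, no shift and no bitwise operation, so
that the lengths of the numbers grow by at most one bit per step. -/

namespace RAM

/-- Statements of the machine's programming language. -/
inductive Stmt where
  /-- do nothing -/
  | nop : Stmt
  /-- `reg r := c` -/
  | const (r c : ℕ) : Stmt
  /-- `reg r := reg s` -/
  | copy (r s : ℕ) : Stmt
  /-- `reg r := reg s + reg q` -/
  | add (r s q : ℕ) : Stmt
  /-- `reg r := reg s - reg q`, truncated at `0` -/
  | sub (r s q : ℕ) : Stmt
  /-- `reg r := mem (reg a)` -/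
  | load (r a : ℕ) : Stmt
  /-- `mem (reg a) := reg r` -/
  | store (a r : ℕ) : Stmt
  /-- execute `p`, then `q` -/
  | seq (p q : Stmt) : Stmt
  /-- execute `p` if `reg r ≠ 0`, and `q` otherwise -/
  | ite (r : ℕ) (p q : Stmt) : Stmt
  /-- execute `p` as long as `reg r ≠ 0` -/
  | loop (r : ℕ) (p : Stmt) : Stmt
  /-- execute the `i`-th procedure of the program and return -/
  | call (i : ℕ) : Stmt

/-- A program: a main statement and finitely many parameterless, possibly recursive procedures,
which act on the same registers and the same memory. -/
structure Program where
  main : Stmt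
  procs : List Stmt

/-- A configuration: the stack of statements still to be executed (the first one is next), the
contents of the registers and the contents of the memory. -/
structure Config where
  code : List Stmt
  reg : ℕ → ℕ
  mem : ℕ → ℕ

/-- One step of the machine. A configuration with nothing left to execute is halted and does not
change any more. Calling a procedure that does not exist has no effect. -/
def step (P : Program) : Config → Config
  | ⟨[], R, M⟩ => ⟨[], R, M⟩
  | ⟨.nop :: K, R, M⟩ => ⟨K, R, M⟩
  | ⟨.const r c :: K, R, M⟩ => ⟨K, Function.update R r c, M⟩
  | ⟨.copy r s :: K, R, M⟩ => ⟨K, Function.update R r (R s), M⟩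
  | ⟨.add r s q :: K, R, M⟩ => ⟨K, Function.update R r (R s + R q), M⟩
  | ⟨.sub r s q :: K, R, M⟩ => ⟨K, Function.update R r (R s - R q), M⟩
  | ⟨.load r a :: K, R, M⟩ => ⟨K, Function.update R r (M (R a)), M⟩
  | ⟨.store a r :: K, R, M⟩ => ⟨K, R, Function.update M (R a) (R r)⟩
  | ⟨.seq p q :: K, R, M⟩ => ⟨p :: q :: K, R, M⟩
  | ⟨.ite r p q :: K, R, M⟩ => ⟨(if R r ≠ 0 then p else q) :: K, R, M⟩
  | ⟨.loop r p :: K, R, M⟩ => ⟨if R r ≠ 0 then p :: .loop r p :: K else K, R, M⟩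
  | ⟨.call i :: K, R, M⟩ => ⟨P.procs.getD i .nop :: K, R, M⟩

/-- The configuration after `T` steps of `P` from registers `R` and memory `M`. -/
def run (P : Program) (R M : ℕ → ℕ) (T : ℕ) : Config :=
  (step P)^[T] ⟨[P.main], R, M⟩

end RAM

/-! ### Input and output of an algorithm for Cheap Coloring Extension -/

/-- Initially, registers `0`, `1`, `2` hold `n`, `k`, `t`, and all other registers hold `0`. -/
def CheapColoringExtension.inputReg (I : CheapColoringExtension) (r : ℕ) : ℕ :=
  if r = 0 then I.n else if r = 1 then I.k else if r = 2 then I.t else 0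

open Classical in
/-- Initially, memory cell `v < n` holds `1` if `v ∈ T₁`, `2` if `v ∈ T₂`, and `0` otherwise; the
next `n²` cells hold the adjacency matrix of `G`, row by row; and all other cells hold `0`. -/
noncomputable def CheapColoringExtension.inputMem (I : CheapColoringExtension) (a : ℕ) : ℕ :=
  if ∃ v ∈ I.T₁, a = v.val then 1
  else if ∃ v ∈ I.T₂, a = v.val then 2
  else if ∃ u v : Fin I.n, a = I.n + u.val * I.n + v.val ∧ I.G.Adj u v then 1
  else 0

/-- A configuration gives a correct answer to the instance: either register `0` holds `1` and the
memory cells `0, …, n - 1` hold the colors (`1` or `2`) of the vertices in some solution, or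
register `0` holds `0` and there is no solution. -/
def CheapColoringExtension.IsCorrectOutput (I : CheapColoringExtension) (C : RAM.Config) : Prop :=
  (C.reg 0 = 1 ∧ ∃ φ : TwoColoring (Fin I.n), I.IsSolution φ ∧
      ∀ v : Fin I.n, C.mem v.val = (φ v).val + 1) ∨
    (C.reg 0 = 0 ∧ ¬ ∃ φ : TwoColoring (Fin I.n), I.IsSolution φ)

/-- Started on the instance `I`, the program `P` halts within `T` steps with a correct answer. -/
def RAM.Program.SolvesWithin (P : RAM.Program) (I : CheapColoringExtension) (T : ℕ) : Prop :=
  (RAM.run P I.inputReg I.inputMem T).code = [] ∧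
    I.IsCorrectOutput (RAM.run P I.inputReg I.inputMem T)

/-! Fix a bipartition `pa` of the graph and encode a coloring by the set `X` of vertices whose color
and side agree (color `1` with `pa v = 1`, color `2` with `pa v = 0`). An edge joins different
sides, so it is monochromatic exactly when it crosses `X`. The cost is `n` minus the number of
monochromatic components, that is, the rank of the crossing edges in the cycle matroid
(`cost_eq_rk`, `sol_iff`). The task becomes: find a cut of rank at most `k` that respects at most
`t` prescribed vertices. An edge set of rank `k` has at most `2k` end vertices (`card_ends_le`), so
only cuts with at most `K = 4k²` edges matter (`card_bd_le`).

Such a cut is found by recursive understanding. The vertices carry classes with the invariant that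
if a solution exists, then one exists that splits no class. Work goes on in a piece `U` that is
joined to the rest only through at most `tau` terminals `T`. If `U` has a cut with at most `K` edges
and more than `q` classes on both sides, the side with fewer terminals is again a piece
(`Piece.descend`). If the search meets no such cut, a small family of cuts of `U` is computed that
contains, for every solution in normal form, a cut that looks the same from outside: same trace on
`T`, same connectivity of `T`, same rank. Replacing one by the other preserves the rank of the whole
cut (`comps_exchange`, `Piece.exchange`). One cut per signature suffices, and there are at most `2 ^
(tau + k + tau²)` signatures, so merging the vertices that no kept cut separates leaves at most `q =
2 ^ 2 ^ (tau + k + tau²)` classes in `U` (`Piece.harden`). Since `U` had more than `q` classes or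
was everything, the pair (number of classes, classes of `U`) decreases lexicographically in every
round until at most `q` classes are left (`refine_spec`). Then all ways to distribute the classes
are tried.

The family is computed by guessing labels "inside" and "outside" for classes. The target is a
solution with fewest edges and then fewest vertices: moving a terminal-free union of classes across
it cannot pay off (`Good`, `Piece.exists_good`). Given labels, take the smallest minimum cut `M`
between the two kinds. Unless `M` is balanced, one of its sides has at most `q` classes; guess the
labels of that side and of its neighbors. Correct guesses either increase a bounded potential or
label all ends of the target's edges (`progress`), and in the latter case `M` is the target itself
(`eq_of_decided`). So a number of guessed bits that depends only on `k` and `t` is enough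
(`exists_guess`), and all bit strings are enumerated.

For the running time, the algorithm is written in a language of bounded loops. A program in it costs
at most `coef * B ^ depth` if all loop bounds are at most `B` (`cost_le`), and it compiles to the
machine within that cost (`Cmd.compile_spec`). Here `B` is a function of `k` and `t` times `max n
1`. -/

set_option linter.constructorNameAsVariable false
set_option linter.unusedSimpArgs false

/-! ### A language of bounded loops and its compilation to the machine -/

namespace Loop

/-- Names of the variables. -/
inductive Var
  | n | k | t | K | tau | sb | ns | q | D | L | NG | K1 | n1 | qK | q2
  | it | jt | g | d | r | i | u | v | w
  | cnt | x | p | J | rk | s | gp | cr | bal | stamp | found | ok | ca | cb | e | cM | cO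
  deriving DecidableEq

/-- Names of the arrays. -/
inductive Arr
  | ROW | CC | PA | CL | VP | TP | NC | G | LAB | QY | F | RE | PAR | QU | BM | SEEN | Y | OUT
  deriving DecidableEq

theorem Var.ctorIdx_injective : Function.Injective Var.ctorIdx := by
  intro x y h
  have := congrArg Var.ofNat h
  simpa [Var.ofNat_ctorIdx] using this

theorem Arr.ctorIdx_injective : Function.Injective Arr.ctorIdx := by
  intro x y h
  have := congrArg Arr.ofNat h
  simpa [Arr.ofNat_ctorIdx] using this

/-- The arrays are interleaved in memory: entry `i` of `A` lies at offset `32 * i + A.ctorIdx`.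
Indices below `32` keep the cells disjoint, and `32` is a power of two because the machine can
multiply only by doubling. -/
theorem Arr.ctorIdx_lt (A : Arr) : A.ctorIdx < 32 := by cases A <;> decide

/-- Expressions; comparisons have value `0` or `1`. -/
inductive Exp
  | lit (c : ℕ)
  | var (x : Var)
  | add (a b : Exp)
  | sub (a b : Exp)
  | lt (a b : Exp)
  | eq (a b : Exp)
  | and (a b : Exp)
  | get (A : Arr) (i : Exp)
  | inp (i : Exp)

/-- Statements; `loop x b p` executes `p` for `x = 0, …, b - 1`. -/
inductive Cmd
  | skip
  | set (x : Var) (e : Exp)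
  | put (A : Arr) (i e : Exp)
  | seq (p q : Cmd)
  | ite (e : Exp) (p q : Cmd)
  | loop (x : Var) (b : Var) (p : Cmd)

/-- Sequential composition of a list of statements. -/
def Cmd.block : List Cmd → Cmd
  | [] => .skip
  | [p] => p
  | p :: ps => .seq p (Cmd.block ps)

/-- Values of the variables and the arrays. -/
structure St where
  v : Var → ℕ
  a : Arr → ℕ → ℕ

def St.setV (σ : St) (x : Var) (c : ℕ) : St := ⟨Function.update σ.v x c, σ.a⟩

def St.setA (σ : St) (A : Arr) (i c : ℕ) : St :=
  ⟨σ.v, Function.update σ.a A (Function.update (σ.a A) i c)⟩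

@[simp] theorem St.setV_v (σ : St) (x : Var) (c : ℕ) (y : Var) :
    (σ.setV x c).v y = if y = x then c else σ.v y := by
  simp [St.setV, Function.update_apply]

@[simp] theorem St.setV_a (σ : St) (x : Var) (c : ℕ) : (σ.setV x c).a = σ.a := rfl

@[simp] theorem St.setA_v (σ : St) (A : Arr) (i c : ℕ) : (σ.setA A i c).v = σ.v := rfl

@[simp] theorem St.setA_a (σ : St) (A : Arr) (i c : ℕ) (B : Arr) (j : ℕ) :
    (σ.setA A i c).a B j = if B = A ∧ j = i then c else σ.a B j := by
  by_cases h : B = A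
  · subst h; simp [St.setA, Function.update_apply]
  · simp [St.setA, h]

/-- `f (m - 1) (… (f 0 σ))` -/
def iter (f : ℕ → St → St) : ℕ → St → St
  | 0, σ => σ
  | m + 1, σ => f m (iter f m σ)

section Semantics

variable (I : ℕ → ℕ)

@[simp] def Exp.eval (σ : St) : Exp → ℕ
  | .lit c => c
  | .var x => σ.v x
  | .add a b => a.eval σ + b.eval σ
  | .sub a b => a.eval σ - b.eval σ
  | .lt a b => if a.eval σ < b.eval σ then 1 else 0
  | .eq a b => if a.eval σ = b.eval σ then 1 else 0
  | .and a b => if a.eval σ ≠ 0 ∧ b.eval σ ≠ 0 then 1 else 0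
  | .get A i => σ.a A (i.eval σ)
  | .inp i => I (i.eval σ)

def Cmd.eval : Cmd → St → St
  | .skip, σ => σ
  | .set x e, σ => σ.setV x (e.eval I σ)
  | .put A i e, σ => σ.setA A (i.eval I σ) (e.eval I σ)
  | .seq p q, σ => q.eval (p.eval σ)
  | .ite e p q, σ => if e.eval I σ ≠ 0 then p.eval σ else q.eval σ
  | .loop x b p, σ => iter (fun j τ => p.eval (τ.setV x j)) (σ.v b) σ

@[simp] theorem eval_skip (σ : St) : Cmd.skip.eval I σ = σ := rfl
@[simp] theorem eval_set (x : Var) (e : Exp) (σ : St) :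
    (Cmd.set x e).eval I σ = σ.setV x (e.eval I σ) := rfl
@[simp] theorem eval_put (A : Arr) (i e : Exp) (σ : St) :
    (Cmd.put A i e).eval I σ = σ.setA A (i.eval I σ) (e.eval I σ) := rfl
@[simp] theorem eval_seq (p q : Cmd) (σ : St) :
    (Cmd.seq p q).eval I σ = q.eval I (p.eval I σ) := rfl
@[simp] theorem eval_ite (e : Exp) (p q : Cmd) (σ : St) :
    (Cmd.ite e p q).eval I σ = if e.eval I σ ≠ 0 then p.eval I σ else q.eval I σ := rfl
theorem eval_loop (x b : Var) (p : Cmd) (σ : St) :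
    (Cmd.loop x b p).eval I σ = iter (fun j τ => p.eval I (τ.setV x j)) (σ.v b) σ := rfl
@[simp] theorem eval_block_nil (σ : St) : (Cmd.block []).eval I σ = σ := rfl
@[simp] theorem eval_block_cons (p : Cmd) (ps : List Cmd) (σ : St) :
    (Cmd.block (p :: ps)).eval I σ = (Cmd.block ps).eval I (p.eval I σ) := by
  cases ps <;> rfl

/-! #### Frame properties -/

def Cmd.setsV : Cmd → Var → Bool
  | .skip, _ => false
  | .set x _, y => decide (y = x)
  | .put .., _ => false
  | .seq p q, y => p.setsV y || q.setsV y
  | .ite _ p q, y => p.setsV y || q.setsV y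
  | .loop x _ p, y => decide (y = x) || p.setsV y

def Cmd.setsA : Cmd → Arr → Bool
  | .skip, _ => false
  | .set .., _ => false
  | .put A .., B => decide (B = A)
  | .seq p q, B => p.setsA B || q.setsA B
  | .ite _ p q, B => p.setsA B || q.setsA B
  | .loop _ _ p, B => p.setsA B

/-- `σ'` differs from `σ` only in variables and arrays that `p` may change. -/
structure Frame (p : Cmd) (σ σ' : St) : Prop where
  v {y : Var} (h : p.setsV y = false) : σ'.v y = σ.v y
  a {B : Arr} (h : p.setsA B = false) : σ'.a B = σ.a B

theorem Frame.refl (p : Cmd) (σ : St) : Frame p σ σ := ⟨fun _ => rfl, fun _ => rfl⟩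

theorem Frame.trans {p : Cmd} {σ σ' σ'' : St} (h : Frame p σ σ') (h' : Frame p σ' σ'') :
    Frame p σ σ'' :=
  ⟨fun hy => (h'.v hy).trans (h.v hy), fun hy => (h'.a hy).trans (h.a hy)⟩

/-- Reduces every claim that a program leaves a variable or an array alone to a Boolean computation
on its syntax, which the later proofs close by `rfl`. -/
theorem frame (p : Cmd) : ∀ σ : St, Frame p σ (p.eval I σ) := by
  induction p with
  | skip => intro σ; exact Frame.refl _ _
  | set x e =>
    intro σ
    refine ⟨fun {y} h => ?_, fun _ => rfl⟩
    have : y ≠ x := by simpa [Cmd.setsV] using h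
    simp [this]
  | put A i e =>
    intro σ
    refine ⟨fun _ => rfl, fun {B} h => ?_⟩
    have : B ≠ A := by simpa [Cmd.setsA] using h
    funext j
    simp [this]
  | seq p q hp hq =>
    intro σ
    refine ⟨fun {y} h => ?_, fun {B} h => ?_⟩
    · simp only [Cmd.setsV, Bool.or_eq_false_iff] at h
      exact ((hq _).v h.2).trans ((hp _).v h.1)
    · simp only [Cmd.setsA, Bool.or_eq_false_iff] at h
      exact ((hq _).a h.2).trans ((hp _).a h.1)
  | ite e p q hp hq =>
    intro σ
    refine ⟨fun {y} h => ?_, fun {B} h => ?_⟩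
    · simp only [Cmd.setsV, Bool.or_eq_false_iff] at h
      rw [eval_ite]
      split_ifs
      · exact (hp _).v h.1
      · exact (hq _).v h.2
    · simp only [Cmd.setsA, Bool.or_eq_false_iff] at h
      rw [eval_ite]
      split_ifs
      · exact (hp _).a h.1
      · exact (hq _).a h.2
  | loop x b p hp =>
    intro σ
    rw [eval_loop]
    generalize σ.v b = m
    induction m with
    | zero => exact Frame.refl _ _
    | succ m ih =>
      refine ih.trans ⟨fun {y} h => ?_, fun {B} h => ?_⟩
      · simp only [Cmd.setsV, Bool.or_eq_false_iff, decide_eq_false_iff_not] at h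
        refine ((hp _).v h.2).trans ?_
        simp [h.1]
      · exact (hp _).a h

/-- The invariant rule for loops. -/
theorem loop_rule {x b : Var} {p : Cmd} (σ : St) (Inv : ℕ → St → Prop) (h0 : Inv 0 σ)
    (hs : ∀ j < σ.v b, ∀ τ, Frame (.loop x b p) σ (τ.setV x j) → Inv j τ →
      Inv (j + 1) (p.eval I (τ.setV x j))) :
    Inv (σ.v b) ((Cmd.loop x b p).eval I σ) := by
  -- The frame is carried along with the invariant, so that the body may use the initial values of
  -- everything the loop does not assign.
  have key : ∀ m ≤ σ.v b, Inv m (iter (fun j τ => p.eval I (τ.setV x j)) m σ) ∧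
      Frame (.loop x b p) σ (iter (fun j τ => p.eval I (τ.setV x j)) m σ) := by
    intro m
    induction m with
    | zero => intro _; exact ⟨h0, Frame.refl _ _⟩
    | succ m ih =>
      intro hm
      obtain ⟨h1, h2⟩ := ih (by omega)
      have h3 : Frame (.loop x b p) σ
          ((iter (fun j τ => p.eval I (τ.setV x j)) m σ).setV x m) := by
        refine h2.trans ⟨fun {y} h => ?_, fun _ => rfl⟩
        simp only [Cmd.setsV, Bool.or_eq_false_iff, decide_eq_false_iff_not] at h
        simp [h.1]
      refine ⟨hs m (by omega) _ h3 h1, h2.trans ⟨fun {y} h => ?_, fun {B} h => ?_⟩⟩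
      · simp only [Cmd.setsV, Bool.or_eq_false_iff, decide_eq_false_iff_not] at h
        refine ((frame I p _).v h.2).trans ?_
        simp [h.1]
      · exact (frame I p _).a h
  exact (key _ le_rfl).1

/-! #### Cost -/

/-- Bounds the steps of `Exp.compile`, where each elementary instruction and each `seq` costs one
step. The `20` of an array access covers the five doublings that multiply the index by `32`. -/
def Exp.cost : Exp → ℕ
  | .lit _ => 1
  | .var _ => 1
  | .add a b => a.cost + b.cost + 3
  | .sub a b => a.cost + b.cost + 3
  | .lt a b => a.cost + b.cost + 6
  | .eq a b => a.cost + b.cost + 10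
  | .and a b => a.cost + b.cost + 6
  | .get _ i => i.cost + 20
  | .inp i => i.cost + 6

/-- An upper bound for the number of machine steps of the compiled statement. -/
def Cmd.cost : Cmd → St → ℕ
  | .skip, _ => 1
  | .set _ e, _ => e.cost + 2
  | .put _ i e, _ => i.cost + e.cost + 20
  | .seq p q, σ => p.cost σ + q.cost (p.eval I σ) + 1
  | .ite e p q, σ => e.cost + p.cost σ + q.cost σ + 2
  | .loop x b p, σ => 6 + ∑ j ∈ Finset.range (σ.v b),
      (p.cost ((iter (fun j τ => p.eval I (τ.setV x j)) j σ).setV x j) + 6)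

/-- The state-independent factor in the bound `coef * B ^ depth` of `cost_le`. -/
def Cmd.coef : Cmd → ℕ
  | .skip => 1
  | .set _ e => e.cost + 2
  | .put _ i e => i.cost + e.cost + 20
  | .seq p q => p.coef + q.coef + 1
  | .ite e p q => e.cost + p.coef + q.coef + 2
  | .loop _ _ p => 12 + p.coef

def Cmd.depth : Cmd → ℕ
  | .skip => 0
  | .set .. => 0
  | .put .. => 0
  | .seq p q => max p.depth q.depth
  | .ite _ p q => max p.depth q.depth
  | .loop _ _ p => p.depth + 1

/-- All loop bounds of `p` satisfy `P`. -/
def Cmd.bounds (P : Var → Bool) : Cmd → Bool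
  | .skip => true
  | .set .. => true
  | .put .. => true
  | .seq p q => p.bounds P && q.bounds P
  | .ite _ p q => p.bounds P && q.bounds P
  | .loop _ b p => P b && p.bounds P

/-- Each loop multiplies the cost by at most `B`, so nesting depth becomes the exponent. The
variables that bound loops must not be assigned anywhere in the program; otherwise their values
could exceed `B` later. -/
theorem cost_le (P : Var → Bool) (B : ℕ) (hB : 1 ≤ B) (p : Cmd) :
    ∀ σ : St, p.bounds P = true → (∀ y, P y = true → p.setsV y = false) →
      (∀ y, P y = true → σ.v y ≤ B) → p.cost I σ ≤ p.coef * B ^ p.depth := by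
  have mono : ∀ {c d d' : ℕ}, d ≤ d' → c * B ^ d ≤ c * B ^ d' := fun h =>
    Nat.mul_le_mul_left _ (Nat.pow_le_pow_right hB h)
  induction p with
  | skip => intro σ _ _ _; simp [Cmd.cost, Cmd.coef, Cmd.depth]
  | set x e => intro σ _ _ _; simp [Cmd.cost, Cmd.coef, Cmd.depth]
  | put A i e => intro σ _ _ _; simp [Cmd.cost, Cmd.coef, Cmd.depth]
  | seq p q hp hq =>
    intro σ h1 h2 h3
    simp only [Cmd.bounds, Bool.and_eq_true] at h1
    simp only [Cmd.setsV, Bool.or_eq_false_iff] at h2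
    have a1 := hp σ h1.1 (fun y hy => (h2 y hy).1) h3
    have a2 := hq (p.eval I σ) h1.2 (fun y hy => (h2 y hy).2) (fun y hy => by
      rw [(frame I p σ).v (h2 y hy).1]; exact h3 y hy)
    have b1 := mono (c := p.coef) (le_max_left p.depth q.depth)
    have b2 := mono (c := q.coef) (le_max_right p.depth q.depth)
    have b3 := Nat.one_le_pow (max p.depth q.depth) B hB
    simp only [Cmd.cost, Cmd.coef, Cmd.depth, add_mul]
    omega
  | ite e p q hp hq =>
    intro σ h1 h2 h3
    simp only [Cmd.bounds, Bool.and_eq_true] at h1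
    simp only [Cmd.setsV, Bool.or_eq_false_iff] at h2
    have a1 := hp σ h1.1 (fun y hy => (h2 y hy).1) h3
    have a2 := hq σ h1.2 (fun y hy => (h2 y hy).2) h3
    have b1 := mono (c := p.coef) (le_max_left p.depth q.depth)
    have b2 := mono (c := q.coef) (le_max_right p.depth q.depth)
    have b3 := Nat.one_le_pow (max p.depth q.depth) B hB
    have b4 : e.cost ≤ e.cost * B ^ (max p.depth q.depth) := Nat.le_mul_of_pos_right _ b3
    simp only [Cmd.cost, Cmd.coef, Cmd.depth, add_mul]
    omega
  | loop x b p hp =>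
    intro σ h1 h2 h3
    simp only [Cmd.bounds, Bool.and_eq_true] at h1
    have h2' : ∀ y, P y = true → y ≠ x ∧ p.setsV y = false := by
      intro y hy; simpa [Cmd.setsV] using h2 y hy
    have fr : ∀ m y, P y = true →
        (iter (fun j τ => p.eval I (τ.setV x j)) m σ).v y = σ.v y := by
      intro m y hy
      induction m with
      | zero => rfl
      | succ m ih =>
        refine ((frame I p _).v (h2' y hy).2).trans ?_
        simp [(h2' y hy).1, ih]
    have a1 : ∀ j, p.cost I ((iter (fun j τ => p.eval I (τ.setV x j)) j σ).setV x j) + 6 ≤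
        (p.coef + 6) * B ^ p.depth := by
      intro j
      have := hp ((iter (fun j τ => p.eval I (τ.setV x j)) j σ).setV x j) h1.2
        (fun y hy => (h2' y hy).2) (fun y hy => by
          simp only [St.setV_v, (h2' y hy).1, if_false, fr j y hy]; exact h3 y hy)
      have b3 := Nat.one_le_pow p.depth B hB
      rw [add_mul]; omega
    have a2 := Finset.sum_le_sum (fun j (_ : j ∈ Finset.range (σ.v b)) => a1 j)
    rw [Finset.sum_const, Finset.card_range, smul_eq_mul] at a2
    have a3 : σ.v b * ((p.coef + 6) * B ^ p.depth) ≤ B * ((p.coef + 6) * B ^ p.depth) :=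
      Nat.mul_le_mul_right _ (h3 b h1.1)
    have b3 := Nat.one_le_pow (p.depth + 1) B hB
    simp only [Cmd.cost, Cmd.coef, Cmd.depth]
    calc _ ≤ 6 + B * ((p.coef + 6) * B ^ p.depth) := by omega
      _ = 6 + (p.coef + 6) * B ^ (p.depth + 1) := by rw [pow_succ]; ring
      _ ≤ (12 + p.coef) * B ^ (p.depth + 1) := by
        simp only [add_mul]; omega

end Semantics

end Loop

/-! ### Compilation of the loop language to the machine -/

namespace Loop

open RAM

/-- Started with the statement `s` on the stack, the machine needs `T` steps to complete `s`. -/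
def Exec (s : Stmt) (R M R' M' : ℕ → ℕ) (T : ℕ) : Prop :=
  ∀ (P : Program) (K : List Stmt), (step P)^[T] ⟨s :: K, R, M⟩ = ⟨K, R', M'⟩

section Exec

variable {R M R₁ M₁ R₂ M₂ : ℕ → ℕ} {p q : Stmt} {t₁ t₂ : ℕ}

theorem Exec.nop : Exec .nop R M R M 1 := fun _ _ => rfl
theorem Exec.const (r c : ℕ) : Exec (.const r c) R M (Function.update R r c) M 1 := fun _ _ => rfl
theorem Exec.copy (r s : ℕ) : Exec (.copy r s) R M (Function.update R r (R s)) M 1 :=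
  fun _ _ => rfl
theorem Exec.add (r s q : ℕ) : Exec (.add r s q) R M (Function.update R r (R s + R q)) M 1 :=
  fun _ _ => rfl
theorem Exec.sub (r s q : ℕ) : Exec (.sub r s q) R M (Function.update R r (R s - R q)) M 1 :=
  fun _ _ => rfl
theorem Exec.load (r a : ℕ) : Exec (.load r a) R M (Function.update R r (M (R a))) M 1 :=
  fun _ _ => rfl
theorem Exec.store (a r : ℕ) : Exec (.store a r) R M R (Function.update M (R a) (R r)) 1 :=
  fun _ _ => rfl

theorem Exec.seq (h₁ : Exec p R M R₁ M₁ t₁) (h₂ : Exec q R₁ M₁ R₂ M₂ t₂) :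
    Exec (.seq p q) R M R₂ M₂ (t₁ + t₂ + 1) := by
  intro P K
  rw [Function.iterate_succ_apply, add_comm t₁ t₂, Function.iterate_add_apply]
  simp only [step]
  rw [h₁ P, h₂ P]

theorem Exec.ite_pos {r : ℕ} (hr : R r ≠ 0) (h : Exec p R M R₁ M₁ t₁) :
    Exec (.ite r p q) R M R₁ M₁ (t₁ + 1) := by
  intro P K
  rw [Function.iterate_succ_apply]
  simp only [step, if_pos hr]
  exact h P K

theorem Exec.ite_neg {r : ℕ} (hr : R r = 0) (h : Exec q R M R₁ M₁ t₁) :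
    Exec (.ite r p q) R M R₁ M₁ (t₁ + 1) := by
  intro P K
  rw [Function.iterate_succ_apply]
  simp only [step, hr, ne_eq, not_true_eq_false, if_false]
  exact h P K

theorem Exec.loop_zero {r : ℕ} (hr : R r = 0) : Exec (.loop r p) R M R M 1 := by
  intro P K
  simp [step, hr]

theorem Exec.loop_succ {r : ℕ} (hr : R r ≠ 0) (h₁ : Exec p R M R₁ M₁ t₁)
    (h₂ : Exec (.loop r p) R₁ M₁ R₂ M₂ t₂) : Exec (.loop r p) R M R₂ M₂ (t₁ + t₂ + 1) := by
  intro P K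
  rw [Function.iterate_succ_apply, add_comm t₁ t₂, Function.iterate_add_apply]
  simp only [step, if_pos hr]
  rw [h₁ P, h₂ P]

end Exec

/-- The register of a variable. -/
def reg (x : Var) : ℕ := 3 * x.ctorIdx

/-- The register for an intermediate result. Register `1` holds the address of the first cell
of the memory that is not part of the input, register `4` holds `1`. -/
def tmp (d : ℕ) : ℕ := 3 * d + 10

/-- Registers are divided by residues modulo `3`: variables are `0`, temporaries (and the reserved
registers `1` and `4`) are `1`, loop control is `2`. The value is left in `tmp d`. Equality tests
whether the sum of the two truncated differences vanishes. An input access compares the address with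
the end of the input, so that addresses in the work area read as `0`. -/
def Exp.compile : Exp → ℕ → Stmt
  | .lit c, d => .const (tmp d) c
  | .var x, d => .copy (tmp d) (reg x)
  | .add a b, d => .seq (a.compile d) (.seq (b.compile (d + 1)) (.add (tmp d) (tmp d) (tmp (d + 1))))
  | .sub a b, d => .seq (a.compile d) (.seq (b.compile (d + 1)) (.sub (tmp d) (tmp d) (tmp (d + 1))))
  | .lt a b, d => .seq (a.compile d) (.seq (b.compile (d + 1))
      (.seq (.sub (tmp d) (tmp (d + 1)) (tmp d))
        (.ite (tmp d) (.const (tmp d) 1) (.const (tmp d) 0))))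
  | .eq a b, d => .seq (a.compile d) (.seq (b.compile (d + 1))
      (.seq (.sub (tmp (d + 2)) (tmp d) (tmp (d + 1))) (.seq (.sub (tmp d) (tmp (d + 1)) (tmp d))
        (.seq (.add (tmp d) (tmp d) (tmp (d + 2)))
          (.ite (tmp d) (.const (tmp d) 0) (.const (tmp d) 1))))))
  | .and a b, d => .seq (a.compile d) (.ite (tmp d)
      (.seq (b.compile d) (.ite (tmp d) (.const (tmp d) 1) (.const (tmp d) 0)))
      (.const (tmp d) 0))
  | .get A i, d => .seq (i.compile d) (.seq (.add (tmp d) (tmp d) (tmp d))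
      (.seq (.add (tmp d) (tmp d) (tmp d)) (.seq (.add (tmp d) (tmp d) (tmp d))
      (.seq (.add (tmp d) (tmp d) (tmp d)) (.seq (.add (tmp d) (tmp d) (tmp d))
      (.seq (.const (tmp (d + 1)) A.ctorIdx) (.seq (.add (tmp d) (tmp d) (tmp (d + 1)))
      (.seq (.add (tmp d) (tmp d) 1) (.load (tmp d) (tmp d))))))))))
  | .inp i, d => .seq (i.compile d) (.seq (.sub (tmp (d + 1)) 1 (tmp d))
      (.ite (tmp (d + 1)) (.load (tmp d) (tmp d)) (.const (tmp d) 0)))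

/-- Registers `R` and memory `M` of the machine represent the state `σ`. -/
structure Sim (I : ℕ → ℕ) (b : ℕ) (σ : St) (R M : ℕ → ℕ) : Prop where
  var (x : Var) : R (reg x) = σ.v x
  base : R 1 = b
  one : R 4 = 1
  arr (A : Arr) (i : ℕ) : M (b + 32 * i + A.ctorIdx) = σ.a A i
  inp (i : ℕ) (h : i < b) : M i = I i

theorem Sim.congr {I : ℕ → ℕ} {b : ℕ} {σ : St} {R R' M : ℕ → ℕ} (h : Sim I b σ R M)
    (h' : ∀ r, r % 3 = 0 ∨ r = 1 ∨ r = 4 → R' r = R r) : Sim I b σ R' M := by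
  refine ⟨fun x => ?_, ?_, ?_, h.arr, h.inp⟩
  · rw [h' _ (Or.inl (by simp [reg])), h.var]
  · rw [h' _ (by omega), h.base]
  · rw [h' _ (by omega), h.one]

variable {I : ℕ → ℕ} {b : ℕ}

/-- The last clause is what the induction needs: evaluation at level `d + 1` does not touch `tmp d`,
so the value of a left operand survives the evaluation of the right one. The hypothesis `hI` makes
the guarded input access agree with `I` beyond the input. -/
theorem Exp.compile_spec (hI : ∀ i, b ≤ i → I i = 0) (e : Exp) :
    ∀ (d : ℕ) (σ : St) (R M : ℕ → ℕ), Sim I b σ R M →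
      ∃ T ≤ e.cost, ∃ R', Exec (e.compile d) R M R' M T ∧ R' (tmp d) = e.eval I σ ∧
        ∀ r, r % 3 ≠ 1 ∨ r < tmp d → R' r = R r := by
  have conv : ∀ {d r : ℕ}, (r % 3 = 0 ∨ r = 1 ∨ r = 4) → (r % 3 ≠ 1 ∨ r < tmp d) := by
    intro d r; simp only [tmp]; omega
  induction e with
  | lit c =>
    intro d σ R M _
    refine ⟨1, le_rfl, _, Exec.const _ _, by simp [Exp.eval], fun r hr => ?_⟩
    rw [Function.update_of_ne]; rintro rfl; simp only [tmp] at hr; omega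
  | var x =>
    intro d σ R M h
    refine ⟨1, le_rfl, _, Exec.copy _ _, by simp [Exp.eval, h.var], fun r hr => ?_⟩
    rw [Function.update_of_ne]; rintro rfl; simp only [tmp] at hr; omega
  | add x y hx hy =>
    intro d σ R M h
    obtain ⟨t₁, l₁, R₁, e₁, v₁, k₁⟩ := hx d σ R M h
    obtain ⟨t₂, l₂, R₂, e₂, v₂, k₂⟩ := hy (d + 1) σ R₁ M (h.congr fun r hr => k₁ r (conv hr))
    refine ⟨_, ?_, _, e₁.seq (e₂.seq (Exec.add _ _ _)), ?_, fun r hr => ?_⟩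
    · simp only [Exp.cost]; omega
    · simp only [Function.update_self, v₂, Exp.eval]
      rw [k₂ _ (by simp only [tmp]; omega), v₁]
    · rw [Function.update_of_ne, k₂ r, k₁ r hr]
      · simp only [tmp] at hr ⊢; omega
      · rintro rfl; simp only [tmp] at hr; omega
  | sub x y hx hy =>
    intro d σ R M h
    obtain ⟨t₁, l₁, R₁, e₁, v₁, k₁⟩ := hx d σ R M h
    obtain ⟨t₂, l₂, R₂, e₂, v₂, k₂⟩ := hy (d + 1) σ R₁ M (h.congr fun r hr => k₁ r (conv hr))
    refine ⟨_, ?_, _, e₁.seq (e₂.seq (Exec.sub _ _ _)), ?_, fun r hr => ?_⟩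
    · simp only [Exp.cost]; omega
    · simp only [Function.update_self, v₂, Exp.eval]
      rw [k₂ _ (by simp only [tmp]; omega), v₁]
    · rw [Function.update_of_ne, k₂ r, k₁ r hr]
      · simp only [tmp] at hr ⊢; omega
      · rintro rfl; simp only [tmp] at hr; omega
  | lt x y hx hy =>
    intro d σ R M h
    obtain ⟨t₁, l₁, R₁, e₁, v₁, k₁⟩ := hx d σ R M h
    obtain ⟨t₂, l₂, R₂, e₂, v₂, k₂⟩ := hy (d + 1) σ R₁ M (h.congr fun r hr => k₁ r (conv hr))
    have v₁' : R₂ (tmp d) = x.eval I σ := by rw [k₂ _ (by simp only [tmp]; omega), v₁]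
    have keep : ∀ r, r % 3 ≠ 1 ∨ r < tmp d → r ≠ tmp d ∧ R₂ r = R r := by
      intro r hr
      refine ⟨by rintro rfl; simp only [tmp] at hr; omega, ?_⟩
      rw [k₂ r, k₁ r hr]
      simp only [tmp] at hr ⊢; omega
    by_cases hlt : x.eval I σ < y.eval I σ
    · refine ⟨_, ?_, _, e₁.seq (e₂.seq ((Exec.sub _ _ _).seq
        (Exec.ite_pos ?_ (Exec.const _ _)))), ?_, fun r hr => ?_⟩
      · simp only [Exp.cost]; omega
      · simp only [Function.update_self, v₂, v₁']; omega
      · simp [Exp.eval, hlt]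
      · simp [keep r hr]
    · refine ⟨_, ?_, _, e₁.seq (e₂.seq ((Exec.sub _ _ _).seq
        (Exec.ite_neg ?_ (Exec.const _ _)))), ?_, fun r hr => ?_⟩
      · simp only [Exp.cost]; omega
      · simp only [Function.update_self, v₂, v₁']; omega
      · simp [Exp.eval, hlt]
      · simp [keep r hr]
  | eq x y hx hy =>
    intro d σ R M h
    obtain ⟨t₁, l₁, R₁, e₁, v₁, k₁⟩ := hx d σ R M h
    obtain ⟨t₂, l₂, R₂, e₂, v₂, k₂⟩ := hy (d + 1) σ R₁ M (h.congr fun r hr => k₁ r (conv hr))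
    have v₁' : R₂ (tmp d) = x.eval I σ := by rw [k₂ _ (by simp only [tmp]; omega), v₁]
    have keep : ∀ r, r % 3 ≠ 1 ∨ r < tmp d → r ≠ tmp d ∧ r ≠ tmp (d + 2) ∧ R₂ r = R r := by
      intro r hr
      refine ⟨by rintro rfl; simp only [tmp] at hr; omega,
        by rintro rfl; simp only [tmp] at hr; omega, ?_⟩
      rw [k₂ r, k₁ r hr]
      simp only [tmp] at hr ⊢; omega
    have n₁ : tmp d ≠ tmp (d + 2) := by simp only [tmp]; omega
    have n₂ : tmp (d + 1) ≠ tmp (d + 2) := by simp only [tmp]; omega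
    by_cases heq : x.eval I σ = y.eval I σ
    · refine ⟨_, ?_, _, e₁.seq (e₂.seq ((Exec.sub _ _ _).seq ((Exec.sub _ _ _).seq
        ((Exec.add _ _ _).seq (Exec.ite_neg ?_ (Exec.const _ _)))))), ?_, fun r hr => ?_⟩
      · simp only [Exp.cost]; omega
      · simp [n₁, n₁.symm, n₂, v₂, v₁', heq]
      · simp [Exp.eval, heq]
      · simp [keep r hr]
    · refine ⟨_, ?_, _, e₁.seq (e₂.seq ((Exec.sub _ _ _).seq ((Exec.sub _ _ _).seq
        ((Exec.add _ _ _).seq (Exec.ite_pos ?_ (Exec.const _ _)))))), ?_, fun r hr => ?_⟩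
      · simp only [Exp.cost]; omega
      · simp [n₁, n₁.symm, n₂, v₂, v₁']; omega
      · simp [Exp.eval, heq]
      · simp [keep r hr]
  | and x y hx hy =>
    intro d σ R M h
    obtain ⟨t₁, l₁, R₁, e₁, v₁, k₁⟩ := hx d σ R M h
    obtain ⟨t₂, l₂, R₂, e₂, v₂, k₂⟩ := hy d σ R₁ M (h.congr fun r hr => k₁ r (conv hr))
    have ne : ∀ r, r % 3 ≠ 1 ∨ r < tmp d → r ≠ tmp d := by
      rintro r hr rfl; simp only [tmp] at hr; omega
    by_cases hx0 : x.eval I σ = 0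
    · refine ⟨_, ?_, _, e₁.seq (Exec.ite_neg (by rw [v₁, hx0]) (Exec.const _ _)), ?_,
        fun r hr => ?_⟩
      · simp only [Exp.cost]; omega
      · simp [Exp.eval, hx0]
      · simp [ne r hr, k₁ r hr]
    · by_cases hy0 : y.eval I σ = 0
      · refine ⟨_, ?_, _, e₁.seq (Exec.ite_pos (by rwa [v₁]) (e₂.seq
          (Exec.ite_neg (by rw [v₂, hy0]) (Exec.const _ _)))), ?_, fun r hr => ?_⟩
        · simp only [Exp.cost]; omega
        · simp [Exp.eval, hy0]
        · simp [ne r hr, k₁ r hr, k₂ r hr]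
      · refine ⟨_, ?_, _, e₁.seq (Exec.ite_pos (by rwa [v₁]) (e₂.seq
          (Exec.ite_pos (by rwa [v₂]) (Exec.const _ _)))), ?_, fun r hr => ?_⟩
        · simp only [Exp.cost]; omega
        · simp [Exp.eval, hx0, hy0]
        · simp [ne r hr, k₁ r hr, k₂ r hr]
  | get A i hi =>
    intro d σ R M h
    obtain ⟨t₁, l₁, R₁, e₁, v₁, k₁⟩ := hi d σ R M h
    have n₁ : tmp d ≠ tmp (d + 1) := by simp only [tmp]; omega
    have n₂ : (1 : ℕ) ≠ tmp d := by simp only [tmp]; omega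
    have n₃ : (1 : ℕ) ≠ tmp (d + 1) := by simp only [tmp]; omega
    refine ⟨_, ?_, _, e₁.seq ((Exec.add _ _ _).seq ((Exec.add _ _ _).seq ((Exec.add _ _ _).seq
      ((Exec.add _ _ _).seq ((Exec.add _ _ _).seq ((Exec.const _ _).seq ((Exec.add _ _ _).seq
      ((Exec.add _ _ _).seq (Exec.load _ _))))))))), ?_, fun r hr => ?_⟩
    · simp only [Exp.cost]; omega
    · simp only [Function.update_self, ne_eq, n₁, n₂, n₃, not_false_eq_true,
        Function.update_of_ne, v₁, Exp.eval]
      rw [k₁ 1 (by simp only [tmp]; omega), h.base, ← h.arr]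
      congr 1; ring
    · have a1 : r ≠ tmp d := by rintro rfl; simp only [tmp] at hr; omega
      have a2 : r ≠ tmp (d + 1) := by rintro rfl; simp only [tmp] at hr; omega
      simp [a1, a2, k₁ r hr]
  | inp i hi =>
    intro d σ R M h
    obtain ⟨t₁, l₁, R₁, e₁, v₁, k₁⟩ := hi d σ R M h
    have n₁ : tmp d ≠ tmp (d + 1) := by simp only [tmp]; omega
    have b₁ : R₁ 1 = b := by rw [k₁ 1 (by simp only [tmp]; omega), h.base]
    have ne : ∀ r, r % 3 ≠ 1 ∨ r < tmp d → r ≠ tmp d ∧ r ≠ tmp (d + 1) := by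
      intro r hr
      constructor <;> (rintro rfl; simp only [tmp] at hr; omega)
    by_cases hib : i.eval I σ < b
    · refine ⟨_, ?_, _, e₁.seq ((Exec.sub _ _ _).seq (Exec.ite_pos ?_ (Exec.load _ _))), ?_,
        fun r hr => ?_⟩
      · simp only [Exp.cost]; omega
      · simp only [Function.update_self, b₁, v₁]; omega
      · simp [n₁, v₁, Exp.eval, h.inp _ hib]
      · simp [ne r hr, k₁ r hr]
    · refine ⟨_, ?_, _, e₁.seq ((Exec.sub _ _ _).seq (Exec.ite_neg ?_ (Exec.const _ _))), ?_,
        fun r hr => ?_⟩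
      · simp only [Exp.cost]; omega
      · simp only [Function.update_self, b₁, v₁]; omega
      · simp [Exp.eval, hI _ (not_lt.mp hib)]
      · simp [ne r hr, k₁ r hr]

/-- The registers with the number of the iterations of a loop that remain and with their total
number. -/
def cntReg (d : ℕ) : ℕ := 3 * (2 * d) + 2
def limReg (d : ℕ) : ℕ := 3 * (2 * d + 1) + 2

/-- A loop counts the remaining iterations down in a register of its own, chosen by the nesting
depth `d`, and recomputes the loop variable from it each time. The bound is thus read once, and the
body may assign the loop variable freely. -/
def Cmd.compile : Cmd → ℕ → Stmt
  | .skip, _ => .nop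
  | .set x e, _ => .seq (e.compile 0) (.copy (reg x) (tmp 0))
  | .put A i e, _ => .seq (e.compile 0) (.seq (i.compile 1)
      (.seq (.add (tmp 1) (tmp 1) (tmp 1)) (.seq (.add (tmp 1) (tmp 1) (tmp 1))
      (.seq (.add (tmp 1) (tmp 1) (tmp 1)) (.seq (.add (tmp 1) (tmp 1) (tmp 1))
      (.seq (.add (tmp 1) (tmp 1) (tmp 1)) (.seq (.const (tmp 2) A.ctorIdx)
      (.seq (.add (tmp 1) (tmp 1) (tmp 2)) (.seq (.add (tmp 1) (tmp 1) 1)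
      (.store (tmp 1) (tmp 0)))))))))))
  | .seq p q, d => .seq (p.compile d) (q.compile d)
  | .ite e p q, d => .seq (e.compile 0) (.ite (tmp 0) (p.compile d) (q.compile d))
  | .loop x b p, d => .seq (.copy (limReg d) (reg b)) (.seq (.copy (cntReg d) (reg b))
      (.loop (cntReg d) (.seq (.sub (reg x) (limReg d) (cntReg d)) (.seq (p.compile (d + 1))
        (.sub (cntReg d) (cntReg d) 4)))))

theorem Sim.setV {σ : St} {R M : ℕ → ℕ} (h : Sim I b σ R M) (x : Var) (c : ℕ) :
    Sim I b (σ.setV x c) (Function.update R (reg x) c) M := by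
  refine ⟨fun y => ?_, ?_, ?_, h.arr, h.inp⟩
  · rw [St.setV_v, Function.update_apply, ← h.var y]
    have : reg y = reg x ↔ y = x := by
      simp only [reg]
      constructor
      · intro h; exact Var.ctorIdx_injective (by omega)
      · rintro rfl; rfl
    simp [this]
  · rw [Function.update_of_ne, h.base]; simp only [reg]; omega
  · rw [Function.update_of_ne, h.one]; simp only [reg]; omega

theorem Sim.setA {σ : St} {R M : ℕ → ℕ} (h : Sim I b σ R M) (A : Arr) (i c : ℕ) :
    Sim I b (σ.setA A i c) R (Function.update M (b + 32 * i + A.ctorIdx) c) := by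
  refine ⟨h.var, h.base, h.one, fun B j => ?_, fun j hj => ?_⟩
  · rw [St.setA_a, Function.update_apply, ← h.arr]
    have : b + 32 * j + B.ctorIdx = b + 32 * i + A.ctorIdx ↔ B = A ∧ j = i := by
      have := A.ctorIdx_lt
      have := B.ctorIdx_lt
      constructor
      · intro h; exact ⟨Arr.ctorIdx_injective (by omega), by omega⟩
      · rintro ⟨rfl, rfl⟩; rfl
    simp [this]
  · rw [Function.update_of_ne, h.inp j hj]; omega

/-- The last clause protects the control registers of the enclosing loops: those at depth below `d`
are the registers of residue `2` below `6 * d`. -/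
theorem Cmd.compile_spec (hI : ∀ i, b ≤ i → I i = 0) (p : Cmd) :
    ∀ (d : ℕ) (σ : St) (R M : ℕ → ℕ), Sim I b σ R M →
      ∃ T ≤ p.cost I σ, ∃ R' M', Exec (p.compile d) R M R' M' T ∧ Sim I b (p.eval I σ) R' M' ∧
        ∀ r, r % 3 = 2 → r < 6 * d → R' r = R r := by
  have conv : ∀ {d r : ℕ}, (r % 3 = 0 ∨ r = 1 ∨ r = 4) → (r % 3 ≠ 1 ∨ r < tmp d) := by
    intro d r; simp only [tmp]; omega
  induction p with
  | skip => intro d σ R M h; exact ⟨1, le_rfl, R, M, Exec.nop, h, fun _ _ _ => rfl⟩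
  | set x e =>
    intro d σ R M h
    obtain ⟨t₁, l₁, R₁, e₁, v₁, k₁⟩ := e.compile_spec hI 0 σ R M h
    refine ⟨_, ?_, _, _, e₁.seq (Exec.copy _ _), ?_, fun r h3 h2 => ?_⟩
    · simp only [Cmd.cost]; omega
    · rw [v₁]; exact (h.congr fun r hr => k₁ r (conv hr)).setV x _
    · rw [Function.update_of_ne, k₁ r (by omega)]
      simp only [reg]; omega
  | put A i e =>
    intro d σ R M h
    obtain ⟨t₁, l₁, R₁, e₁, v₁, k₁⟩ := e.compile_spec hI 0 σ R M h
    have h₁ := h.congr fun r hr => k₁ r (conv hr)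
    obtain ⟨t₂, l₂, R₂, e₂, v₂, k₂⟩ := i.compile_spec hI 1 σ R₁ M h₁
    have h₂ := h₁.congr fun r hr => k₂ r (conv hr)
    refine ⟨_, ?_, _, _, e₁.seq (e₂.seq ((Exec.add _ _ _).seq ((Exec.add _ _ _).seq
      ((Exec.add _ _ _).seq ((Exec.add _ _ _).seq ((Exec.add _ _ _).seq ((Exec.const _ _).seq
      ((Exec.add _ _ _).seq ((Exec.add _ _ _).seq (Exec.store _ _)))))))))), ?_,
      fun r h3 h2 => ?_⟩
    · simp only [Cmd.cost]; omega
    · have n₁ : tmp 1 ≠ tmp 2 := by decide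
      have n₂ : (1 : ℕ) ≠ tmp 1 := by decide
      have n₃ : (1 : ℕ) ≠ tmp 2 := by decide
      have n₄ : tmp 0 ≠ tmp 1 := by decide
      have n₅ : tmp 0 ≠ tmp 2 := by decide
      simp only [Function.update_self, ne_eq, n₁, n₂, n₃, n₄, n₅, not_false_eq_true,
        Function.update_of_ne, v₂, eval_put]
      rw [h₂.base, k₂ (tmp 0) (by simp [tmp]), v₁]
      have e1 : ∀ y, y + y + (y + y) + (y + y + (y + y)) +
          (y + y + (y + y) + (y + y + (y + y))) + (y + y + (y + y) + (y + y + (y + y)) +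
          (y + y + (y + y) + (y + y + (y + y)))) + A.ctorIdx + b = b + 32 * y + A.ctorIdx := by
        intro y; ring
      rw [e1]
      refine (h₂.setA A _ _).congr fun r hr => ?_
      have a1 : r ≠ tmp 1 := by rintro rfl; revert hr; decide
      have a2 : r ≠ tmp 2 := by rintro rfl; revert hr; decide
      simp [a1, a2]
    · have a1 : r ≠ tmp 1 := by rintro rfl; revert h3; decide
      have a2 : r ≠ tmp 2 := by rintro rfl; revert h3; decide
      simp only [ne_eq, a1, a2, not_false_eq_true, Function.update_of_ne]
      rw [k₂ r (by omega), k₁ r (by omega)]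
  | seq p q hp hq =>
    intro d σ R M h
    obtain ⟨t₁, l₁, R₁, M₁, e₁, h₁, k₁⟩ := hp d σ R M h
    obtain ⟨t₂, l₂, R₂, M₂, e₂, h₂, k₂⟩ := hq d _ R₁ M₁ h₁
    refine ⟨_, ?_, _, _, e₁.seq e₂, h₂, fun r h3 hr => (k₂ r h3 hr).trans (k₁ r h3 hr)⟩
    simp only [Cmd.cost]; omega
  | ite e p q hp hq =>
    intro d σ R M h
    obtain ⟨t₁, l₁, R₁, e₁, v₁, k₁⟩ := e.compile_spec hI 0 σ R M h
    have h₁ := h.congr fun r hr => k₁ r (conv hr)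
    by_cases he : e.eval I σ = 0
    · obtain ⟨t₂, l₂, R₂, M₂, e₂, h₂, k₂⟩ := hq d σ R₁ M h₁
      refine ⟨_, ?_, _, _, e₁.seq (Exec.ite_neg (by rw [v₁, he]) e₂), ?_,
        fun r h3 hr => (k₂ r h3 hr).trans (k₁ r (by omega))⟩
      · simp only [Cmd.cost]; omega
      · rw [eval_ite, if_neg (by simpa using he)]; exact h₂
    · obtain ⟨t₂, l₂, R₂, M₂, e₂, h₂, k₂⟩ := hp d σ R₁ M h₁
      refine ⟨_, ?_, _, _, e₁.seq (Exec.ite_pos (by rwa [v₁]) e₂), ?_,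
        fun r h3 hr => (k₂ r h3 hr).trans (k₁ r (by omega))⟩
      · simp only [Cmd.cost]; omega
      · rw [eval_ite, if_pos he]; exact h₂
  | loop x c p hp =>
    intro d σ R M h
    set m := σ.v c with hm
    set f : ℕ → St → St := fun j τ => p.eval I (τ.setV x j) with hf
    set body : Stmt := .seq (.sub (reg x) (limReg d) (cntReg d)) (.seq (p.compile (d + 1))
        (.sub (cntReg d) (cntReg d) 4)) with hbody
    -- Induction on the number `j` of remaining iterations; `m - j` of them have been executed.
    have key : ∀ j ≤ m, ∀ R M, Sim I b (iter f (m - j) σ) R M → R (limReg d) = m →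
        R (cntReg d) = j → ∃ T ≤ 1 + ∑ i ∈ Finset.Ico (m - j) m,
          (p.cost I ((iter f i σ).setV x i) + 6), ∃ R' M',
          Exec (.loop (cntReg d) body) R M R' M' T ∧ Sim I b (iter f m σ) R' M' ∧
          ∀ r, r % 3 = 2 → r < 6 * d → R' r = R r := by
      intro j
      induction j with
      | zero =>
        intro _ R M h _ h0
        exact ⟨1, by simp, R, M, Exec.loop_zero h0, by simpa using h, fun _ _ _ => rfl⟩
      | succ j ih =>
        intro hj R M h hl hc
        have hs := h.setV x (m - (j + 1))
        obtain ⟨t₂, l₂, R₂, M₂, e₂, h₂, k₂⟩ := hp (d + 1) _ _ _ hs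
        have ec : R₂ (cntReg d) = j + 1 := by
          rw [k₂ _ (by simp only [cntReg]; omega) (by simp only [cntReg]; omega),
            Function.update_of_ne (by simp only [cntReg, reg]; omega), hc]
        have el : R₂ (limReg d) = m := by
          rw [k₂ _ (by simp only [limReg]; omega) (by simp only [limReg]; omega),
            Function.update_of_ne (by simp only [limReg, reg]; omega), hl]
        have h₃ : Sim I b (iter f (m - j) σ) (Function.update R₂ (cntReg d) j) M₂ := by
          have e1 : m - j = (m - (j + 1)) + 1 := by omega
          rw [e1]
          show Sim I b (p.eval I _) _ _
          refine h₂.congr fun r hr => ?_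
          rw [Function.update_of_ne]
          simp only [cntReg]; omega
        obtain ⟨t₃, l₃, R₃, M₃, e₃, h₄, k₃⟩ := ih (by omega) _ _ h₃
          (by rw [Function.update_of_ne, el]; simp only [limReg, cntReg]; omega) (by simp)
        have hb : Exec body R M (Function.update R₂ (cntReg d) j) M₂ (1 + (t₂ + 1 + 1) + 1) := by
          refine Exec.seq (R₁ := Function.update R (reg x) (m - (j + 1))) (M₁ := M) ?_
            (e₂.seq ?_)
          · have := Exec.sub (R := R) (M := M) (reg x) (limReg d) (cntReg d)
            rwa [hl, hc] at this
          · have := Exec.sub (R := R₂) (M := M₂) (cntReg d) (cntReg d) 4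
            rwa [ec, h₂.one] at this
        refine ⟨_, ?_, R₃, M₃, Exec.loop_succ (by omega) hb e₃, h₄, fun r h3 hr => ?_⟩
        · rw [Finset.sum_eq_sum_Ico_succ_bot (by omega)]
          have e1 : m - (j + 1) + 1 = m - j := by omega
          rw [e1]
          omega
        · rw [k₃ r h3 hr, Function.update_of_ne, k₂ r h3 (by omega), Function.update_of_ne]
          · simp only [reg]; omega
          · simp only [cntReg]; omega
    have hs : Sim I b σ (Function.update (Function.update R (limReg d) m) (cntReg d) m) M := by
      refine h.congr fun r hr => ?_
      rw [Function.update_of_ne, Function.update_of_ne]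
      · simp only [limReg]; omega
      · simp only [cntReg]; omega
    obtain ⟨T, hT, R', M', e', h', k'⟩ := key m le_rfl _ M (by simpa [iter] using hs)
      (by rw [Function.update_of_ne, Function.update_self]; simp only [limReg, cntReg]; omega)
      (by simp)
    refine ⟨1 + (1 + T + 1) + 1, ?_, R', M', ?_, h', fun r h3 hr => ?_⟩
    · simp only [Cmd.cost]
      rw [Nat.sub_self, ← Finset.range_eq_Ico] at hT
      simp only [← hm, ← hf]
      omega
    · refine Exec.seq (R₁ := Function.update R (limReg d) m) (M₁ := M) ?_ (Exec.seq ?_ e')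
      · have := Exec.copy (R := R) (M := M) (limReg d) (reg c)
        rwa [h.var] at this
      · have := Exec.copy (R := Function.update R (limReg d) m) (M := M) (cntReg d) (reg c)
        rwa [Function.update_of_ne (by simp only [reg, limReg]; omega), h.var] at this
    · rw [k' r h3 hr, Function.update_of_ne, Function.update_of_ne]
      · simp only [limReg]; omega
      · simp only [cntReg]; omega

end Loop

/-! ### The algorithm -/

namespace Loop

@[simp] def rd (A : Arr) (x : Var) : Exp := .get A (.var x)

instance : Add Exp := ⟨.add⟩
instance : Sub Exp := ⟨.sub⟩

@[simp] theorem eval_add (I : ℕ → ℕ) (σ : St) (a b : Exp) :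
    (a + b).eval I σ = a.eval I σ + b.eval I σ := rfl
@[simp] theorem eval_sub (I : ℕ → ℕ) (σ : St) (a b : Exp) :
    (a - b).eval I σ = a.eval I σ - b.eval I σ := rfl

/-- `x := x + 1` -/
@[simp] def incr (x : Var) : Cmd := .set x (.var x + .lit 1)

/-- `A[x] := e` for all `x < b` -/
def fill (A : Arr) (x b : Var) (e : Exp) : Cmd := .loop x b (.put A (.var x) e)

/-- The entry of the adjacency matrix at `(u, v)`. -/
@[simp] def adjE (u v : Var) : Exp := .inp (.var .n + (rd .ROW u + .var v))

@[simp] def flowIx (u v : Var) : Exp := rd .ROW u + .var v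

/-! #### Parameters -/

/-- In the absence of multiplication, products and powers are computed by repeated addition and
doubling. The values are `K = 4k²` (edges of a cut of rank `k`), `tau = t + 2K` (terminals of a
piece), `sb = tau + k + tau²` (digits of a signature), `ns = 2 ^ sb`, `q = 2 ^ ns` (codes), `D = (K
+ 1)(q + 2) + 1` (rounds of guesses), `L = tau + D (q + K)` (guessed digits in all) and `NG = 2 ^
L`. -/
def paramK : Cmd := .seq (.set .K (.lit 0)) (.loop .i .k (.loop .u .k (.set .K (.var .K + .lit 4))))
def paramTau : Cmd := .block [.set .tau (.var .t + (.var .K + .var .K)),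
  .set .sb (.var .tau + .var .k), .loop .i .tau (.set .sb (.var .sb + .var .tau))]
def paramNs : Cmd := .seq (.set .ns (.lit 1)) (.loop .i .sb (.set .ns (.var .ns + .var .ns)))
def paramQ : Cmd := .seq (.set .q (.lit 1)) (.loop .i .ns (.set .q (.var .q + .var .q)))
def paramD : Cmd := .block [.set .K1 (.var .K + .lit 1), .set .q2 (.var .q + .lit 2),
  .set .D (.lit 1), .loop .i .K1 (.set .D (.var .D + .var .q2))]
def paramL : Cmd := .block [.set .qK (.var .q + .var .K), .set .L (.var .tau),
  .loop .i .D (.set .L (.var .L + .var .qK))]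
def paramNG : Cmd := .block [.set .NG (.lit 1), .loop .i .L (.set .NG (.var .NG + .var .NG)),
  .set .n1 (.var .n + .lit 1)]

/-! #### Initialization -/

/-- A table of the multiples of `n`, which replaces the multiplication in matrix addresses. -/
def initRow : Cmd := .seq (.set .cnt (.lit 0))
  (.loop .u .n (.seq (.put .ROW (.var .u) (.var .cnt)) (.set .cnt (.var .cnt + .var .n))))

/-- In every component, the entries of `PA` are the sides of a bipartition. -/
def bipartition : Cmd := .block [fill .CC .v .n (.var .v), fill .PA .v .n (.lit 0),
  .loop .u .n (.loop .v .n (.ite (adjE .u .v) (.ite (.eq (rd .CC .u) (rd .CC .v)) .skip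
    (.block [.set .ca (rd .CC .u), .set .cb (rd .CC .v), .set .e (.eq (rd .PA .u) (rd .PA .v)),
      .loop .w .n (.ite (.eq (rd .CC .w) (.var .ca))
        (.seq (.put .CC (.var .w) (.var .cb))
          (.ite (.var .e) (.put .PA (.var .w) (.lit 1 - rd .PA .w)) .skip)) .skip)])) .skip))]

/-- The whole graph with the terminals of the instance. -/
def resetPiece : Cmd := .seq (fill .VP .v .n (.lit 1)) (fill .TP .v .n (.lt (.lit 0) (.inp (.var .v))))

/-! #### The rank of the cut given by `RE` -/

def merge : Cmd := .block [.set .ca (rd .CC .u), .set .cb (rd .CC .v),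
  .loop .w .n (.ite (.eq (rd .CC .w) (.var .ca)) (.put .CC (.var .w) (.var .cb)) .skip)]

/-- Grows a spanning forest of the cut edges greedily; the number of merges is the rank. The
component labels stay in `CC`, where `signature` reads them. -/
def rank : Cmd := .block [.set .rk (.lit 0), fill .CC .v .n (.var .v),
  .loop .u .n (.loop .v .n (.ite
    (.and (.and (.and (rd .VP .u) (rd .VP .v)) (adjE .u .v))
      (.and (rd .RE .u) (.eq (rd .RE .v) (.lit 0))))
    (.ite (.eq (rd .CC .u) (rd .CC .v)) .skip (.seq (incr .rk) merge)) .skip))]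

/-! #### Minimum cuts -/

/-- Appends `v` to the queue. -/
def visit (p : Exp) : Cmd := .block [.put .QU (.var .cnt) (.var .v), incr .cnt,
  .put .RE (.var .v) (.var .cnt), .put .PAR (.var .v) p]

/-- Breadth-first search from the vertices of classes labelled `1`. `RE v` is one plus the position
of `v` in the queue, hence `0` for vertices not found, and smaller for the parent of `v` than for
`v`. Parent `n` marks a source. The sum in the condition serves as a disjunction. -/
def reach : Cmd := .block [fill .RE .v .n (.lit 0), .set .cnt (.lit 0),
  .loop .v .n (.ite (.and (rd .VP .v) (.eq (.get .LAB (rd .CL .v)) (.lit 1))) (visit (.var .n)) .skip),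
  .loop .i .n (.ite (.lt (.var .i) (.var .cnt))
    (.seq (.set .u (rd .QU .i)) (.loop .v .n (.ite
      (.and (.and (rd .VP .v) (.eq (rd .RE .v) (.lit 0)))
        (.eq (rd .CL .u) (rd .CL .v) + .and (adjE .u .v) (.eq (.get .F (flowIx .u .v)) (.lit 0))))
      (visit (.var .u)) .skip))) .skip)]

def findTarget : Cmd := .seq (.set .x (.var .n)) (.loop .v .n (.ite
  (.and (rd .RE .v) (.eq (.get .LAB (rd .CL .v)) (.lit 2))) (.set .x (.var .v)) .skip))

/-- Pushes one unit of flow to `x` along the edge from its parent. -/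
def push : Cmd := .seq (.set .p (rd .PAR .x)) (.ite (.lt (.var .p) (.var .n))
  (.seq (.ite (.eq (rd .CL .p) (rd .CL .x)) .skip
    (.ite (.get .F (flowIx .x .p)) (.put .F (flowIx .x .p) (.lit 0))
      (.put .F (flowIx .p .x) (.lit 1)))) (.set .x (.var .p))) .skip)

def augment : Cmd := .block [reach, findTarget,
  .ite (.lt (.var .x) (.var .n)) (.seq (incr .J) (.loop .i .n push)) .skip]

/-- After `K + 1` augmentations the minimum cut is known to exceed `K`, so no more are needed; if
one of them fails, `RE` is the smallest minimum cut. -/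
def flow : Cmd := .block [
  .loop .u .n (.loop .v .n (.put .F (flowIx .u .v) (.lit 0))), .set .J (.lit 0),
  .loop .r .K1 augment]

/-! #### Guessing a cut -/

/-- The next guessed label for every queried class that has none. -/
def answer : Cmd := .loop .v .n (.ite
  (.and (rd .QY .v) (.eq (.get .LAB (rd .CL .v)) (.lit 0)))
  (.seq (.put .LAB (rd .CL .v) (.lit 2 - .get .G (.var .gp))) (incr .gp)) .skip)

def countSides : Cmd := .block [.set .cM (.lit 0), .set .cO (.lit 0),
  .loop .v .n (.ite (.and (rd .VP .v) (.eq (rd .CL .v) (.var .v)))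
    (.ite (rd .RE .v) (incr .cM) (incr .cO)) .skip)]

/-- The value of `e` tells whether the small side is the complement of the cut. -/
@[simp] def inSide (v : Var) : Exp := .eq (.eq (rd .RE v) (.lit 0)) (.var .e)

/-- Keeps the cut in `BM` if it is balanced. In any case it marks one representative per class of
the chosen side, and every vertex across that has a neighbor in this side: these are the vertices
whose labels are guessed next. -/
def query : Cmd := .block [countSides, fill .QY .v .n (.lit 0),
  .ite (.lt (.var .K) (.var .J)) .skip (.block [
    .ite (.and (.lt (.var .q) (.var .cM)) (.lt (.var .q) (.var .cO)))
      (.seq (.set .bal (.lit 1)) (fill .BM .v .n (.and (rd .VP .v) (rd .RE .v)))) .skip,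
    .set .e (.lt (.var .q) (.var .cM)),
    .loop .v .n (.ite (.and (rd .VP .v) (inSide .v))
      (.put .QY (.var .v) (.eq (rd .CL .v) (.var .v))) .skip),
    .loop .u .n (.loop .v .n (.ite
      (.and (.and (rd .VP .u) (rd .VP .v)) (.and (.and (inSide .u) (.eq (inSide .v) (.lit 0))) (adjE .u .v)))
      (.put .QY (.var .v) (.lit 1)) .skip))])]

/-- A number that encodes the trace of the cut on the terminals and its rank. -/
def signature : Cmd := .block [.set .s (.lit 0),
  .loop .u .n (.ite (rd .TP .u) (.seq (.set .s (.var .s + .var .s + .lt (.lit 0) (rd .RE .u)))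
    (.loop .v .n (.ite (rd .TP .v)
      (.set .s (.var .s + .var .s + .eq (rd .CC .u) (rd .CC .v))) .skip))) .skip),
  .loop .i .k (.set .s (.var .s + .var .s + .lt (.var .i) (.var .rk)))]

/-- Refines the codes by the cut `RE` if it is the first one with its signature. -/
def record : Cmd := .seq rank (.ite (.lt (.var .k) (.var .rk)) .skip (.seq signature
  (.ite (.eq (rd .SEEN .s) (.var .stamp)) .skip (.seq (.put .SEEN (.var .s) (.var .stamp))
    (.loop .v .n (.put .NC (.var .v) (rd .NC .v + rd .NC .v + .lt (.lit 0) (rd .RE .v))))))))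

def guessRun : Cmd := .block [.set .gp (.lit 0), fill .LAB .v .n (.lit 0),
  fill .QY .v .n (rd .TP .v), answer, .loop .d .D (.block [flow, query, answer]), flow, record]

/-! #### Enumeration of all guesses -/

/-- Adds one to the binary number stored in `G`, least significant digit first, with carry `cr`. -/
def nextGuess : Cmd := .seq (.set .cr (.lit 1)) (.loop .i .L (.ite (rd .G .i)
  (.ite (.var .cr) (.put .G (.var .i) (.lit 0)) .skip)
  (.ite (.var .cr) (.seq (.put .G (.var .i) (.lit 1)) (.set .cr (.lit 0))) .skip)))

def forGuesses (p : Cmd) : Cmd :=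
  .seq (fill .G .i .L (.lit 0)) (.loop .g .NG (.seq p nextGuess))

/-! #### Refinement of the classes -/

/-- Continues with the side of the balanced cut `BM` that has fewer terminals. -/
def descend : Cmd := .block [.set .ca (.lit 0), .set .cb (.lit 0),
  .loop .v .n (.ite (rd .TP .v) (.ite (rd .BM .v) (incr .ca) (incr .cb)) .skip),
  .ite (.lt (.var .cb) (.var .ca))
    (fill .BM .v .n (.and (rd .VP .v) (.eq (rd .BM .v) (.lit 0)))) .skip,
  .loop .u .n (.loop .v .n (.ite
    (.and (.and (rd .VP .u) (.eq (rd .BM .u) (.lit 0))) (.and (rd .BM .v) (adjE .u .v)))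
    (.put .TP (.var .v) (.lit 1)) .skip)),
  fill .TP .v .n (.and (rd .TP .v) (rd .BM .v)), fill .VP .v .n (rd .BM .v)]

/-- Merges the vertices with equal codes. -/
def harden : Cmd := .seq (.loop .v .n (.ite (rd .VP .v) (.block [.set .e (.var .n),
    .loop .u .n (.ite (.and (rd .VP .u) (.eq (rd .NC .u) (rd .NC .v)))
      (.ite (.eq (.var .e) (.var .n)) (.set .e (.var .u)) .skip) .skip),
    .put .CL (.var .v) (.var .e)]) .skip)) resetPiece

/-- A fresh `stamp` empties `SEEN` without clearing it. -/
def refine : Cmd := .block [incr .stamp, .set .bal (.lit 0), fill .NC .v .n (.lit 0),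
  forGuesses guessRun, .ite (.var .bal) descend harden]

/-! #### The final search -/

/-- The color of `v` is `col v + 1`. -/
@[simp] def col (v : Var) : Exp := .eq (.eq (rd .RE v) (rd .PA v)) (.lit 0)

/-- One guessed digit per representative decides on which side of the cut its class lies; the rank
and the prescribed colors are then checked directly. -/
def tryGuess : Cmd := .block [.set .gp (.lit 0),
  .loop .v .n (.ite (.eq (rd .CL .v) (.var .v))
    (.seq (.put .Y (.var .v) (.get .G (.var .gp))) (incr .gp)) .skip),
  fill .RE .v .n (.get .Y (rd .CL .v)), rank, .set .ok (.eq (.lt (.var .k) (.var .rk)) (.lit 0)),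
  .loop .v .n (.block [
    .ite (.and (.eq (.inp (.var .v)) (.lit 1)) (col .v)) (.set .ok (.lit 0)) .skip,
    .ite (.and (.eq (.inp (.var .v)) (.lit 2)) (.eq (col .v) (.lit 0))) (.set .ok (.lit 0)) .skip]),
  .ite (.var .ok) (.seq (.set .found (.lit 1)) (fill .OUT .v .n (col .v + .lit 1))) .skip]

def setup : Cmd := .block [initRow, bipartition, fill .CL .v .n (.var .v), resetPiece,
  .set .stamp (.lit 0)]

/-- The pair (number of classes, number of classes of the piece) decreases lexicographically with
every `refine` and both entries are at most `n`, so `(n + 1)²` rounds are enough. -/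
def solve : Cmd := .block [setup, .loop .it .n1 (.loop .jt .n1 refine), resetPiece,
  .set .found (.lit 0), forGuesses tryGuess]

end Loop

/-! ### Cuts and flows -/

namespace Cut

open Finset

/-- `S` is a set of vertices of `U` that contains with a vertex its whole class. -/
def Closed (cl : ℕ → ℕ) (U S : Finset ℕ) : Prop :=
  S ⊆ U ∧ ∀ u ∈ S, ∀ v ∈ U, cl u = cl v → v ∈ S

open Classical in
/-- The edges that leave `S` in the graph on `U`. -/
noncomputable def bd (E : ℕ → ℕ → Prop) (U S : Finset ℕ) : Finset (ℕ × ℕ) :=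
  (S ×ˢ (U \ S)).filter fun e => E e.1 e.2

/-- The cut `S` respects the classes and the labels of the classes. -/
structure Feasible (cl lab : ℕ → ℕ) (U S : Finset ℕ) : Prop where
  closed : Closed cl U S
  source {v : ℕ} (hv : v ∈ U) (h : lab (cl v) = 1) : v ∈ S
  target {v : ℕ} (hv : v ∈ S) : lab (cl v) ≠ 2

/-- `M` is the smallest minimum cut. -/
structure IsMinCut (E : ℕ → ℕ → Prop) (cl lab : ℕ → ℕ) (U M : Finset ℕ) : Prop where
  feasible : Feasible cl lab U M
  le {S : Finset ℕ} (h : Feasible cl lab U S) : (bd E U M).card ≤ (bd E U S).card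
  subset {S : Finset ℕ} (h : Feasible cl lab U S) (h' : (bd E U S).card ≤ (bd E U M).card) : M ⊆ S

theorem IsMinCut.unique {E : ℕ → ℕ → Prop} {cl lab : ℕ → ℕ} {U M M' : Finset ℕ}
    (h : IsMinCut E cl lab U M) (h' : IsMinCut E cl lab U M') : M = M' :=
  Subset.antisymm (h.subset h'.feasible (h'.le h.feasible)) (h'.subset h.feasible (h.le h'.feasible))

theorem mem_bd {E : ℕ → ℕ → Prop} {U S : Finset ℕ} {u v : ℕ} :
    (u, v) ∈ bd E U S ↔ u ∈ S ∧ v ∈ U ∧ v ∉ S ∧ E u v := by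
  simp [bd, and_assoc]

theorem Closed.compl {cl : ℕ → ℕ} {U S : Finset ℕ} (h : Closed cl U S) : Closed cl U (U \ S) := by
  refine ⟨sdiff_subset, fun u hu v hv e => ?_⟩
  rw [mem_sdiff] at hu ⊢
  exact ⟨hv, fun hvS => hu.2 (h.2 v hvS u hu.1 e.symm)⟩

theorem Closed.union {cl : ℕ → ℕ} {U S S' : Finset ℕ} (h : Closed cl U S) (h' : Closed cl U S') :
    Closed cl U (S ∪ S') := by
  refine ⟨union_subset h.1 h'.1, fun u hu v hv e => ?_⟩
  rw [mem_union] at hu ⊢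
  exact hu.imp (fun hu => h.2 u hu v hv e) (fun hu => h'.2 u hu v hv e)

theorem Closed.inter {cl : ℕ → ℕ} {U S S' : Finset ℕ} (h : Closed cl U S) (h' : Closed cl U S') :
    Closed cl U (S ∩ S') := by
  refine ⟨inter_subset_left.trans h.1, fun u hu v hv e => ?_⟩
  rw [mem_inter] at hu ⊢
  exact hu.imp (fun hu => h.2 u hu v hv e) (fun hu => h'.2 u hu v hv e)

theorem Closed.sdiff {cl : ℕ → ℕ} {U S S' : Finset ℕ} (h : Closed cl U S) (h' : Closed cl U S') :
    Closed cl U (S \ S') := by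
  have : S \ S' = S ∩ (U \ S') := by
    ext v
    simp only [mem_sdiff, mem_inter]
    exact ⟨fun hv => ⟨hv.1, h.1 hv.1, hv.2⟩, fun hv => ⟨hv.1, hv.2.2⟩⟩
  rw [this]
  exact h.inter h'.compl

/-- The net flow out of `S`. -/
def net (F : ℕ → ℕ → ℕ) (U S : Finset ℕ) : ℤ :=
  ∑ e ∈ S ×ˢ (U \ S), ((F e.1 e.2 : ℤ) - F e.2 e.1)

/-- `F` respects the unit capacities. -/
structure Capacity (E : ℕ → ℕ → Prop) (U : Finset ℕ) (F : ℕ → ℕ → ℕ) : Prop where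
  edge {u v : ℕ} (hu : u ∈ U) (hv : v ∈ U) (h : F u v ≠ 0) : E u v
  le_one {u v : ℕ} (hu : u ∈ U) (hv : v ∈ U) : F u v ≤ 1
  anti {u v : ℕ} (hu : u ∈ U) (hv : v ∈ U) (h : F u v ≠ 0) : F v u = 0

/-- `F` is a flow of value `J`. -/
structure IsFlow (E : ℕ → ℕ → Prop) (cl lab : ℕ → ℕ) (U : Finset ℕ) (F : ℕ → ℕ → ℕ) (J : ℕ) :
    Prop where
  cap : Capacity E U F
  net {S : Finset ℕ} (h : Feasible cl lab U S) : net F U S = J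

/-- The residual graph, in which the classes are strongly connected. -/
def Res (E : ℕ → ℕ → Prop) (cl : ℕ → ℕ) (F : ℕ → ℕ → ℕ) (u v : ℕ) : Prop :=
  cl u = cl v ∨ E u v ∧ F u v = 0

variable {E : ℕ → ℕ → Prop} {cl lab : ℕ → ℕ} {U : Finset ℕ} {F : ℕ → ℕ → ℕ}

open Classical in
theorem card_bd (E : ℕ → ℕ → Prop) (U S : Finset ℕ) :
    ((bd E U S).card : ℤ) = ∑ e ∈ S ×ˢ (U \ S), if E e.1 e.2 then (1 : ℤ) else 0 := by
  rw [bd, card_filter]; push_cast; rfl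

open Classical in
theorem Capacity.term_le (h : Capacity E U F) {S : Finset ℕ} (hS : S ⊆ U) (e : ℕ × ℕ)
    (he : e ∈ S ×ˢ (U \ S)) :
    ((F e.1 e.2 : ℤ) - F e.2 e.1) ≤ if E e.1 e.2 then 1 else 0 := by
  rw [mem_product, mem_sdiff] at he
  have h1 := h.le_one (hS he.1) he.2.1
  split_ifs with hE
  · omega
  · have : F e.1 e.2 = 0 := by_contra fun h0 => hE (h.edge (hS he.1) he.2.1 h0)
    omega

theorem Capacity.net_le (h : Capacity E U F) {S : Finset ℕ} (hS : S ⊆ U) :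
    net F U S ≤ (bd E U S).card := by
  rw [card_bd, net]
  exact sum_le_sum fun e he => h.term_le hS e he

/-- Every term of the net flow is at most the capacity, so a flow that fills the whole cut leaves no
edge of it without flow. -/
theorem Capacity.saturated (h : Capacity E U F) {S : Finset ℕ} (hS : S ⊆ U)
    (hn : ((bd E U S).card : ℤ) ≤ net F U S) {u v : ℕ} (hu : u ∈ S) (hv : v ∈ U) (hv' : v ∉ S)
    (hE : E u v) : F u v ≠ 0 := by
  intro h0
  have hlt : net F U S < (bd E U S).card := by
    rw [card_bd, net]
    refine sum_lt_sum (fun e he => h.term_le hS e he) ⟨(u, v), ?_, ?_⟩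
    · simp [hu, hv, hv']
    · simp only [h0, hE, if_true]; push_cast; omega
  omega

/-- No residual edge leaves `S`, so every edge out of `S` carries one unit and, by antisymmetry,
nothing flows back. -/
theorem Capacity.net_eq (h : Capacity E U F) (hE : ∀ u v, E u v → E v u) {S : Finset ℕ}
    (hS : S ⊆ U) (hc : ∀ u ∈ S, ∀ v ∈ U, Res E cl F u v → v ∈ S) :
    net F U S = (bd E U S).card := by
  rw [card_bd, net]
  refine sum_congr rfl fun e he => ?_
  rw [mem_product, mem_sdiff] at he
  have hu := hS he.1
  split_ifs with hE'
  · have h0 : F e.1 e.2 ≠ 0 := fun h0 => he.2.2 (hc _ he.1 _ he.2.1 (Or.inr ⟨hE', h0⟩))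
    have h1 := h.le_one hu he.2.1
    have h2 := h.anti hu he.2.1 h0
    omega
  · have h0 : F e.1 e.2 = 0 := by_contra fun h0 => hE' (h.edge hu he.2.1 h0)
    have h1 : F e.2 e.1 = 0 := by_contra fun h1 => hE' (hE _ _ (h.edge he.2.1 hu h1))
    simp [h0, h1]

theorem IsFlow.le_card {J : ℕ} (h : IsFlow E cl lab U F J) {S : Finset ℕ}
    (hS : Feasible cl lab U S) : J ≤ (bd E U S).card := by
  have := h.cap.net_le hS.closed.1
  rw [h.net hS] at this
  exact_mod_cast this

/-- The vertices reachable in the residual graph of a maximum flow form the smallest minimum cut. -/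
theorem IsFlow.isMinCut {J : ℕ} (h : IsFlow E cl lab U F J) (hE : ∀ u v, E u v → E v u)
    {R : Finset ℕ} (hR : R ⊆ U) (hs : ∀ v ∈ U, lab (cl v) = 1 → v ∈ R)
    (ht : ∀ v ∈ R, lab (cl v) ≠ 2) (hc : ∀ u ∈ R, ∀ v ∈ U, Res E cl F u v → v ∈ R)
    (hmin : ∀ S, S ⊆ U → (∀ v ∈ U, lab (cl v) = 1 → v ∈ S) →
      (∀ u ∈ S, ∀ v ∈ U, Res E cl F u v → v ∈ S) → R ⊆ S) :
    IsMinCut E cl lab U R ∧ (bd E U R).card = J := by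
  have hf : Feasible cl lab U R := ⟨⟨hR, fun u hu v hv e => hc u hu v hv (Or.inl e)⟩,
    fun hv h1 => hs _ hv h1, fun hv => ht _ hv⟩
  have hJ : (bd E U R).card = J := by
    have := h.cap.net_eq hE hR hc
    rw [h.net hf] at this
    exact_mod_cast this.symm
  refine ⟨⟨hf, fun hS => hJ ▸ h.le_card hS, fun {S} hS hle => ?_⟩, hJ⟩
  refine hmin S hS.closed.1 (fun v hv h1 => hS.source hv h1) ?_
  -- Another minimum cut `S` is saturated by the flow, so no residual edge leaves it, and it must
  -- contain everything reachable.
  rintro u hu v hv (e | ⟨e, e0⟩)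
  · exact hS.closed.2 u hu v hv e
  · by_contra hv'
    refine h.cap.saturated hS.closed.1 ?_ hu hv hv' e e0
    rw [h.net hS]
    exact_mod_cast hle.trans hJ.le

/-- A unit sent from `p` to `x`, whether by adding flow or by cancelling it, counts exactly for the
cuts that separate `p` from `x`. -/
theorem net_push {F' : ℕ → ℕ → ℕ} {p x : ℕ} {S : Finset ℕ} (hp : p ∈ U) (hx : x ∈ U)
    (hF : ∀ u ∈ U, ∀ v ∈ U, (F' u v : ℤ) - F' v u =
      F u v - F v u + (if (u, v) = (p, x) then 1 else 0) - if (u, v) = (x, p) then 1 else 0)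
    (hS : S ⊆ U) :
    net F' U S = net F U S + (if p ∈ S then 1 else 0) - if x ∈ S then 1 else 0 := by
  have h1 : net F' U S = net F U S + (if (p, x) ∈ S ×ˢ (U \ S) then 1 else 0) -
      if (x, p) ∈ S ×ˢ (U \ S) then 1 else 0 := by
    rw [net, net, ← sum_ite_eq' (S ×ˢ (U \ S)) (p, x) fun _ => (1 : ℤ),
      ← sum_ite_eq' (S ×ˢ (U \ S)) (x, p) fun _ => (1 : ℤ), ← sum_add_distrib, ← sum_sub_distrib]
    refine sum_congr rfl fun e he => ?_
    rw [mem_product, mem_sdiff] at he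
    exact hF _ (hS he.1) _ he.2.1
  rw [h1]
  simp only [mem_product, mem_sdiff, hp, hx, true_and]
  by_cases h2 : p ∈ S <;> by_cases h3 : x ∈ S <;> simp [h2, h3]

end Cut

/-! ### Guessing a cut with few edges -/

namespace Cut

open Finset

variable {E : ℕ → ℕ → Prop} {cl lab lab' : ℕ → ℕ} {U T X M M' : Finset ℕ} {q K : ℕ}

open Classical in
-- Submodularity of the cut function, checked edge by edge.
theorem card_bd_add_le (S S' : Finset ℕ) (hS : S ⊆ U) (hS' : S' ⊆ U) :
    (bd E U (S ∩ S')).card + (bd E U (S ∪ S')).card ≤ (bd E U S).card + (bd E U S').card := by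
  have key : ∀ S ⊆ U, (bd E U S).card =
      ∑ e ∈ U ×ˢ U, if e.1 ∈ S ∧ e.2 ∉ S ∧ E e.1 e.2 then 1 else 0 := by
    intro S hS
    rw [← card_filter]
    congr 1
    ext ⟨u, v⟩
    simp only [mem_bd, mem_filter, mem_product]
    exact ⟨fun h => ⟨⟨hS h.1, h.2.1⟩, h.1, h.2.2.1, h.2.2.2⟩,
      fun h => ⟨h.2.1, h.1.2, h.2.2.1, h.2.2.2⟩⟩
  rw [key _ hS, key _ hS', key _ (inter_subset_left.trans hS), key _ (union_subset hS hS'),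
    ← sum_add_distrib, ← sum_add_distrib]
  refine sum_le_sum fun e _ => ?_
  by_cases h1 : e.1 ∈ S <;> by_cases h2 : e.1 ∈ S' <;> by_cases h3 : e.2 ∈ S <;>
    by_cases h4 : e.2 ∈ S' <;> by_cases h5 : E e.1 e.2 <;> simp [h1, h2, h3, h4, h5]

/-- Take a minimum cut with the fewest vertices. By submodularity its intersection with any other
minimum cut is again minimum, so it equals the intersection and is contained in the other one. -/
theorem exists_isMinCut (hX : Feasible cl lab U X) : ∃ M, IsMinCut E cl lab U M := by
  classical
  have hne : (U.powerset.filter (Feasible cl lab U)).Nonempty :=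
    ⟨X, by simp [hX, hX.closed.1]⟩
  obtain ⟨S, hS, hSmin⟩ := exists_min_image _ (fun S => (bd E U S).card) hne
  have hne' : ((U.powerset.filter (Feasible cl lab U)).filter
      fun S' => (bd E U S').card ≤ (bd E U S).card).Nonempty := ⟨S, by simpa using hS⟩
  obtain ⟨M, hM, hMmin⟩ := exists_min_image _ card hne'
  simp only [mem_filter, mem_powerset] at hS hSmin hM hMmin
  have hle : ∀ {S'}, Feasible cl lab U S' → (bd E U M).card ≤ (bd E U S').card := fun h =>
    hM.2.trans (hSmin _ ⟨h.closed.1, h⟩)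
  refine ⟨M, hM.1.2, hle, fun {S'} h h' => ?_⟩
  have f1 : Feasible cl lab U (M ∩ S') := ⟨hM.1.2.closed.inter h.closed,
    fun hv h1 => mem_inter.2 ⟨hM.1.2.source hv h1, h.source hv h1⟩,
    fun hv => h.target (mem_inter.1 hv).2⟩
  have f2 : Feasible cl lab U (M ∪ S') := ⟨hM.1.2.closed.union h.closed,
    fun hv h1 => mem_union_left _ (hM.1.2.source hv h1),
    fun hv => (mem_union.1 hv).elim (fun hv => hM.1.2.target hv) (fun hv => h.target hv)⟩
  have h3 := card_bd_add_le (E := E) M S' hM.1.1 h.closed.1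
  have h4 := hle f2
  have h5 := hMmin (M ∩ S') ⟨⟨f1.closed.1, f1⟩, by have := hSmin S' ⟨h.closed.1, h⟩; omega⟩
  exact inter_eq_left.1 (eq_of_subset_of_card_le inter_subset_left h5)

/-- The number of classes in a set. -/
def cnum (cl : ℕ → ℕ) (S : Finset ℕ) : ℕ := (S.image cl).card

/-- A cut that does not become smaller by moving classes without terminals to the other side. -/
structure Good (E : ℕ → ℕ → Prop) (cl : ℕ → ℕ) (U T X : Finset ℕ) : Prop where
  closed : Closed cl U X
  inside {C : Finset ℕ} (hC : Closed cl U C) (h : C ⊆ X) (hT : Disjoint C T) (hne : C.Nonempty) :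
    ∃ u ∈ C, ∃ v ∈ X, v ∉ C ∧ E u v
  outside {C : Finset ℕ} (hC : Closed cl U C) (h : Disjoint C X) (hT : Disjoint C T)
    (hne : ∃ u ∈ C, ∃ v ∈ X, E u v) : ∃ u ∈ C, ∃ v ∈ U, v ∉ X ∧ v ∉ C ∧ E u v

/-- The classes of `U` have their representatives in `U`. -/
def Reps (cl : ℕ → ℕ) (U : Finset ℕ) : Prop := ∀ v ∈ U, cl v ∈ U ∧ cl (cl v) = cl v

open Classical in
/-- The side of the cut `M` that has at most `q` classes, if there is one. -/
noncomputable def side (cl : ℕ → ℕ) (q : ℕ) (U M : Finset ℕ) : Finset ℕ :=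
  if cnum cl M ≤ q then M else U \ M

/-- The vertices whose labels are guessed. -/
def Query (E : ℕ → ℕ → Prop) (cl : ℕ → ℕ) (q K : ℕ) (U : Finset ℕ) (lab : ℕ → ℕ) (v : ℕ) : Prop :=
  ∃ M, IsMinCut E cl lab U M ∧ (bd E U M).card ≤ K ∧
    (v ∈ side cl q U M ∧ cl v = v ∨ v ∈ U ∧ v ∉ side cl q U M ∧ ∃ u ∈ side cl q U M, E u v)

/-- The smallest minimum cut has many classes on both sides. -/
def Balanced (E : ℕ → ℕ → Prop) (cl : ℕ → ℕ) (q K : ℕ) (U : Finset ℕ) (lab : ℕ → ℕ) : Prop :=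
  ∃ M, IsMinCut E cl lab U M ∧ (bd E U M).card ≤ K ∧ q < cnum cl M ∧ q < cnum cl (U \ M)

theorem side_closed (hM : Closed cl U M) : Closed cl U (side cl q U M) := by
  unfold side; split_ifs
  · exact hM
  · exact hM.compl

theorem card_bd_compl (hE : ∀ u v, E u v → E v u) (hM : M ⊆ U) :
    (bd E U (U \ M)).card = (bd E U M).card := by
  refine card_bij (fun e _ => (e.2, e.1)) ?_ ?_ ?_
  · rintro ⟨u, v⟩ h
    simp only [mem_bd, mem_sdiff] at h ⊢
    have : v ∈ M := by_contra fun hv => h.2.2.1 ⟨h.2.1, hv⟩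
    exact ⟨this, h.1.1, h.1.2, hE _ _ h.2.2.2⟩
  · rintro ⟨u, v⟩ _ ⟨u', v'⟩ _ h
    simp only [Prod.mk.injEq] at h ⊢
    exact ⟨h.2, h.1⟩
  · rintro ⟨u, v⟩ h
    rw [mem_bd] at h
    refine ⟨(v, u), ?_, rfl⟩
    simp only [mem_bd, mem_sdiff]
    exact ⟨⟨h.2.1, h.2.2.1⟩, hM h.1, fun h' => h'.2 h.1, hE _ _ h.2.2.2⟩

open Classical in
-- The small side contributes one representative for each of its at most `q` classes, and each
-- queried vertex across is the end of one of at most `K` cut edges.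
theorem card_query_le (hE : ∀ u v, E u v → E v u) (hb : ¬ Balanced E cl q K U lab) (s : Finset ℕ) :
    (s.filter (Query E cl q K U lab)).card ≤ q + K := by
  by_cases hM : ∃ M, IsMinCut E cl lab U M ∧ (bd E U M).card ≤ K
  · obtain ⟨M, hM, hK⟩ := hM
    have hS : cnum cl (side cl q U M) ≤ q := by
      unfold side
      split_ifs with h
      · exact h
      · by_contra h'
        exact hb ⟨M, hM, hK, by omega, by omega⟩
    have hS' : (bd E U (side cl q U M)).card ≤ K := by
      unfold side
      split_ifs with h
      · exact hK
      · rwa [card_bd_compl hE hM.feasible.closed.1]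
    have hsub : s.filter (Query E cl q K U lab) ⊆ (side cl q U M).image cl ∪
        (bd E U (side cl q U M)).image Prod.snd := by
      intro v hv
      rw [mem_filter] at hv
      obtain ⟨M', hM', -, h⟩ := hv.2
      obtain rfl := hM.unique hM'
      rw [mem_union, mem_image, mem_image]
      rcases h with ⟨h, e⟩ | ⟨hU, hn, u, hu, e⟩
      · exact Or.inl ⟨v, h, e⟩
      · exact Or.inr ⟨(u, v), mem_bd.2 ⟨hu, hU, hn, e⟩, rfl⟩
    calc _ ≤ _ := card_le_card hsub
      _ ≤ _ := card_union_le _ _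
      _ ≤ q + K := Nat.add_le_add hS (card_image_le.trans hS')
  · rw [filter_eq_empty_iff.2, card_empty]
    · exact Nat.zero_le _
    · rintro v - ⟨M, h1, h2, -⟩
      exact hM ⟨M, h1, h2⟩

/-- All end vertices of edges of the cut `X` are labelled. -/
def Decided (E : ℕ → ℕ → Prop) (cl lab : ℕ → ℕ) (U X : Finset ℕ) : Prop :=
  ∀ u v, (u, v) ∈ bd E U X → lab (cl u) ≠ 0 ∧ lab (cl v) ≠ 0

theorem eq_one_of_mem (h2 : ∀ c, lab c ≤ 2) (hX : Feasible cl lab U X) {v : ℕ} (hv : v ∈ X)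
    (h0 : lab (cl v) ≠ 0) : lab (cl v) = 1 := by
  have := hX.target hv
  have := h2 (cl v)
  omega

theorem eq_two_of_not_mem (h2 : ∀ c, lab c ≤ 2) (hX : Feasible cl lab U X) {v : ℕ} (hU : v ∈ U)
    (hv : v ∉ X) (h0 : lab (cl v) ≠ 0) : lab (cl v) = 2 := by
  have : lab (cl v) ≠ 1 := fun h => hv (hX.source hU h)
  have := h2 (cl v)
  omega

/-- Every edge of `X` joins a class labelled `1` to one labelled `2`, so it also crosses `M`;
minimality of `M` then makes the two edge sets equal and gives `M ⊆ X`. If `X \ M` were nonempty, it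
would be free of terminals, so `Good.inside` would give an edge from it to `M`. That edge crosses
`M` but lies inside `X`, a contradiction. -/
theorem eq_of_decided (hE : ∀ u v, E u v → E v u) (hX : Good E cl U T X) (h2 : ∀ c, lab c ≤ 2)
    (hT : ∀ v ∈ T, lab (cl v) ≠ 0) (hf : Feasible cl lab U X) (hd : Decided E cl lab U X)
    (hM : IsMinCut E cl lab U M) : M = X := by
  have hsub : bd E U X ⊆ bd E U M := by
    rintro ⟨u, v⟩ he
    obtain ⟨hu, hv⟩ := hd u v he
    rw [mem_bd] at he ⊢
    refine ⟨hM.feasible.source (hX.closed.1 he.1) (eq_one_of_mem h2 hf he.1 hu), he.2.1,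
      fun h => hM.feasible.target h (eq_two_of_not_mem h2 hf he.2.1 he.2.2.1 hv), he.2.2.2⟩
  have heq : bd E U X = bd E U M := eq_of_subset_of_card_le hsub (hM.le hf)
  have hMX : M ⊆ X := hM.subset hf (by rw [heq])
  refine Subset.antisymm hMX ?_
  by_contra hne
  obtain ⟨u, hu, v, hv, hv', e⟩ := hX.inside (C := X \ M) (hX.closed.sdiff hM.feasible.closed)
    sdiff_subset (by
      rw [disjoint_left]
      intro t ht htT
      rw [mem_sdiff] at ht
      exact ht.2 (hM.feasible.source (hX.closed.1 ht.1) (eq_one_of_mem h2 hf ht.1 (hT t htT))))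
    (by rwa [sdiff_nonempty])
  rw [mem_sdiff] at hu hv'
  have : (v, u) ∈ bd E U M := mem_bd.2 ⟨by_contra fun h => hv' ⟨hv, h⟩, hX.closed.1 hu.1, hu.2,
    hE _ _ e⟩
  rw [← heq, mem_bd] at this
  exact this.2.2.1 hu.1

/-- The quantity that increases with every round of guesses. -/
noncomputable def potential (E : ℕ → ℕ → Prop) (cl : ℕ → ℕ) (q : ℕ) (U M : Finset ℕ) : ℕ :=
  (bd E U M).card * (q + 2) + min (cnum cl M) (q + 1)

/-- One more cut edge weighs `q + 2`, more than the truncated number of classes can lose. -/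
theorem potential_lt_of_card_lt (h : (bd E U M).card < (bd E U M').card) :
    potential E cl q U M < potential E cl q U M' := by
  have : ((bd E U M).card + 1) * (q + 2) ≤ (bd E U M').card * (q + 2) := Nat.mul_le_mul_right _ h
  unfold potential
  rw [add_mul] at this
  have := min_le_right (cnum cl M) (q + 1)
  omega

/-- The answers are those of the target `X`. If some newly labelled vertex contradicts `M`, the next
smallest minimum cut has more edges, or as many edges and strictly more classes, of which there were
at most `q`. If none does, the local optimality of `X` forces it to one side of `M`, and then all
ends of its edges have been asked. -/
theorem progress (hE : ∀ u v, E u v → E v u) (hr : Reps cl U) (hX : Good E cl U T X)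
    (h2 : ∀ c, lab c ≤ 2) (h2' : ∀ c, lab' c ≤ 2)
    (hext : ∀ c, lab c ≠ 0 → lab' c = lab c) (hT : ∀ v ∈ T, lab (cl v) ≠ 0)
    (hf : Feasible cl lab' U X) (hM : IsMinCut E cl lab U M) (hK : (bd E U M).card ≤ K)
    (hM' : IsMinCut E cl lab' U M') (hQ : ∀ v, Query E cl q K U lab v → lab' (cl v) ≠ 0) :
    potential E cl q U M < potential E cl q U M' ∨ Decided E cl lab' U X := by
  have weaken : ∀ {S}, Feasible cl lab' U S → Feasible cl lab U S := fun h =>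
    ⟨h.closed, fun hv h1 => h.source hv (by rw [hext _ (by omega), h1]),
      fun hv h1 => h.target hv (by rw [hext _ (by omega), h1])⟩
  have hf0 := weaken hf
  have hMM' := hM.le (weaken hM'.feasible)
  have hXU := hX.closed.1
  have hMU := hM.feasible.closed.1
  have hSl : ∀ v ∈ side cl q U M, lab' (cl v) ≠ 0 := by
    intro v hv
    have hc := side_closed (q := q) hM.feasible.closed
    have hvU := hc.1 hv
    have := hQ (cl v) ⟨M, hM, hK, Or.inl ⟨hc.2 v hv _ (hr v hvU).1 (hr v hvU).2.symm,
      (hr v hvU).2⟩⟩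
    rwa [(hr v hvU).2] at this
  have hNl : ∀ v ∈ U, v ∉ side cl q U M → (∃ u ∈ side cl q U M, E u v) → lab' (cl v) ≠ 0 :=
    fun v hv hv' h => hQ v ⟨M, hM, hK, Or.inr ⟨hv, hv', h⟩⟩
  by_cases hq : cnum cl M ≤ q
  · have hs : side cl q U M = M := by simp [side, hq]
    rw [hs] at hSl hNl
    -- The small side is `M` itself. A neighbor `v` of `M` that belongs to `X` is now labelled `1`,
    -- so `M'` contains it, and it costs more or strictly contains `M`.
    by_cases hy : ∃ v ∈ U, v ∉ M ∧ v ∈ X ∧ ∃ u ∈ M, E u v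
    · left
      obtain ⟨v, hvU, hvM, hvX, hu⟩ := hy
      have hv1 := eq_one_of_mem h2' hf hvX (hNl v hvU hvM hu)
      have hvM' := hM'.feasible.source hvU hv1
      rcases hMM'.lt_or_eq with hlt | heq
      · exact potential_lt_of_card_lt hlt
      · have hsub := hM.subset (weaken hM'.feasible) heq.symm.le
        have hss : M.image cl ⊂ M'.image cl := by
          refine ⟨image_subset_image hsub, fun h => ?_⟩
          obtain ⟨w, hw, e⟩ := mem_image.1 (h (mem_image_of_mem cl hvM'))
          exact hvM (hM.feasible.closed.2 w hw v hvU e)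
        have := card_lt_card hss
        have e1 : cnum cl M < cnum cl M' := this
        unfold potential
        rw [heq]
        omega
    · right
      push Not at hy
      -- Otherwise `Good.inside` applied to `X \ M` gives a neighbor of `M` that lies in `X`, the
      -- case excluded by `hy`.
      have hXM : X ⊆ M := by
        by_contra hne
        obtain ⟨u, hu, v, hv, hv', e⟩ := hX.inside (C := X \ M)
          (hX.closed.sdiff hM.feasible.closed) sdiff_subset (by
            rw [disjoint_left]
            intro t ht htT
            rw [mem_sdiff] at ht
            exact ht.2 (hM.feasible.source (hXU ht.1)
              (eq_one_of_mem h2 hf0 ht.1 (hT t htT))))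
          (by rwa [sdiff_nonempty])
        rw [mem_sdiff] at hu hv'
        exact hy u (hXU hu.1) hu.2 hu.1 v (by_contra fun h => hv' ⟨hv, h⟩) (hE _ _ e)
      intro u v he
      rw [mem_bd] at he
      refine ⟨hSl u (hXM he.1), ?_⟩
      by_cases hv : v ∈ M
      · exact hSl v hv
      · exact hNl v he.2.1 hv ⟨u, hXM he.1, he.2.2.2⟩
  · have hs : side cl q U M = U \ M := by simp [side, hq]
    rw [hs] at hSl hNl
    -- The small side is `U \ M`. A vertex `x` of `M` outside `X` that has a neighbor there is now
    -- labelled `2`; a new cut of equal size would still contain `M`, hence `x`, so the size grows.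
    by_cases hx : ∃ x ∈ M, x ∉ X ∧ ∃ y ∈ U \ M, E y x
    · left
      obtain ⟨x, hxM, hxX, hy⟩ := hx
      have hx2 := eq_two_of_not_mem h2' hf (hMU hxM) hxX (hNl x (hMU hxM) (by simp [hxM]) hy)
      refine potential_lt_of_card_lt (lt_of_le_of_ne hMM' fun heq => ?_)
      exact hM'.feasible.target (hM.subset (weaken hM'.feasible) heq.symm.le hxM) hx2
    · right
      push Not at hx
      have hcl : Closed cl U (M \ X) := hM.feasible.closed.sdiff hX.closed
      have hdT : Disjoint (M \ X) T := by
        rw [disjoint_left]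
        intro t ht htT
        rw [mem_sdiff] at ht
        exact hM.feasible.target ht.1 (eq_two_of_not_mem h2 hf0 (hMU ht.1) ht.2 (hT t htT))
      -- The set `M \ X` has no edge to `U \ M`, and outside `X` and itself there is only `U \ M`;
      -- so `Good.outside` forbids edges from `M \ X` to `X`. Cutting `M` down to `M ∩ X` therefore
      -- adds no edge, and minimality gives `M ⊆ X`.
      have hno : ∀ u ∈ M \ X, ∀ v ∈ X, ¬ E u v := by
        intro u hu v hv e
        obtain ⟨u', hu', v', hv', hvX, hvC, e'⟩ := hX.outside hcl
          (disjoint_sdiff_self_left) hdT ⟨u, hu, v, hv, e⟩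
        rw [mem_sdiff] at hu'
        refine hx u' hu'.1 hu'.2 v' (mem_sdiff.2 ⟨hv', fun h => hvC (mem_sdiff.2 ⟨h, hvX⟩)⟩)
          (hE _ _ e')
      have hfMX : Feasible cl lab U (M ∩ X) := ⟨hM.feasible.closed.inter hX.closed,
        fun hv h1 => mem_inter.2 ⟨hM.feasible.source hv h1, hf0.source hv h1⟩,
        fun hv => hM.feasible.target (mem_inter.1 hv).1⟩
      have hbd : bd E U (M ∩ X) ⊆ bd E U M := by
        rintro ⟨u, v⟩ he
        rw [mem_bd, mem_inter] at he
        refine mem_bd.2 ⟨he.1.1, he.2.1, fun hvM => ?_, he.2.2.2⟩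
        have hvX : v ∉ X := fun hvX => he.2.2.1 (mem_inter.2 ⟨hvM, hvX⟩)
        exact hno v (mem_sdiff.2 ⟨hvM, hvX⟩) u he.1.2 (hE _ _ he.2.2.2)
      have hMX : M ⊆ X := (hM.subset hfMX (card_le_card hbd)).trans inter_subset_right
      intro u v he
      rw [mem_bd] at he
      have hv : v ∈ U \ M := mem_sdiff.2 ⟨he.2.1, fun h => he.2.2.1 (hMX h)⟩
      refine ⟨?_, hSl v hv⟩
      by_cases hu : u ∈ M
      · exact hNl u (hMU hu) (by simp [hu]) ⟨v, hv, hE _ _ he.2.2.2⟩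
      · exact hSl u (mem_sdiff.2 ⟨hXU he.1, hu⟩)

end Cut

/-! ### Rounds of guessed labels -/

namespace Cut

open Finset

open Classical in
/-- The classes of the queried vertices below `m` that have no label are labelled by the next
guesses. The state consists of the labels and the number of guesses used. -/
noncomputable def ask (cl : ℕ → ℕ) (Q : ℕ → Prop) (b : ℕ → ℕ) :
    ℕ → (ℕ → ℕ) × ℕ → (ℕ → ℕ) × ℕ
  | 0, s => s
  | m + 1, s =>
    let s' := ask cl Q b m s
    if Q m ∧ s'.1 (cl m) = 0 then (Function.update s'.1 (cl m) (2 - b s'.2), s'.2 + 1) else s'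

/-- The state after `d` rounds of guesses. -/
noncomputable def rounds (E : ℕ → ℕ → Prop) (cl : ℕ → ℕ) (q K n : ℕ) (U T : Finset ℕ)
    (b : ℕ → ℕ) : ℕ → (ℕ → ℕ) × ℕ
  | 0 => ask cl (· ∈ T) b n (fun _ => 0, 0)
  | d + 1 => let s := rounds E cl q K n U T b d
    ask cl (Query E cl q K U s.1) b n s

variable {E : ℕ → ℕ → Prop} {cl : ℕ → ℕ} {U T X M M' : Finset ℕ} {q K n : ℕ}

/-- The sequence of bits `b` starts with `A`. -/
def Agree (b : ℕ → ℕ) (A : List ℕ) : Prop := ∀ i < A.length, b i = A.getD i 0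

theorem Agree.of_prefix {b : ℕ → ℕ} {A A' : List ℕ} (h : Agree b A') (hA : A <+: A') :
    Agree b A := by
  obtain ⟨B, rfl⟩ := hA
  intro i hi
  rw [h i (by rw [List.length_append]; omega), List.getD_append _ _ _ _ hi]

open Classical in
/-- Some guesses label all queried classes as in `X`. -/
theorem exists_ask {lab : ℕ → ℕ} (Q : ℕ → Prop) (hf : Feasible cl lab U X)
    (h2 : ∀ c, lab c ≤ 2) (hQ : ∀ v, Q v → v ∈ U) (A : List ℕ) (hA : ∀ a ∈ A, a ≤ 1) (m : ℕ) :
    ∃ (lab' : ℕ → ℕ) (A' : List ℕ), A <+: A' ∧ (∀ a ∈ A', a ≤ 1) ∧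
      A'.length ≤ A.length + ((range m).filter Q).card ∧
      (∀ b, Agree b A' → ask cl Q b m (lab, A.length) = (lab', A'.length)) ∧
      Feasible cl lab' U X ∧ (∀ c, lab' c ≤ 2) ∧ (∀ c, lab c ≠ 0 → lab' c = lab c) ∧
      ∀ v < m, Q v → lab' (cl v) ≠ 0 := by
  induction m with
  | zero => exact ⟨lab, A, List.prefix_rfl, hA, by simp, fun b _ => rfl, hf, h2, fun _ _ => rfl,
      fun v hv => absurd hv (Nat.not_lt_zero _)⟩
  | succ m ih =>
    obtain ⟨lab', A', hAA', hA', hlen, hb, hf', h2', hext, hl⟩ := ih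
    have hmono : ((range m).filter Q).card ≤ ((range (m + 1)).filter Q).card :=
      card_le_card (filter_subset_filter _ (range_subset_range.2 (Nat.le_succ m)))
    by_cases hc : Q m ∧ lab' (cl m) = 0
    -- The correct guess is whether `m` lies in `X`; it turns into the label `2 - a`. Vertices whose
    -- class has a label already consume no digit.
    · set a : ℕ := if m ∈ X then 1 else 0 with ha
      have ha1 : a ≤ 1 := by rw [ha]; split_ifs <;> omega
      have hmU := hQ m hc.1
      refine ⟨Function.update lab' (cl m) (2 - a), A' ++ [a],
        hAA'.trans (List.prefix_append _ _), ?_, ?_, ?_, ?_, ?_, ?_, ?_⟩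
      · intro x hx
        rcases List.mem_append.1 hx with hx | hx
        · exact hA' x hx
        · rw [List.mem_singleton.1 hx]; exact ha1
      · rw [List.length_append, range_add_one, filter_insert, if_pos hc.1,
          card_insert_of_notMem (by simp)]
        simp only [List.length_singleton]; omega
      · intro b hab
        have h1 := hb b (hab.of_prefix (List.prefix_append _ _))
        have h3 : b A'.length = a := by
          rw [hab _ (by simp)]; simp
        simp only [ask, h1, if_pos hc, h3, List.length_append, List.length_singleton]
      · refine ⟨hf'.closed, fun {v} hv h1 => ?_, fun {v} hv => ?_⟩
        · by_cases e : cl v = cl m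
          · rw [e, Function.update_self] at h1
            have : m ∈ X := by by_contra hm; simp [ha, hm] at h1
            exact hf'.closed.2 m this v hv e.symm
          · rw [Function.update_of_ne e] at h1
            exact hf'.source hv h1
        · by_cases e : cl v = cl m
          · have : m ∈ X := hf'.closed.2 v hv m hmU e
            rw [e, Function.update_self]; simp [ha, this]
          · rw [Function.update_of_ne e]
            exact hf'.target hv
      · intro c
        rw [Function.update_apply]; split_ifs
        · omega
        · exact h2' c
      · intro c h0
        rw [Function.update_of_ne, hext c h0]
        rintro rfl
        exact h0 (by rw [← hext _ h0]; exact hc.2)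
      · intro v hv hQv
        rw [Function.update_apply]; split_ifs with e
        · omega
        · refine hl v ?_ hQv
          have : v ≠ m := by rintro rfl; exact e rfl
          omega
    · refine ⟨lab', A', hAA', hA', by omega, fun b hab => ?_, hf', h2', hext, fun v hv hQv => ?_⟩
      · simp only [ask, hb b hab, if_neg hc]
      · rcases Nat.lt_succ_iff_lt_or_eq.1 hv with hv | rfl
        · exact hl v hv hQv
        · exact fun h0 => hc ⟨hQv, h0⟩

theorem Decided.ext {lab lab' : ℕ → ℕ} (h : Decided E cl lab U X)
    (hext : ∀ c, lab c ≠ 0 → lab' c = lab c) : Decided E cl lab' U X := fun u v he =>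
  ⟨by rw [hext _ (h u v he).1]; exact (h u v he).1, by rw [hext _ (h u v he).2]; exact (h u v he).2⟩

theorem getD_agree (A : List ℕ) : Agree (fun i => A.getD i 0) A := fun _ _ => rfl

/-- If no sequence of guesses of length at most `L` leads to a balanced cut, then some sequence of
guesses leads to the cut `X`. -/
theorem exists_guess (hE : ∀ u v, E u v → E v u) (hr : Reps cl U) (hU : U ⊆ range n) (hTU : T ⊆ U)
    (hX : Good E cl U T X) (hK : (bd E U X).card ≤ K) {L : ℕ}
    (hL : T.card + ((K + 1) * (q + 2) + 1) * (q + K) ≤ L)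
    (hb : ∀ A : List ℕ, A.length ≤ L → (∀ a ∈ A, a ≤ 1) → ∀ d < (K + 1) * (q + 2) + 1,
      ¬ Balanced E cl q K U (rounds E cl q K n U T (fun i => A.getD i 0) d).1) :
    ∃ A : List ℕ, A.length ≤ L ∧ (∀ a ∈ A, a ≤ 1) ∧ IsMinCut E cl
      (rounds E cl q K n U T (fun i => A.getD i 0) ((K + 1) * (q + 2) + 1)).1 U X := by
  classical
  have f0 : Feasible cl (fun _ => 0) U X := ⟨hX.closed, by simp, by simp⟩
  -- Some string of correct guesses keeps `X` feasible for `d` rounds. Unless the cut is decided by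
  -- then, the potential of the smallest minimum cut is at least `d`.
  have key : ∀ d ≤ (K + 1) * (q + 2) + 1, ∃ (lab : ℕ → ℕ) (A : List ℕ), (∀ a ∈ A, a ≤ 1) ∧
      A.length ≤ T.card + d * (q + K) ∧
      (∀ b, Agree b A → rounds E cl q K n U T b d = (lab, A.length)) ∧ Feasible cl lab U X ∧
      (∀ c, lab c ≤ 2) ∧ (∀ v ∈ T, lab (cl v) ≠ 0) ∧
      ((∀ M, IsMinCut E cl lab U M → d ≤ potential E cl q U M) ∨ Decided E cl lab U X) := by
    intro d
    induction d with
    | zero =>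
      intro _
      obtain ⟨lab, A, -, hA, hlen, hab, hf, h2, -, hl⟩ := exists_ask (cl := cl) (· ∈ T) f0
        (by simp) (fun v hv => hTU hv) [] (by simp) n
      refine ⟨lab, A, hA, ?_, fun b hb => by simpa [rounds] using hab b hb, hf, h2,
        fun v hv => hl v (mem_range.1 (hU (hTU hv))) hv, Or.inl fun M _ => Nat.zero_le _⟩
      refine hlen.trans ?_
      simp only [List.length_nil, zero_add, zero_mul, add_zero]
      refine card_le_card fun v hv => ?_
      simp only [mem_filter] at hv
      exact hv.2
    | succ d ih =>
      intro hd
      obtain ⟨lab, A, hA, hlen, hab, hf, h2, hT, hpot⟩ := ih (by omega)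
      have hle : A.length ≤ L := by
        refine hlen.trans (le_trans ?_ hL)
        exact Nat.add_le_add_left (Nat.mul_le_mul_right _ (by omega)) _
      have hbal := hb A hle hA d (by omega)
      rw [hab _ (getD_agree A)] at hbal
      change ¬ Balanced E cl q K U lab at hbal
      obtain ⟨M, hM⟩ := exists_isMinCut (E := E) hf
      have hMK := (hM.le hf).trans hK
      have hQU : ∀ v, Query E cl q K U lab v → v ∈ U := by
        rintro v ⟨M', hM', -, ⟨h, -⟩ | ⟨h, -⟩⟩
        · exact (side_closed hM'.feasible.closed).1 h
        · exact h
      obtain ⟨lab', A', hAA', hA', hlen', hab', hf', h2', hext, hl⟩ :=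
        exists_ask (cl := cl) (Query E cl q K U lab) hf h2 hQU A hA n
      refine ⟨lab', A', hA', ?_, fun b hb => ?_, hf', h2', fun v hv => ?_, ?_⟩
      · have := card_query_le hE hbal (range n)
        rw [add_mul, one_mul]
        omega
      · simp only [rounds, hab b (hb.of_prefix hAA')]
        exact hab' b hb
      · rw [hext _ (hT v hv)]; exact hT v hv
      · rcases hpot with hpot | hdec
        · by_cases hdec : Decided E cl lab' U X
          · exact Or.inr hdec
          · refine Or.inl fun M' hM' => ?_
            rcases progress hE hr hX h2 h2' hext hT hf' hM hMK hM'
              (fun v hv => hl v (mem_range.1 (hU (hQU v hv))) hv) with h | h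
            · have := hpot M hM; omega
            · exact absurd h hdec
        · exact Or.inr (hdec.ext hext)
  obtain ⟨lab, A, hA, hlen, hab, hf, h2, hT, hpot⟩ := key _ le_rfl
  refine ⟨A, hlen.trans hL, hA, ?_⟩
  rw [hab _ (getD_agree A)]
  obtain ⟨M, hM⟩ := exists_isMinCut (E := E) hf
  have hdec : Decided E cl lab U X := by
    rcases hpot with hpot | hdec
    -- The potential is at most `K * (q + 2) + (q + 1)`, because `X` itself is feasible and has at
    -- most `K` edges. This is less than the number of rounds.
    · exfalso
      have h1 := hpot M hM
      have h3 : (bd E U M).card * (q + 2) ≤ K * (q + 2) :=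
        Nat.mul_le_mul_right _ ((hM.le hf).trans hK)
      have h4 := min_le_right (cnum cl M) (q + 1)
      unfold potential at h1
      rw [add_mul] at h1
      omega
    · exact hdec
  rwa [eq_of_decided hE hX h2 hT hf hdec hM] at hM

end Cut

/-! ### Connectivity and rank -/

namespace Cut

open Finset Relation

/-- Two vertices below `n` have equal labels if and only if `R` connects them. -/
def Labels (n : ℕ) (R : ℕ → ℕ → Prop) (C : ℕ → ℕ) : Prop :=
  ∀ u < n, ∀ v < n, C u = C v ↔ EqvGen R u v

/-- The least vertex connected to `v`. -/
noncomputable def least (R : ℕ → ℕ → Prop) (v : ℕ) : ℕ := sInf {u | EqvGen R v u}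

/-- The number of connected components. -/
noncomputable def comps (n : ℕ) (R : ℕ → ℕ → Prop) : ℕ := ((range n).image (least R)).card

/-- The rank in the cycle matroid. -/
noncomputable def rk (n : ℕ) (R : ℕ → ℕ → Prop) : ℕ := n - comps n R

/-- `R` with the additional edge from `u` to `v` -/
def addEdge (R : ℕ → ℕ → Prop) (u v : ℕ) (a b : ℕ) : Prop := R a b ∨ a = u ∧ b = v

variable {n : ℕ} {R R' : ℕ → ℕ → Prop} {C C' : ℕ → ℕ}

theorem least_spec (R : ℕ → ℕ → Prop) (v : ℕ) : EqvGen R v (least R v) :=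
  Nat.sInf_mem (s := {u | EqvGen R v u}) ⟨v, EqvGen.refl v⟩

theorem least_eq_iff {u v : ℕ} : least R u = least R v ↔ EqvGen R u v := by
  constructor
  · intro h
    refine (least_spec R u).trans _ _ _ ?_
    rw [h]
    exact (least_spec R v).symm
  · intro h
    have : {w | EqvGen R u w} = {w | EqvGen R v w} := by
      ext w
      exact ⟨fun h' => (h.symm _ _).trans _ _ _ h', fun h' => h.trans _ _ _ h'⟩
    simp only [least, this]

theorem labels_least : Labels n R (least R) := fun _ _ _ _ => least_eq_iff

/-- On the numbers below `n` the map `C'` factors through `C`. -/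
theorem card_image_le_of_imp (h : ∀ u < n, ∀ v < n, C u = C v → C' u = C' v) :
    ((range n).image C').card ≤ ((range n).image C).card := by
  have : (range n).image C' ⊆ ((range n).image C).image
      fun c => C' (Function.invFunOn C (range n : Set ℕ) c) := by
    intro c hc
    obtain ⟨v, hv, rfl⟩ := mem_image.1 hc
    have hv' : ∃ a ∈ (range n : Set ℕ), C a = C v := ⟨v, hv, rfl⟩
    refine mem_image.2 ⟨C v, mem_image_of_mem C hv, h _ ?_ v (mem_range.1 hv) ?_⟩
    · exact mem_range.1 (Function.invFunOn_mem hv')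
    · exact Function.invFunOn_eq hv'
  exact (card_le_card this).trans card_image_le

theorem Labels.comps_eq (h : Labels n R C) : comps n R = ((range n).image C).card :=
  le_antisymm (card_image_le_of_imp fun u hu v hv e => least_eq_iff.2 ((h u hu v hv).1 e))
    (card_image_le_of_imp fun u hu v hv e => (h u hu v hv).2 (least_eq_iff.1 e))

theorem comps_le : comps n R ≤ n := card_image_le.trans (card_range n).le

theorem rk_add_comps : rk n R + comps n R = n := Nat.sub_add_cancel comps_le

theorem comps_anti (h : ∀ u v, R u v → R' u v) : comps n R' ≤ comps n R :=
  card_image_le_of_imp fun _ _ _ _ e => least_eq_iff.2 ((least_eq_iff.1 e).mono h)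

theorem rk_mono (h : ∀ u v, R u v → R' u v) : rk n R ≤ rk n R' :=
  Nat.sub_le_sub_left (comps_anti h) n

/-- A connection needs the new edge at most once, in one of its two directions. -/
theorem eqvGen_addEdge {u v a b : ℕ} : EqvGen (addEdge R u v) a b ↔
    EqvGen R a b ∨ EqvGen R a u ∧ EqvGen R v b ∨ EqvGen R a v ∧ EqvGen R u b := by
  have inc : ∀ {a b}, EqvGen R a b → EqvGen (addEdge R u v) a b := fun h =>
    h.mono fun _ _ => Or.inl
  have huv : EqvGen (addEdge R u v) u v := EqvGen.rel _ _ (Or.inr ⟨rfl, rfl⟩)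
  constructor
  · intro h
    induction h with
    | rel a b h =>
      rcases h with h | ⟨rfl, rfl⟩
      · exact Or.inl (EqvGen.rel _ _ h)
      · exact Or.inr (Or.inl ⟨EqvGen.refl _, EqvGen.refl _⟩)
    | refl a => exact Or.inl (EqvGen.refl _)
    | symm a b _ ih =>
      rcases ih with h | ⟨h, h'⟩ | ⟨h, h'⟩
      · exact Or.inl h.symm
      · exact Or.inr (Or.inr ⟨h'.symm, h.symm⟩)
      · exact Or.inr (Or.inl ⟨h'.symm, h.symm⟩)
    | trans a b c _ _ ih1 ih2 =>
      rcases ih1 with h | ⟨h, h'⟩ | ⟨h, h'⟩ <;> rcases ih2 with g | ⟨g, g'⟩ | ⟨g, g'⟩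
      · exact Or.inl (h.trans _ _ _ g)
      · exact Or.inr (Or.inl ⟨h.trans _ _ _ g, g'⟩)
      · exact Or.inr (Or.inr ⟨h.trans _ _ _ g, g'⟩)
      · exact Or.inr (Or.inl ⟨h, h'.trans _ _ _ g⟩)
      · exact Or.inr (Or.inl ⟨h, g'⟩)
      · exact Or.inl (h.trans _ _ _ g')
      · exact Or.inr (Or.inr ⟨h, h'.trans _ _ _ g⟩)
      · exact Or.inl (h.trans _ _ _ g')
      · exact Or.inr (Or.inr ⟨h, g'⟩)
  · rintro (h | ⟨h, h'⟩ | ⟨h, h'⟩)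
    · exact inc h
    · exact ((inc h).trans _ _ _ huv).trans _ _ _ (inc h')
    · exact ((inc h).trans _ _ _ huv.symm).trans _ _ _ (inc h')

theorem Labels.addEdge_of_eq (h : Labels n R C) {u v : ℕ} (hu : u < n) (hv : v < n)
    (e : C u = C v) : Labels n (addEdge R u v) C := by
  have huv := (h u hu v hv).1 e
  intro a ha b hb
  rw [h a ha b hb, eqvGen_addEdge]
  refine ⟨Or.inl, ?_⟩
  rintro (h | ⟨h, h'⟩ | ⟨h, h'⟩)
  · exact h
  · exact (h.trans _ _ _ huv).trans _ _ _ h'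
  · exact (h.trans _ _ _ huv.symm).trans _ _ _ h'

theorem Labels.addEdge_of_ne (h : Labels n R C) {u v : ℕ} (hu : u < n) (hv : v < n)
    (e : C u ≠ C v) (hC' : ∀ w < n, C' w = if C w = C u then C v else C w) :
    Labels n (addEdge R u v) C' ∧
      ((range n).image C').card + 1 = ((range n).image C).card := by
  constructor
  · intro a ha b hb
    rw [hC' a ha, hC' b hb, eqvGen_addEdge, ← h a ha b hb, ← h a ha u hu, ← h v hv b hb,
      ← h a ha v hv, ← h u hu b hb]
    split_ifs with h1 h2 h2
    · simp [h1, h2]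
    · simp only [h1, e, true_and, false_and, or_false]
      exact ⟨Or.inr, fun h => h.elim (fun h => absurd h.symm h2) id⟩
    · simp only [h2, e.symm, and_false, and_true, false_or]
      exact ⟨Or.inr, fun h => h.elim (fun h => absurd h h1) id⟩
    · simp only [h1, false_and, false_or]
      exact ⟨Or.inl, fun h => h.elim id fun h => absurd h.2.symm h2⟩
  · have : (range n).image C' = ((range n).image C).erase (C u) := by
      ext c
      simp only [mem_erase, mem_image, mem_range]
      constructor
      · rintro ⟨w, hw, rfl⟩
        rw [hC' w hw]
        split_ifs with h1
        · exact ⟨e.symm, v, hv, rfl⟩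
        · exact ⟨h1, w, hw, rfl⟩
      · rintro ⟨h1, w, hw, rfl⟩
        exact ⟨w, hw, by rw [hC' w hw, if_neg h1]⟩
    rw [this, card_erase_add_one]
    exact mem_image_of_mem C (mem_range.2 hu)

open Classical in
theorem comps_addEdge {u v : ℕ} (hu : u < n) (hv : v < n) :
    comps n (addEdge R u v) + (if EqvGen R u v then 0 else 1) = comps n R := by
  by_cases e : EqvGen R u v
  · rw [if_pos e, (labels_least.addEdge_of_eq hu hv (least_eq_iff.2 e)).comps_eq]; rfl
  · obtain ⟨h1, h2⟩ := labels_least.addEdge_of_ne (R := R) hu hv (mt least_eq_iff.1 e)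
      (C' := fun w => if least R w = least R u then least R v else least R w) (fun _ _ => rfl)
    rw [if_neg e, h1.comps_eq, h2]; rfl

/-- `R` with the additional edges in `l` -/
def addEdges (R : ℕ → ℕ → Prop) (l : List (ℕ × ℕ)) (a b : ℕ) : Prop := R a b ∨ (a, b) ∈ l

theorem addEdges_nil : addEdges R [] = R := by
  funext a b; simp [addEdges]

theorem addEdges_cons (e : ℕ × ℕ) (l : List (ℕ × ℕ)) :
    addEdges R (e :: l) = addEdge (addEdges R l) e.1 e.2 := by
  funext a b
  simp only [addEdges, addEdge, List.mem_cons, Prod.ext_iff]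
  apply propext; tauto

/-- Edges between vertices of `Z` change the rank of `R` and of `R'` alike if both connect the same
vertices of `Z`. -/
theorem comps_exchange {Z : ℕ → Prop} (hZ : ∀ a b, Z a → Z b → (EqvGen R a b ↔ EqvGen R' a b))
    (l : List (ℕ × ℕ)) (hl : ∀ e ∈ l, (Z e.1 ∧ e.1 < n) ∧ Z e.2 ∧ e.2 < n) :
    (∀ a b, Z a → Z b → (EqvGen (addEdges R l) a b ↔ EqvGen (addEdges R' l) a b)) ∧
      comps n (addEdges R l) + comps n R' = comps n (addEdges R' l) + comps n R := by
  classical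
  induction l with
  | nil => simpa only [addEdges_nil] using ⟨hZ, add_comm _ _⟩
  | cons e l ih =>
    obtain ⟨ih1, ih2⟩ := ih fun e he => hl e (List.mem_cons_of_mem _ he)
    obtain ⟨⟨h1, h1n⟩, h2, h2n⟩ := hl e List.mem_cons_self
    simp only [addEdges_cons]
    constructor
    · intro a b ha hb
      rw [eqvGen_addEdge, eqvGen_addEdge, ih1 a b ha hb, ih1 a _ ha h1, ih1 a _ ha h2,
        ih1 _ b h1 hb, ih1 _ b h2 hb]
    -- The ends of the new edge lie in `Z`, so they are connected on both sides or on neither, and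
    -- both component counts drop by the same amount.
    · have e1 := comps_addEdge (R := addEdges R l) h1n h2n
      have e2 := comps_addEdge (R := addEdges R' l) h1n h2n
      rw [ih1 _ _ h1 h2] at e1
      omega

theorem eqvGen_of_forall {P : ℕ → Prop} (hP : ∀ a b, R a b → P a ∧ P b) {a b : ℕ}
    (h : EqvGen R a b) : a = b ∨ P a ∧ P b := by
  induction h with
  | rel a b h => exact Or.inr (hP a b h)
  | refl => exact Or.inl rfl
  | symm a b _ ih => exact ih.imp Eq.symm And.symm
  | trans a b c _ _ ih1 ih2 =>
    rcases ih1 with rfl | h1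
    · exact ih2
    · rcases ih2 with rfl | h2
      · exact Or.inr h1
      · exact Or.inr ⟨h1.1, h2.2⟩

/-- An edge set of rank `r` has at most `2 * r` end vertices. -/
theorem card_ends_le (l : List (ℕ × ℕ)) (hl : ∀ e ∈ l, e.1 < n ∧ e.2 < n ∧ e.1 ≠ e.2) :
    (l.toFinset.image Prod.fst ∪ l.toFinset.image Prod.snd).card + 2 * comps n (addEdges (fun _ _ => False) l) ≤
      2 * n := by
  classical
  induction l with
  | nil =>
    have := comps_le (n := n) (R := addEdges (fun _ _ => False) [])
    simpa using this
  | cons e l ih =>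
    have ih := ih fun e he => hl e (List.mem_cons_of_mem _ he)
    obtain ⟨h1, h2, h3⟩ := hl e List.mem_cons_self
    have e1 := comps_addEdge (R := addEdges (fun _ _ => False) l) h1 h2
    rw [addEdges_cons]
    have hset : (e :: l).toFinset.image Prod.fst ∪ (e :: l).toFinset.image Prod.snd =
        insert e.1 (insert e.2 (l.toFinset.image Prod.fst ∪ l.toFinset.image Prod.snd)) := by
      ext a
      simp only [List.toFinset_cons, image_insert, mem_union, mem_insert]
      tauto
    rw [hset]
    set S := l.toFinset.image Prod.fst ∪ l.toFinset.image Prod.snd with hS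
    -- An edge that closes a cycle has both ends among the earlier ones, as distinct connected
    -- vertices meet earlier edges. Any other edge lowers the number of components by one and adds
    -- at most two ends.
    by_cases he : EqvGen (addEdges (fun _ _ => False) l) e.1 e.2
    · have hP := eqvGen_of_forall (P := fun a => a ∈ S) (fun a b hab => by
        rcases hab with hab | hab
        · exact hab.elim
        · simp only [hS, mem_union, mem_image, List.mem_toFinset]
          exact ⟨Or.inl ⟨_, hab, rfl⟩, Or.inr ⟨_, hab, rfl⟩⟩) he
      rcases hP with hP | hP
      · exact absurd hP h3
      · rw [insert_eq_of_mem hP.2, insert_eq_of_mem hP.1]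
        rw [if_pos he] at e1
        omega
    · have c1 := card_insert_le e.1 (insert e.2 S)
      have c2 := card_insert_le e.2 S
      rw [if_neg he] at e1
      omega

end Cut

/-! ### The cost of a coloring as a rank -/

namespace Cut

open Finset Relation

/-- The monochromatic edges. -/
def Mono {n : ℕ} (G : SimpleGraph (Fin n)) (φ : TwoColoring (Fin n)) (a b : ℕ) : Prop :=
  ∃ (ha : a < n) (hb : b < n), G.Adj ⟨a, ha⟩ ⟨b, hb⟩ ∧ φ ⟨a, ha⟩ = φ ⟨b, hb⟩

variable {n : ℕ} (G : SimpleGraph (Fin n)) (φ : TwoColoring (Fin n))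

/-- The monochromatic components. -/
abbrev MonoComp : Type := Σ c : Fin 2, (G.induce {v | φ v = c}).ConnectedComponent

def monoComp (v : Fin n) : MonoComp G φ := ⟨φ v, SimpleGraph.connectedComponentMk _ ⟨v, rfl⟩⟩

theorem monoComp_eq {c : Fin 2} (v : Fin n) (h : φ v = c) :
    monoComp G φ v = ⟨c, SimpleGraph.connectedComponentMk _ ⟨v, h⟩⟩ := by
  subst h; rfl

theorem eqvGen_of_reachable {c : Fin 2} {u v : {v | φ v = c}}
    (h : (G.induce {v | φ v = c}).Reachable u v) : EqvGen (Mono G φ) u.1 v.1 := by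
  rw [SimpleGraph.reachable_iff_reflTransGen] at h
  induction h with
  | refl => exact EqvGen.refl _
  | tail _ h ih =>
    rename_i x y _
    refine ih.trans _ _ _ (EqvGen.rel _ _ ⟨x.1.2, y.1.2, h, ?_⟩)
    exact x.2.trans y.2.symm

theorem monoComp_eq_iff (u v : Fin n) :
    monoComp G φ u = monoComp G φ v ↔ EqvGen (Mono G φ) u v := by
  constructor
  · intro h
    have hc : φ u = φ v := congrArg Sigma.fst h
    rw [monoComp_eq G φ u hc, monoComp_eq G φ v rfl] at h
    simp only [Sigma.mk.injEq, heq_eq_eq, true_and] at h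
    exact eqvGen_of_reachable G φ (SimpleGraph.ConnectedComponent.exact h)
  · intro h
    have key : ∀ {a b : ℕ}, EqvGen (Mono G φ) a b →
        (if h : a < n then some (monoComp G φ ⟨a, h⟩) else none) =
        (if h : b < n then some (monoComp G φ ⟨b, h⟩) else none) := by
      intro a b h
      induction h with
      | rel a b h =>
        obtain ⟨ha, hb, hG, hφ⟩ := h
        rw [dif_pos ha, dif_pos hb, monoComp_eq G φ _ hφ, monoComp_eq G φ ⟨b, hb⟩ rfl]
        congr 2
        exact SimpleGraph.ConnectedComponent.sound (SimpleGraph.Adj.reachable hG)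
      | refl => rfl
      | symm _ _ _ ih => exact ih.symm
      | trans _ _ _ _ _ ih1 ih2 => exact ih1.trans ih2
    have := key h
    rw [dif_pos u.2, dif_pos v.2] at this
    exact Option.some_injective _ this

open Classical in
theorem cost_add_card : φ.cost G + Fintype.card (MonoComp G φ) = n := by
  have h1 : ∀ (c : Fin 2) (X : (G.induce {v | φ v = c}).ConnectedComponent), 1 ≤ Nat.card X.supp := by
    intro c X
    have : Nonempty X.supp := X.nonempty_supp.to_subtype
    exact Nat.card_pos
  have h2 : ∀ c : Fin 2, (∑ X : (G.induce {v | φ v = c}).ConnectedComponent, Nat.card X.supp) =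
      Fintype.card {v | φ v = c} := by
    intro c
    rw [← Fintype.card_congr (Equiv.sigmaFiberEquiv
      (SimpleGraph.connectedComponentMk (G.induce {v | φ v = c}))), Fintype.card_sigma]
    refine sum_congr rfl fun X _ => ?_
    rw [Nat.card_eq_fintype_card]
    exact Fintype.card_congr (Equiv.refl _)
  have h3 : ∑ c : Fin 2, Fintype.card {v | φ v = c} = n := by
    have := Fintype.card_congr (Equiv.sigmaFiberEquiv φ)
    rw [Fintype.card_sigma, Fintype.card_fin] at this
    exact Eq.trans (sum_congr rfl fun c _ => Fintype.card_congr (Equiv.refl _)) this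
  rw [TwoColoring.cost, Fintype.card_sigma, ← sum_add_distrib]
  refine Eq.trans (sum_congr rfl fun c _ => ?_) h3
  rw [← h2, ← sum_congr rfl fun X _ => Nat.sub_add_cancel (h1 c X), sum_add_distrib,
    Fintype.card_eq_sum_ones]
  congr!

/-- Summing `|X| - 1` over the components gives `n` minus their number, and the monochromatic
components are the components of the relation `Mono`. -/
theorem cost_eq_rk : φ.cost G = rk n (Mono G φ) := by
  classical
  have hsurj : Function.Surjective (monoComp G φ) := by
    rintro ⟨c, X⟩
    induction X using SimpleGraph.ConnectedComponent.ind with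
    | _ v => exact ⟨v.1, monoComp_eq G φ v.1 v.2⟩
  set C : ℕ → ℕ := fun a => if h : a < n then (Fintype.equivFin _ (monoComp G φ ⟨a, h⟩)).val else 0
    with hC
  have hCv : ∀ v : Fin n, C v = (Fintype.equivFin _ (monoComp G φ v)).val := fun v => by
    simp [hC]
  have hlab : Labels n (Mono G φ) C := by
    intro u hu v hv
    rw [hCv ⟨u, hu⟩, hCv ⟨v, hv⟩, ← monoComp_eq_iff G φ ⟨u, hu⟩ ⟨v, hv⟩]
    exact ⟨fun h => (Fintype.equivFin _).injective (Fin.ext h), fun h => by rw [h]⟩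
  have hcard : comps n (Mono G φ) = Fintype.card (MonoComp G φ) := by
    rw [hlab.comps_eq]
    have : (range n).image C = range (Fintype.card (MonoComp G φ)) := by
      ext c
      simp only [mem_image, mem_range]
      constructor
      · rintro ⟨v, hv, rfl⟩
        rw [hCv ⟨v, hv⟩]
        exact Fin.is_lt _
      · intro hc
        obtain ⟨v, hv⟩ := hsurj ((Fintype.equivFin _).symm ⟨c, hc⟩)
        exact ⟨v, v.2, by rw [hCv, hv]; simp⟩
    rw [this, card_range]
  have h1 := cost_add_card G φ
  have h2 := rk_add_comps (n := n) (R := Mono G φ)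
  omega

end Cut

/-! ### Refinement of the classes -/

namespace Cut

open Finset Relation

/-- The edges of the cut `S` of the graph on `U`. -/
def CutRel (E : ℕ → ℕ → Prop) (U S : Finset ℕ) (a b : ℕ) : Prop := (a, b) ∈ bd E U S

/-- `E` is the adjacency relation of a simple graph on `0, …, n - 1`. -/
structure IsGraph (E : ℕ → ℕ → Prop) (n : ℕ) : Prop where
  symm {u v : ℕ} (h : E u v) : E v u
  lt {u v : ℕ} (h : E u v) : u < n
  ne {u v : ℕ} (h : E u v) : u ≠ v

/-- A cut of rank at most `k` that contains `A` and avoids `B`. -/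
structure Sol (E : ℕ → ℕ → Prop) (n k : ℕ) (A B X : Finset ℕ) : Prop where
  sub : X ⊆ range n
  left {v : ℕ} (hv : v ∈ A) : v ∈ X
  right {v : ℕ} (hv : v ∈ B) : v ∉ X
  rk_le : rk n (CutRel E (range n) X) ≤ k

/-- A part `U` of the graph that is connected to the rest only by the terminals `T`. -/
structure Piece (E : ℕ → ℕ → Prop) (cl : ℕ → ℕ) (n q tau : ℕ) (A B U T : Finset ℕ) : Prop where
  closed : Closed cl (range n) U
  sub : T ⊆ U
  card_le : T.card ≤ tau
  left {v : ℕ} (hv : v ∈ U) (h : v ∈ A) : v ∈ T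
  right {v : ℕ} (hv : v ∈ U) (h : v ∈ B) : v ∈ T
  boundary {u v : ℕ} (hu : u ∈ U) (hv : v ∉ U) (h : E u v) : u ∈ T
  big : U = range n ∨ q < cnum cl U

/-- `Y` and `Y'` are indistinguishable from outside the piece. -/
structure SameSig (E : ℕ → ℕ → Prop) (n : ℕ) (U T Y Y' : Finset ℕ) : Prop where
  mem {u : ℕ} (hu : u ∈ T) : u ∈ Y ↔ u ∈ Y'
  conn {u v : ℕ} (hu : u ∈ T) (hv : v ∈ T) :
    EqvGen (CutRel E U Y) u v ↔ EqvGen (CutRel E U Y') u v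
  rank : rk n (CutRel E U Y) = rk n (CutRel E U Y')

variable {E : ℕ → ℕ → Prop} {cl cl' : ℕ → ℕ} {n k q tau K : ℕ} {A B U T X Y Y' M W : Finset ℕ}

theorem Closed.trans {S : Finset ℕ} (hU : Closed cl (range n) U) (hS : Closed cl U S) :
    Closed cl (range n) S :=
  ⟨hS.1.trans hU.1, fun u hu v hv e => hS.2 u hu v (hU.2 u (hS.1 hu) v hv e) e⟩

theorem Closed.restrict (hU : Closed cl (range n) U) (hX : Closed cl (range n) X) :
    Closed cl U (X ∩ U) :=
  ⟨inter_subset_right, fun u hu v hv e => mem_inter.2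
    ⟨hX.2 u (mem_inter.1 hu).1 v (hU.1 hv) e, hv⟩⟩

theorem Piece.reps (hP : Piece E cl n q tau A B U T) (hr : Reps cl (range n)) : Reps cl U :=
  fun v hv => ⟨hP.closed.2 v hv _ (hr v (hP.closed.1 hv)).1 (hr v (hP.closed.1 hv)).2.symm,
    (hr v (hP.closed.1 hv)).2⟩

theorem Sol.mono {X' : Finset ℕ} (hX : Sol E n k A B X) (hsub : X' ⊆ range n)
    (hA : ∀ v ∈ A, v ∈ X') (hB : ∀ v ∈ B, v ∉ X') (hbd : bd E (range n) X' ⊆ bd E (range n) X) :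
    Sol E n k A B X' :=
  ⟨hsub, fun hv => hA _ hv, fun hv => hB _ hv, (rk_mono fun _ _ h => hbd h).trans hX.rk_le⟩

/-- Take a solution with the fewest edges and, among these, the fewest vertices. If `C` had no edge
to the rest of `X ∩ U`, removing it would add no edges and shrink `X`. If `C` outside touched `X`
but nothing else outside within the piece, adding it would lose an edge. As `C` avoids the
terminals, it has no neighbors outside the piece and the prescribed vertices stay where they are. -/
theorem Piece.exists_good (hE : IsGraph E n) (hP : Piece E cl n q tau A B U T)
    (h : ∃ X, Sol E n k A B X ∧ Closed cl (range n) X) :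
    ∃ X, Sol E n k A B X ∧ Closed cl (range n) X ∧ Good E cl U T (X ∩ U) := by
  classical
  obtain ⟨X₀, hX₀, hX₀'⟩ := h
  have hne : ((range n).powerset.filter
      fun X => Sol E n k A B X ∧ Closed cl (range n) X).Nonempty := ⟨X₀, by
    simp [hX₀, hX₀', hX₀.sub]⟩
  -- The weight `n + 1` makes this a lexicographic minimum, since `X.card ≤ n`.
  obtain ⟨X, hX, hmin⟩ := exists_min_image _
    (fun X => (bd E (range n) X).card * (n + 1) + X.card) hne
  simp only [mem_filter, mem_powerset] at hX hmin
  obtain ⟨-, hS, hc⟩ := hX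
  refine ⟨X, hS, hc, hP.closed.restrict hc, ?_, ?_⟩
  · intro C hC hCX hCT hCne
    by_contra hno
    push Not at hno
    have hbd : bd E (range n) (X \ C) ⊆ bd E (range n) X := by
      rintro ⟨u, v⟩ he
      rw [mem_bd, mem_sdiff] at he
      refine mem_bd.2 ⟨he.1.1, he.2.1, fun hvX => ?_, he.2.2.2⟩
      have hvC : v ∈ C := by_contra fun h => he.2.2.1 (mem_sdiff.2 ⟨hvX, h⟩)
      by_cases hu : u ∈ U
      · exact hno v hvC u (mem_inter.2 ⟨he.1.1, hu⟩) he.1.2 (hE.symm he.2.2.2)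
      · exact disjoint_left.1 hCT hvC (hP.boundary (hC.1 hvC) hu (hE.symm he.2.2.2))
    have hS' : Sol E n k A B (X \ C) := hS.mono (sdiff_subset.trans hS.sub)
      (fun v hv => mem_sdiff.2 ⟨hS.left hv, fun hvC =>
        disjoint_left.1 hCT hvC (hP.left (hC.1 hvC) hv)⟩)
      (fun v hv h => hS.right hv (mem_sdiff.1 h).1) hbd
    have h1 := hmin (X \ C) ⟨hS'.sub, hS', hc.sdiff (hP.closed.trans hC)⟩
    have h2 := Nat.mul_le_mul_right (n + 1) (card_le_card hbd)
    have h3 : (X \ C).card < X.card := by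
      refine card_lt_card ⟨sdiff_subset, fun h => ?_⟩
      obtain ⟨c, hcC⟩ := hCne
      exact (mem_sdiff.1 (h (mem_inter.1 (hCX hcC)).1)).2 hcC
    omega
  · rintro C hC hCX hCT ⟨u₀, hu₀, v₀, hv₀, e₀⟩
    by_contra hno
    push Not at hno
    rw [mem_inter] at hv₀
    have hdis : ∀ c ∈ C, c ∉ X := fun c hcC hcX =>
      disjoint_left.1 hCX hcC (mem_inter.2 ⟨hcX, hC.1 hcC⟩)
    have hbd : bd E (range n) (X ∪ C) ⊆ bd E (range n) X := by
      rintro ⟨u, v⟩ he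
      rw [mem_bd, mem_union, mem_union, not_or] at he
      refine mem_bd.2 ⟨he.1.resolve_right fun huC => ?_, he.2.1, he.2.2.1.1, he.2.2.2⟩
      by_cases hv : v ∈ U
      · exact hno u huC v hv (fun h => he.2.2.1.1 (mem_inter.1 h).1) he.2.2.1.2 he.2.2.2
      · exact disjoint_left.1 hCT huC (hP.boundary (hC.1 huC) hv he.2.2.2)
    have hsubC : C ⊆ range n := hC.1.trans hP.closed.1
    have hS' : Sol E n k A B (X ∪ C) := hS.mono (union_subset hS.sub hsubC)
      (fun v hv => mem_union_left _ (hS.left hv))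
      (fun v hv h => (mem_union.1 h).elim (hS.right hv) fun hvC =>
        disjoint_left.1 hCT hvC (hP.right (hC.1 hvC) hv)) hbd
    have h1 := hmin (X ∪ C) ⟨hS'.sub, hS', hc.union (hP.closed.trans hC)⟩
    have h2 : (bd E (range n) (X ∪ C)).card < (bd E (range n) X).card := by
      refine card_lt_card ⟨hbd, fun h => ?_⟩
      have : (v₀, u₀) ∈ bd E (range n) X :=
        mem_bd.2 ⟨hv₀.1, hsubC hu₀, hdis u₀ hu₀, hE.symm e₀⟩
      have := (mem_bd.1 (h this)).2.2.1
      exact this (mem_union_right _ hu₀)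
    have h3 : (X ∪ C).card ≤ n := (card_le_card hS'.sub).trans (card_range n).le
    have h4 := Nat.mul_le_mul_right (n + 1) (Nat.succ_le_of_lt h2)
    rw [Nat.succ_mul] at h4
    omega

/-- Rank at most `k` leaves at most `2 * k` end vertices, and an edge is a pair of them. -/
theorem card_bd_le (hE : IsGraph E n) (hU : U ⊆ range n) (hX : Sol E n k A B X) :
    (bd E U (X ∩ U)).card ≤ 4 * (k * k) := by
  classical
  set l := (bd E U (X ∩ U)).toList with hl
  have h1 := card_ends_le (n := n) l (by
    rintro ⟨u, v⟩ he
    rw [hl, mem_toList, mem_bd] at he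
    exact ⟨hE.lt he.2.2.2, hE.lt (hE.symm he.2.2.2), hE.ne he.2.2.2⟩)
  have h2 : comps n (CutRel E (range n) X) ≤ comps n (addEdges (fun _ _ => False) l) := by
    refine comps_anti fun u v h => ?_
    rcases h with h | h
    · exact h.elim
    · rw [hl, mem_toList, mem_bd] at h
      exact mem_bd.2 ⟨(mem_inter.1 h.1).1, hU h.2.1, fun hv =>
        h.2.2.1 (mem_inter.2 ⟨hv, h.2.1⟩), h.2.2.2⟩
  have h3 := rk_add_comps (n := n) (R := CutRel E (range n) X)
  have h4 := hX.rk_le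
  set S := l.toFinset.image Prod.fst ∪ l.toFinset.image Prod.snd with hS
  have h5 : S.card ≤ 2 * k := by omega
  have h6 : bd E U (X ∩ U) ⊆ S ×ˢ S := by
    rintro ⟨u, v⟩ he
    have he' : (u, v) ∈ l.toFinset := by rw [hl, toList_toFinset]; exact he
    exact mem_product.2 ⟨mem_union_left _ (mem_image.2 ⟨_, he', rfl⟩),
      mem_union_right _ (mem_image.2 ⟨_, he', rfl⟩)⟩
  calc _ ≤ (S ×ˢ S).card := card_le_card h6
    _ = S.card * S.card := card_product _ _
    _ ≤ (2 * k) * (2 * k) := Nat.mul_le_mul h5 h5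
    _ = 4 * (k * k) := by ring

/-- The cut edges that do not lie inside `U` are the same before and after the exchange, and their
ends are terminals or outside `U`. On such vertices the two cuts of the piece induce the same
connectivity, so `comps_exchange` shows that the total rank is unchanged. -/
theorem Piece.exchange (hE : IsGraph E n) (hP : Piece E cl n q tau A B U T)
    (hX : Sol E n k A B X) (hY' : Y' ⊆ U) (hs : SameSig E n U T (X ∩ U) Y') :
    Sol E n k A B (Y' ∪ X \ U) := by
  classical
  have hsub : Y' ∪ X \ U ⊆ range n :=
    union_subset (hY'.trans hP.closed.1) (sdiff_subset.trans hX.sub)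
  have hmem : ∀ v, v ∈ T ∨ v ∉ U → (v ∈ Y' ∪ X \ U ↔ v ∈ X) := by
    rintro v (hv | hv)
    · have hvU := hP.sub hv
      have := hs.mem hv
      rw [mem_inter] at this
      rw [mem_union, mem_sdiff]
      tauto
    · have : v ∉ Y' := fun h => hv (hY' h)
      rw [mem_union, mem_sdiff]
      tauto
  have hmemU : ∀ v ∈ U, v ∈ Y' ∪ X \ U ↔ v ∈ Y' := by
    intro v hv
    rw [mem_union, mem_sdiff]; tauto
  have hterm : ∀ v, v ∈ A ∨ v ∈ B → v ∈ T ∨ v ∉ U := by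
    intro v hv
    by_cases hvU : v ∈ U
    · exact Or.inl (hv.elim (hP.left hvU) (hP.right hvU))
    · exact Or.inr hvU
  refine ⟨hsub, fun hv => (hmem _ (hterm _ (Or.inl hv))).2 (hX.left hv),
    fun hv h => hX.right hv ((hmem _ (hterm _ (Or.inr hv))).1 h), ?_⟩
  -- The common part of both cuts: the edges with an end outside the piece.
  set l := ((bd E (range n) X).filter fun e => e.1 ∉ U ∨ e.2 ∉ U).toList with hl
  have hlZ : ∀ u v, E u v → u ∉ U ∨ v ∉ U → (u ∈ T ∨ u ∉ U) ∧ (v ∈ T ∨ v ∉ U) := by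
    intro u v e h
    by_cases hu : u ∈ U
    · have hv := h.resolve_left (not_not.2 hu)
      exact ⟨Or.inl (hP.boundary hu hv e), Or.inr hv⟩
    · refine ⟨Or.inr hu, ?_⟩
      by_cases hv : v ∈ U
      · exact Or.inl (hP.boundary hv hu (hE.symm e))
      · exact Or.inr hv
  have e1 : CutRel E (range n) X = addEdges (CutRel E U (X ∩ U)) l := by
    funext u v
    apply propext
    simp only [CutRel, addEdges, hl, mem_toList, mem_filter, mem_bd, mem_inter]
    constructor
    · rintro ⟨h1, h2, h3, h4⟩
      by_cases h : u ∉ U ∨ v ∉ U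
      · exact Or.inr ⟨⟨h1, h2, h3, h4⟩, h⟩
      · push Not at h
        exact Or.inl ⟨⟨h1, h.1⟩, h.2, fun h' => h3 h'.1, h4⟩
    · rintro (⟨h1, h2, h3, h4⟩ | ⟨h, -⟩)
      · exact ⟨h1.1, hP.closed.1 h2, fun h' => h3 ⟨h', h2⟩, h4⟩
      · exact h
  have e2 : CutRel E (range n) (Y' ∪ X \ U) = addEdges (CutRel E U Y') l := by
    funext u v
    apply propext
    simp only [CutRel, addEdges, hl, mem_toList, mem_filter, mem_bd]
    constructor
    · rintro ⟨h1, h2, h3, h4⟩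
      by_cases h : u ∉ U ∨ v ∉ U
      · obtain ⟨z1, z2⟩ := hlZ u v h4 h
        exact Or.inr ⟨⟨(hmem u z1).1 h1, h2, fun h' => h3 ((hmem v z2).2 h'), h4⟩, h⟩
      · push Not at h
        exact Or.inl ⟨(hmemU u h.1).1 h1, h.2, fun h' => h3 ((hmemU v h.2).2 h'), h4⟩
    · rintro (⟨h1, h2, h3, h4⟩ | ⟨⟨h1, h2, h3, h4⟩, h⟩)
      · exact ⟨(hmemU u (hY' h1)).2 h1, hP.closed.1 h2, fun h' => h3 ((hmemU v h2).1 h'), h4⟩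
      · obtain ⟨z1, z2⟩ := hlZ u v h4 h
        exact ⟨(hmem u z1).2 h1, h2, fun h' => h3 ((hmem v z2).1 h'), h4⟩
  have hsame := (comps_exchange (n := n) (R := CutRel E U (X ∩ U)) (R' := CutRel E U Y')
    (Z := fun a => a ∈ T ∨ a ∉ U) (by
      have hin : ∀ (S : Finset ℕ), S ⊆ U → ∀ a b, CutRel E U S a b → a ∈ U ∧ b ∈ U :=
        fun S hS a b h => ⟨hS (mem_bd.1 h).1, (mem_bd.1 h).2.1⟩
      intro a b ha hb
      by_cases hab : a = b
      · subst hab; exact ⟨fun _ => EqvGen.refl _, fun _ => EqvGen.refl _⟩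
      · constructor
        · intro h
          obtain ⟨h1, h2⟩ := (eqvGen_of_forall (hin _ inter_subset_right) h).resolve_left hab
          exact (hs.conn (ha.resolve_right (not_not.2 h1)) (hb.resolve_right (not_not.2 h2))).1 h
        · intro h
          obtain ⟨h1, h2⟩ := (eqvGen_of_forall (hin _ hY') h).resolve_left hab
          exact (hs.conn (ha.resolve_right (not_not.2 h1)) (hb.resolve_right (not_not.2 h2))).2 h)
    l (by
      rintro ⟨u, v⟩ he
      rw [hl, mem_toList, mem_filter, mem_bd] at he
      obtain ⟨z1, z2⟩ := hlZ u v he.1.2.2.2 he.2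
      exact ⟨⟨z1, hE.lt he.1.2.2.2⟩, z2, hE.lt (hE.symm he.1.2.2.2)⟩)).2
  rw [← e1, ← e2] at hsame
  have h1 := hs.rank
  have h2 := hX.rk_le
  have c1 := rk_add_comps (n := n) (R := CutRel E (range n) X)
  have c2 := rk_add_comps (n := n) (R := CutRel E (range n) (Y' ∪ X \ U))
  have c3 := rk_add_comps (n := n) (R := CutRel E U (X ∩ U))
  have c4 := rk_add_comps (n := n) (R := CutRel E U Y')
  omega

theorem cnum_add (hS : Closed cl U W) : cnum cl W + cnum cl (U \ W) = cnum cl U := by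
  unfold cnum
  rw [← card_union_of_disjoint, ← image_union, union_sdiff_of_subset hS.1]
  rw [disjoint_left]
  intro c h1 h2
  obtain ⟨u, hu, rfl⟩ := mem_image.1 h1
  obtain ⟨v, hv, e⟩ := mem_image.1 h2
  exact (mem_sdiff.1 hv).2 (hS.2 u hu v (mem_sdiff.1 hv).1 e.symm)

open Classical in
/-- Both sides of a balanced cut are pieces. -/
theorem Piece.descend (hE : IsGraph E n) (hP : Piece E cl n q tau A B U T) (hW : Closed cl U W)
    (hK : (bd E U W).card ≤ K) (h1 : q < cnum cl W) (h2 : q < cnum cl (U \ W))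
    (hT : 2 * (T ∩ W).card ≤ T.card) (htau : 2 * K ≤ tau) :
    Piece E cl n q tau A B W ((T ∪ U.filter fun v => ∃ u ∈ U, u ∉ W ∧ E u v) ∩ W) ∧
      cnum cl W < cnum cl U := by
  constructor
  · refine ⟨hP.closed.trans hW, inter_subset_right, ?_, fun {v} hv h => ?_, fun {v} hv h => ?_,
      fun {u v} hu hv h => ?_, Or.inr h1⟩
    -- The new terminals are at most half of the old ones and one for each cut edge. Their number is
    -- at most `tau / 2 + K`, and `2 * K ≤ tau`.
    · have hsub : (T ∪ U.filter fun v => ∃ u ∈ U, u ∉ W ∧ E u v) ∩ W ⊆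
          (T ∩ W) ∪ (bd E U W).image Prod.fst := by
        intro v hv
        rw [mem_inter, mem_union, mem_filter] at hv
        rw [mem_union, mem_inter, mem_image]
        rcases hv with ⟨hv | ⟨-, u, hu, huW, e⟩, hvW⟩
        · exact Or.inl ⟨hv, hvW⟩
        · exact Or.inr ⟨(v, u), mem_bd.2 ⟨hvW, hu, huW, hE.symm e⟩, rfl⟩
      have c1 := card_le_card hsub
      have c2 := card_union_le (T ∩ W) ((bd E U W).image Prod.fst)
      have c3 := card_image_le (s := bd E U W) (f := Prod.fst)
      have c4 := hP.card_le
      omega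
    · exact mem_inter.2 ⟨mem_union_left _ (hP.left (hW.1 hv) h), hv⟩
    · exact mem_inter.2 ⟨mem_union_left _ (hP.right (hW.1 hv) h), hv⟩
    · refine mem_inter.2 ⟨?_, hu⟩
      by_cases hvU : v ∈ U
      · exact mem_union_right _ (mem_filter.2 ⟨hW.1 hu, v, hvU, hv, hE.symm h⟩)
      · exact mem_union_left _ (hP.boundary (hW.1 hu) hvU h)
  · have := cnum_add hW
    omega

/-- Merging the vertices of a piece with equal codes. -/
theorem Piece.harden (hE : IsGraph E n) (hP : Piece E cl n q tau A B U T)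
    (hr : Reps cl (range n)) (code : ℕ → ℕ) (hcode : ∀ v ∈ U, code v < q)
    (hin : ∀ v ∈ U, cl' v ∈ U ∧ code (cl' v) = code v)
    (hout : ∀ v, v < n → v ∉ U → cl' v = cl v)
    (heq : ∀ u ∈ U, ∀ v ∈ U, code u = code v → cl' u = cl' v)
    (hsol : ∀ X, Sol E n k A B X → Closed cl (range n) X → Good E cl U T (X ∩ U) →
      ∃ Y' ⊆ U, SameSig E n U T (X ∩ U) Y' ∧
        ∀ u ∈ U, ∀ v ∈ U, code u = code v → (u ∈ Y' ↔ v ∈ Y')) :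
    Reps cl' (range n) ∧ (cnum cl' (range n) ≤ q ∨ cnum cl' (range n) < cnum cl (range n)) ∧
      ((∃ X, Sol E n k A B X ∧ Closed cl (range n) X) →
        ∃ X, Sol E n k A B X ∧ Closed cl' (range n) X) := by
  have hUn := hP.closed.1
  have hclU : ∀ v, v < n → v ∉ U → cl v ∉ U := fun v hv hvU h =>
    hvU (hP.closed.2 _ h v (mem_range.2 hv) (hr v (mem_range.2 hv)).2)
  have hsep : ∀ u ∈ U, ∀ v, v < n → v ∉ U → cl' u ≠ cl' v := by
    intro u hu v hv hvU e
    rw [hout v hv hvU] at e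
    exact hclU v hv hvU (e ▸ (hin u hu).1)
  have hcU : Closed cl' (range n) U := ⟨hUn, fun u hu v hv e => by_contra fun hvU =>
    hsep u hu v (mem_range.1 hv) hvU e⟩
  -- The code is injective on the new representatives, because representatives with equal codes
  -- coincide.
  have hU : cnum cl' U ≤ q := by
    unfold cnum
    have : (U.image cl').card ≤ (U.image code).card := by
      have hsub : (U.image cl').image code ⊆ U.image code := by
        intro c hc
        obtain ⟨w, hw, rfl⟩ := mem_image.1 hc
        obtain ⟨v, hv, rfl⟩ := mem_image.1 hw
        rw [(hin v hv).2]
        exact mem_image_of_mem _ hv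
      rw [← card_image_of_injOn (s := U.image cl') (f := code)]
      · exact card_le_card hsub
      · intro a ha b hb e
        obtain ⟨u, hu, rfl⟩ := mem_image.1 (mem_coe.1 ha)
        obtain ⟨v, hv, rfl⟩ := mem_image.1 (mem_coe.1 hb)
        simp only [(hin u hu).2, (hin v hv).2] at e
        exact heq u hu v hv e
    refine this.trans ?_
    calc _ ≤ (range q).card := card_le_card fun c hc => by
          obtain ⟨v, hv, rfl⟩ := mem_image.1 hc
          exact mem_range.2 (hcode v hv)
      _ = q := card_range q
  refine ⟨fun v hv => ?_, ?_, ?_⟩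
  · by_cases hvU : v ∈ U
    · exact ⟨hUn (hin v hvU).1, heq _ (hin v hvU).1 _ hvU (hin v hvU).2⟩
    · have hv' := mem_range.1 hv
      rw [hout v hv' hvU]
      refine ⟨(hr v hv).1, ?_⟩
      rw [hout _ (mem_range.1 (hr v hv).1) (hclU v hv' hvU), (hr v hv).2]
  · rcases hP.big with h | h
    · left; rwa [← h]
    · right
      have e1 := cnum_add hcU
      have e2 := cnum_add hP.closed
      have e3 : cnum cl' (range n \ U) = cnum cl (range n \ U) := by
        unfold cnum
        rw [image_congr]
        intro v hv
        rw [mem_coe, mem_sdiff] at hv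
        exact hout v (mem_range.1 hv.1) hv.2
      omega
  · intro h
    obtain ⟨X, hX, hXc, hXg⟩ := hP.exists_good hE h
    obtain ⟨Y', hY', hs, hcY⟩ := hsol X hX hXc hXg
    have hS := hP.exchange hE hX hY' hs
    -- The exchanged solution respects the new classes: inside `U` it is constant on codes, outside
    -- it is the old one. That new classes are unions of old ones is not used.
    refine ⟨_, hS, hS.sub, fun u hu v hv e => ?_⟩
    rw [mem_union, mem_sdiff] at hu ⊢
    have hv' := mem_range.1 hv
    by_cases huU : u ∈ U
    · have huY : u ∈ Y' := hu.resolve_right fun h => h.2 huU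
      have hvU : v ∈ U := hcU.2 u huU v hv e
      refine Or.inl ((hcY u huU v hvU ?_).1 huY)
      rw [← (hin u huU).2, e, (hin v hvU).2]
    · have huX := hu.resolve_left fun h => huU (hY' h)
      have hun := mem_range.1 (hX.sub huX.1)
      have hvU : v ∉ U := fun hvU => hsep v hvU u hun huU e.symm
      rw [hout u hun huU, hout v hv' hvU] at e
      exact Or.inr ⟨hXc.2 u huX.1 v hv e, hvU⟩

end Cut

/-! ### Correctness of the programs: constant data, nested loops and the rank of a cut -/

namespace Loop

open Cut Finset

/-- The set of numbers below `n` with nonzero entries. -/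
def asSet (n : ℕ) (f : ℕ → ℕ) : Finset ℕ := (range n).filter (f · ≠ 0)

@[simp] theorem mem_asSet {n : ℕ} {f : ℕ → ℕ} {v : ℕ} : v ∈ asSet n f ↔ v < n ∧ f v ≠ 0 := by
  simp [asSet]

theorem asSet_sub (n : ℕ) (f : ℕ → ℕ) : asSet n f ⊆ range n := filter_subset _ _

/-- The graph with the adjacency matrix stored from address `n` on. -/
def adj (I : ℕ → ℕ) (n u v : ℕ) : Prop := u < n ∧ v < n ∧ I (n + (u * n + v)) ≠ 0

/-- The parameters of the algorithm. -/
structure Pars where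
  n : ℕ
  k : ℕ
  K : ℕ
  tau : ℕ
  q : ℕ
  D : ℕ
  L : ℕ
  NG : ℕ

/-- The variables and arrays that are constant during the algorithm. -/
structure Env (P : Pars) (σ : St) : Prop where
  n : σ.v .n = P.n
  k : σ.v .k = P.k
  K : σ.v .K = P.K
  q : σ.v .q = P.q
  D : σ.v .D = P.D
  L : σ.v .L = P.L
  NG : σ.v .NG = P.NG
  K1 : σ.v .K1 = P.K + 1
  row : ∀ u < P.n, σ.a .ROW u = u * P.n

/-- A syntactic test, evaluated by `rfl`, under which `Env` survives. -/
def Cmd.keepsEnv (p : Cmd) : Bool :=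
  !(p.setsV .n || p.setsV .k || p.setsV .K || p.setsV .q || p.setsV .D || p.setsV .L ||
    p.setsV .NG || p.setsV .K1 || p.setsA .ROW)

variable {I : ℕ → ℕ} {P : Pars} {σ τ : St}

theorem Env.frame (h : Env P σ) {p : Cmd} (hf : Frame p σ τ) (hp : p.keepsEnv = true) :
    Env P τ := by
  simp only [Cmd.keepsEnv, Bool.not_eq_true', Bool.or_eq_false_iff] at hp
  obtain ⟨⟨⟨⟨⟨⟨⟨⟨h1, h2⟩, h3⟩, h4⟩, h5⟩, h6⟩, h7⟩, h8⟩, h9⟩ := hp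
  exact ⟨by rw [hf.v h1, h.n], by rw [hf.v h2, h.k], by rw [hf.v h3, h.K], by rw [hf.v h4, h.q],
    by rw [hf.v h5, h.D], by rw [hf.v h6, h.L], by rw [hf.v h7, h.NG], by rw [hf.v h8, h.K1],
    by rw [hf.a h9]; exact h.row⟩

theorem Env.eval (h : Env P σ) (p : Cmd) (hp : p.keepsEnv = true) : Env P (p.eval I σ) :=
  h.frame (Loop.frame I p σ) hp

theorem Env.adj (h : Env P σ) {x y : Var} (hx : σ.v x < P.n) (hy : σ.v y < P.n) :
    (adjE x y).eval I σ ≠ 0 ↔ adj I P.n (σ.v x) (σ.v y) := by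
  simp only [adjE, Exp.eval, eval_add, rd, h.n, h.row _ hx, Loop.adj, hx, hy, true_and]

/-- What `fill` does, provided that `e` depends neither on the array nor on the other entries. -/
theorem eval_fill (A : Arr) (x b : Var) (e : Exp) (σ : St) (f : ℕ → ℕ)
    (hf : ∀ j < σ.v b, ∀ τ : St, τ.v x = j → (∀ y, y ≠ x → τ.v y = σ.v y) →
      (∀ B, B ≠ A → τ.a B = σ.a B) → (∀ i, j ≤ i → τ.a A i = σ.a A i) → e.eval I τ = f j) (i : ℕ) :
    ((fill A x b e).eval I σ).a A i = if i < σ.v b then f i else σ.a A i := by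
  have := loop_rule I (x := x) (b := b) (p := .put A (.var x) e) σ
    (fun m τ => ∀ i, τ.a A i = if i < m then f i else σ.a A i) (by simp) (by
      intro j hj τ hF hI i
      have h1 : e.eval I (τ.setV x j) = f j := by
        refine hf j hj _ (by simp) (fun y hy => hF.v (by simp [Cmd.setsV, hy]))
          (fun B hB => hF.a (by simp [Cmd.setsA, hB])) (fun i hi => ?_)
        rw [St.setV_a, hI, if_neg (by omega)]
      simp only [eval_put, St.setA_a, Exp.eval, St.setV_v, if_true, true_and, h1, St.setV_a, hI]
      by_cases hij : i = j
      · simp [hij]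
      · simp only [hij, if_false]
        by_cases h2 : i < j
        · rw [if_pos h2, if_pos (by omega)]
        · rw [if_neg h2, if_neg (by omega)])
  exact this i

theorem merge_spec (h : Env P σ) {w : ℕ} (hw : w < P.n) : (merge.eval I σ).a .CC w =
    if σ.a .CC w = σ.a .CC (σ.v .u) then σ.a .CC (σ.v .v) else σ.a .CC w := by
  have key : ∀ σ' : St, σ'.v .n = P.n → (Cmd.eval I (.loop .w .n
      (.ite (.eq (rd .CC .w) (.var .ca)) (.put .CC (.var .w) (.var .cb)) .skip)) σ').a .CC w =
      if σ'.a .CC w = σ'.v .ca then σ'.v .cb else σ'.a .CC w := by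
    intro σ' hn
    have := loop_rule I (x := .w) (b := .n) (p :=
      .ite (.eq (rd .CC .w) (.var .ca)) (.put .CC (.var .w) (.var .cb)) .skip) σ'
      (fun m τ => ∀ i, τ.a .CC i = if i < m ∧ σ'.a .CC i = σ'.v .ca then σ'.v .cb else σ'.a .CC i)
      (by simp) (by
        intro j hj τ hF hI i
        have h1 := hF.v (y := .ca) rfl
        have h2 := hF.v (y := .cb) rfl
        have h3 := hI j
        simp only [lt_irrefl, false_and, if_false] at h3
        simp at h1 h2
        simp only [eval_ite, Exp.eval, rd, St.setV_v, if_true, St.setV_a, h3, h1, reduceCtorEq,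
          if_false, eval_put, eval_skip, h2]
        by_cases hc : σ'.a .CC j = σ'.v .ca
        · simp only [hc, if_true, ne_eq, one_ne_zero, not_false_eq_true, St.setA_a, true_and, hI,
            St.setV_a]
          by_cases hij : i = j
          · subst hij; simp [hc]
          · simp only [hij, if_false]
            congr 1
            simp only [eq_iff_iff, and_congr_left_iff]; omega
        · simp only [hc, if_false, ne_eq, not_true_eq_false, St.setV_a, hI]
          congr 1
          simp only [eq_iff_iff, and_congr_left_iff]
          intro hi
          have : i ≠ j := by rintro rfl; exact hc hi
          omega)
    rw [this, hn]
    simp [hw]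
  simp only [merge, eval_block_cons, eval_block_nil, eval_set]
  rw [key _ (by simp [h.n])]
  simp

/-- The invariant rule for two nested loops. -/
theorem loop_rule2 {x y b : Var} {p : Cmd} (σ : St) (N : ℕ) (hN : σ.v b = N)
    (hb : (Cmd.loop x b (.loop y b p)).setsV b = false) (hxy : (Cmd.loop y b p).setsV x = false)
    (Inv : ℕ → ℕ → St → Prop) (h0 : Inv 0 0 σ)
    (hx : ∀ i j τ c, Inv i j τ → Inv i j (τ.setV x c))
    (hy : ∀ i j τ c, Inv i j τ → Inv i j (τ.setV y c))
    (hnext : ∀ i < N, ∀ τ, Inv i N τ → Inv (i + 1) 0 τ)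
    (hs : ∀ i < N, ∀ j < N, ∀ τ, Frame (.loop x b (.loop y b p)) σ τ → τ.v x = i → τ.v y = j →
      Inv i j τ → Inv i (j + 1) (p.eval I τ)) :
    Inv N 0 ((Cmd.loop x b (.loop y b p)).eval I σ) := by
  have := loop_rule I (x := x) (b := b) (p := .loop y b p) σ (fun i τ => Inv i 0 τ) h0 (by
    intro i hi τ hF hI
    have hb' : (τ.setV x i).v b = N := by rw [hF.v hb, hN]
    have h2 := loop_rule I (x := y) (b := b) (p := p) (τ.setV x i) (fun j τ => Inv i j τ)
      (hx _ _ _ _ hI) (by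
      intro j hj τ' hF' hI'
      refine hs i (hN ▸ hi) j (hb' ▸ hj) _ (hF.trans ⟨fun {y'} h => hF'.v ?_, fun {B} h => hF'.a h⟩)
        ?_ (by simp) (hy _ _ _ _ hI')
      · simp only [Cmd.setsV, Bool.or_eq_false_iff] at h ⊢; exact h.2
      · rw [hF'.v hxy]; simp)
    rw [hb'] at h2
    exact hnext i (hN ▸ hi) _ h2)
  rwa [hN] at this

/-- The pairs of `R` before `(i, j)` in lexicographic order. -/
def before (R : ℕ → ℕ → Prop) (i j a b : ℕ) : Prop := R a b ∧ (a < i ∨ a = i ∧ b < j)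

theorem before_zero (R : ℕ → ℕ → Prop) : before R 0 0 = fun _ _ => False := by
  funext a b; simp [before]

theorem before_next {R : ℕ → ℕ → Prop} {n : ℕ} (hR : ∀ a b, R a b → b < n) (i : ℕ) :
    before R i n = before R (i + 1) 0 := by
  funext a b
  apply propext
  simp only [before]
  constructor
  · rintro ⟨h, h'⟩; exact ⟨h, by omega⟩
  · rintro ⟨h, h'⟩
    have := hR a b h
    exact ⟨h, by omega⟩

theorem before_end {R : ℕ → ℕ → Prop} {n : ℕ} (hR : ∀ a b, R a b → a < n) :
    before R n 0 = R := by
  funext a b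
  apply propext
  simp only [before]
  exact ⟨fun h => h.1, fun h => ⟨h, Or.inl (hR a b h)⟩⟩

theorem before_succ_of_pos {R : ℕ → ℕ → Prop} {i j : ℕ} (h : R i j) :
    before R i (j + 1) = addEdge (before R i j) i j := by
  funext a b
  apply propext
  simp only [before, addEdge]
  constructor
  · rintro ⟨h1, h2⟩
    by_cases h3 : a = i ∧ b = j
    · exact Or.inr h3
    · exact Or.inl ⟨h1, by omega⟩
  · rintro (⟨h1, h2⟩ | ⟨rfl, rfl⟩)
    · exact ⟨h1, by omega⟩
    · exact ⟨h, by omega⟩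

theorem before_succ_of_neg {R : ℕ → ℕ → Prop} {i j : ℕ} (h : ¬ R i j) :
    before R i (j + 1) = before R i j := by
  funext a b
  apply propext
  simp only [before]
  constructor
  · rintro ⟨h1, h2⟩
    have h3 : ¬ (a = i ∧ b = j) := by rintro ⟨rfl, rfl⟩; exact h h1
    exact ⟨h1, by omega⟩
  · rintro ⟨h1, h2⟩; exact ⟨h1, by omega⟩

theorem labels_id {n : ℕ} : Labels n (fun _ _ => False) fun v => v := by
  intro u _ v _
  refine ⟨fun h => by rw [show u = v from h]; exact Relation.EqvGen.refl _, fun h => ?_⟩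
  exact (eqvGen_of_forall (P := fun _ => False) (fun _ _ h => h.elim) h).resolve_right fun h => h.1

theorem labels_congr {n : ℕ} {R : ℕ → ℕ → Prop} {C C' : ℕ → ℕ} (h : Labels n R C)
    (hC : ∀ v < n, C' v = C v) : Labels n R C' := fun u hu v hv => by
  rw [hC u hu, hC v hv]; exact h u hu v hv

/-- While the pairs are scanned, the number of merges plus the number of distinct labels stays `n`,
and the labels describe the components of the cut edges scanned so far. -/
theorem rank_spec (h : Env P σ) (U S : Finset ℕ) (hU : U = asSet P.n (σ.a .VP))
    (hS : S = U ∩ asSet P.n (σ.a .RE)) :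
    ((rank.eval I σ).v .rk = rk P.n (CutRel (adj I P.n) U S)) ∧
      Labels P.n (CutRel (adj I P.n) U S) ((rank.eval I σ).a .CC) := by
  simp only [rank, eval_block_cons, eval_block_nil, eval_set]
  set σ₁ := (fill .CC .v .n (.var .v)).eval I (σ.setV .rk (Exp.eval I σ (.lit 0))) with hσ₁
  have F₁ : Frame (.seq (.set .rk (.lit 0)) (fill .CC .v .n (.var .v))) σ σ₁ := Loop.frame I _ σ
  have h₁ : Env P σ₁ := h.frame F₁ rfl
  have hCC : ∀ v < P.n, σ₁.a .CC v = v := by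
    intro v hv
    rw [hσ₁, eval_fill .CC .v .n (.var .v) _ (fun v => v) (fun j _ τ h1 _ _ _ => h1), if_pos]
    simpa [h.n] using hv
  have hrk : σ₁.v .rk = 0 := by
    have := (Loop.frame I (fill .CC .v .n (.var .v)) (σ.setV .rk (Exp.eval I σ (.lit 0)))).v
      (y := .rk) rfl
    rw [hσ₁, this]; simp
  set R := CutRel (adj I P.n) U S with hR
  have hRn : ∀ a b, R a b → a < P.n ∧ b < P.n := fun a b h =>
    ⟨(mem_bd.1 h).2.2.2.1, (mem_bd.1 h).2.2.2.2.1⟩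
  have key := loop_rule2 (I := I) σ₁ P.n h₁.n (x := .u) (y := .v)
    (p := .ite (.and (.and (.and (rd .VP .u) (rd .VP .v)) (adjE .u .v))
      (.and (rd .RE .u) (.eq (rd .RE .v) (.lit 0))))
      (.ite (.eq (rd .CC .u) (rd .CC .v)) .skip (.seq (incr .rk) merge)) .skip) rfl rfl
    (fun i j τ => τ.v .rk + ((range P.n).image (τ.a .CC)).card = P.n ∧
      Labels P.n (before R i j) (τ.a .CC))
    (by
      rw [before_zero]
      refine ⟨?_, labels_congr labels_id hCC⟩
      rw [hrk, image_congr (g := id) (fun v hv => hCC v (by simpa using hv)), image_id, card_range,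
        zero_add])
    (fun i j τ c h => by simpa using h) (fun i j τ c h => by simpa using h)
    (fun i hi τ h => by rwa [← before_next fun a b h => (hRn a b h).2])
    (by
      intro i hi j hj τ hF hu hv hI
      have hτ : Env P τ := h₁.frame hF rfl
      have hcond : (Exp.and (.and (.and (rd .VP .u) (rd .VP .v)) (adjE .u .v))
          (.and (rd .RE .u) (.eq (rd .RE .v) (.lit 0)))).eval I τ ≠ 0 ↔ R i j := by
        have e1 : τ.a .VP = σ.a .VP := (hF.a rfl).trans (F₁.a rfl)
        have e2 : τ.a .RE = σ.a .RE := (hF.a rfl).trans (F₁.a rfl)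
        have e3 := hτ.adj (I := I) (x := .u) (y := .v) (by omega) (by omega)
        rw [hu, hv] at e3
        rw [Exp.eval, Exp.eval, Exp.eval, Exp.eval]
        simp only [hR, CutRel, mem_bd, hS, mem_inter, hU, mem_asSet, ← e3, ← e1, ← e2, rd,
          Exp.eval, hu, hv, hi, hj]
        simp
        tauto
      simp only [eval_ite]
      by_cases hc : R i j
      · rw [if_pos (hcond.2 hc)]
        rw [before_succ_of_pos hc]
        by_cases he : τ.a .CC i = τ.a .CC j
        · rw [if_pos (by simp [hu, hv, he])]
          exact ⟨hI.1, hI.2.addEdge_of_eq hi hj he⟩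
        · rw [if_neg (by simp [hu, hv, he])]
          simp only [eval_seq]
          set τ' := (incr .rk).eval I τ with hτ'
          have hF' := Loop.frame I (incr .rk) τ
          have hFm := Loop.frame I merge τ'
          have hm := fun w hw => merge_spec (I := I) (hτ.frame hF' rfl : Env P τ') (w := w) hw
          rw [hF'.a (B := .CC) rfl, hF'.v (y := .u) rfl, hF'.v (y := .v) rfl, hu, hv] at hm
          obtain ⟨l1, l2⟩ := hI.2.addEdge_of_ne hi hj he hm
          refine ⟨?_, l1⟩
          have e1 : (merge.eval I τ').v .rk = τ.v .rk + 1 := by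
            rw [hFm.v rfl, hτ']; simp
          have := hI.1
          omega
      · rw [if_neg (mt hcond.1 hc)]
        rw [before_succ_of_neg hc]
        exact hI)
  rw [before_end fun a b h => (hRn a b h).1] at key
  refine ⟨?_, key.2⟩
  have := key.2.comps_eq
  have h2 := rk_add_comps (n := P.n) (R := R)
  omega

end Loop

namespace Loop

open Cut Finset

variable {I : ℕ → ℕ} {P : Pars} {σ τ : St}

/-! #### Search in the residual graph -/

/-- The way in which `v` was found: as a source, or from the vertex `p`. -/
def Parent (E : ℕ → ℕ → Prop) (cl lab : ℕ → ℕ) (F : ℕ → ℕ → ℕ) (n : ℕ) (RE : ℕ → ℕ) (p v : ℕ) : Prop :=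
  p = n ∧ lab (cl v) = 1 ∨ p < n ∧ RE p ≠ 0 ∧ RE p < RE v ∧ Res E cl F p v

/-- The vertices found so far are listed in `QU`. -/
structure Queue (E : ℕ → ℕ → Prop) (cl lab : ℕ → ℕ) (F : ℕ → ℕ → ℕ) (n : ℕ) (U : Finset ℕ)
    (cnt : ℕ) (QU RE PAR : ℕ → ℕ) : Prop where
  queue {i : ℕ} (h : i < cnt) : QU i < n ∧ RE (QU i) = i + 1
  found {v : ℕ} (hv : v < n) (h : RE v ≠ 0) : RE v ≤ cnt ∧ QU (RE v - 1) = v ∧ v ∈ U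
  parent {v : ℕ} (hv : v < n) (h : RE v ≠ 0) : Parent E cl lab F n RE (PAR v) v

section Queue

variable {E : ℕ → ℕ → Prop} {cl lab : ℕ → ℕ} {F : ℕ → ℕ → ℕ} {n cnt : ℕ} {U : Finset ℕ}
  {QU RE PAR : ℕ → ℕ}

theorem Queue.visit (h : Queue E cl lab F n U cnt QU RE PAR) {v p : ℕ} (hv : v < n) (hU : v ∈ U)
    (h0 : RE v = 0) (hp : p = n ∧ lab (cl v) = 1 ∨ p < n ∧ RE p ≠ 0 ∧ Res E cl F p v) :
    Queue E cl lab F n U (cnt + 1) (Function.update QU cnt v) (Function.update RE v (cnt + 1))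
      (Function.update PAR v p) := by
  have hle : ∀ w < n, RE w ≤ cnt := fun w hw => by
    by_cases h' : RE w = 0
    · omega
    · exact (h.found hw h').1
  refine ⟨fun {i} hi => ?_, fun {w} hw hw0 => ?_, fun {w} hw hw0 => ?_⟩
  · by_cases hic : i = cnt
    · subst hic; simp [hv]
    · obtain ⟨h1, h2⟩ := h.queue (i := i) (by omega)
      have : QU i ≠ v := by rintro e; rw [e, h0] at h2; omega
      simp [hic, this, h1, h2]
  · by_cases hwv : w = v
    · subst hwv; simp [hU]
    · rw [Function.update_of_ne hwv] at hw0 ⊢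
      obtain ⟨h1, h2, h3⟩ := h.found hw hw0
      refine ⟨by omega, ?_, h3⟩
      rw [Function.update_of_ne (by omega), h2]
  · by_cases hwv : w = v
    · subst hwv
      simp only [Parent, Function.update_self]
      refine hp.imp id fun ⟨h1, h2, h3⟩ => ⟨h1, ?_, ?_, h3⟩
      · rwa [Function.update_of_ne]; rintro rfl; exact h2 h0
      · rw [Function.update_of_ne (by rintro rfl; exact h2 h0)]
        have := hle p h1; omega
    · rw [Function.update_of_ne hwv] at hw0
      have := h.parent hw hw0
      simp only [Parent, Function.update_of_ne hwv] at this ⊢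
      refine this.imp id fun ⟨h1, h2, h3, h4⟩ => ?_
      rw [Function.update_of_ne (by rintro e; rw [e] at h2; exact h2 h0)]
      exact ⟨h1, h2, h3, h4⟩

/-- The entries of the queue are distinct vertices, which is why `n` iterations of the outer loop of
`reach` process all of it. -/
theorem Queue.cnt_le (h : Queue E cl lab F n U cnt QU RE PAR) : cnt ≤ n := by
  have := card_le_card_of_injOn (s := range cnt) (t := range n) QU
    (fun i hi => by simpa using (h.queue (mem_range.1 hi)).1) (by
      intro i hi j hj e
      have h1 := (h.queue (mem_range.1 (mem_coe.1 hi))).2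
      have h2 := (h.queue (mem_range.1 (mem_coe.1 hj))).2
      rw [e] at h1; omega)
  simpa using this

end Queue

/-- The flow stored in the array `F`. -/
def flowOf (n : ℕ) (A : ℕ → ℕ) (u v : ℕ) : ℕ := A (u * n + v)

theorem index_inj {n a b c d : ℕ} (hb : b < n) (hd : d < n) :
    a * n + b = c * n + d ↔ a = c ∧ b = d := by
  constructor
  · intro h
    have h1 := congrArg (· / n) h
    have h2 := congrArg (· % n) h
    simp only [mul_comm _ n, Nat.mul_add_div (show 0 < n by omega), Nat.mul_add_mod,
      Nat.div_eq_of_lt hb, Nat.div_eq_of_lt hd, Nat.mod_eq_of_lt hb, Nat.mod_eq_of_lt hd] at h1 h2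
    exact ⟨by simpa using h1, h2⟩
  · rintro ⟨rfl, rfl⟩; rfl

/-- The result of the search in the residual graph. -/
structure Reached (E : ℕ → ℕ → Prop) (cl lab : ℕ → ℕ) (F : ℕ → ℕ → ℕ) (n : ℕ) (U : Finset ℕ)
    (RE PAR : ℕ → ℕ) : Prop where
  le {v : ℕ} (hv : v < n) : RE v ≤ n
  mem {v : ℕ} (hv : v < n) (h : RE v ≠ 0) : v ∈ U
  parent {v : ℕ} (hv : v < n) (h : RE v ≠ 0) : Parent E cl lab F n RE (PAR v) v
  source {v : ℕ} (hv : v ∈ U) (h : lab (cl v) = 1) : RE v ≠ 0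
  closed {u v : ℕ} (hu : u < n) (h : RE u ≠ 0) (hv : v ∈ U) (hr : Res E cl F u v) : RE v ≠ 0

theorem visit_spec (p : Exp) (c : ℕ) (hp : ∀ τ : St, τ.v .n = σ.v .n → τ.v .u = σ.v .u → p.eval I τ = c) :
    ((visit p).eval I σ).v .cnt = σ.v .cnt + 1 ∧
    ((visit p).eval I σ).a .QU = Function.update (σ.a .QU) (σ.v .cnt) (σ.v .v) ∧
    ((visit p).eval I σ).a .RE = Function.update (σ.a .RE) (σ.v .v) (σ.v .cnt + 1) ∧
    ((visit p).eval I σ).a .PAR = Function.update (σ.a .PAR) (σ.v .v) c := by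
  simp only [visit, eval_block_cons, eval_block_nil, eval_put, eval_set, incr]
  refine ⟨by simp, ?_, ?_, ?_⟩
  · funext i; simp [Function.update_apply]
  · funext i; simp [Function.update_apply]
  · funext i
    rw [St.setA_a, hp _ (by simp) (by simp)]
    simp [Function.update_apply]

/-- The first loop enqueues the sources. In the second, once entry `i` has been processed, all its
residual neighbors in `U` have been found; entries of the queue are never changed, so this persists
while the queue grows. -/
theorem reach_spec (h : Env P σ) (U : Finset ℕ) (hU : U = asSet P.n (σ.a .VP)) :
    Reached (adj I P.n) (σ.a .CL) (σ.a .LAB) (flowOf P.n (σ.a .F)) P.n U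
      ((reach.eval I σ).a .RE) ((reach.eval I σ).a .PAR) := by
  have hUn : ∀ v, v ∈ U ↔ v < P.n ∧ σ.a .VP v ≠ 0 := fun v => by rw [hU, mem_asSet]
  simp only [reach, eval_block_cons, eval_block_nil]
  set σ₁ := (Cmd.set .cnt (.lit 0)).eval I ((fill .RE .v .n (.lit 0)).eval I σ) with hσ₁
  have F₁ : Frame (.seq (fill .RE .v .n (.lit 0)) (.set .cnt (.lit 0))) σ σ₁ := Loop.frame I _ σ
  have h₁ : Env P σ₁ := h.frame F₁ rfl
  have hRE : ∀ v < P.n, σ₁.a .RE v = 0 := by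
    intro v hv
    rw [hσ₁, eval_set, St.setV_a, eval_fill .RE .v .n (.lit 0) _ (fun _ => 0) (fun _ _ _ _ _ _ _ => rfl),
      if_pos (by rwa [h.n])]
  set E := adj I P.n with hE
  set cl := σ.a .CL with hcl
  set lab := σ.a .LAB with hlab
  set F := flowOf P.n (σ.a .F) with hF
  set σ₂ := (Cmd.loop .v .n (.ite (.and (rd .VP .v) (.eq (.get .LAB (rd .CL .v)) (.lit 1)))
    (visit (.var .n)) .skip)).eval I σ₁ with hσ₂
  have F₂ : Frame _ σ₁ σ₂ := Loop.frame I _ σ₁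
  have h₂ : Env P σ₂ := h₁.frame F₂ rfl
  have key₁ := loop_rule I (x := .v) (b := .n)
    (p := .ite (.and (rd .VP .v) (.eq (.get .LAB (rd .CL .v)) (.lit 1))) (visit (.var .n)) .skip) σ₁
    (fun j τ => Queue E cl lab F P.n U (τ.v .cnt) (τ.a .QU) (τ.a .RE) (τ.a .PAR) ∧
      (∀ v < j, v ∈ U → lab (cl v) = 1 → τ.a .RE v ≠ 0) ∧ ∀ v < P.n, j ≤ v → τ.a .RE v = 0)
    (by
      refine ⟨⟨fun {i} hi => ?_, fun {v} hv h' => absurd (hRE v hv) h',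
        fun {v} hv h' => absurd (hRE v hv) h'⟩, by simp, fun v hv _ => hRE v hv⟩
      simp [hσ₁] at hi)
    (by
      intro j hj τ hFr hI
      rw [h₁.n] at hj
      set τ' := τ.setV .v j with hτ'
      have e1 : τ'.a .VP = σ.a .VP := (hFr.a rfl).trans (F₁.a rfl)
      have e2 : τ'.a .LAB = lab := (hFr.a rfl).trans (F₁.a rfl)
      have e3 : τ'.a .CL = cl := (hFr.a rfl).trans (F₁.a rfl)
      have e4 : τ'.v .n = P.n := (hFr.v rfl).trans h₁.n
      have e5 : τ'.v .v = j := by simp [hτ']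
      have hc : (Exp.and (rd .VP .v) (.eq (.get .LAB (rd .CL .v)) (.lit 1))).eval I τ' ≠ 0 ↔
          j ∈ U ∧ lab (cl j) = 1 := by
        rw [hUn]
        simp only [Exp.eval, rd, e5, e1, e2, e3, hj, true_and]
        simp
      obtain ⟨h1, h2, h3⟩ := hI
      simp only [eval_ite]
      by_cases hc' : j ∈ U ∧ lab (cl j) = 1
      · rw [if_pos (hc.2 hc')]
        obtain ⟨s1, s2, s3, s4⟩ := visit_spec (I := I) (σ := τ') (.var .n) P.n
          (fun τ h _ => by rw [Exp.eval, h, e4])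
        have s0 : τ'.v .cnt = τ.v .cnt := by simp [hτ']
        rw [s1, s2, s3, s4, e5, s0]
        refine ⟨h1.visit hj hc'.1 (h3 j hj le_rfl) (Or.inl ⟨rfl, hc'.2⟩), fun v hv hvU hv1 => ?_,
          fun v hv hv' => ?_⟩
        · rw [Function.update_apply]; split_ifs with e
          · omega
          · exact h2 v (by omega) hvU hv1
        · rw [Function.update_of_ne (by omega)]
          exact h3 v hv (by omega)
      · rw [if_neg (mt hc.1 hc')]
        refine ⟨by simpa [hτ'] using h1, fun v hv hvU hv1 => ?_,
          fun v hv hv' => h3 v hv (by omega)⟩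
        have : v ≠ j := by rintro rfl; exact hc' ⟨hvU, hv1⟩
        exact h2 v (by omega) hvU hv1)
  rw [← hσ₂, h₁.n] at key₁
  obtain ⟨k1, k2, -⟩ := key₁
  have key₂ := loop_rule I (x := .i) (b := .n) (p := .ite (.lt (.var .i) (.var .cnt))
    (.seq (.set .u (rd .QU .i)) (.loop .v .n (.ite
      (.and (.and (rd .VP .v) (.eq (rd .RE .v) (.lit 0)))
        (.eq (rd .CL .u) (rd .CL .v) + .and (adjE .u .v) (.eq (.get .F (flowIx .u .v)) (.lit 0))))
      (visit (.var .u)) .skip))) .skip) σ₂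
    (fun m τ => Queue E cl lab F P.n U (τ.v .cnt) (τ.a .QU) (τ.a .RE) (τ.a .PAR) ∧
      (∀ v ∈ U, lab (cl v) = 1 → τ.a .RE v ≠ 0) ∧
      ∀ i < m, i < τ.v .cnt → ∀ v ∈ U, Res E cl F (τ.a .QU i) v → τ.a .RE v ≠ 0)
    ⟨k1, fun v hv h1 => k2 v ((hUn v).1 hv).1 hv h1, by simp⟩
    (by
      rintro m hm τ hFr ⟨q1, q2, q3⟩
      rw [h₂.n] at hm
      simp only [eval_ite]
      by_cases hmc : m < τ.v .cnt
      · rw [if_pos (by simp [hmc])]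
        simp only [eval_seq]
        set u := τ.a .QU m with hu
        have hun : u < P.n := (q1.queue hmc).1
        set τ₀ := (Cmd.set .u (rd .QU .i)).eval I (τ.setV .i m) with hτ₀
        have t1 : τ₀.v .u = u := by simp [hτ₀, hu]
        have Ft : Frame (.seq reach (.set .i (.lit 0))) σ τ₀ := by
          refine ⟨fun {y} hy => ?_, fun {B} hy => ?_⟩
          · have e1 : y ≠ .u ∧ y ≠ .i ∧ y ≠ .cnt ∧ y ≠ .v := by
              refine ⟨?_, ?_, ?_, ?_⟩ <;> (rintro rfl; revert hy; decide)
            rw [hτ₀, eval_set, St.setV_v, if_neg e1.1]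
            refine ((hFr.v ?_).trans (F₂.v ?_)).trans (F₁.v ?_) <;>
              simp [Cmd.setsV, visit, Cmd.block, fill, e1]
          · have e1 : B ≠ .RE ∧ B ≠ .QU ∧ B ≠ .PAR := by
              refine ⟨?_, ?_, ?_⟩ <;> (rintro rfl; revert hy; decide)
            refine ((hFr.a ?_).trans (F₂.a ?_)).trans (F₁.a ?_) <;>
              simp [Cmd.setsA, visit, Cmd.block, fill, e1]
        have ht : Env P τ₀ := h.frame Ft rfl
        have key₃ := loop_rule I (x := .v) (b := .n) (p := .ite
          (.and (.and (rd .VP .v) (.eq (rd .RE .v) (.lit 0)))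
            (.eq (rd .CL .u) (rd .CL .v) + .and (adjE .u .v) (.eq (.get .F (flowIx .u .v)) (.lit 0))))
          (visit (.var .u)) .skip) τ₀
          (fun j τ' => Queue E cl lab F P.n U (τ'.v .cnt) (τ'.a .QU) (τ'.a .RE) (τ'.a .PAR) ∧
            (∀ v < P.n, τ.a .RE v ≠ 0 → τ'.a .RE v ≠ 0) ∧
            τ.v .cnt ≤ τ'.v .cnt ∧ (∀ i < τ.v .cnt, τ'.a .QU i = τ.a .QU i) ∧
            ∀ v < j, v ∈ U → Res E cl F u v → τ'.a .RE v ≠ 0)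
          ⟨by simpa [hτ₀] using q1, fun v _ h => h, by simp [hτ₀], fun i _ => rfl, by simp⟩
          (by
            rintro j hj τ' hFr' ⟨r1, r2, r3, r4, r5⟩
            rw [ht.n] at hj
            set τ'' := τ'.setV .v j with hτ''
            have e0 : Env P τ'' := ht.frame hFr' rfl
            have e1 : τ''.a .VP = σ.a .VP := (hFr'.a rfl).trans (Ft.a rfl)
            have e2 : τ''.a .F = σ.a .F := (hFr'.a rfl).trans (Ft.a rfl)
            have e3 : τ''.a .CL = cl := (hFr'.a rfl).trans (Ft.a rfl)
            have e4 : τ''.v .u = u := (hFr'.v rfl).trans t1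
            have e5 : τ''.v .v = j := by simp [hτ'']
            have e6 : τ''.a .RE = τ'.a .RE := rfl
            have e7 : τ''.v .cnt = τ'.v .cnt := by simp [hτ'']
            have e8 := e0.adj (I := I) (x := .u) (y := .v) (by omega) (by omega)
            rw [e4, e5] at e8
            have hc : (Exp.and (.and (rd .VP .v) (.eq (rd .RE .v) (.lit 0)))
                (.eq (rd .CL .u) (rd .CL .v) + .and (adjE .u .v)
                  (.eq (.get .F (flowIx .u .v)) (.lit 0)))).eval I τ'' ≠ 0 ↔
                j ∈ U ∧ τ'.a .RE j = 0 ∧ Res E cl F u j := by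
              rw [Exp.eval, Exp.eval, eval_add, Exp.eval, Exp.eval, hUn, Res, hE, ← e8]
              simp only [Exp.eval, rd, e5, e1, e2, e3, e4, e6, hj, true_and, flowIx, eval_add,
                e0.row _ hun, hF, flowOf]
              simp
              tauto
            simp only [eval_ite]
            by_cases hc' : j ∈ U ∧ τ'.a .RE j = 0 ∧ Res E cl F u j
            · rw [if_pos (hc.2 hc')]
              obtain ⟨s1, s2, s3, s4⟩ := visit_spec (I := I) (σ := τ'') (.var .u) u
                (fun τ _ h => by rw [Exp.eval, h, e4])
              rw [s1, s2, s3, s4, e5, e7]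
              refine ⟨r1.visit hj hc'.1 hc'.2.1 (Or.inr ⟨hun, r2 u hun ?_, hc'.2.2⟩),
                fun v hv hv0 => ?_, by omega, fun i hi => ?_, fun v hv hvU hvr => ?_⟩
              · rw [(q1.queue hmc).2]; omega
              · show Function.update (τ'.a .RE) j (τ'.v .cnt + 1) v ≠ 0
                rw [Function.update_apply]; split_ifs
                · omega
                · exact r2 v hv hv0
              · show Function.update (τ'.a .QU) (τ'.v .cnt) j i = _
                rw [Function.update_of_ne (by omega)]; exact r4 i hi
              · show Function.update (τ'.a .RE) j (τ'.v .cnt + 1) v ≠ 0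
                rw [Function.update_apply]; split_ifs with e
                · omega
                · exact r5 v (by omega) hvU hvr
            · rw [if_neg (mt hc.1 hc')]
              refine ⟨by simpa [hτ''] using r1, r2, by rw [eval_skip, e7]; exact r3, r4,
                fun v hv hvU hvr => ?_⟩
              by_cases e : v = j
              · subst e
                exact fun h0 => hc' ⟨hvU, h0, hvr⟩
              · exact r5 v (by omega) hvU hvr)
        rw [ht.n] at key₃
        obtain ⟨r1, r2, r3, r4, r5⟩ := key₃
        refine ⟨r1, fun v hv h1 => r2 v ((hUn v).1 hv).1 (q2 v hv h1), fun i hi hi' v hv hvr => ?_⟩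
        have hvn := ((hUn v).1 hv).1
        rcases Nat.lt_succ_iff_lt_or_eq.1 hi with hi | rfl
        · rw [r4 i (by omega)] at hvr
          exact r2 v hvn (q3 i hi (by omega) v hv hvr)
        · rw [r4 i hmc] at hvr
          exact r5 v hvn hv hvr
      · rw [if_neg (by simp [hmc])]
        refine ⟨by simpa using q1, q2, fun i hi hi' v hv hvr => ?_⟩
        have e1 : (Cmd.eval I .skip (τ.setV .i m)).v .cnt = τ.v .cnt := by simp
        rw [e1] at hi'
        exact q3 i (by omega) hi' v hv hvr)
  rw [h₂.n] at key₂
  generalize Cmd.eval I _ σ₂ = σ₃ at key₂ ⊢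
  obtain ⟨q1, q2, q3⟩ := key₂
  have hcnt := q1.cnt_le
  refine ⟨fun {v} hv => ?_, fun hv h => (q1.found hv h).2.2, fun hv h => q1.parent hv h,
    fun hv h => q2 _ hv h, fun {u v} hu h hv hr => ?_⟩
  · by_cases h0 : σ₃.a .RE v = 0
    · rw [h0]; exact Nat.zero_le _
    · exact (q1.found hv h0).1.trans hcnt
  · obtain ⟨f1, f2, -⟩ := q1.found hu h
    have := q3 (σ₃.a .RE u - 1) (by omega) (by omega) v hv
    rw [f2] at this
    exact this hr

end Loop

namespace Loop

open Cut Finset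

variable {I : ℕ → ℕ} {P : Pars} {σ τ : St}

/-! #### Augmenting paths -/

/-- A unit from `p` to `x` first cancels flow from `x` to `p`. This keeps the flow one-directional
on every edge and all values at most one. -/
theorem push_capacity {E : ℕ → ℕ → Prop} {U : Finset ℕ} {F F' : ℕ → ℕ → ℕ} {p x : ℕ}
    (h : Capacity E U F) (hp : p ∈ U) (hx : x ∈ U) (hpx : p ≠ x) (he : E p x) (h0 : F p x = 0)
    (hF' : ∀ u ∈ U, ∀ v ∈ U, F' u v = if F x p ≠ 0 then (if u = x ∧ v = p then 0 else F u v)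
      else if u = p ∧ v = x then 1 else F u v) :
    Capacity E U F' ∧ ∀ S ⊆ U,
      net F' U S = net F U S + (if p ∈ S then 1 else 0) - if x ∈ S then 1 else 0 := by
  refine ⟨⟨fun {u v} hu hv h1 => ?_, fun {u v} hu hv => ?_, fun {u v} hu hv h1 => ?_⟩,
    fun S hS => net_push hp hx (fun u hu v hv => ?_) hS⟩
  · rw [hF' u hu v hv] at h1
    split_ifs at h1 with h2 h3 h3
    · exact absurd rfl h1
    · exact h.edge hu hv h1
    · rw [h3.1, h3.2]; exact he
    · exact h.edge hu hv h1
  · rw [hF' u hu v hv]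
    have := h.le_one hu hv
    split_ifs <;> omega
  · rw [hF' u hu v hv] at h1
    rw [hF' v hv u hu]
    have anti := fun h1 => h.anti hu hv h1
    have hxp := hpx.symm
    by_cases h2 : F x p ≠ 0
    · rw [if_pos h2] at h1 ⊢
      by_cases h3 : u = x ∧ v = p
      · rw [if_pos h3] at h1; exact absurd rfl h1
      · rw [if_neg h3] at h1
        rw [anti h1, ite_self]
    · rw [if_neg h2] at h1 ⊢
      rw [not_not] at h2
      by_cases h3 : u = p ∧ v = x
      · obtain ⟨rfl, rfl⟩ := h3
        rw [if_neg fun h => hpx h.2]; exact h2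
      · rw [if_neg h3] at h1
        rw [if_neg, anti h1]
        rintro ⟨rfl, rfl⟩
        exact h1 h2
  · rw [hF' u hu v hv, hF' v hv u hu]
    have h1 := h.le_one hx hp
    have hxp := hpx.symm
    simp only [Prod.mk.injEq]
    by_cases h2 : F x p ≠ 0
    · rw [if_pos h2, if_pos h2]
      have h3 : F x p = 1 := by omega
      by_cases c1 : u = x ∧ v = p
      · obtain ⟨rfl, rfl⟩ := c1
        simp [hpx, hxp, h0, h3]
      · by_cases c2 : u = p ∧ v = x
        · obtain ⟨rfl, rfl⟩ := c2
          simp [hpx, hxp, h0, h3]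
        · have c3 : ¬ (v = x ∧ u = p) := fun h => c2 ⟨h.2, h.1⟩
          simp [c1, c2, c3]
    · rw [if_neg h2, if_neg h2]
      rw [not_not] at h2
      by_cases c1 : u = x ∧ v = p
      · obtain ⟨rfl, rfl⟩ := c1
        simp [hpx, hxp, h0, h2]
      · by_cases c2 : u = p ∧ v = x
        · obtain ⟨rfl, rfl⟩ := c2
          simp [hpx, hxp, h0, h2]
        · have c3 : ¬ (v = p ∧ u = x) := fun h => c1 ⟨h.2, h.1⟩
          simp [c1, c2, c3]

theorem push_spec (h : Env P τ) {x p : ℕ} (hx : τ.v .x = x) (hp : τ.a .PAR x = p) (hxn : x < P.n) :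
    (push.eval I τ).v .x = (if p < P.n then p else x) ∧ ∀ i, (push.eval I τ).a .F i =
      if p < P.n ∧ τ.a .CL p ≠ τ.a .CL x then
        if τ.a .F (x * P.n + p) ≠ 0 then (if i = x * P.n + p then 0 else τ.a .F i)
        else if i = p * P.n + x then 1 else τ.a .F i
      else τ.a .F i := by
  have hr := h.row
  have hn := h.n
  by_cases h1 : p < P.n
  · have r1 := hr x hxn
    have r2 := hr p h1
    by_cases h2 : τ.a .CL p = τ.a .CL x
    · simp [push, hx, hp, h1, h2, hn]
    · by_cases h3 : τ.a .F (x * P.n + p) = 0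
      · simp [push, hx, hp, h1, h2, h3, hn, r1, r2]
      · simp [push, hx, hp, h1, h2, h3, hn, r1, r2]
  · simp [push, hx, hp, h1, hn]

theorem findTarget_spec (h : Env P σ) :
    ((findTarget.eval I σ).v .x < P.n ∧ σ.a .RE ((findTarget.eval I σ).v .x) ≠ 0 ∧
      σ.a .LAB (σ.a .CL ((findTarget.eval I σ).v .x)) = 2) ∨
    ((findTarget.eval I σ).v .x = P.n ∧
      ∀ v < P.n, σ.a .RE v ≠ 0 → σ.a .LAB (σ.a .CL v) ≠ 2) := by
  simp only [findTarget, eval_seq, eval_set]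
  set σ₁ := σ.setV .x (Exp.eval I σ (.var .n)) with hσ₁
  have hn : σ₁.v .n = P.n := by simp [hσ₁, h.n]
  have key := loop_rule I (x := .v) (b := .n) (p := .ite
    (.and (rd .RE .v) (.eq (.get .LAB (rd .CL .v)) (.lit 2))) (.set .x (.var .v)) .skip) σ₁
    (fun j τ => (τ.v .x < P.n ∧ σ.a .RE (τ.v .x) ≠ 0 ∧ σ.a .LAB (σ.a .CL (τ.v .x)) = 2) ∨
      (τ.v .x = P.n ∧ ∀ v < j, σ.a .RE v ≠ 0 → σ.a .LAB (σ.a .CL v) ≠ 2))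
    (Or.inr ⟨by simp [hσ₁, h.n], by simp⟩) (by
      intro j hj τ hF hI
      rw [hn] at hj
      have e1 : τ.a .RE = σ.a .RE := hF.a rfl
      have e2 : τ.a .LAB = σ.a .LAB := hF.a rfl
      have e3 : τ.a .CL = σ.a .CL := hF.a rfl
      have hc : (Exp.and (rd .RE .v) (.eq (.get .LAB (rd .CL .v)) (.lit 2))).eval I (τ.setV .v j) ≠ 0
          ↔ σ.a .RE j ≠ 0 ∧ σ.a .LAB (σ.a .CL j) = 2 := by
        simp only [Exp.eval, rd, St.setV_a, St.setV_v, if_true, e1, e2, e3]; simp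
      simp only [eval_ite]
      by_cases hc' : σ.a .RE j ≠ 0 ∧ σ.a .LAB (σ.a .CL j) = 2
      · rw [if_pos (hc.2 hc')]
        left
        simpa using ⟨hj, hc'⟩
      · rw [if_neg (mt hc.1 hc')]
        rcases hI with hI | ⟨h1, h2⟩
        · left; simpa using hI
        · right
          refine ⟨by simpa using h1, fun v hv h3 h4 => ?_⟩
          rcases Nat.lt_succ_iff_lt_or_eq.1 hv with hv | rfl
          · exact h2 v hv h3 h4
          · exact hc' ⟨h3, h4⟩)
  rw [hn] at key
  exact key

/-- The path is traced back from the target. After each push the net flow out of a feasible `S` is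
`J`, plus one if `S` contains the current vertex `x`: a target never lies in `S`, a source always
does. Only arcs with an end found later than `x` have been changed, so the next arc towards the
parent is still residual. `RE` decreases at every step, so `n` steps reach a source, where further
pushes do nothing. -/
theorem pushes_spec (h : Env P σ) {U : Finset ℕ} (hUn : ∀ v, v ∈ U → v < P.n)
    (hR : Reached (adj I P.n) (σ.a .CL) (σ.a .LAB) (flowOf P.n (σ.a .F)) P.n U (σ.a .RE) (σ.a .PAR))
    {J : ℕ} (hf : IsFlow (adj I P.n) (σ.a .CL) (σ.a .LAB) U (flowOf P.n (σ.a .F)) J)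
    (hx : σ.v .x < P.n) (hx0 : σ.a .RE (σ.v .x) ≠ 0) (hx2 : σ.a .LAB (σ.a .CL (σ.v .x)) = 2) :
    IsFlow (adj I P.n) (σ.a .CL) (σ.a .LAB) U
      (flowOf P.n (((Cmd.loop .i .n push).eval I σ).a .F)) (J + 1) := by
  set E := adj I P.n
  set cl := σ.a .CL with hcl
  set lab := σ.a .LAB
  set F₀ := flowOf P.n (σ.a .F) with hF₀
  set RE := σ.a .RE
  set PAR := σ.a .PAR
  have key := loop_rule I (x := .i) (b := .n) (p := push) σ
    (fun m τ => τ.v .x < P.n ∧ RE (τ.v .x) ≠ 0 ∧ Capacity E U (flowOf P.n (τ.a .F)) ∧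
      (∀ S, Feasible cl lab U S → net (flowOf P.n (τ.a .F)) U S = J + if τ.v .x ∈ S then 1 else 0) ∧
      (∀ a < P.n, ∀ b < P.n, RE a ≤ RE (τ.v .x) → RE b ≤ RE (τ.v .x) →
        flowOf P.n (τ.a .F) a b = F₀ a b) ∧ (PAR (τ.v .x) = P.n ∨ RE (τ.v .x) + m ≤ P.n))
    (by
      refine ⟨hx, hx0, hf.cap, fun S hS => ?_, fun _ _ _ _ _ _ => rfl, Or.inr (by simpa using hR.le hx)⟩
      rw [if_neg fun hS' => hS.target hS' hx2, hf.net hS, add_zero])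
    (by
      intro m hm τ hF
      generalize hxx : τ.v .x = x
      rintro ⟨h1, h2, h3, h4, h5, h6⟩
      set τ' := τ.setV .i m with hτ'
      have hE' : Env P τ' := h.frame hF rfl
      have e1 : τ'.a .PAR = PAR := hF.a rfl
      have e2 : τ'.a .CL = cl := hF.a rfl
      have e3 : τ'.a .F = τ.a .F := rfl
      have e4 : τ'.v .x = x := by simp [hτ', hxx]
      obtain ⟨s1, s2⟩ := push_spec (I := I) hE' e4 rfl h1
      rw [e1, e2, e3] at s2
      rw [e1] at s1
      rw [s1]
      have hxU := hR.mem h1 h2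
      rcases hR.parent h1 h2 with ⟨hp, hl⟩ | ⟨hp, hp0, hlt, hres⟩
      · have hnot : ¬ PAR x < P.n := by omega
        simp only [hnot, false_and, if_false] at s2 ⊢
        have s3 : (push.eval I τ').a .F = τ.a .F := funext s2
        rw [s3]
        exact ⟨h1, h2, h3, h4, h5, Or.inl hp⟩
      · simp only [hp, true_and, if_true] at s2 ⊢
        have hpU := hR.mem hp hp0
        refine ⟨hp0, ?_⟩
        have h6' : PAR (PAR x) = P.n ∨ RE (PAR x) + (m + 1) ≤ P.n := by
          rcases h6 with h6 | h6
          · omega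
          · right; omega
        by_cases hc : cl (PAR x) = cl x
        · simp only [hc, ne_eq, not_true_eq_false, if_false] at s2
          have s3 : (push.eval I τ').a .F = τ.a .F := funext s2
          rw [s3]
          refine ⟨h3, fun S hS => ?_, fun a ha b hb h7 h8 => h5 a ha b hb (by omega) (by omega), h6'⟩
          rw [h4 S hS]
          have : PAR x ∈ S ↔ x ∈ S := ⟨fun h => hS.closed.2 _ h _ hxU hc,
            fun h => hS.closed.2 _ h _ hpU hc.symm⟩
          simp only [this]
        · simp only [ne_eq, hc, not_false_eq_true, if_true] at s2
          obtain ⟨he, hz⟩ := hres.resolve_left hc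
          have hz' : flowOf P.n (τ.a .F) (PAR x) x = 0 := by
            rw [h5 _ hp _ h1 (by omega) le_rfl]; exact hz
          have hne : PAR x ≠ x := fun e => hc (by rw [e])
          have s3 : ∀ u, u < P.n → ∀ v, v < P.n → flowOf P.n ((push.eval I τ').a .F) u v =
              if flowOf P.n (τ.a .F) x (PAR x) ≠ 0 then
                (if u = x ∧ v = PAR x then 0 else flowOf P.n (τ.a .F) u v)
              else if u = PAR x ∧ v = x then 1 else flowOf P.n (τ.a .F) u v := by
            intro u hu v hv
            simp only [flowOf, s2, index_inj hv hp, index_inj hv h1, ne_eq]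
            congr
          obtain ⟨g1, g2⟩ := push_capacity h3 hpU hxU hne he hz'
            fun u hu v hv => s3 u (hUn u hu) v (hUn v hv)
          refine ⟨g1, fun S hS => ?_, fun a ha b hb h7 h8 => ?_, h6'⟩
          · rw [g2 S hS.closed.1, h4 S hS]; ring
          · rw [s3 a ha b hb, if_neg (c := a = x ∧ b = PAR x) (by rintro ⟨rfl, -⟩; omega),
              if_neg (c := a = PAR x ∧ b = x) (by rintro ⟨-, rfl⟩; omega), ite_self]
            exact h5 a ha b hb (by omega) (by omega))
  rw [h.n] at key
  generalize (Cmd.loop .i .n push).eval I σ = σ' at key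
  obtain ⟨h1, h2, h3, h4, h5, h6⟩ := key
  refine ⟨h3, fun {S} hS => ?_⟩
  have hxU := hR.mem h1 h2
  rcases hR.parent h1 h2 with ⟨hp, hl⟩ | ⟨hp, hp0, hlt, hres⟩
  · rw [h4 S hS, if_pos (hS.source hxU hl)]; push_cast; ring
  · omega

/-- Induction on `RE`, along the parents back to a source. -/
theorem Reached.subset {E : ℕ → ℕ → Prop} {cl lab : ℕ → ℕ} {F : ℕ → ℕ → ℕ} {n : ℕ} {U : Finset ℕ}
    {RE PAR : ℕ → ℕ} (h : Reached E cl lab F n U RE PAR) {S : Finset ℕ}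
    (hs : ∀ v ∈ U, lab (cl v) = 1 → v ∈ S)
    (hc : ∀ u ∈ S, ∀ v ∈ U, Res E cl F u v → v ∈ S) {v : ℕ} (hv : v < n) (h0 : RE v ≠ 0) : v ∈ S := by
  induction hm : RE v using Nat.strong_induction_on generalizing v with
  | _ m ih =>
    have hvU := h.mem hv h0
    rcases h.parent hv h0 with ⟨-, hl⟩ | ⟨hp, hp0, hlt, hres⟩
    · exact hs v hvU hl
    · exact hc _ (ih _ (hm ▸ hlt) hp hp0 rfl) v hvU hres

/-- `S` is the smallest minimum cut, of value `J`. -/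
def IsCutOf (E : ℕ → ℕ → Prop) (cl lab : ℕ → ℕ) (U S : Finset ℕ) (J : ℕ) : Prop :=
  IsMinCut E cl lab U S ∧ (bd E U S).card = J

/-- If a target is reached, the path of parents augments the flow; otherwise the reached vertices
are closed in the residual graph and free of targets, which is the situation of `IsFlow.isMinCut`.
-/
theorem augment_spec (h : Env P σ) (hE : ∀ u v, adj I P.n u v → adj I P.n v u) {U : Finset ℕ}
    (hU : U = asSet P.n (σ.a .VP))
    (hf : IsFlow (adj I P.n) (σ.a .CL) (σ.a .LAB) U (flowOf P.n (σ.a .F)) (σ.v .J)) :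
    let σ' := augment.eval I σ
    IsFlow (adj I P.n) (σ.a .CL) (σ.a .LAB) U (flowOf P.n (σ'.a .F)) (σ'.v .J) ∧
    (σ'.v .J = σ.v .J + 1 ∨ σ'.v .J = σ.v .J ∧
      IsCutOf (adj I P.n) (σ.a .CL) (σ.a .LAB) U (asSet P.n (σ'.a .RE)) (σ'.v .J)) := by
  have hR := reach_spec h U hU (I := I)
  have hUn : ∀ v, v ∈ U → v < P.n := fun v hv => by rw [hU, mem_asSet] at hv; exact hv.1
  simp only [augment, eval_block_cons, eval_block_nil]
  have F₁ := Loop.frame I reach σ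
  set σ₁ := reach.eval I σ
  have h₁ : Env P σ₁ := h.frame F₁ rfl
  have ht := findTarget_spec h₁ (I := I)
  have F₂ := Loop.frame I findTarget σ₁
  set σ₂ := findTarget.eval I σ₁
  have h₂ : Env P σ₂ := h₁.frame F₂ rfl
  have a1 : σ₁.a .CL = σ.a .CL := F₁.a rfl
  have a2 : σ₁.a .LAB = σ.a .LAB := F₁.a rfl
  have a3 : σ₁.a .F = σ.a .F := F₁.a rfl
  have b1 : σ₂.a .CL = σ.a .CL := (F₂.a rfl).trans a1
  have b2 : σ₂.a .LAB = σ.a .LAB := (F₂.a rfl).trans a2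
  have b3 : σ₂.a .F = σ.a .F := (F₂.a rfl).trans a3
  have b4 : σ₂.a .RE = σ₁.a .RE := F₂.a rfl
  have b5 : σ₂.a .PAR = σ₁.a .PAR := F₂.a rfl
  have bJ : σ₂.v .J = σ.v .J := (F₂.v rfl).trans (F₁.v rfl)
  rw [a1, a2] at ht
  rcases ht with ⟨t1, t2, t3⟩ | ⟨t1, t2⟩
  · have hc : (Exp.lt (.var .x) (.var .n)).eval I σ₂ ≠ 0 := by simp [h₂.n, t1]
    rw [eval_ite, if_pos hc, eval_seq]
    set σ₃ := (incr .J).eval I σ₂ with hσ₃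
    have F₃ := Loop.frame I (incr .J) σ₂
    have h₃ : Env P σ₃ := h₂.frame F₃ rfl
    have c1 : σ₃.a = σ₂.a := by simp [hσ₃]
    have c2 : σ₃.v .x = σ₂.v .x := by simp [hσ₃]
    have c3 : σ₃.v .J = σ.v .J + 1 := by simp [hσ₃, bJ]
    have c4 : ((Cmd.loop .i .n push).eval I σ₃).v .J = σ.v .J + 1 :=
      ((Loop.frame I (Cmd.loop .i .n push) σ₃).v rfl).trans c3
    have := pushes_spec (I := I) h₃ hUn (J := σ.v .J) (by rw [c1, b1, b2, b3, b4, b5]; exact hR)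
      (by rw [c1, b1, b2, b3]; exact hf) (by rw [c2]; exact t1) (by rw [c1, c2, b4]; exact t2)
      (by rw [c1, c2, b1, b2]; exact t3)
    rw [c1, b1, b2] at this
    rw [c4]
    exact ⟨this, Or.inl rfl⟩
  · have hc : ¬ (Exp.lt (.var .x) (.var .n)).eval I σ₂ ≠ 0 := by simp [h₂.n, t1]
    rw [eval_ite, if_neg hc, eval_skip, b3, b4, bJ]
    refine ⟨hf, Or.inr ⟨rfl, hf.isMinCut hE (fun v hv => ?_) (fun v hv h1 => ?_) (fun v hv => ?_)
      (fun u hu v hv hr => ?_) (fun S _ hs hc v hv => ?_)⟩⟩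
    · rw [mem_asSet] at hv; exact hR.mem hv.1 hv.2
    · rw [mem_asSet]; exact ⟨hUn v hv, hR.source hv h1⟩
    · rw [mem_asSet] at hv; exact t2 v hv.1 hv.2
    · rw [mem_asSet] at hu ⊢; exact ⟨hUn v hv, hR.closed hu.1 hu.2 hv hr⟩
    · rw [mem_asSet] at hv; exact hR.subset hs hc hv.1 hv.2

theorem isFlow_zero {E : ℕ → ℕ → Prop} {cl lab : ℕ → ℕ} {U : Finset ℕ} {F : ℕ → ℕ → ℕ}
    (h : ∀ u ∈ U, ∀ v ∈ U, F u v = 0) : IsFlow E cl lab U F 0 := by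
  refine ⟨⟨fun hu hv h0 => absurd (h _ hu _ hv) h0, fun hu hv => by rw [h _ hu _ hv]; omega,
    fun hu hv h0 => absurd (h _ hu _ hv) h0⟩, fun {S} hS => ?_⟩
  rw [net]
  refine sum_eq_zero fun e he => ?_
  rw [mem_product, mem_sdiff] at he
  rw [h _ (hS.closed.1 he.1) _ he.2.1, h _ he.2.1 _ (hS.closed.1 he.1)]; rfl

/-- After `flow`, either `RE` is the smallest minimum cut and `J` is its value, or `J > K` and
all cuts have value greater than `K`. -/
theorem flow_spec (h : Env P σ) (hE : ∀ u v, adj I P.n u v → adj I P.n v u) {U : Finset ℕ}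
    (hU : U = asSet P.n (σ.a .VP)) :
    let σ' := flow.eval I σ
    (σ'.v .J ≤ P.K ∧
      IsCutOf (adj I P.n) (σ.a .CL) (σ.a .LAB) U (asSet P.n (σ'.a .RE)) (σ'.v .J)) ∨
    (P.K < σ'.v .J ∧ ∀ S, Feasible (σ.a .CL) (σ.a .LAB) U S → P.K < (bd (adj I P.n) U S).card) := by
  have hUn : ∀ v, v ∈ U → v < P.n := fun v hv => by rw [hU, mem_asSet] at hv; exact hv.1
  simp only [flow, eval_block_cons, eval_block_nil]
  set c₁ := Cmd.loop .u .n (.loop .v .n (.put .F (flowIx .u .v) (.lit 0))) with hc₁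
  have F₁ := Loop.frame I c₁ σ
  have key := loop_rule2 (I := I) σ P.n h.n (x := .u) (y := .v)
    (p := .put .F (flowIx .u .v) (.lit 0)) rfl rfl
    (fun i j τ => ∀ a < P.n, ∀ b < P.n, a < i ∨ a = i ∧ b < j → flowOf P.n (τ.a .F) a b = 0)
    (fun a _ b _ h => by omega) (fun i j τ c h => h) (fun i j τ c h => h)
    (fun i hi τ h a ha b hb h' => h a ha b hb (by omega))
    (by
      intro i hi j hj τ hF hu hv hI a ha b hb hab
      have hτ : Env P τ := h.frame hF rfl
      simp only [flowOf, eval_put, St.setA_a, flowIx, eval_add, rd, Exp.eval, hu, hv,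
        hτ.row i hi, true_and, index_inj hb hj]
      split_ifs with h1
      · rfl
      · exact hI a ha b hb (by omega))
  rw [← hc₁] at key
  set σ₁ := c₁.eval I σ
  set σ₂ := (Cmd.set .J (.lit 0)).eval I σ₁ with hσ₂
  have F₂ : Frame (.seq c₁ (.set .J (.lit 0))) σ σ₂ := Loop.frame I (.seq c₁ (.set .J (.lit 0))) σ
  have h₂ : Env P σ₂ := h.frame F₂ rfl
  have hJ : σ₂.v .J = 0 := by simp [hσ₂]
  have b1 : σ₂.a .CL = σ.a .CL := F₂.a rfl
  have b2 : σ₂.a .LAB = σ.a .LAB := F₂.a rfl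
  have b4 : σ₂.a .VP = σ.a .VP := F₂.a rfl
  have main := loop_rule I (x := .r) (b := .K1) (p := augment) σ₂
    (fun m τ => IsFlow (adj I P.n) (σ.a .CL) (σ.a .LAB) U (flowOf P.n (τ.a .F)) (τ.v .J) ∧
      τ.v .J ≤ m ∧ (τ.v .J = m ∨
        IsCutOf (adj I P.n) (σ.a .CL) (σ.a .LAB) U (asSet P.n (τ.a .RE)) (τ.v .J)))
    ⟨by
      rw [hJ]
      exact isFlow_zero fun u hu v hv => key u (hUn u hu) v (hUn v hv) (Or.inl (hUn u hu)),
      by rw [hJ], Or.inl hJ⟩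
    (by
      intro m hm τ hF ⟨i1, i2, i3⟩
      have hτ : Env P (τ.setV .r m) := h₂.frame hF rfl
      have d1 : (τ.setV .r m).a .CL = σ.a .CL := (hF.a rfl).trans b1
      have d2 : (τ.setV .r m).a .LAB = σ.a .LAB := (hF.a rfl).trans b2
      have d4 : (τ.setV .r m).a .VP = σ.a .VP := (hF.a rfl).trans b4
      have dJ : (τ.setV .r m).v .J = τ.v .J := by simp
      have := augment_spec (I := I) hτ hE (U := U) (by rw [d4]; exact hU)
        (by rw [d1, d2, dJ]; exact i1)
      rw [d1, d2, dJ] at this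
      obtain ⟨s1, s2⟩ := this
      refine ⟨s1, ?_, ?_⟩
      · rcases s2 with s2 | ⟨s2, -⟩ <;> omega
      · rcases s2 with s2 | ⟨s2, s3⟩
        · rcases i3 with i3 | i3
          · left; omega
          -- A cut of value `J` was found before, so the flow cannot grow to `J + 1`.
          · exfalso
            have h5 := s1.le_card i3.1.feasible
            rw [i3.2] at h5
            omega
        · exact Or.inr s3)
  rw [h₂.K1] at main
  obtain ⟨i1, i2, i3⟩ := main
  rcases i3 with i3 | i3
  · right
    refine ⟨by omega, fun S hS => ?_⟩
    have := i1.le_card hS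
    omega
  · by_cases hle : (Cmd.eval I (.loop .r .K1 augment) σ₂).v .J ≤ P.K
    · exact Or.inl ⟨hle, i3⟩
    · right
      refine ⟨by omega, fun S hS => ?_⟩
      have := i1.le_card hS
      omega

end Loop

/-! ### One round of guesses as executed by the program -/

namespace Cut

open Finset

theorem ask_congr {cl b : ℕ → ℕ} {Q Q' : ℕ → Prop} {s : (ℕ → ℕ) × ℕ} {m : ℕ}
    (h : ∀ v < m, Q v ↔ Q' v) : ask cl Q b m s = ask cl Q' b m s := by
  induction m with
  | zero => rfl
  | succ m ih =>
    simp only [ask]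
    rw [ih fun v hv => h v (by omega), propext (h m (by omega))]

theorem cnum_eq {cl : ℕ → ℕ} {U S : Finset ℕ} (h : Closed cl U S) (hr : Reps cl U) :
    cnum cl S = (S.filter fun v => cl v = v).card := by
  rw [cnum]
  congr 1
  ext c
  rw [mem_image, mem_filter]
  constructor
  · rintro ⟨v, hv, rfl⟩
    obtain ⟨h1, h2⟩ := hr v (h.1 hv)
    exact ⟨h.2 v hv _ h1 h2.symm, h2⟩
  · rintro ⟨h1, h2⟩; exact ⟨c, h1, h2⟩

/-- A cut with few edges and many classes on both sides. -/
structure IsBalancedCut (E : ℕ → ℕ → Prop) (cl : ℕ → ℕ) (q K : ℕ) (U M : Finset ℕ) : Prop where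
  closed : Closed cl U M
  card_le : (bd E U M).card ≤ K
  lt : q < cnum cl M
  lt' : q < cnum cl (U \ M)

end Cut

namespace Loop

open Cut Finset

variable {I : ℕ → ℕ} {P : Pars} {σ τ : St} {cl : ℕ → ℕ} {U T : Finset ℕ}

/-- The classes and the piece that the algorithm is working on. -/
structure Ctx (P : Pars) (cl : ℕ → ℕ) (U T : Finset ℕ) (σ : St) : Prop where
  env : Env P σ
  cls : σ.a .CL = cl
  part : U = asSet P.n (σ.a .VP)
  term : T = asSet P.n (σ.a .TP)
  clean : ∀ i, P.n ≤ i → σ.a .LAB i = 0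

def Cmd.keepsCtx (p : Cmd) : Bool :=
  p.keepsEnv && !(p.setsA .CL || p.setsA .VP || p.setsA .TP)

theorem Ctx.frame' (h : Ctx P cl U T σ) {p : Cmd} (hf : Frame p σ τ) (hp : p.keepsCtx = true)
    (hl : ∀ i, P.n ≤ i → τ.a .LAB i = 0) : Ctx P cl U T τ := by
  simp only [Cmd.keepsCtx, Bool.and_eq_true, Bool.not_eq_true', Bool.or_eq_false_iff] at hp
  obtain ⟨h1, ⟨h2, h3⟩, h4⟩ := hp
  exact ⟨h.env.frame hf h1, by rw [hf.a h2, h.cls], by rw [hf.a h3, h.part],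
    by rw [hf.a h4, h.term], hl⟩

theorem Ctx.frame (h : Ctx P cl U T σ) {p : Cmd} (hf : Frame p σ τ) (hp : p.keepsCtx = true)
    (hl : p.setsA .LAB = false) : Ctx P cl U T τ :=
  h.frame' hf hp (by rw [hf.a hl]; exact h.clean)

theorem Ctx.lt (h : Ctx P cl U T σ) {v : ℕ} (hv : v ∈ U) : v < P.n := by
  rw [h.part, mem_asSet] at hv; exact hv.1

theorem Ctx.mem_part (h : Ctx P cl U T σ) {v : ℕ} (hv : v < P.n) : σ.a .VP v ≠ 0 ↔ v ∈ U := by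
  rw [h.part, mem_asSet]; exact ⟨fun h => ⟨hv, h⟩, fun h => h.2⟩

theorem Ctx.mem_term (h : Ctx P cl U T σ) {v : ℕ} (hv : v < P.n) : σ.a .TP v ≠ 0 ↔ v ∈ T := by
  rw [h.term, mem_asSet]; exact ⟨fun h => ⟨hv, h⟩, fun h => h.2⟩

/-- The loop is `ask` step by step. The equality of label functions holds everywhere, not just below
`n`, because labels are written only at `cl v < n`. -/
theorem answer_spec (h : Ctx P cl U T σ) (hcl : ∀ v < P.n, cl v < P.n) :
    Ctx P cl U T (answer.eval I σ) ∧
    ((answer.eval I σ).a .LAB, (answer.eval I σ).v .gp) =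
      ask cl (fun v => σ.a .QY v ≠ 0) (σ.a .G) P.n (σ.a .LAB, σ.v .gp) := by
  have key := loop_rule I (x := .v) (b := .n) (p := .ite
    (.and (rd .QY .v) (.eq (.get .LAB (rd .CL .v)) (.lit 0)))
    (.seq (.put .LAB (rd .CL .v) (.lit 2 - .get .G (.var .gp))) (incr .gp)) .skip) σ
    (fun m τ => (∀ i, P.n ≤ i → τ.a .LAB i = 0) ∧ (τ.a .LAB, τ.v .gp) =
      ask cl (fun v => σ.a .QY v ≠ 0) (σ.a .G) m (σ.a .LAB, σ.v .gp)) ⟨h.clean, rfl⟩ (by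
      rintro m hm τ hF ⟨i1, i2⟩
      rw [h.env.n] at hm
      have e1 : τ.a .QY = σ.a .QY := hF.a rfl
      have e2 : τ.a .CL = cl := (hF.a rfl).trans h.cls
      have e3 : τ.a .G = σ.a .G := hF.a rfl
      simp only [ask, ← i2]
      have hc : (Exp.and (rd .QY .v) (.eq (.get .LAB (rd .CL .v)) (.lit 0))).eval I (τ.setV .v m) ≠ 0
          ↔ σ.a .QY m ≠ 0 ∧ τ.a .LAB (cl m) = 0 := by
        simp only [Exp.eval, rd, St.setV_a, St.setV_v, if_true, e1, e2]; simp
      simp only [eval_ite]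
      by_cases hc' : σ.a .QY m ≠ 0 ∧ τ.a .LAB (cl m) = 0
      · rw [if_pos (hc.2 hc'), if_pos hc']
        have e4 : (Cmd.eval I (.seq (.put .LAB (rd .CL .v) (.lit 2 - .get .G (.var .gp))) (incr .gp))
            (τ.setV .v m)).a .LAB = Function.update (τ.a .LAB) (cl m) (2 - σ.a .G (τ.v .gp)) := by
          funext i
          simp [e2, e3, Function.update_apply]
        refine ⟨fun i hi => ?_, Prod.ext e4 (by simp)⟩
        rw [e4, Function.update_of_ne]
        · exact i1 i hi
        · have := hcl m hm; omega
      · rw [if_neg (mt hc.1 hc'), if_neg hc']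
        exact ⟨i1, by simp⟩)
  rw [h.env.n] at key
  exact ⟨h.frame' (Loop.frame I answer σ) rfl key.1, key.2⟩

theorem countSides_spec (h : Ctx P cl U T σ) (hr : Reps cl U) {M : Finset ℕ}
    (hM : M = asSet P.n (σ.a .RE)) (hMc : Closed cl U M) :
    (countSides.eval I σ).v .cM = cnum cl M ∧ (countSides.eval I σ).v .cO = cnum cl (U \ M) := by
  simp only [countSides, eval_block_cons, eval_block_nil]
  set σ₁ := (Cmd.set .cO (.lit 0)).eval I ((Cmd.set .cM (.lit 0)).eval I σ) with hσ₁
  have F₁ : Frame (.seq (.set .cM (.lit 0)) (.set .cO (.lit 0))) σ σ₁ := Loop.frame I _ σ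
  have h₁ := h.frame F₁ rfl rfl
  have key := loop_rule I (x := .v) (b := .n) (p := .ite (.and (rd .VP .v) (.eq (rd .CL .v) (.var .v)))
    (.ite (rd .RE .v) (incr .cM) (incr .cO)) .skip) σ₁
    (fun m τ => τ.v .cM = ((range m).filter fun v => v ∈ M ∧ cl v = v).card ∧
      τ.v .cO = ((range m).filter fun v => v ∈ U \ M ∧ cl v = v).card)
    (by simp [hσ₁]) (by
      rintro m hm τ hF ⟨i1, i2⟩
      rw [h₁.env.n] at hm
      have hτ := h₁.frame hF rfl rfl
      have e0 : (τ.setV .v m).a .RE = σ.a .RE := (hF.a rfl).trans (F₁.a rfl)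
      have hm' : m ∈ M ↔ σ.a .RE m ≠ 0 := by
        rw [hM, mem_asSet]; exact ⟨fun h => h.2, fun h => ⟨hm, h⟩⟩
      have e1 := hτ.mem_part hm
      have e2 := hτ.cls
      have hc : (Exp.and (rd .VP .v) (.eq (rd .CL .v) (.var .v))).eval I (τ.setV .v m) ≠ 0
          ↔ m ∈ U ∧ cl m = m := by
        rw [← e1, ← e2]
        simp only [Exp.eval, rd, St.setV_v, if_true]
        by_cases e : τ.a .CL m = m <;> simp [e]
      have hc2 : (rd .RE .v).eval I (τ.setV .v m) ≠ 0 ↔ m ∈ M := by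
        rw [hm', ← e0]; simp
      simp only [eval_ite, range_add_one, filter_insert]
      by_cases hc' : m ∈ U ∧ cl m = m
      · rw [if_pos (hc.2 hc')]
        by_cases hmM : m ∈ M
        · rw [if_pos (hc2.2 hmM), if_pos ⟨hmM, hc'.2⟩, if_neg (by simp [hmM]),
            card_insert_of_notMem (by simp)]
          simp [i1, i2]
        · rw [if_neg (mt hc2.1 hmM), if_neg (by simp [hmM]),
            if_pos ⟨mem_sdiff.2 ⟨hc'.1, hmM⟩, hc'.2⟩, card_insert_of_notMem (by simp)]
          simp [i1, i2]
      · rw [if_neg (mt hc.1 hc'), if_neg fun h => hc' ⟨hMc.1 h.1, h.2⟩,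
          if_neg fun h => hc' ⟨(mem_sdiff.1 h.1).1, h.2⟩]
        simp [i1, i2])
  rw [h₁.env.n] at key
  have hS : ∀ S ⊆ U, ((range P.n).filter fun v => v ∈ S ∧ cl v = v) = S.filter fun v => cl v = v := by
    intro S hS
    ext v
    simp only [mem_filter, mem_range]
    exact ⟨fun h => h.2, fun h' => ⟨h.lt (hS h'.1), h'⟩⟩
  rw [cnum_eq hMc hr, cnum_eq hMc.compl hr, ← hS _ hMc.1, ← hS _ sdiff_subset]
  exact key

/-- The result of `flow`. -/
def FlowResult (E : ℕ → ℕ → Prop) (cl lab : ℕ → ℕ) (U : Finset ℕ) (K : ℕ) (R : Finset ℕ) (J : ℕ) :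
    Prop :=
  J ≤ K ∧ IsCutOf E cl lab U R J ∨
    K < J ∧ ∀ S, Feasible cl lab U S → K < (bd E U S).card

/-- By uniqueness of the smallest minimum cut, the existential quantifiers in `Query` and `Balanced`
refer to the computed cut. If `flow` found that all feasible cuts exceed `K`, both predicates are
empty and nothing is marked. -/
theorem query_spec (h : Ctx P cl U T σ) (hr : Reps cl U)
    (hf : FlowResult (adj I P.n) cl (σ.a .LAB) U P.K (asSet P.n (σ.a .RE)) (σ.v .J)) :
    let σ' := query.eval I σ
    (∀ v < P.n, σ'.a .QY v ≠ 0 ↔ Query (adj I P.n) cl P.q P.K U (σ.a .LAB) v) ∧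
    ((σ'.v .bal = σ.v .bal ∧ σ'.a .BM = σ.a .BM ∧ ¬ Balanced (adj I P.n) cl P.q P.K U (σ.a .LAB)) ∨
      (σ'.v .bal = 1 ∧ IsBalancedCut (adj I P.n) cl P.q P.K U (asSet P.n (σ'.a .BM)))) := by
  set E := adj I P.n with hE
  set lab := σ.a .LAB with hlab
  simp only [query, eval_block_cons, eval_block_nil]
  set σ₁ := (fill .QY .v .n (.lit 0)).eval I (countSides.eval I σ) with hσ₁
  have F₁ : Frame (.seq countSides (fill .QY .v .n (.lit 0))) σ σ₁ := Loop.frame I _ σ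
  have h₁ := h.frame F₁ rfl rfl
  have a1 : σ₁.a .RE = σ.a .RE := F₁.a rfl
  have a2 : σ₁.v .bal = σ.v .bal := F₁.v rfl
  have a3 : σ₁.a .BM = σ.a .BM := F₁.a rfl
  have a4 : σ₁.v .J = σ.v .J := F₁.v rfl
  have hQ : ∀ v < P.n, σ₁.a .QY v = 0 := by
    intro v hv
    rw [hσ₁, eval_fill .QY .v .n (.lit 0) _ (fun _ => 0) (fun _ _ _ _ _ _ _ => rfl), if_pos]
    rwa [(h.env.eval countSides rfl).n]
  rcases hf with ⟨hJ, hM, hMJ⟩ | ⟨hJ, hno⟩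
  swap
  · have hc : (Exp.lt (.var .K) (.var .J)).eval I σ₁ ≠ 0 := by simp [h₁.env.K, a4, hJ]
    rw [eval_ite, if_pos hc, eval_skip]
    refine ⟨fun v hv => ⟨fun h0 => absurd (hQ v hv) h0, ?_⟩, Or.inl ⟨a2, a3, ?_⟩⟩
    · rintro ⟨M, hM, hMK, -⟩
      have := hno M hM.feasible
      omega
    · rintro ⟨M, hM, hMK, -⟩
      have := hno M hM.feasible
      omega
  · have hc : ¬ (Exp.lt (.var .K) (.var .J)).eval I σ₁ ≠ 0 := by simp [h₁.env.K, a4, hJ]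
    rw [eval_ite, if_neg hc]
    set M := asSet P.n (σ.a .RE) with hMdef
    have hMc := hM.feasible.closed
    obtain ⟨n1, n2⟩ := countSides_spec (I := I) h hr hMdef hMc
    have a5 : σ₁.v .cM = cnum cl M := by
      rw [← n1]
      exact (Loop.frame I (fill .QY .v .n (.lit 0)) (countSides.eval I σ)).v rfl
    have a6 : σ₁.v .cO = cnum cl (U \ M) := by
      rw [← n2]
      exact (Loop.frame I (fill .QY .v .n (.lit 0)) (countSides.eval I σ)).v rfl
    have hmem : ∀ v < P.n, v ∈ M ↔ σ.a .RE v ≠ 0 := fun v hv => by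
      rw [hMdef, mem_asSet]; exact ⟨fun h => h.2, fun h => ⟨hv, h⟩⟩
    have hbal : Balanced E cl P.q P.K U lab ↔ P.q < cnum cl M ∧ P.q < cnum cl (U \ M) := by
      constructor
      · rintro ⟨M', hM', -, h1⟩
        rwa [hM'.unique hM] at h1
      · exact fun h1 => ⟨M, hM, by omega, h1⟩
    have hquery : ∀ v, Query E cl P.q P.K U lab v ↔ (v ∈ side cl P.q U M ∧ cl v = v ∨
        v ∈ U ∧ v ∉ side cl P.q U M ∧ ∃ u ∈ side cl P.q U M, E u v) := by
      intro v
      constructor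
      · rintro ⟨M', hM', -, h1⟩
        rwa [hM'.unique hM] at h1
      · exact fun h1 => ⟨M, hM, by omega, h1⟩
    simp only [eval_block_cons, eval_block_nil]
    set c₂ := Cmd.ite (.and (.lt (.var .q) (.var .cM)) (.lt (.var .q) (.var .cO)))
      (.seq (.set .bal (.lit 1)) (fill .BM .v .n (.and (rd .VP .v) (rd .RE .v)))) .skip with hc₂
    have hb : ((c₂.eval I σ₁).v .bal = σ.v .bal ∧ (c₂.eval I σ₁).a .BM = σ.a .BM ∧
        ¬ Balanced E cl P.q P.K U lab) ∨
        ((c₂.eval I σ₁).v .bal = 1 ∧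
          IsBalancedCut E cl P.q P.K U (asSet P.n ((c₂.eval I σ₁).a .BM))) := by
      have hcond : (Exp.and (.lt (.var .q) (.var .cM)) (.lt (.var .q) (.var .cO))).eval I σ₁ ≠ 0 ↔
          P.q < cnum cl M ∧ P.q < cnum cl (U \ M) := by
        simp only [Exp.eval, a5, a6, h₁.env.q]; simp
      rw [hc₂, eval_ite]
      by_cases hB : P.q < cnum cl M ∧ P.q < cnum cl (U \ M)
      · right
        rw [if_pos (hcond.2 hB), eval_seq]
        set σ₂ := (Cmd.set .bal (.lit 1)).eval I σ₁ with hσ₂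
        have F₂ := Loop.frame I (Cmd.set .bal (.lit 1)) σ₁
        have h₂ := h₁.frame F₂ rfl rfl
        have hset : asSet P.n ((fill .BM .v .n (.and (rd .VP .v) (rd .RE .v))).eval I σ₂ |>.a .BM) =
            M := by
          ext v
          rw [mem_asSet]
          constructor
          · rintro ⟨hv, h0⟩
            rw [eval_fill .BM .v .n (.and (rd .VP .v) (rd .RE .v)) σ₂
              (fun v => if σ₂.a .VP v ≠ 0 ∧ σ₂.a .RE v ≠ 0 then 1 else 0)
              (fun j _ τ e1 _ e2 _ => by
                simp only [Exp.eval, rd, e1, e2 .VP (by decide), e2 .RE (by decide)]),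
              if_pos (by rwa [h₂.env.n])] at h0
            rw [hmem v hv, ← a1]
            by_contra hcon
            rw [if_neg fun hcc => hcc.2 hcon] at h0
            exact h0 rfl
          · intro hv
            have hvn := h.lt (hMc.1 hv)
            refine ⟨hvn, ?_⟩
            rw [eval_fill .BM .v .n (.and (rd .VP .v) (rd .RE .v)) σ₂
              (fun v => if σ₂.a .VP v ≠ 0 ∧ σ₂.a .RE v ≠ 0 then 1 else 0)
              (fun j _ τ e1 _ e2 _ => by
                simp only [Exp.eval, rd, e1, e2 .VP (by decide), e2 .RE (by decide)]),
              if_pos (by rwa [h₂.env.n]), if_pos]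
            · omega
            · refine ⟨(h₂.mem_part hvn).2 (hMc.1 hv), ?_⟩
              show σ₁.a .RE v ≠ 0
              rw [a1, ← hmem v hvn]; exact hv
        rw [hset]
        refine ⟨?_, hMc, by omega, hB.1, hB.2⟩
        rw [(Loop.frame I (fill .BM .v .n (.and (rd .VP .v) (rd .RE .v))) σ₂).v rfl, hσ₂]
        simp
      · left
        rw [if_neg (mt hcond.1 hB), eval_skip]
        exact ⟨a2, a3, fun hc => hB (hbal.1 hc)⟩
    set σ₂ := (Cmd.set .e (.lt (.var .q) (.var .cM))).eval I (c₂.eval I σ₁) with hσ₂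
    have F₂ : Frame (.seq c₂ (.set .e (.lt (.var .q) (.var .cM)))) σ₁ σ₂ := Loop.frame I _ σ₁
    have h₂ := h₁.frame F₂ rfl rfl
    have he : σ₂.v .e = if P.q < cnum cl M then 1 else 0 := by
      have e1 : (c₂.eval I σ₁).v .q = P.q := (h₁.env.eval c₂ rfl).q
      have e2 : (c₂.eval I σ₁).v .cM = cnum cl M := ((Loop.frame I c₂ σ₁).v rfl).trans a5
      rw [hσ₂, eval_set, St.setV_v, if_pos rfl, Exp.eval, Exp.eval, Exp.eval, e1, e2]
    have b1 : σ₂.a .RE = σ.a .RE := (F₂.a rfl).trans a1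
    have b2 : σ₂.a .QY = σ₁.a .QY := F₂.a rfl
    have hside : ∀ (x : Var) (τ : St), τ.v .e = σ₂.v .e → τ.a .RE = σ₂.a .RE → τ.v x < P.n →
        τ.v x ∈ U → ((inSide x).eval I τ ≠ 0 ↔ τ.v x ∈ side cl P.q U M) := by
      intro x τ e1 e2 hxn hxU
      simp only [inSide, Exp.eval, rd, e1, he, e2, b1, side]
      have := hmem _ hxn
      by_cases hq : P.q < cnum cl M
      · rw [if_pos hq, if_neg (show ¬ cnum cl M ≤ P.q by omega), mem_sdiff, this]
        simp [hxU]
      · rw [if_neg hq, if_pos (show cnum cl M ≤ P.q by omega), this]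
        simp
    set c₃ := Cmd.loop .v .n (.ite (.and (rd .VP .v) (inSide .v))
      (.put .QY (.var .v) (.eq (rd .CL .v) (.var .v))) .skip) with hc₃
    have F₃ := Loop.frame I c₃ σ₂
    have key₃ := loop_rule I (x := .v) (b := .n) (p := .ite (.and (rd .VP .v) (inSide .v))
      (.put .QY (.var .v) (.eq (rd .CL .v) (.var .v))) .skip) σ₂
      (fun m τ => ∀ v < P.n, τ.a .QY v ≠ 0 ↔ v < m ∧ v ∈ side cl P.q U M ∧ cl v = v)
      (fun v hv => by rw [b2]; simp [hQ v hv]) (by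
        intro m hm τ hF hI
        rw [h₂.env.n] at hm
        have hτ := h₂.frame hF rfl rfl
        set τ' := τ.setV .v m with hτ'
        have e1 : τ'.v .v = m := by simp [hτ']
        have hc : (Exp.and (rd .VP .v) (inSide .v)).eval I τ' ≠ 0 ↔ m ∈ side cl P.q U M := by
          by_cases hmU : m ∈ U
          · have e2 := hside .v τ' (hF.v rfl) (hF.a rfl) (by omega) (by rw [e1]; exact hmU)
            rw [e1] at e2
            rw [← e2, Exp.eval]
            have := (hτ.mem_part hm).2 hmU
            simp [e1, this]
          · have := mt (hτ.mem_part hm).1 hmU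
            have e3 : m ∉ side cl P.q U M := fun h => hmU ((side_closed hMc).1 h)
            rw [Exp.eval]
            rw [not_not] at this
            simp [e1, this, e3]
        rw [eval_ite]
        intro v hv
        by_cases hc' : m ∈ side cl P.q U M
        · rw [if_pos (hc.2 hc')]
          simp only [eval_put, St.setA_a, Exp.eval, e1, rd, hτ.cls, true_and]
          by_cases hvm : v = m
          · subst hvm; simp [hc']
          · rw [if_neg hvm]
            refine (hI v hv).trans (and_congr_left fun _ => ?_)
            omega
        · rw [if_neg (mt hc.1 hc'), eval_skip]
          refine (hI v hv).trans (and_congr_left fun hh => ?_)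
          have : v ≠ m := by rintro rfl; exact hc' hh.1
          omega)
    rw [← hc₃, h₂.env.n] at key₃
    set σ₃ := c₃.eval I σ₂
    have h₃ := h₂.frame F₃ rfl rfl
    set c₄ := Cmd.loop .u .n (.loop .v .n (.ite
      (.and (.and (rd .VP .u) (rd .VP .v)) (.and (.and (inSide .u) (.eq (inSide .v) (.lit 0))) (adjE .u .v)))
      (.put .QY (.var .v) (.lit 1)) .skip)) with hc₄
    have F₄ := Loop.frame I c₄ σ₃
    have key₄ := loop_rule2 (I := I) σ₃ P.n h₃.env.n (x := .u) (y := .v) (p := .ite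
      (.and (.and (rd .VP .u) (rd .VP .v)) (.and (.and (inSide .u) (.eq (inSide .v) (.lit 0))) (adjE .u .v)))
      (.put .QY (.var .v) (.lit 1)) .skip) rfl rfl
      (fun i j τ => ∀ v < P.n, τ.a .QY v ≠ 0 ↔ (v ∈ side cl P.q U M ∧ cl v = v) ∨
        v ∈ U ∧ v ∉ side cl P.q U M ∧ ∃ u ∈ side cl P.q U M, E u v ∧ (u < i ∨ u = i ∧ v < j))
      (fun v hv => by
        rw [key₃ v hv]
        simp [hv])
      (fun i j τ c h => h) (fun i j τ c h => h)
      (fun i hi τ h v hv => by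
        rw [h v hv]
        refine or_congr_right (and_congr_right fun _ => and_congr_right fun _ => exists_congr fun u =>
          and_congr_right fun _ => and_congr_right fun _ => ?_)
        omega)
      (by
        intro i hi j hj τ hF hu hv hI
        have hτ := h₃.frame hF rfl rfl
        have hc : (Exp.and (.and (rd .VP .u) (rd .VP .v))
            (.and (.and (inSide .u) (.eq (inSide .v) (.lit 0))) (adjE .u .v))).eval I τ ≠ 0 ↔
            i ∈ side cl P.q U M ∧ j ∈ U ∧ j ∉ side cl P.q U M ∧ E i j := by
          have m1 := hτ.mem_part hi
          have m2 := hτ.mem_part hj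
          have m3 := hτ.env.adj (I := I) (x := .u) (y := .v) (by omega) (by omega)
          rw [hu, hv] at m3
          have g1 : τ.v .e = σ₂.v .e := (hF.v rfl).trans (F₃.v rfl)
          have g2 : τ.a .RE = σ₂.a .RE := (hF.a rfl).trans (F₃.a rfl)
          have m4 : i ∈ U → _ := fun hiU => hside .u τ g1 g2 (by omega) (by rw [hu]; exact hiU)
          have m5 : j ∈ U → _ := fun hjU => hside .v τ g1 g2 (by omega) (by rw [hv]; exact hjU)
          rw [hu] at m4
          rw [hv] at m5
          have m6 : i ∈ side cl P.q U M → i ∈ U := fun h => (side_closed hMc).1 h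
          rw [Exp.eval, Exp.eval, Exp.eval, Exp.eval, Exp.eval]
          rw [← hE] at m3
          generalize (inSide .u).eval I τ = a at *
          generalize (inSide .v).eval I τ = b at *
          generalize (adjE .u .v).eval I τ = c at *
          have r1 : (rd .VP .u).eval I τ = τ.a .VP i := by simp [hu]
          have r2 : (rd .VP .v).eval I τ = τ.a .VP j := by simp [hv]
          rw [r1, r2]
          generalize τ.a .VP i = d at *
          generalize τ.a .VP j = f at *
          rw [← m3]
          constructor
          · intro hh
            have hd : d ≠ 0 := by rintro rfl; simp at hh
            have hf : f ≠ 0 := by rintro rfl; simp at hh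
            have hb : b = 0 := by by_contra hb; simp [hb] at hh
            have ha : a ≠ 0 := by rintro rfl; simp at hh
            have hc : c ≠ 0 := by rintro rfl; simp at hh
            exact ⟨(m4 (m1.1 hd)).1 ha, m2.1 hf, fun h => (m5 (m2.1 hf)).2 h hb, hc⟩
          · rintro ⟨g1, g2, g3, g4⟩
            have hd := m1.2 (m6 g1)
            have hf := m2.2 g2
            have ha := (m4 (m6 g1)).2 g1
            have hb : b = 0 := by by_contra hb; exact g3 ((m5 g2).1 hb)
            simp [hd, hf, ha, hb, g4]
        rw [eval_ite]
        intro v' hv'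
        by_cases hc' : i ∈ side cl P.q U M ∧ j ∈ U ∧ j ∉ side cl P.q U M ∧ E i j
        · rw [if_pos (hc.2 hc')]
          simp only [eval_put, St.setA_a, Exp.eval, hv, true_and]
          by_cases hvm : v' = j
          · subst hvm
            rw [if_pos rfl]
            simp only [ne_eq, one_ne_zero, not_false_eq_true, true_iff]
            exact Or.inr ⟨hc'.2.1, hc'.2.2.1, i, hc'.1, hc'.2.2.2, Or.inr ⟨rfl, by omega⟩⟩
          · rw [if_neg hvm, hI v' hv']
            refine or_congr_right (and_congr_right fun _ => and_congr_right fun _ =>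
              exists_congr fun u => and_congr_right fun _ => and_congr_right fun _ => ?_)
            omega
        · rw [if_neg (mt hc.1 hc'), eval_skip, hI v' hv']
          refine or_congr_right (and_congr_right fun g1 => and_congr_right fun g2 =>
            exists_congr fun u => and_congr_right fun g3 => and_congr_right fun g4 => ?_)
          have : ¬ (u = i ∧ v' = j) := by rintro ⟨rfl, rfl⟩; exact hc' ⟨g3, g1, g2, g4⟩
          omega)
    rw [← hc₄] at key₄
    refine ⟨fun v hv => ?_, ?_⟩
    · rw [key₄ v hv, hquery]
      refine or_congr_right (and_congr_right fun _ => and_congr_right fun _ =>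
          exists_congr fun u => and_congr_right fun hu => ?_)
      have := h.lt ((side_closed hMc).1 hu)
      exact ⟨fun h => h.1, fun h => ⟨h, Or.inl this⟩⟩
    · have e1 : (c₄.eval I σ₃).v .bal = (c₂.eval I σ₁).v .bal :=
        (F₄.v rfl).trans ((F₃.v rfl).trans (by simp [hσ₂]))
      have e2 : (c₄.eval I σ₃).a .BM = (c₂.eval I σ₁).a .BM :=
        (F₄.a rfl).trans ((F₃.a rfl).trans (by simp [hσ₂]))
      rw [e1, e2]
      exact hb

end Loop

/-! ### Numbers that encode cuts -/

/-- The number with the binary digits `l`. -/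
def bits (l : List ℕ) : ℕ := l.foldl (fun s b => s + s + b) 0

theorem bits_append (l : List ℕ) (b : ℕ) : bits (l ++ [b]) = bits l + bits l + b := by
  simp [bits]

theorem bits_lt (l : List ℕ) (h : ∀ b ∈ l, b ≤ 1) : bits l < 2 ^ l.length := by
  induction l using List.reverseRecOn with
  | nil => simp [bits]
  | append_singleton l b ih =>
    have h1 := ih fun b hb => h b (by simp [hb])
    have h2 := h b (by simp)
    rw [bits_append, List.length_append, List.length_singleton, pow_succ]
    omega

theorem bits_inj {l l' : List ℕ} (hl : l.length = l'.length) (h : ∀ b ∈ l, b ≤ 1)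
    (h' : ∀ b ∈ l', b ≤ 1) (e : bits l = bits l') : l = l' := by
  induction l using List.reverseRecOn generalizing l' with
  | nil => exact (List.length_eq_zero_iff.1 hl.symm).symm
  | append_singleton l b ih =>
    induction l' using List.reverseRecOn with
    | nil => simp at hl
    | append_singleton l' b' _ =>
      have h2 := h b (by simp)
      have h3 := h' b' (by simp)
      rw [bits_append, bits_append] at e
      rw [ih (by simpa using hl) (fun b hb => h b (by simp [hb])) (fun b hb => h' b (by simp [hb]))
        (by omega), show b = b' by omega]

theorem flatMap_inj {α β : Type*} {f g : α → List β} {l : List α}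
    (hl : ∀ u, (f u).length = (g u).length) (h : l.flatMap f = l.flatMap g) :
    ∀ u ∈ l, f u = g u := by
  induction l with
  | nil => simp
  | cons a l ih =>
    rw [List.flatMap_cons, List.flatMap_cons] at h
    obtain ⟨h1, h2⟩ := List.append_inj h (hl a)
    intro u hu
    rcases List.mem_cons.1 hu with rfl | hu
    · exact h1
    · exact ih h2 u hu

/-! ### Signatures of cuts and the cuts kept in the codes -/

namespace Cut

open Finset

open Classical in
/-- The elements of `T` below `m`, in increasing order. -/
noncomputable def elems (T : Finset ℕ) (m : ℕ) : List ℕ := (List.range m).filter (· ∈ T)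

theorem mem_elems {T : Finset ℕ} {m v : ℕ} : v ∈ elems T m ↔ v < m ∧ v ∈ T := by
  simp [elems]

theorem elems_succ (T : Finset ℕ) (m : ℕ) :
    elems T (m + 1) = if m ∈ T then elems T m ++ [m] else elems T m := by
  classical
  rw [elems, List.range_succ, List.filter_append]
  by_cases h : m ∈ T
  · rw [if_pos h, List.filter_cons_of_pos (by simpa using h)]; rfl
  · rw [if_neg h, List.filter_cons_of_neg (by simpa using h)]; simp [elems]

theorem length_elems_le (T : Finset ℕ) (m : ℕ) : (elems T m).length ≤ T.card := by
  classical
  have hnd : (elems T m).Nodup := List.Nodup.filter _ List.nodup_range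
  rw [← List.toFinset_card_of_nodup hnd]
  exact card_le_card fun v hv => (mem_elems.1 (List.mem_toFinset.1 hv)).2

variable (E : ℕ → ℕ → Prop) (n k : ℕ) (U T Y : Finset ℕ)

open Classical in
/-- What the cut `Y` of `U` looks like from the terminals. -/
noncomputable def connBits (m u : ℕ) : List ℕ :=
  (elems T m).map fun v => if Relation.EqvGen (CutRel E U Y) u v then 1 else 0

open Classical in
noncomputable def traceBits (m : ℕ) : List ℕ :=
  (elems T m).flatMap fun u => (if u ∈ Y then 1 else 0) :: connBits E U T Y n u

/-- The rank in unary with `k` digits; it is faithful for ranks up to `k`. -/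
noncomputable def rankBits (m : ℕ) : List ℕ :=
  (List.range m).map fun i => if i < rk n (CutRel E U Y) then 1 else 0

/-- A number that encodes the trace of `Y` on `T`, the connectivity of `T` and the rank. -/
noncomputable def sig : ℕ := bits (traceBits E n U T Y n ++ rankBits E n U Y k)

variable {E n k U T Y}

theorem bit_le {l : List ℕ} (hl : l = traceBits E n U T Y n ++ rankBits E n U Y k) :
    ∀ b ∈ l, b ≤ 1 := by
  classical
  subst hl
  intro b hb
  rw [List.mem_append] at hb
  rcases hb with hb | hb
  · obtain ⟨u, -, hb⟩ := List.mem_flatMap.1 hb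
    rcases List.mem_cons.1 hb with rfl | hb
    · split_ifs <;> omega
    · obtain ⟨v, -, rfl⟩ := List.mem_map.1 hb
      split_ifs <;> omega
  · obtain ⟨v, -, rfl⟩ := List.mem_map.1 hb
    split_ifs <;> omega

theorem length_traceBits (m : ℕ) :
    (traceBits E n U T Y m).length = (elems T m).length * ((elems T n).length + 1) := by
  rw [traceBits, List.length_flatMap]
  simp [connBits]

/-- Each terminal contributes one digit for its side and one for its connection to every terminal,
and the rank contributes `k` digits. -/
theorem sig_lt {tau : ℕ} (h : T.card ≤ tau) : sig E n k U T Y < 2 ^ (tau + k + tau * tau) := by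
  refine (bits_lt _ (bit_le rfl)).trans_le (Nat.pow_le_pow_right (by omega) ?_)
  rw [List.length_append, length_traceBits, rankBits, List.length_map, List.length_range]
  have := (length_elems_le T n).trans h
  nlinarith [Nat.mul_le_mul this this]

/-- Both digit strings have the same block structure, determined by `T`, so equal numbers mean equal
blocks: membership, connectivity and, for ranks at most `k`, the rank. -/
theorem sameSig_of_sig_eq {Y' : Finset ℕ} (hTn : T ⊆ range n)
    (h : sig E n k U T Y = sig E n k U T Y')
    (hk : rk n (CutRel E U Y) ≤ k) (hk' : rk n (CutRel E U Y') ≤ k) : SameSig E n U T Y Y' := by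
  classical
  have h0 := bits_inj (by
    simp only [List.length_append, length_traceBits, rankBits, List.length_map]) (bit_le rfl)
    (bit_le rfl) h
  obtain ⟨h1, h2⟩ := List.append_inj h0 (by simp only [length_traceBits])
  have h3 := flatMap_inj (by simp [connBits]) h1
  have hmem : ∀ {u}, u ∈ T → u ∈ elems T n := fun hu => mem_elems.2 ⟨mem_range.1 (hTn hu), hu⟩
  refine ⟨fun {u} hu => ?_, fun {u v} hu hv => ?_, ?_⟩
  · have h4 := (List.cons.inj (h3 u (hmem hu))).1
    by_cases a : u ∈ Y <;> by_cases b : u ∈ Y' <;> simp [a, b] at h4 ⊢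
  · have h4 := (List.cons.inj (h3 u (hmem hu))).2
    have h5 := List.map_inj_left.1 h4 v (hmem hv)
    by_cases a : Relation.EqvGen (CutRel E U Y) u v <;>
      by_cases b : Relation.EqvGen (CutRel E U Y') u v <;> simp [a, b] at h5 ⊢
  · have h4 := List.map_inj_left.1 h2
    by_contra hne
    rcases lt_or_gt_of_ne hne with hlt | hlt
    · have := h4 _ (List.mem_range.2 (hlt.trans_le hk'))
      simp [hlt] at this
    · have := h4 _ (List.mem_range.2 (hlt.trans_le hk))
      simp [hlt] at this

/-- The cuts `ys` have been recorded in the codes `NC`. -/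
structure Kept (E : ℕ → ℕ → Prop) (n k B : ℕ) (U T : Finset ℕ) (stamp : ℕ) (SEEN NC : ℕ → ℕ)
    (ys : List (Finset ℕ)) : Prop where
  old (s : ℕ) : SEEN s ≤ stamp
  seen {s : ℕ} (h : SEEN s = stamp) :
    ∃ Y ∈ ys, Y ⊆ U ∧ rk n (CutRel E U Y) ≤ k ∧ sig E n k U T Y = s
  code {u v : ℕ} (hu : u ∈ U) (hv : v ∈ U) (h : NC u = NC v) {Y : Finset ℕ} (hY : Y ∈ ys) :
    u ∈ Y ↔ v ∈ Y
  lt {v : ℕ} (hv : v ∈ U) : NC v < 2 ^ ys.length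
  length : ys.length ≤ ((range B).filter fun s => SEEN s = stamp).card

/-- Doubling the codes and adding the membership in `Y` appends one binary digit, so equal codes
mean equal membership in all kept cuts. The new cut stamps a new signature, so the number of kept
cuts stays bounded by the number of signatures. -/
theorem Kept.cons {B stamp s : ℕ} {SEEN NC NC' : ℕ → ℕ} {ys : List (Finset ℕ)}
    (h : Kept E n k B U T stamp SEEN NC ys) (hY : Y ⊆ U) (hk : rk n (CutRel E U Y) ≤ k)
    (hs : sig E n k U T Y = s) (hB : s < B) (hnew : SEEN s ≠ stamp)
    (hNC : ∀ v ∈ U, ∃ b, b ≤ 1 ∧ (b = 1 ↔ v ∈ Y) ∧ NC' v = NC v + NC v + b) :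
    Kept E n k B U T stamp (Function.update SEEN s stamp) NC' (Y :: ys) := by
  refine ⟨fun s' => ?_, fun {s'} h' => ?_, fun {u v} hu hv h' {Z} hZ => ?_, fun {v} hv => ?_, ?_⟩
  · rw [Function.update_apply]; split_ifs
    · exact le_rfl
    · exact h.old s'
  · by_cases e : s' = s
    · subst e; exact ⟨Y, List.mem_cons_self, hY, hk, hs⟩
    · rw [Function.update_of_ne e] at h'
      obtain ⟨Z, hZ, h1⟩ := h.seen h'
      exact ⟨Z, List.mem_cons_of_mem _ hZ, h1⟩
  · obtain ⟨b, b1, b2, b3⟩ := hNC u hu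
    obtain ⟨c, c1, c2, c3⟩ := hNC v hv
    rcases List.mem_cons.1 hZ with rfl | hZ
    · rw [← b2, ← c2]; omega
    · exact h.code hu hv (by omega) hZ
  · obtain ⟨b, b1, b2, b3⟩ := hNC v hv
    have := h.lt hv
    rw [List.length_cons, pow_succ]; omega
  · have : ((range B).filter fun s' => Function.update SEEN s stamp s' = stamp) =
        insert s ((range B).filter fun s' => SEEN s' = stamp) := by
      ext s'
      simp only [mem_filter, mem_insert, mem_range, Function.update_apply]
      by_cases e : s' = s
      · subst e; simp [hB]
      · simp [e]
    rw [this, card_insert_of_notMem (by simp [hnew]), List.length_cons]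
    have := h.length
    omega

end Cut

/-! ### Recording one cut per signature -/

namespace Loop

open Cut Finset

variable {I : ℕ → ℕ} {P : Pars} {σ τ : St} {cl : ℕ → ℕ} {U T : Finset ℕ}

theorem signature_spec (h : Ctx P cl U T σ) (hTU : T ⊆ U) {Y : Finset ℕ}
    (hY : Y = U ∩ asSet P.n (σ.a .RE)) (hrk : σ.v .rk = rk P.n (CutRel (adj I P.n) U Y))
    (hl : Labels P.n (CutRel (adj I P.n) U Y) (σ.a .CC)) :
    (signature.eval I σ).v .s = sig (adj I P.n) P.n P.k U T Y := by
  classical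
  simp only [signature, eval_block_cons, eval_block_nil]
  set E := adj I P.n
  set σ₁ := (Cmd.set .s (.lit 0)).eval I σ with hσ₁
  have F₁ := Loop.frame I (Cmd.set .s (.lit 0)) σ
  have h₁ := h.frame F₁ rfl rfl
  have inner := fun (σ' : St) (l : List ℕ) (u : ℕ) (h' : Ctx P cl U T σ') (hu : σ'.v .u = u)
      (hun : u < P.n) (hCC : σ'.a .CC = σ.a .CC) (hs : σ'.v .s = bits l) => loop_rule I (x := .v) (b := .n)
      (p := .ite (rd .TP .v) (.set .s (.var .s + .var .s + .eq (rd .CC .u) (rd .CC .v))) .skip) σ'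
    (fun m τ => τ.v .s = bits (l ++ connBits E U T Y m u)) (by simp [hs, connBits, elems]) (by
      intro m hm τ hF hI
      rw [h'.env.n] at hm
      have hτ := h'.frame hF rfl rfl
      have e1 := hτ.mem_term hm
      have e2 : (τ.setV .v m).a .CC = σ.a .CC := (hF.a rfl).trans hCC
      have e3 : (τ.setV .v m).v .u = u := (hF.v rfl).trans hu
      have hc : (rd .TP .v).eval I (τ.setV .v m) ≠ 0 ↔ m ∈ T := by rw [← e1]; simp
      rw [eval_ite, connBits, elems_succ]
      by_cases hm' : m ∈ T
      · rw [if_pos (hc.2 hm'), if_pos hm', List.map_append, ← List.append_assoc, List.map_singleton,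
          bits_append]
        have e4 := hl u hun m hm
        rw [eval_set, St.setV_v, if_pos rfl]
        simp only [eval_add, Exp.eval, rd, e2, e3]
        simp only [St.setV_v, if_true, reduceCtorEq, if_false, hI, e4, connBits]
      · rw [if_neg (mt hc.1 hm'), if_neg hm', eval_skip]
        simpa [connBits] using hI)
  set c₂ := Cmd.loop .u .n (.ite (rd .TP .u) (.seq (.set .s (.var .s + .var .s + .lt (.lit 0) (rd .RE .u)))
    (.loop .v .n (.ite (rd .TP .v)
      (.set .s (.var .s + .var .s + .eq (rd .CC .u) (rd .CC .v))) .skip))) .skip) with hc₂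
  have key := loop_rule I (x := .u) (b := .n) (p := .ite (rd .TP .u)
    (.seq (.set .s (.var .s + .var .s + .lt (.lit 0) (rd .RE .u)))
    (.loop .v .n (.ite (rd .TP .v)
      (.set .s (.var .s + .var .s + .eq (rd .CC .u) (rd .CC .v))) .skip))) .skip) σ₁
    (fun m τ => τ.v .s = bits (traceBits E P.n U T Y m)) (by simp [hσ₁, traceBits, elems, bits]) (by
      intro m hm τ hF hI
      rw [h₁.env.n] at hm
      have hτ := h₁.frame hF rfl rfl
      have e1 := hτ.mem_term hm
      have e2 : (τ.setV .u m).a .RE = σ.a .RE := (hF.a rfl).trans (F₁.a rfl)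
      have e4 : (τ.setV .u m).a .CC = σ.a .CC := (hF.a rfl).trans (F₁.a rfl)
      have hc : (rd .TP .u).eval I (τ.setV .u m) ≠ 0 ↔ m ∈ T := by rw [← e1]; simp
      rw [eval_ite, traceBits, elems_succ]
      by_cases hm' : m ∈ T
      · rw [if_pos (hc.2 hm'), if_pos hm', List.flatMap_append, List.flatMap_singleton, eval_seq]
        set τ' := (Cmd.set .s (.var .s + .var .s + .lt (.lit 0) (rd .RE .u))).eval I (τ.setV .u m)
          with hτ'
        have F' := Loop.frame I (Cmd.set .s (.var .s + .var .s + .lt (.lit 0) (rd .RE .u)))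
          (τ.setV .u m)
        have hmY : m ∈ Y ↔ 0 < σ.a .RE m := by
          rw [hY, mem_inter, mem_asSet, Nat.pos_iff_ne_zero]
          exact ⟨fun h => h.2.2, fun h => ⟨hTU hm', hm, h⟩⟩
        have := inner τ' (traceBits E P.n U T Y m ++ [if m ∈ Y then 1 else 0]) m
          (hτ.frame F' rfl rfl) ((F'.v rfl).trans (by simp)) hm ((F'.a rfl).trans e4) (by
            rw [bits_append, hτ', eval_set, St.setV_v, if_pos rfl]
            simp only [eval_add, Exp.eval, rd, e2]
            simp only [St.setV_v, if_true, reduceCtorEq, if_false, hI, hmY])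
        rw [(hτ.frame F' rfl rfl).env.n] at this
        rw [this]
        simp [traceBits]
      · rw [if_neg (mt hc.1 hm'), if_neg hm', eval_skip]
        simpa [traceBits] using hI)
  rw [← hc₂, h₁.env.n] at key
  have F₂ := Loop.frame I c₂ σ₁
  have e1 : (c₂.eval I σ₁).v .rk = σ.v .rk := (F₂.v rfl).trans (F₁.v rfl)
  have key₂ := loop_rule I (x := .i) (b := .k)
    (p := .set .s (.var .s + .var .s + .lt (.var .i) (.var .rk))) (c₂.eval I σ₁)
    (fun m τ => τ.v .s = bits (traceBits E P.n U T Y P.n ++ rankBits E P.n U Y m))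
    (by simpa [rankBits] using key) (by
      intro m hm τ hF hI
      have e2 : (τ.setV .i m).v .rk = rk P.n (CutRel E U Y) := (hF.v rfl).trans (e1.trans hrk)
      rw [rankBits, List.range_succ, List.map_append, ← List.append_assoc, List.map_singleton,
        bits_append, eval_set, St.setV_v, if_pos rfl]
      simp only [eval_add, Exp.eval, e2]
      simp only [St.setV_v, if_true, reduceCtorEq, if_false, hI, rankBits])
  rw [(h₁.frame F₂ rfl rfl).env.k] at key₂
  exact key₂

/-- Any subset of `U` of rank at most `k` may be recorded. In the end the signature of `Y` is
stamped, whether by `Y` now or by an earlier cut, which serves equally well. -/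
theorem record_spec (h : Ctx P cl U T σ) (hTU : T ⊆ U) (hT : T.card ≤ P.tau) {Y : Finset ℕ}
    (hY : Y = U ∩ asSet P.n (σ.a .RE)) {stamp : ℕ} (hst : σ.v .stamp = stamp)
    {ys : List (Finset ℕ)} (hk : Kept (adj I P.n) P.n P.k (2 ^ (P.tau + P.k + P.tau * P.tau)) U T
      stamp (σ.a .SEEN) (σ.a .NC) ys) :
    let σ' := record.eval I σ
    (∃ ys', Kept (adj I P.n) P.n P.k (2 ^ (P.tau + P.k + P.tau * P.tau)) U T
      stamp (σ'.a .SEEN) (σ'.a .NC) ys') ∧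
    (∀ s, σ.a .SEEN s = stamp → σ'.a .SEEN s = stamp) ∧
    (rk P.n (CutRel (adj I P.n) U Y) ≤ P.k →
      σ'.a .SEEN (sig (adj I P.n) P.n P.k U T Y) = stamp) := by
  simp only [record, eval_seq]
  obtain ⟨r1, r2⟩ := rank_spec (I := I) h.env U Y h.part hY
  have F₁ := Loop.frame I rank σ
  set σ₁ := rank.eval I σ
  have h₁ := h.frame F₁ rfl rfl
  have a1 : σ₁.a .SEEN = σ.a .SEEN := F₁.a rfl
  have a2 : σ₁.a .NC = σ.a .NC := F₁.a rfl
  have a3 : σ₁.a .RE = σ.a .RE := F₁.a rfl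
  have a4 : σ₁.v .stamp = stamp := (F₁.v rfl).trans hst
  have hc : (Exp.lt (.var .k) (.var .rk)).eval I σ₁ ≠ 0 ↔
      P.k < rk P.n (CutRel (adj I P.n) U Y) := by
    simp only [Exp.eval, h₁.env.k, r1]; simp
  rw [eval_ite]
  by_cases hlt : P.k < rk P.n (CutRel (adj I P.n) U Y)
  · rw [if_pos (hc.2 hlt), eval_skip, a1, a2]
    exact ⟨⟨ys, hk⟩, fun s hs => hs, fun h => by omega⟩
  rw [if_neg (mt hc.1 hlt), eval_seq]
  have hs := signature_spec h₁ hTU (by rw [a3]; exact hY) r1 r2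
  have F₂ := Loop.frame I signature σ₁
  set σ₂ := signature.eval I σ₁
  have h₂ := h₁.frame F₂ rfl rfl
  have b1 : σ₂.a .SEEN = σ.a .SEEN := (F₂.a rfl).trans a1
  have b2 : σ₂.a .NC = σ.a .NC := (F₂.a rfl).trans a2
  have b3 : σ₂.a .RE = σ.a .RE := (F₂.a rfl).trans a3
  have b4 : σ₂.v .stamp = stamp := (F₂.v rfl).trans a4
  set s := sig (adj I P.n) P.n P.k U T Y with hs'
  have hc : (Exp.eq (rd .SEEN .s) (.var .stamp)).eval I σ₂ ≠ 0 ↔ σ.a .SEEN s = stamp := by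
    simp only [Exp.eval, rd, b1, hs, b4]; simp
  rw [eval_ite]
  by_cases hseen : σ.a .SEEN s = stamp
  · rw [if_pos (hc.2 hseen), eval_skip, b1, b2]
    exact ⟨⟨ys, hk⟩, fun s hs => hs, fun _ => hseen⟩
  rw [if_neg (mt hc.1 hseen), eval_seq]
  set σ₃ := (Cmd.put .SEEN (.var .s) (.var .stamp)).eval I σ₂ with hσ₃
  have F₃ := Loop.frame I (Cmd.put .SEEN (.var .s) (.var .stamp)) σ₂
  have h₃ := h₂.frame F₃ rfl rfl
  have c1 : σ₃.a .SEEN = Function.update (σ.a .SEEN) s stamp := by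
    funext i
    rw [hσ₃, eval_put, St.setA_a, b1, Function.update_apply]
    simp [hs, b4]
  have c2 : σ₃.a .NC = σ.a .NC := (F₃.a rfl).trans b2
  have c3 : σ₃.a .RE = σ.a .RE := (F₃.a rfl).trans b3
  set c := Cmd.loop .v .n (.put .NC (.var .v) (rd .NC .v + rd .NC .v + .lt (.lit 0) (rd .RE .v)))
    with hcdef
  have e1 : (c.eval I σ₃).a .SEEN = σ₃.a .SEEN := (Loop.frame I c σ₃).a rfl
  rw [e1, c1]
  refine ⟨⟨Y :: ys, hk.cons (by rw [hY]; exact inter_subset_left) (by omega) rfl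
    (sig_lt hT) hseen fun v hv => ?_⟩, fun s' hs' => ?_, fun _ => ?_⟩
  · have hvn := h.lt hv
    refine ⟨if 0 < σ.a .RE v then 1 else 0, by split_ifs <;> omega, ?_, ?_⟩
    · rw [hY, mem_inter, mem_asSet]
      by_cases h0 : 0 < σ.a .RE v
      · simp [h0, hv, hvn, Nat.pos_iff_ne_zero.1 h0]
      · rw [not_lt, Nat.le_zero] at h0
        simp [h0]
    · have := eval_fill (I := I) .NC .v .n (rd .NC .v + rd .NC .v + .lt (.lit 0) (rd .RE .v)) σ₃
        (fun v => σ.a .NC v + σ.a .NC v + if 0 < σ.a .RE v then 1 else 0)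
        (fun j _ τ e1 _ e2 e3 => by
          simp only [eval_add, Exp.eval, rd, e1, e2 .RE (by decide), e3 j le_rfl, c2, c3]) v
      rw [if_pos (by rw [h₃.env.n]; exact hvn)] at this
      exact this
  · rw [Function.update_apply]; split_ifs
    · rfl
    · exact hs'
  · rw [Function.update_self]

theorem flow_spec' (h : Ctx P cl U T σ) (hE : ∀ u v, adj I P.n u v → adj I P.n v u) :
    let σ' := flow.eval I σ
    FlowResult (adj I P.n) cl (σ.a .LAB) U P.K (asSet P.n (σ'.a .RE)) (σ'.v .J) := by
  have := flow_spec (I := I) h.env hE h.part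
  rw [h.cls] at this
  exact this

/-- The state of the search for a balanced cut. -/
def BalState (E : ℕ → ℕ → Prop) (cl : ℕ → ℕ) (q K n : ℕ) (U : Finset ℕ) (σ σ' : St) (C : Prop) : Prop :=
  (σ'.v .bal = σ.v .bal ∧ σ'.a .BM = σ.a .BM ∧ C) ∨
    (σ'.v .bal = 1 ∧ IsBalancedCut E cl q K U (asSet n (σ'.a .BM)))

/-- The labels of the program follow `rounds` for the digits in `G`. If the labels after the last
round have `X` as smallest minimum cut of value at most `K`, the final `flow` computes `X` by
uniqueness. For all other guesses the recorded cut is arbitrary and harmless. -/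
theorem guessRun_spec (h : Ctx P cl U T σ) (hE : ∀ u v, adj I P.n u v → adj I P.n v u)
    (hr : Reps cl U) (hcl : ∀ v < P.n, cl v < P.n) (hTU : T ⊆ U) (hT : T.card ≤ P.tau)
    {stamp : ℕ} (hst : σ.v .stamp = stamp)
    {ys : List (Finset ℕ)} (hk : Kept (adj I P.n) P.n P.k (2 ^ (P.tau + P.k + P.tau * P.tau)) U T
      stamp (σ.a .SEEN) (σ.a .NC) ys) :
    let σ' := guessRun.eval I σ
    let s := rounds (adj I P.n) cl P.q P.K P.n U T (σ.a .G)
    Ctx P cl U T σ' ∧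
    BalState (adj I P.n) cl P.q P.K P.n U σ σ'
      (∀ d < P.D, ¬ Balanced (adj I P.n) cl P.q P.K U (s d).1) ∧
    (∃ ys', Kept (adj I P.n) P.n P.k (2 ^ (P.tau + P.k + P.tau * P.tau)) U T
      stamp (σ'.a .SEEN) (σ'.a .NC) ys') ∧
    (∀ s, σ.a .SEEN s = stamp → σ'.a .SEEN s = stamp) ∧
    ∀ X, IsMinCut (adj I P.n) cl (s P.D).1 U X → (bd (adj I P.n) U X).card ≤ P.K →
      rk P.n (CutRel (adj I P.n) U X) ≤ P.k →
      σ'.a .SEEN (sig (adj I P.n) P.n P.k U T X) = stamp := by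
  intro σ' s
  set E := adj I P.n
  have hσ' : σ' = guessRun.eval I σ := rfl
  clear_value σ'
  simp only [guessRun, eval_block_cons, eval_block_nil] at hσ'
  set σ₁ := (fill .QY .v .n (rd .TP .v)).eval I ((fill .LAB .v .n (.lit 0)).eval I
    ((Cmd.set .gp (.lit 0)).eval I σ)) with hσ₁
  have F₁ : Frame (.seq (.seq (.set .gp (.lit 0)) (fill .LAB .v .n (.lit 0)))
    (fill .QY .v .n (rd .TP .v))) σ σ₁ := Loop.frame I _ σ
  -- `fill` clears only the cells below `n`; the field `clean` of `Ctx` supplies the others, as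
  -- `rounds` starts from the zero function.
  have hLAB : σ₁.a .LAB = fun _ => 0 := by
    funext i
    have e1 : σ₁.a .LAB = ((fill .LAB .v .n (.lit 0)).eval I
        ((Cmd.set .gp (.lit 0)).eval I σ)).a .LAB := (Loop.frame I (fill .QY .v .n (rd .TP .v)) _).a rfl
    rw [e1, eval_fill .LAB .v .n (.lit 0) _ (fun _ => 0) (fun _ _ _ _ _ _ _ => rfl)]
    split_ifs with hi
    · rfl
    · rw [((h.env.eval (Cmd.set .gp (.lit 0)) rfl).n)] at hi
      exact h.clean i (by omega)
  have hgp : σ₁.v .gp = 0 := by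
    have e1 : σ₁.v .gp = ((Cmd.set .gp (.lit 0)).eval I σ).v .gp :=
      (Loop.frame I (.seq (fill .LAB .v .n (.lit 0)) (fill .QY .v .n (rd .TP .v))) _).v rfl
    rw [e1]; simp
  have h₁ := h.frame' F₁ rfl (by rw [hLAB]; simp)
  have hQ : ∀ v < P.n, σ₁.a .QY v = σ.a .TP v := by
    intro v hv
    have F₀ := Loop.frame I (.seq (.set .gp (.lit 0)) (fill .LAB .v .n (.lit 0))) σ
    rw [hσ₁, eval_fill .QY .v .n (rd .TP .v) _ (σ.a .TP) (fun j _ τ e1 _ e2 _ => by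
      rw [rd, Exp.eval, Exp.eval, e1, e2 .TP (by decide)]; exact congrFun (F₀.a rfl) j), if_pos]
    have := (h.env.frame F₀ rfl).n
    rw [eval_seq] at this
    rwa [this]
  obtain ⟨h₂, hans⟩ := answer_spec (I := I) h₁ hcl
  have F₂ := Loop.frame I answer σ₁
  set σ₂ := answer.eval I σ₁
  have hG₁ : σ₁.a .G = σ.a .G := F₁.a rfl
  have hG₂ : σ₂.a .G = σ.a .G := (F₂.a rfl).trans hG₁
  have hs0 : (σ₂.a .LAB, σ₂.v .gp) = s 0 := by
    rw [hans, hLAB, hgp, hG₁]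
    refine ask_congr fun v hv => ?_
    rw [hQ v hv, h.mem_term hv]
  have key := loop_rule I (x := .d) (b := .D) (p := .block [flow, query, answer]) σ₂
    (fun d τ => (∀ i, P.n ≤ i → τ.a .LAB i = 0) ∧ (τ.a .LAB, τ.v .gp) = s d ∧
      BalState E cl P.q P.K P.n U σ₂ τ (∀ d' < d, ¬ Balanced E cl P.q P.K U (s d').1))
    ⟨h₂.clean, hs0, Or.inl ⟨rfl, rfl, fun d h => absurd h (Nat.not_lt_zero d)⟩⟩ (by
      rintro d hd τ hF ⟨i1, i2, i3⟩
      have hτ := h₂.frame' hF rfl i1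
      set τ₀ := τ.setV .d d with hτ₀
      have i2' : (τ₀.a .LAB, τ₀.v .gp) = s d := by rw [← i2]; simp [hτ₀]
      have i3' : BalState E cl P.q P.K P.n U σ₂ τ₀ (∀ d' < d, ¬ Balanced E cl P.q P.K U (s d').1) := by
        unfold BalState at i3 ⊢; simpa [hτ₀] using i3
      have hl : τ₀.a .LAB = (s d).1 := by rw [← i2']
      simp only [eval_block_cons, eval_block_nil]
      have hf := flow_spec' hτ hE
      have Ff := Loop.frame I flow τ₀
      set τ₁ := flow.eval I τ₀
      have hτ₁ := hτ.frame Ff rfl rfl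
      have l1 : τ₁.a .LAB = τ₀.a .LAB := Ff.a rfl
      simp only [← l1] at hf
      obtain ⟨q1, q2⟩ := query_spec hτ₁ hr hf
      have Fq := Loop.frame I query τ₁
      set τ₂ := query.eval I τ₁
      have hτ₂ := hτ₁.frame Fq rfl rfl
      obtain ⟨hτ₃, a1⟩ := answer_spec (I := I) hτ₂ hcl
      have Fa := Loop.frame I answer τ₂
      set τ₃ := answer.eval I τ₂
      have l2 : τ₂.a .LAB = τ₀.a .LAB := (Fq.a rfl).trans l1
      have l3 : τ₂.v .gp = τ₀.v .gp := (Fq.v rfl).trans (Ff.v rfl)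
      have l4 : τ₂.a .G = σ.a .G := (Fq.a rfl).trans ((Ff.a rfl).trans ((hF.a rfl).trans hG₂))
      refine ⟨hτ₃.clean, ?_, ?_⟩
      · rw [a1, l2, l3, l4, i2']
        refine ask_congr fun v hv => ?_
        rw [q1 v hv, l1, hl]
      · have b1 : τ₃.v .bal = τ₂.v .bal := Fa.v rfl
        have b2 : τ₃.a .BM = τ₂.a .BM := Fa.a rfl
        have b3 : τ₁.v .bal = τ₀.v .bal := Ff.v rfl
        have b4 : τ₁.a .BM = τ₀.a .BM := Ff.a rfl
        unfold BalState
        rw [b1, b2]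
        rcases q2 with ⟨c1, c2, c3⟩ | c
        · rw [c1, c2, b3, b4]
          rcases i3' with ⟨d1, d2, d3⟩ | d1
          · refine Or.inl ⟨d1, d2, fun d' hd' => ?_⟩
            rcases Nat.lt_succ_iff_lt_or_eq.1 hd' with hd' | rfl
            · exact d3 d' hd'
            · rw [← hl, ← l1]; exact c3
          · exact Or.inr d1
        · exact Or.inr c)
  rw [h₂.env.D] at key
  set c₃ := Cmd.loop .d .D (.block [flow, query, answer])
  have F₃ := Loop.frame I c₃ σ₂
  set σ₃ := c₃.eval I σ₂
  obtain ⟨i1, i2, i3⟩ := key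
  have h₃ := h₂.frame' F₃ rfl i1
  have hf := flow_spec' h₃ hE
  have F₄ := Loop.frame I flow σ₃
  set σ₄ := flow.eval I σ₃
  have h₄ := h₃.frame F₄ rfl rfl
  have hl : σ₃.a .LAB = (s P.D).1 := by rw [← i2]
  have g1 : σ₄.a .SEEN = σ.a .SEEN := (F₄.a rfl).trans ((F₃.a rfl).trans ((F₂.a rfl).trans (F₁.a rfl)))
  have g2 : σ₄.a .NC = σ.a .NC := (F₄.a rfl).trans ((F₃.a rfl).trans ((F₂.a rfl).trans (F₁.a rfl)))
  have g3 : σ₄.v .stamp = stamp :=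
    (F₄.v rfl).trans ((F₃.v rfl).trans ((F₂.v rfl).trans ((F₁.v rfl).trans hst)))
  obtain ⟨r1, r2, r3⟩ := record_spec h₄ hTU hT rfl g3 (by rw [g1, g2]; exact hk)
  have F₅ := Loop.frame I record σ₄
  rw [← hσ'] at r1 r2 r3 F₅
  refine ⟨h₄.frame F₅ rfl rfl, ?_, r1, ?_, fun X hX hXK hXk => ?_⟩
  · have b1 : σ'.v .bal = σ₃.v .bal := (F₅.v rfl).trans (F₄.v rfl)
    have b2 : σ'.a .BM = σ₃.a .BM := (F₅.a rfl).trans (F₄.a rfl)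
    have b3 : σ₂.v .bal = σ.v .bal := (F₂.v rfl).trans (F₁.v rfl)
    have b4 : σ₂.a .BM = σ.a .BM := (F₂.a rfl).trans (F₁.a rfl)
    unfold BalState at i3 ⊢
    rwa [b1, b2, ← b3, ← b4]
  · rw [← g1]; exact r2
  · rw [hl] at hf
    rcases hf with ⟨-, f1, -⟩ | ⟨-, f2⟩
    · have := f1.unique hX
      rw [this, inter_eq_right.2 hX.feasible.closed.1] at r3
      exact r3 hXk
    · exact absurd hXK (not_le.2 (f2 X hX.feasible))

end Loop

namespace Loop

open Cut Finset

variable {I : ℕ → ℕ} {P : Pars} {σ τ : St} {cl : ℕ → ℕ} {U T : Finset ℕ}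

/-! #### The enumeration of all guesses -/

/-- The last `L` binary digits of `g`. -/
def digits (L g i : ℕ) : ℕ := if i < L then g / 2 ^ i % 2 else 0

theorem exists_digits {L : ℕ} {A : List ℕ} (hL : A.length ≤ L) (hA : ∀ a ∈ A, a ≤ 1) :
    ∃ g < 2 ^ L, digits L g = fun i => A.getD i 0 := by
  have key : ∀ A : List ℕ, (∀ a ∈ A, a ≤ 1) →
      ∃ g < 2 ^ A.length, ∀ i, g / 2 ^ i % 2 = A.getD i 0 := by
    intro A hA
    induction A with
    | nil => exact ⟨0, by simp, by simp⟩
    | cons a A ih =>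
      obtain ⟨g, hg, hi⟩ := ih fun b hb => hA b (by simp [hb])
      have ha := hA a (by simp)
      refine ⟨a + 2 * g, ?_, fun i => ?_⟩
      · rw [List.length_cons, pow_succ]; omega
      · cases i with
        | zero => simp; omega
        | succ i =>
          rw [pow_succ', ← Nat.div_div_eq_div_mul, show (a + 2 * g) / 2 = g by omega, hi]
          simp
  obtain ⟨g, hg, hi⟩ := key A hA
  refine ⟨g, hg.trans_le (Nat.pow_le_pow_right (by omega) hL), funext fun i => ?_⟩
  rw [digits]; split_ifs with h
  · exact hi i
  · rw [List.getD_eq_default _ _ (by omega)]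

/-- The carry arrives at digit `m` exactly if all lower digits of `g` are one, that is, if `2 ^ m`
divides `g + 1`. -/
theorem digit_succ (g m : ℕ) : (g + 1) / 2 ^ m % 2 =
      (if 2 ^ m ∣ g + 1 then 1 - g / 2 ^ m % 2 else g / 2 ^ m % 2) ∧
    (2 ^ (m + 1) ∣ g + 1 ↔ 2 ^ m ∣ g + 1 ∧ g / 2 ^ m % 2 = 1) := by
  have h1 := Nat.succ_div (a := g) (b := 2 ^ m)
  constructor
  · rw [h1]; split_ifs <;> omega
  · constructor
    · intro h
      have h2 : 2 ^ m ∣ g + 1 := (pow_dvd_pow 2 (Nat.le_succ m)).trans h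
      rw [pow_succ, ← Nat.dvd_div_iff_mul_dvd h2, h1, if_pos h2] at h
      exact ⟨h2, by omega⟩
    · rintro ⟨h2, h3⟩
      rw [pow_succ, ← Nat.dvd_div_iff_mul_dvd h2, h1, if_pos h2]
      omega

theorem nextGuess_spec {L g : ℕ} (hL : σ.v .L = L) (hG : σ.a .G = digits L g) :
    (nextGuess.eval I σ).a .G = digits L (g + 1) := by
  simp only [nextGuess, eval_seq]
  set σ₁ := (Cmd.set .cr (.lit 1)).eval I σ with hσ₁
  have F₁ := Loop.frame I (Cmd.set .cr (.lit 1)) σ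
  have key := loop_rule I (x := .i) (b := .L) (p := .ite (rd .G .i)
    (.ite (.var .cr) (.put .G (.var .i) (.lit 0)) .skip)
    (.ite (.var .cr) (.seq (.put .G (.var .i) (.lit 1)) (.set .cr (.lit 0))) .skip)) σ₁
    (fun m τ => (∀ i, τ.a .G i = if i < m then digits L (g + 1) i else digits L g i) ∧
      τ.v .cr = if 2 ^ m ∣ g + 1 then 1 else 0)
    (by simp [hσ₁, hG]) (by
      rintro m hm τ hF ⟨i1, i2⟩
      have hm' : m < L := by rw [← hL, ← F₁.v (y := .L) rfl]; exact hm
      obtain ⟨d1, d2⟩ := digit_succ g m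
      have i3 := i1 m
      rw [if_neg (lt_irrefl m), digits, if_pos hm'] at i3
      have hs : ∀ τ' : St, (∀ i, τ'.a .G i = if i = m then (g + 1) / 2 ^ m % 2 else τ.a .G i) →
          ∀ i, τ'.a .G i = if i < m + 1 then digits L (g + 1) i else digits L g i := by
        intro τ' h i
        rw [h, i1]
        by_cases e : i = m
        · subst e; simp [digits, hm']
        · rw [if_neg e]
          congr 1
          rw [eq_iff_iff]; omega
      have hlt := Nat.mod_lt (g / 2 ^ m) (show 0 < 2 by omega)
      simp only [eval_ite, Exp.eval, rd, St.setV_a, St.setV_v, if_true, i3, reduceCtorEq, if_false,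
        i2, eval_put, eval_seq, eval_skip, eval_set]
      by_cases h1 : 2 ^ m ∣ g + 1
      · rw [if_pos h1] at d1
        by_cases h2 : g / 2 ^ m % 2 = 1
        · refine ⟨hs _ fun i => ?_, ?_⟩
          · simp [h1, h2, d1]
          · simp [h1, h2, d2, i2]
        · have h2 : g / 2 ^ m % 2 = 0 := by omega
          refine ⟨hs _ fun i => ?_, ?_⟩
          · simp [h1, h2, d1]
          · simp [h1, h2, d2]
      · rw [if_neg h1] at d1
        refine ⟨hs _ fun i => ?_, ?_⟩
        · by_cases e : i = m
          · subst e; simp [h1, d1, i3]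
          · simp [h1, e]
        · simp [h1, d2, i2])
  have hL₁ : σ₁.v .L = L := (F₁.v rfl).trans hL
  rw [hL₁] at key
  funext i
  rw [key.1]
  split_ifs with h
  · rfl
  · rw [digits, digits, if_neg h, if_neg h]

/-- The invariant rule for the enumeration of all guesses. -/
theorem forGuesses_rule {p : Cmd} {L : ℕ} (hL : σ.v .L = L) (hN : σ.v .NG = 2 ^ L)
    (hG : ∀ i, L ≤ i → σ.a .G i = 0) (hpG : p.setsA .G = false) (hpL : p.setsV .L = false)
    (Inv : ℕ → St → Prop) (h0 : Inv 0 σ)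
    (hst : ∀ m τ τ', Frame (forGuesses .skip) τ τ' → Inv m τ → Inv m τ')
    (hs : ∀ g < 2 ^ L, ∀ τ, Frame (forGuesses p) σ τ → τ.a .G = digits L g → Inv g τ →
      Inv (g + 1) (p.eval I τ)) :
    Inv (2 ^ L) ((forGuesses p).eval I σ) ∧ ∀ i, L ≤ i → ((forGuesses p).eval I σ).a .G i = 0 := by
  have hsub : ∀ {τ τ'}, Frame (fill .G .i .L (.lit 0)) τ τ' → Frame (forGuesses .skip) τ τ' :=
    fun h => ⟨fun {y} hy => h.v (by
      simp only [forGuesses, Cmd.setsV, Bool.or_eq_false_iff] at hy; exact hy.1), fun {B} hB => h.a (by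
      simp only [forGuesses, Cmd.setsA, Bool.or_eq_false_iff] at hB; exact hB.1)⟩
  have hsub' : ∀ {τ τ'}, Frame nextGuess τ τ' → Frame (forGuesses .skip) τ τ' :=
    fun h => ⟨fun {y} hy => h.v (by
      simp only [forGuesses, Cmd.setsV, Bool.or_eq_false_iff] at hy; exact hy.2.2.2), fun {B} hB => h.a (by
      simp only [forGuesses, Cmd.setsA, Bool.or_eq_false_iff] at hB; exact hB.2.2)⟩
  have key : ∀ σ' : St, σ' = (fill .G .i .L (.lit 0)).eval I σ →
      Inv (2 ^ L) ((Cmd.loop .g .NG (.seq p nextGuess)).eval I σ') ∧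
      ((Cmd.loop .g .NG (.seq p nextGuess)).eval I σ').a .G = digits L (2 ^ L) := by
    intro σ₁ hσ₁
    have F₁ := Loop.frame I (fill .G .i .L (.lit 0)) σ
    have hG₁ : σ₁.a .G = digits L 0 := by
      funext i
      rw [hσ₁, eval_fill .G .i .L (.lit 0) _ (fun _ => 0) (fun _ _ _ _ _ _ _ => rfl), hL, digits]
      split_ifs with h
      · simp
      · exact hG i (by omega)
    have := loop_rule I (x := .g) (b := .NG) (p := .seq p nextGuess) σ₁
      (fun m τ => Inv m τ ∧ τ.a .G = digits L m)
      ⟨hst _ _ _ (hsub (hσ₁ ▸ F₁)) h0, hG₁⟩ (by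
        rintro g hg τ hF ⟨i1, i2⟩
        have hN₁ : σ₁.v .NG = 2 ^ L := by rw [hσ₁]; exact (F₁.v rfl).trans hN
        rw [hN₁] at hg
        have hF' : Frame (forGuesses p) σ (τ.setV .g g) := by
          refine ⟨fun {y} hy => ?_, fun {B} hB => ?_⟩
          · simp only [forGuesses, Cmd.setsV, Bool.or_eq_false_iff] at hy
            rw [hF.v (by simp only [Cmd.setsV, Bool.or_eq_false_iff]; exact hy.2), hσ₁]
            exact F₁.v hy.1
          · simp only [forGuesses, Cmd.setsA, Bool.or_eq_false_iff] at hB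
            rw [hF.a (by simp only [Cmd.setsA, Bool.or_eq_false_iff]; exact hB.2), hσ₁]
            exact F₁.a hB.1
        have hI := hs g hg _ hF' i2 (hst g τ _ ⟨fun {y} hy => by
          rw [St.setV_v, if_neg]; rintro rfl; revert hy; decide, fun _ => rfl⟩ i1)
        have Fp := Loop.frame I p (τ.setV .g g)
        have Fn := Loop.frame I nextGuess (p.eval I (τ.setV .g g))
        rw [eval_seq]
        refine ⟨hst _ _ _ (hsub' Fn) hI, nextGuess_spec ?_ ?_⟩
        · rw [Fp.v hpL, hF'.v, hL]
          simp only [forGuesses, Cmd.setsV, hpL]; rfl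
        · rw [Fp.a hpG]; exact i2)
    rwa [show σ₁.v .NG = 2 ^ L by rw [hσ₁]; exact (F₁.v rfl).trans hN] at this
  obtain ⟨k1, k2⟩ := key _ rfl
  simp only [forGuesses, eval_seq]
  refine ⟨k1, fun i hi => ?_⟩
  rw [k2, digits, if_neg (by omega)]

/-! #### All guesses for a piece -/

/-- The relations between the parameters. -/
structure Pars.Valid (P : Pars) : Prop where
  K : P.K = 4 * (P.k * P.k)
  tau : 2 * P.K ≤ P.tau
  q : P.q = 2 ^ 2 ^ (P.tau + P.k + P.tau * P.tau)
  D : P.D = (P.K + 1) * (P.q + 2) + 1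
  L : P.L = P.tau + P.D * (P.q + P.K)
  NG : P.NG = 2 ^ P.L

def search : Cmd := .block [incr .stamp, .set .bal (.lit 0), fill .NC .v .n (.lit 0),
  forGuesses guessRun]

/-- `code` distinguishes the vertices on different sides of some cut, for any possible view of a
solution from outside. -/
def GoodCode (E : ℕ → ℕ → Prop) (cl : ℕ → ℕ) (n k q : ℕ) (A B U T : Finset ℕ) (code : ℕ → ℕ) : Prop :=
  (∀ v ∈ U, code v < q) ∧ ∀ X, Sol E n k A B X → Closed cl (range n) X → Good E cl U T (X ∩ U) →
    ∃ Y' ⊆ U, SameSig E n U T (X ∩ U) Y' ∧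
      ∀ u ∈ U, ∀ v ∈ U, code u = code v → (u ∈ Y' ↔ v ∈ Y')

/-- Either some guess runs into a balanced cut, or no guess does. In the second case `exists_guess`
applies to every good solution, so its trace in the piece is the outcome of some guess and its
signature has been stamped. -/
theorem search_spec (hv : P.Valid) (h : Ctx P cl U T σ) {A B : Finset ℕ} (hE : IsGraph (adj I P.n) P.n)
    (hr : Reps cl (range P.n)) (hP : Piece (adj I P.n) cl P.n P.q P.tau A B U T)
    (hG : ∀ i, P.L ≤ i → σ.a .G i = 0) (hst : ∀ s, σ.a .SEEN s ≤ σ.v .stamp) :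
    let σ' := search.eval I σ
    Ctx P cl U T σ' ∧ (∀ i, P.L ≤ i → σ'.a .G i = 0) ∧ (∀ s, σ'.a .SEEN s ≤ σ'.v .stamp) ∧
    ((σ'.v .bal = 0 ∧ GoodCode (adj I P.n) cl P.n P.k P.q A B U T (σ'.a .NC)) ∨
      (σ'.v .bal = 1 ∧ IsBalancedCut (adj I P.n) cl P.q P.K U (asSet P.n (σ'.a .BM)))) := by
  intro σ'
  set E := adj I P.n with hEdef
  have hrU := hP.reps hr
  have hcl : ∀ v < P.n, cl v < P.n := fun v hv => mem_range.1 (hr v (mem_range.2 hv)).1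
  have hσ' : σ' = search.eval I σ := rfl
  clear_value σ'
  simp only [search, eval_block_cons, eval_block_nil] at hσ'
  set c₁ := Cmd.seq (.seq (incr .stamp) (.set .bal (.lit 0))) (fill .NC .v .n (.lit 0)) with hc₁
  have F₁ := Loop.frame I c₁ σ
  have hσ₁ : σ' = (forGuesses guessRun).eval I (c₁.eval I σ) := hσ'
  have hNC : ∀ v ∈ U, (c₁.eval I σ).a .NC v = 0 := by
    intro v hv
    rw [hc₁, eval_seq, eval_fill .NC .v .n (.lit 0) _ (fun _ => 0) (fun _ _ _ _ _ _ _ => rfl), if_pos]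
    have := (h.env.eval (I := I) (.seq (incr .stamp) (.set .bal (.lit 0))) rfl).n
    rw [this]; exact h.lt hv
  have hb0 : (c₁.eval I σ).v .bal = 0 := by
    rw [hc₁, eval_seq, (Loop.frame I (fill .NC .v .n (.lit 0)) _).v rfl]; simp
  have hs0 : (c₁.eval I σ).v .stamp = σ.v .stamp + 1 := by
    rw [hc₁, eval_seq, (Loop.frame I (fill .NC .v .n (.lit 0)) _).v rfl]; simp
  set σ₁ := c₁.eval I σ
  have h₁ := h.frame F₁ rfl rfl
  have hS : σ₁.a .SEEN = σ.a .SEEN := F₁.a rfl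
  have hG₁ : σ₁.a .G = σ.a .G := F₁.a rfl
  set stamp := σ.v .stamp + 1 with hstamp
  set NS := 2 ^ (P.tau + P.k + P.tau * P.tau) with hNS
  obtain ⟨key, hGe⟩ := forGuesses_rule (I := I) (σ := σ₁) (p := guessRun) (L := P.L) h₁.env.L
    (by rw [h₁.env.NG, hv.NG]) (by rw [hG₁]; exact hG) rfl rfl
    (fun m τ => Ctx P cl U T τ ∧ τ.v .stamp = stamp ∧
      ((τ.v .bal = 0 ∧ ∀ g < m, ∀ d < P.D, ¬ Balanced E cl P.q P.K U
        (rounds E cl P.q P.K P.n U T (digits P.L g) d).1) ∨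
        (τ.v .bal = 1 ∧ IsBalancedCut E cl P.q P.K U (asSet P.n (τ.a .BM)))) ∧
      (∃ ys, Kept E P.n P.k NS U T stamp (τ.a .SEEN) (τ.a .NC) ys) ∧
      ∀ g < m, ∀ X, IsMinCut E cl (rounds E cl P.q P.K P.n U T (digits P.L g) P.D).1 U X →
        (bd E U X).card ≤ P.K → rk P.n (CutRel E U X) ≤ P.k →
        τ.a .SEEN (sig E P.n P.k U T X) = stamp)
    (by
      refine ⟨h₁, hs0, Or.inl ⟨hb0, fun g hg => absurd hg (Nat.not_lt_zero g)⟩, ⟨[], ?_⟩,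
        fun g hg => absurd hg (Nat.not_lt_zero g)⟩
      rw [hS]
      refine ⟨fun s => (hst s).trans (by omega), fun {s} hs => ?_, fun {u v} hu hv' h' {Y} hY => ?_,
        fun {v} hv => ?_, by simp⟩
      · have := hst s; omega
      · exact absurd hY List.not_mem_nil
      · rw [hNC v hv]; simp)
    (by
      rintro m τ τ' hF ⟨i1, i2, i3, i4, i5⟩
      have e1 : τ'.v .stamp = τ.v .stamp := hF.v rfl
      have e2 : τ'.v .bal = τ.v .bal := hF.v rfl
      have e3 : τ'.a .BM = τ.a .BM := hF.a rfl
      have e4 : τ'.a .SEEN = τ.a .SEEN := hF.a rfl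
      have e5 : τ'.a .NC = τ.a .NC := hF.a rfl
      rw [e1, e2, e3, e4, e5]
      exact ⟨i1.frame hF rfl rfl, i2, i3, i4, i5⟩)
    (by
      rintro g hg τ hF hGτ ⟨i1, i2, i3, ⟨ys, i4⟩, i5⟩
      obtain ⟨r1, r2, r3, r4, r5⟩ := guessRun_spec (I := I) i1 (fun u v h => hE.symm h) hrU hcl
        hP.sub hP.card_le i2 i4
      have Fg := Loop.frame I guessRun τ
      rw [hGτ, ← hEdef] at r2 r5
      refine ⟨r1, (Fg.v rfl).trans i2, ?_, r3, fun g' hg' X hX h1 h2 => ?_⟩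
      · rcases r2 with ⟨b1, b2, b3⟩ | b
        · rw [b1, b2]
          rcases i3 with ⟨c1, c2⟩ | c
          · refine Or.inl ⟨c1, fun g' hg' => ?_⟩
            rcases Nat.lt_succ_iff_lt_or_eq.1 hg' with hg' | rfl
            · exact c2 g' hg'
            · exact b3
          · exact Or.inr c
        · exact Or.inr b
      · rcases Nat.lt_succ_iff_lt_or_eq.1 hg' with hg' | rfl
        · exact r4 _ (i5 g' hg' X hX h1 h2)
        · exact r5 X hX h1 h2)
  rw [← hσ₁] at key hGe
  obtain ⟨i1, i2, i3, ⟨ys, i4⟩, i5⟩ := key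
  refine ⟨i1, hGe, fun s => by rw [i2]; exact i4.old s, ?_⟩
  rcases i3 with ⟨c1, c2⟩ | c
  swap
  · exact Or.inr c
  refine Or.inl ⟨c1, fun v hv' => ?_, fun X hX hXc hgood => ?_⟩
  · refine (i4.lt hv').trans_le ?_
    rw [hv.q]
    refine Nat.pow_le_pow_right (by omega) (i4.length.trans ((card_filter_le _ _).trans ?_))
    rw [card_range]
  · have hXK : (bd E U (X ∩ U)).card ≤ P.K := by
      rw [hv.K]; exact card_bd_le hE hP.closed.1 hX
    have hXk : rk P.n (CutRel E U (X ∩ U)) ≤ P.k := by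
      refine (rk_mono fun u v he => ?_).trans hX.rk_le
      simp only [CutRel, mem_bd, mem_inter] at he ⊢
      exact ⟨he.1.1, hP.closed.1 he.2.1, fun h => he.2.2.1 ⟨h, he.2.1⟩, he.2.2.2⟩
    -- Bit strings of length at most `L` occur among the enumerated numbers, padded with zeros;
    -- hence the absence of balanced cuts extends to all of them.
    obtain ⟨Z, hZ, hZ1, hZ2⟩ := exists_guess (n := P.n) (fun u v h => hE.symm h) hrU hP.closed.1 hP.sub hgood hXK
      (L := P.L) (by rw [hv.L, hv.D]; exact Nat.add_le_add_right hP.card_le _) (by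
        intro Z hZ hZ1 d hd
        obtain ⟨g, hg, e⟩ := exists_digits hZ hZ1
        rw [← e]
        exact c2 g hg d (by rw [hv.D]; exact hd))
    obtain ⟨g, hg, e⟩ := exists_digits hZ hZ1
    rw [← e, ← hv.D] at hZ2
    -- The kept cut with this signature need not be `X ∩ U`, but it is indistinguishable from it
    -- from outside.
    obtain ⟨Y, hY, hYU, hYk, hYs⟩ := i4.seen (i5 g hg _ hZ2 hXK hXk)
    exact ⟨Y, hYU, sameSig_of_sig_eq (hP.sub.trans hP.closed.1) hYs.symm hXk hYk,
      fun u hu v hv hc => i4.code hu hv hc hY⟩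

end Loop

/-! ### One round of refinement and its progress -/

namespace Loop

open Cut Finset

variable {I : ℕ → ℕ} {P : Pars} {σ τ : St} {cl : ℕ → ℕ} {U T : Finset ℕ}

theorem resetPiece_spec (h : Env P σ) (hcl : σ.a .CL = cl) (hl : ∀ i, P.n ≤ i → σ.a .LAB i = 0) :
    Ctx P cl (range P.n) (asSet P.n I) (resetPiece.eval I σ) := by
  have F := Loop.frame I resetPiece σ
  have F₁ := Loop.frame I (fill .VP .v .n (.lit 1)) σ
  refine ⟨h.frame F rfl, (F.a rfl).trans hcl, ?_, ?_, by rw [F.a rfl]; exact hl⟩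
  · ext v
    rw [mem_asSet, mem_range]
    refine ⟨fun hv => ⟨hv, ?_⟩, fun hv => hv.1⟩
    rw [resetPiece, eval_seq, (Loop.frame I (fill .TP .v .n (.lt (.lit 0) (.inp (.var .v)))) _).a rfl,
      eval_fill .VP .v .n (.lit 1) _ (fun _ => 1) (fun _ _ _ _ _ _ _ => rfl), if_pos (by rwa [h.n])]
    omega
  · ext v
    rw [mem_asSet, mem_asSet]
    refine and_congr_right fun hv => ?_
    rw [resetPiece, eval_seq, eval_fill .TP .v .n (.lt (.lit 0) (.inp (.var .v))) _
      (fun v => if 0 < I v then 1 else 0) (fun j _ τ e _ _ _ => by simp only [Exp.eval, e]),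
      if_pos (by rw [F₁.v rfl]; rwa [h.n])]
    simp [Nat.pos_iff_ne_zero]

/-- `harden` redefines the classes. -/
theorem harden_spec (h : Ctx P cl U T σ) :
    ∃ cl', Ctx P cl' (range P.n) (asSet P.n I) (harden.eval I σ) ∧
      (∀ v ∈ U, IsLeast {u | u ∈ U ∧ σ.a .NC u = σ.a .NC v} (cl' v)) ∧
      ∀ v, v ∉ U → cl' v = cl v := by
  set c := Cmd.loop .v .n (.ite (rd .VP .v) (.block [.set .e (.var .n),
    .loop .u .n (.ite (.and (rd .VP .u) (.eq (rd .NC .u) (rd .NC .v)))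
      (.ite (.eq (.var .e) (.var .n)) (.set .e (.var .u)) .skip) .skip),
    .put .CL (.var .v) (.var .e)]) .skip) with hc
  have F := Loop.frame I c σ
  have key := loop_rule I (x := .v) (b := .n) (p := .ite (rd .VP .v) (.block [.set .e (.var .n),
    .loop .u .n (.ite (.and (rd .VP .u) (.eq (rd .NC .u) (rd .NC .v)))
      (.ite (.eq (.var .e) (.var .n)) (.set .e (.var .u)) .skip) .skip),
    .put .CL (.var .v) (.var .e)]) .skip) σ
    (fun m τ => (∀ v ∈ U, v < m → IsLeast {u | u ∈ U ∧ σ.a .NC u = σ.a .NC v} (τ.a .CL v)) ∧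
      ∀ v, ¬ (v ∈ U ∧ v < m) → τ.a .CL v = cl v)
    ⟨by simp, fun v _ => by rw [h.cls]⟩ (by
      rintro m hm τ hF ⟨i1, i2⟩
      rw [h.env.n] at hm
      set τ₀ := τ.setV .v m with hτ₀
      have e1 : τ₀.a .VP = σ.a .VP := hF.a rfl
      have e2 : τ₀.a .NC = σ.a .NC := hF.a rfl
      have e3 : Env P τ₀ := h.env.frame hF rfl
      have e4 : τ₀.v .v = m := by simp [hτ₀]
      have hcond : (rd .VP .v).eval I τ₀ ≠ 0 ↔ m ∈ U := by
        rw [← h.mem_part hm, ← e1]; simp [e4]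
      rw [eval_ite]
      by_cases hmU : m ∈ U
      · rw [if_pos (hcond.2 hmU)]
        simp only [eval_block_cons, eval_block_nil]
        set τ₁ := (Cmd.set .e (.var .n)).eval I τ₀ with hτ₁
        have F₁ := Loop.frame I (Cmd.set .e (.var .n)) τ₀
        have f1 : Env P τ₁ := e3.frame F₁ rfl
        have f2 : τ₁.v .e = P.n := by simp [hτ₁, e3.n]
        have key := loop_rule I (x := .u) (b := .n)
          (p := .ite (.and (rd .VP .u) (.eq (rd .NC .u) (rd .NC .v)))
            (.ite (.eq (.var .e) (.var .n)) (.set .e (.var .u)) .skip) .skip) τ₁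
          (fun j τ => (τ.v .e = P.n ∧ ∀ u < j, ¬ (u ∈ U ∧ σ.a .NC u = σ.a .NC m)) ∨
            τ.v .e < P.n ∧ IsLeast {u | u ∈ U ∧ σ.a .NC u = σ.a .NC m} (τ.v .e))
          (Or.inl ⟨f2, by simp⟩) (by
            intro j hj τ' hF' hI
            rw [f1.n] at hj
            set τ'' := τ'.setV .u j with hτ''
            have g1 : τ''.a .VP = σ.a .VP := (hF'.a rfl).trans ((F₁.a rfl).trans e1)
            have g2 : τ''.a .NC = σ.a .NC := (hF'.a rfl).trans ((F₁.a rfl).trans e2)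
            have g3 : τ''.v .v = m := (hF'.v rfl).trans ((F₁.v rfl).trans e4)
            have g4 : τ''.v .n = P.n := (hF'.v rfl).trans f1.n
            have g5 : τ''.v .u = j := by simp [hτ'']
            have g6 : τ''.v .e = τ'.v .e := by simp [hτ'']
            have hc : (Exp.and (rd .VP .u) (.eq (rd .NC .u) (rd .NC .v))).eval I τ'' ≠ 0 ↔
                j ∈ U ∧ σ.a .NC j = σ.a .NC m := by
              rw [← h.mem_part hj]
              simp only [Exp.eval, rd, g1, g2, g3, g5]
              by_cases e : σ.a .NC j = σ.a .NC m <;> simp [e]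
            rw [eval_ite]
            by_cases hc' : j ∈ U ∧ σ.a .NC j = σ.a .NC m
            · rw [if_pos (hc.2 hc'), eval_ite]
              simp only [Exp.eval, g4, g6]
              rcases hI with ⟨h1, h2⟩ | h1
              · right
                simp only [h1, if_true, ne_eq, one_ne_zero, not_false_eq_true, eval_set, St.setV_v,
                  Exp.eval, g5]
                exact ⟨hj, hc', fun u hu => by
                  by_contra hlt; exact h2 u (by omega) hu⟩
              · right
                rw [if_neg (by rw [if_neg (by omega)]; simp), eval_skip, g6]
                exact h1
            · rw [if_neg (mt hc.1 hc'), eval_skip, g6]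
              refine hI.imp (fun ⟨h1, h2⟩ => ⟨h1, fun u hu h3 => ?_⟩) id
              rcases Nat.lt_succ_iff_lt_or_eq.1 hu with hu | rfl
              · exact h2 u hu h3
              · exact hc' h3)
        rw [f1.n] at key
        set c₂ := Cmd.loop .u .n (.ite (.and (rd .VP .u) (.eq (rd .NC .u) (rd .NC .v)))
            (.ite (.eq (.var .e) (.var .n)) (.set .e (.var .u)) .skip) .skip)
        have F₂ := Loop.frame I c₂ τ₁
        set τ₂ := c₂.eval I τ₁
        have hle : IsLeast {u | u ∈ U ∧ σ.a .NC u = σ.a .NC m} (τ₂.v .e) := by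
          rcases key with ⟨-, h2⟩ | h2
          · exact absurd ⟨hmU, rfl⟩ (h2 m hm)
          · exact h2.2
        have k1 : τ₂.v .v = m := (F₂.v rfl).trans ((F₁.v rfl).trans e4)
        have k2 : τ₂.a .CL = τ.a .CL := (F₂.a rfl).trans (F₁.a rfl)
        have k3 : ((Cmd.put .CL (.var .v) (.var .e)).eval I τ₂).a .CL =
            Function.update (τ.a .CL) m (τ₂.v .e) := by
          funext i
          simp [k1, k2, Function.update_apply]
        rw [k3]
        refine ⟨fun v hv hvm => ?_, fun v hv => ?_⟩
        · by_cases e : v = m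
          · subst e; rw [Function.update_self]; exact hle
          · rw [Function.update_of_ne e]; exact i1 v hv (by omega)
        · rw [Function.update_of_ne]
          · exact i2 v fun hh => hv ⟨hh.1, by omega⟩
          · rintro rfl; exact hv ⟨hmU, by omega⟩
      · rw [if_neg (mt hcond.1 hmU), eval_skip]
        refine ⟨fun v hv hvm => i1 v hv ?_, fun v hv => i2 v fun hh => hv ⟨hh.1, by omega⟩⟩
        have : v ≠ m := by rintro rfl; exact hmU hv
        omega)
  rw [h.env.n] at key
  refine ⟨(c.eval I σ).a .CL, resetPiece_spec (h.env.frame F rfl) rfl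
    (by rw [F.a rfl]; exact h.clean), fun v hv => key.1 v hv (h.lt hv),
    fun v hv => key.2 v fun hh => hv hh.1⟩

open Classical in
/-- `descend` continues with one side of the balanced cut. -/
theorem descend_spec (h : Ctx P cl U T σ) (hTU : T ⊆ U) {M : Finset ℕ}
    (hM : M = asSet P.n (σ.a .BM)) (hMU : M ⊆ U) :
    ∃ W, (W = M ∨ W = U \ M) ∧ 2 * (T ∩ W).card ≤ T.card ∧
      Ctx P cl W ((T ∪ U.filter fun v => ∃ u ∈ U, u ∉ W ∧ adj I P.n u v) ∩ W) (descend.eval I σ) := by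
  set σ' := descend.eval I σ with hσ'
  clear_value σ'
  simp only [descend, eval_block_cons, eval_block_nil] at hσ'
  set σ₁ := (Cmd.set .cb (.lit 0)).eval I ((Cmd.set .ca (.lit 0)).eval I σ) with hσ₁
  have F₁ : Frame (.seq (.set .ca (.lit 0)) (.set .cb (.lit 0))) σ σ₁ := Loop.frame I _ σ
  have h₁ := h.frame F₁ rfl rfl
  have hmem : ∀ v < P.n, σ.a .BM v ≠ 0 ↔ v ∈ M := fun v hv => by
    rw [hM, mem_asSet]; exact ⟨fun h => ⟨hv, h⟩, fun h => h.2⟩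
  have key := loop_rule I (x := .v) (b := .n)
    (p := .ite (rd .TP .v) (.ite (rd .BM .v) (incr .ca) (incr .cb)) .skip) σ₁
    (fun m τ => τ.v .ca = ((range m).filter fun v => v ∈ T ∧ v ∈ M).card ∧
      τ.v .cb = ((range m).filter fun v => v ∈ T ∧ v ∉ M).card)
    (by simp [hσ₁]) (by
      rintro m hm τ hF ⟨i1, i2⟩
      rw [h₁.env.n] at hm
      have hτ := h₁.frame hF rfl rfl
      have e1 := hτ.mem_term hm
      have e2 : (τ.setV .v m).a .BM = σ.a .BM := (hF.a rfl).trans (F₁.a rfl)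
      have hc : (rd .TP .v).eval I (τ.setV .v m) ≠ 0 ↔ m ∈ T := by rw [← e1]; simp
      have hc2 : (rd .BM .v).eval I (τ.setV .v m) ≠ 0 ↔ m ∈ M := by
        rw [← hmem m hm, ← e2]; simp
      simp only [eval_ite, range_add_one, filter_insert]
      by_cases hmT : m ∈ T
      · rw [if_pos (hc.2 hmT)]
        by_cases hmM : m ∈ M
        · rw [if_pos (hc2.2 hmM), if_pos ⟨hmT, hmM⟩, if_neg (by simp [hmM]),
            card_insert_of_notMem (by simp)]
          simp [i1, i2]
        · rw [if_neg (mt hc2.1 hmM), if_neg (by simp [hmM]), if_pos ⟨hmT, hmM⟩,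
            card_insert_of_notMem (by simp)]
          simp [i1, i2]
      · rw [if_neg (mt hc.1 hmT), if_neg fun h => hmT h.1, if_neg fun h => hmT h.1]
        simp [i1, i2])
  rw [h₁.env.n] at key
  set c₂ := Cmd.loop .v .n (.ite (rd .TP .v) (.ite (rd .BM .v) (incr .ca) (incr .cb)) .skip)
  have F₂ := Loop.frame I c₂ σ₁
  set σ₂ := c₂.eval I σ₁
  have h₂ := h₁.frame F₂ rfl rfl
  have hca : σ₂.v .ca = (T ∩ M).card := by
    rw [key.1]; congr 1; ext v
    simp only [mem_filter, mem_range, mem_inter]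
    exact ⟨fun h => h.2, fun h' => ⟨h.lt (hTU h'.1), h'⟩⟩
  have hcb : σ₂.v .cb = (T \ M).card := by
    rw [key.2]; congr 1; ext v
    simp only [mem_filter, mem_range, mem_sdiff]
    exact ⟨fun h => h.2, fun h' => ⟨h.lt (hTU h'.1), h'⟩⟩
  have hsum : (T ∩ M).card + (T \ M).card = T.card := by rw [add_comm, card_sdiff_add_card_inter]
  have hBM₂ : σ₂.a .BM = σ.a .BM := (F₂.a rfl).trans (F₁.a rfl)
  set c₃ := Cmd.ite (.lt (.var .cb) (.var .ca))
    (fill .BM .v .n (.and (rd .VP .v) (.eq (rd .BM .v) (.lit 0)))) .skip with hc₃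
  have F₃ := Loop.frame I c₃ σ₂
  have hW : ∃ W, (W = M ∨ W = U \ M) ∧ 2 * (T ∩ W).card ≤ T.card ∧
      ∀ v < P.n, (c₃.eval I σ₂).a .BM v ≠ 0 ↔ v ∈ W := by
    have hcond : (Exp.lt (.var .cb) (.var .ca)).eval I σ₂ ≠ 0 ↔ (T \ M).card < (T ∩ M).card := by
      simp only [Exp.eval, hca, hcb]; simp
    rw [hc₃, eval_ite]
    by_cases hlt : (T \ M).card < (T ∩ M).card
    · refine ⟨U \ M, Or.inr rfl, ?_, fun v hv => ?_⟩
      · have : T ∩ (U \ M) = T \ M := by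
          ext v; rw [mem_inter, mem_sdiff, mem_sdiff]
          exact ⟨fun h => ⟨h.1, h.2.2⟩, fun h => ⟨h.1, hTU h.1, h.2⟩⟩
        rw [this]; omega
      · rw [if_pos (hcond.2 hlt),
          eval_fill .BM .v .n (.and (rd .VP .v) (.eq (rd .BM .v) (.lit 0))) σ₂
            (fun v => if σ₂.a .VP v ≠ 0 ∧ σ.a .BM v = 0 then 1 else 0)
            (fun j _ τ e1 _ e2 e3 => by
              simp only [Exp.eval, rd, e1, e2 .VP (by decide), e3 j le_rfl, hBM₂]
              by_cases e : σ.a .BM j = 0 <;> simp [e]), if_pos (by rwa [h₂.env.n]), mem_sdiff,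
          ← hmem v hv, ← h₂.mem_part hv]
        simp
    · refine ⟨M, Or.inl rfl, by omega, fun v hv => ?_⟩
      rw [if_neg (mt hcond.1 hlt), eval_skip, hBM₂, hmem v hv]
  obtain ⟨W, hWM, hWT, hmemW⟩ := hW
  have hWU : W ⊆ U := by rcases hWM with rfl | rfl; exacts [hMU, sdiff_subset]
  set σ₃ := c₃.eval I σ₂
  have h₃ := h₂.frame F₃ rfl rfl
  have key₄ := loop_rule2 (I := I) σ₃ P.n h₃.env.n (x := .u) (y := .v) (p := .ite
      (.and (.and (rd .VP .u) (.eq (rd .BM .u) (.lit 0))) (.and (rd .BM .v) (adjE .u .v)))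
      (.put .TP (.var .v) (.lit 1)) .skip) rfl rfl
    (fun i j τ => ∀ v < P.n, τ.a .TP v ≠ 0 ↔ v ∈ T ∨ v ∈ W ∧ ∃ u ∈ U, u ∉ W ∧ adj I P.n u v ∧
      (u < i ∨ u = i ∧ v < j))
    (fun v hv => by rw [h₃.mem_term hv]; simp)
    (fun i j τ c h => h) (fun i j τ c h => h)
    (fun i hi τ h v hv => by
      rw [h v hv]
      refine or_congr_right (and_congr_right fun _ => exists_congr fun u =>
        and_congr_right fun _ => and_congr_right fun _ => and_congr_right fun _ => ?_)
      omega)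
    (by
      intro i hi j hj τ hF hu hv hI
      have g1 : τ.a .VP = σ₃.a .VP := hF.a rfl
      have g2 : τ.a .BM = σ₃.a .BM := hF.a rfl
      have hτ : Env P τ := h₃.env.frame hF rfl
      have m3 := hτ.adj (I := I) (x := .u) (y := .v) (by omega) (by omega)
      rw [hu, hv] at m3
      have hc : (Exp.and (.and (rd .VP .u) (.eq (rd .BM .u) (.lit 0)))
          (.and (rd .BM .v) (adjE .u .v))).eval I τ ≠ 0 ↔ i ∈ U ∧ i ∉ W ∧ j ∈ W ∧ adj I P.n i j := by
        rw [← h₃.mem_part hi, ← hmemW i hi, ← hmemW j hj, ← m3]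
        rw [Exp.eval, Exp.eval, Exp.eval, Exp.eval]
        simp only [rd, Exp.eval, hu, hv, g1, g2]
        by_cases e : σ₃.a .BM i = 0 <;> simp [e, and_assoc]
      rw [eval_ite]
      intro v' hv'
      by_cases hc' : i ∈ U ∧ i ∉ W ∧ j ∈ W ∧ adj I P.n i j
      · rw [if_pos (hc.2 hc')]
        simp only [eval_put, St.setA_a, Exp.eval, hv, true_and]
        by_cases hvm : v' = j
        · subst hvm
          rw [if_pos rfl]
          simp only [ne_eq, one_ne_zero, not_false_eq_true, true_iff]
          exact Or.inr ⟨hc'.2.2.1, i, hc'.1, hc'.2.1, hc'.2.2.2, Or.inr ⟨rfl, by omega⟩⟩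
        · rw [if_neg hvm, hI v' hv']
          refine or_congr_right (and_congr_right fun _ => exists_congr fun u =>
            and_congr_right fun _ => and_congr_right fun _ => and_congr_right fun _ => ?_)
          omega
      · rw [if_neg (mt hc.1 hc'), eval_skip, hI v' hv']
        refine or_congr_right (and_congr_right fun g1 => exists_congr fun u =>
          and_congr_right fun g2 => and_congr_right fun g3 => and_congr_right fun g4 => ?_)
        have : ¬ (u = i ∧ v' = j) := by rintro ⟨rfl, rfl⟩; exact hc' ⟨g2, g3, g1, g4⟩
        omega)
  set c₄ := Cmd.loop .u .n (.loop .v .n (.ite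
    (.and (.and (rd .VP .u) (.eq (rd .BM .u) (.lit 0))) (.and (rd .BM .v) (adjE .u .v)))
    (.put .TP (.var .v) (.lit 1)) .skip))
  have F₄ := Loop.frame I c₄ σ₃
  set σ₄ := c₄.eval I σ₃
  have n₄ : σ₄.v .n = P.n := (F₄.v rfl).trans h₃.env.n
  have hBM₄ : σ₄.a .BM = σ₃.a .BM := F₄.a rfl
  set c₅ := fill .TP .v .n (.and (rd .TP .v) (rd .BM .v))
  have F₅ := Loop.frame I c₅ σ₄
  have hTP₅ : ∀ v < P.n, (c₅.eval I σ₄).a .TP v ≠ 0 ↔ σ₄.a .TP v ≠ 0 ∧ v ∈ W := by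
    intro v hv
    rw [eval_fill .TP .v .n (.and (rd .TP .v) (rd .BM .v)) σ₄
      (fun v => if σ₄.a .TP v ≠ 0 ∧ σ₄.a .BM v ≠ 0 then 1 else 0)
      (fun j _ τ e1 _ e2 e3 => by
        simp only [Exp.eval, rd, e1, e2 .BM (by decide), e3 j le_rfl]), if_pos (by rwa [n₄]),
      ← hmemW v hv, hBM₄]
    simp
  set σ₅ := c₅.eval I σ₄
  have hBM₅ : σ₅.a .BM = σ₃.a .BM := (F₅.a rfl).trans hBM₄
  have n₅ : σ₅.v .n = P.n := (F₅.v rfl).trans n₄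
  set c₆ := fill .VP .v .n (rd .BM .v)
  have F₆ := Loop.frame I c₆ σ₅
  have hVP₆ : ∀ v < P.n, (c₆.eval I σ₅).a .VP v ≠ 0 ↔ v ∈ W := by
    intro v hv
    rw [eval_fill .VP .v .n (rd .BM .v) σ₅ (fun v => σ₃.a .BM v)
      (fun j _ τ e1 _ e2 _ => by
        simp only [Exp.eval, rd, e1, e2 .BM (by decide), hBM₅]), if_pos (by rwa [n₅])]
    exact hmemW v hv
  rw [← hσ'] at F₆ hVP₆
  have G : Frame (.seq c₄ (.seq c₅ c₆)) σ₃ σ' := by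
    rw [hσ']; exact Loop.frame I (.seq c₄ (.seq c₅ c₆)) σ₃
  refine ⟨W, hWM, hWT, h₃.env.frame G rfl, (G.a rfl).trans h₃.cls, ?_, ?_,
    by rw [G.a rfl]; exact h₃.clean⟩
  · ext v
    rw [mem_asSet]
    exact ⟨fun hv => ⟨h.lt (hWU hv), (hVP₆ v (h.lt (hWU hv))).2 hv⟩, fun hv => (hVP₆ v hv.1).1 hv.2⟩
  · ext v
    rw [mem_asSet, F₆.a rfl, mem_inter, mem_union, mem_filter]
    by_cases hv : v < P.n
    · rw [hTP₅ v hv, key₄ v hv]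
      simp only [hv, true_and]
      refine and_congr_left fun hvW => or_congr_right ?_
      simp only [hvW, hWU hvW, true_and]
      refine exists_congr fun u => and_congr_right fun hu => and_congr_right fun _ => ?_
      exact ⟨fun h => ⟨h, Or.inl (h₃.lt hu)⟩, fun h => h.1⟩
    · exact ⟨fun hh => absurd (h.lt (hWU hh.2)) hv, fun hh => absurd hh.1 hv⟩

/-- The invariant of the main loop. After `m` rounds there are few classes, or some measure has
decreased by `m`. -/
structure MainInv (I : ℕ → ℕ) (P : Pars) (A B : Finset ℕ) (m : ℕ) (σ : St) (cl : ℕ → ℕ)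
    (U T : Finset ℕ) : Prop where
  ctx : Ctx P cl U T σ
  reps : Reps cl (range P.n)
  piece : Piece (adj I P.n) cl P.n P.q P.tau A B U T
  sol : (∃ X, Sol (adj I P.n) P.n P.k A B X) →
    ∃ X, Sol (adj I P.n) P.n P.k A B X ∧ Closed cl (range P.n) X
  digits : ∀ i, P.L ≤ i → σ.a .G i = 0
  stamps : ∀ s, σ.a .SEEN s ≤ σ.v .stamp
  progress : cnum cl (range P.n) ≤ P.q ∨
    cnum cl (range P.n) * (P.n + 1) + cnum cl U + m ≤ P.n * (P.n + 1) + P.n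

theorem cnum_le {cl : ℕ → ℕ} {n : ℕ} : cnum cl (range n) ≤ n := by
  have := card_image_le (s := range n) (f := cl)
  rwa [card_range] at this

/-- Descending keeps the classes and loses more than `q` classes of the piece. Merging returns to
the whole graph with fewer classes, unless at most `q` are left, and that state is never lost again.
-/
theorem refine_spec (hv : P.Valid) {A B : Finset ℕ} (hE : IsGraph (adj I P.n) P.n)
    (hA : A ⊆ asSet P.n I) (hB : B ⊆ asSet P.n I) (hI : (asSet P.n I).card ≤ P.tau) {m : ℕ}
    (h : MainInv I P A B m σ cl U T) :
    ∃ cl' U' T', MainInv I P A B (m + 1) (Loop.refine.eval I σ) cl' U' T' := by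
  have e : Loop.refine.eval I σ = (Cmd.ite (.var .bal) descend harden).eval I (search.eval I σ) := rfl
  obtain ⟨s1, s2, s3, s4⟩ := search_spec (I := I) hv h.ctx hE h.reps h.piece h.digits h.stamps
  rw [e]
  set σ₁ := search.eval I σ
  rw [eval_ite]
  -- Losing one class pays `n + 1`, more than the whole graph can have in classes, so resetting the
  -- piece still leaves a gain of at least one.
  have hn : ∀ {cl' : ℕ → ℕ}, cnum cl' (range P.n) < cnum cl (range P.n) →
      cnum cl' (range P.n) * (P.n + 1) + cnum cl' (range P.n) + 1 ≤
        cnum cl (range P.n) * (P.n + 1) := by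
    intro cl' hlt
    have h1 : (cnum cl' (range P.n) + 1) * (P.n + 1) ≤ cnum cl (range P.n) * (P.n + 1) :=
      Nat.mul_le_mul_right _ hlt
    have h2 := cnum_le (cl := cl') (n := P.n)
    rw [add_mul] at h1
    omega
  rcases s4 with ⟨b, c1, c2⟩ | ⟨b, hbal⟩
  · rw [if_neg (by simp [b])]
    obtain ⟨cl', h1, h2, h3⟩ := harden_spec (I := I) s1
    have F := Loop.frame I harden σ₁
    obtain ⟨r1, r2, r3⟩ := h.piece.harden (cl' := cl') hE h.reps (σ₁.a .NC) c1
      (fun v hv => (h2 v hv).1) (fun v _ hv' => h3 v hv') (fun u hu v hv' hc => by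
        have h4 := h2 u hu
        rw [hc] at h4
        exact h4.unique (h2 v hv')) c2
    refine ⟨cl', range P.n, asSet P.n I, h1, r1, ⟨⟨Subset.rfl, fun _ _ v hv' _ => hv'⟩, asSet_sub _ _, hI,
      fun _ hv => hA hv, fun _ hv => hB hv, fun hu hv' he => absurd (mem_range.2 (hE.lt (hE.symm he))) hv',
      Or.inl rfl⟩, fun hs => r3 (h.sol hs), ?_, ?_, ?_⟩
    · rw [F.a rfl]; exact s2
    · rw [F.a rfl, F.v rfl]; exact s3
    · rcases r2 with r2 | r2
      · exact Or.inl r2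
      · have := hn r2
        rcases h.progress with h4 | h4
        · left; omega
        · right; omega
  · rw [if_pos (by simp [b])]
    obtain ⟨W, hW, hWT, h1⟩ := descend_spec (I := I) s1 h.piece.sub rfl hbal.closed.1
    have F := Loop.frame I descend σ₁
    set M := asSet P.n (σ₁.a .BM)
    have hWc : Closed cl U W ∧ (bd (adj I P.n) U W).card ≤ P.K ∧ P.q < cnum cl W ∧
        P.q < cnum cl (U \ W) := by
      rcases hW with rfl | rfl
      · exact ⟨hbal.closed, hbal.card_le, hbal.lt, hbal.lt'⟩
      · refine ⟨hbal.closed.compl, ?_, hbal.lt', ?_⟩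
        · rw [card_bd_compl (fun _ _ h => hE.symm h) hbal.closed.1]; exact hbal.card_le
        · rw [Finset.sdiff_sdiff_eq_self hbal.closed.1]; exact hbal.lt
    obtain ⟨p1, p2⟩ := h.piece.descend hE hWc.1 hWc.2.1 hWc.2.2.1 hWc.2.2.2 hWT hv.tau
    refine ⟨cl, W, _, h1, h.reps, p1, h.sol, ?_, ?_, ?_⟩
    · rw [F.a rfl]; exact s2
    · rw [F.a rfl, F.v rfl]; exact s3
    · rcases h.progress with h4 | h4
      · exact Or.inl h4
      · right; omega

end Loop

namespace Loop

open Cut Finset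

variable {I : ℕ → ℕ} {P : Pars} {σ τ : St} {cl : ℕ → ℕ} {U T : Finset ℕ}

/-! #### Bipartitions -/

/-- `f` is a proper coloring with the colors `0` and `1`. -/
structure Proper (E : ℕ → ℕ → Prop) (f : ℕ → ℕ) (n : ℕ) : Prop where
  le {v : ℕ} (hv : v < n) : f v ≤ 1
  ne {u v : ℕ} (h : E u v) : f u ≠ f v

theorem join_spec (h : Env P σ) {ca cb e : ℕ} (ha : σ.v .ca = ca) (hb : σ.v .cb = cb)
    (he : σ.v .e = e) :
    let σ' := (Cmd.loop .w .n (.ite (.eq (rd .CC .w) (.var .ca))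
        (.seq (.put .CC (.var .w) (.var .cb))
          (.ite (.var .e) (.put .PA (.var .w) (.lit 1 - rd .PA .w)) .skip)) .skip)).eval I σ
    ∀ w < P.n, σ'.a .CC w = (if σ.a .CC w = ca then cb else σ.a .CC w) ∧
      σ'.a .PA w = if σ.a .CC w = ca ∧ e ≠ 0 then 1 - σ.a .PA w else σ.a .PA w := by
  have key := loop_rule I (x := .w) (b := .n) (p := .ite (.eq (rd .CC .w) (.var .ca))
        (.seq (.put .CC (.var .w) (.var .cb))
          (.ite (.var .e) (.put .PA (.var .w) (.lit 1 - rd .PA .w)) .skip)) .skip) σ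
    (fun m τ => ∀ w, (τ.a .CC w = if w < m ∧ σ.a .CC w = ca then cb else σ.a .CC w) ∧
      τ.a .PA w = if w < m ∧ σ.a .CC w = ca ∧ e ≠ 0 then 1 - σ.a .PA w else σ.a .PA w)
    (by simp) (by
      intro m hm τ hF hI w
      set τ₀ := τ.setV .w m with hτ₀
      have e1 : τ₀.v .ca = ca := (hF.v rfl).trans ha
      have e2 : τ₀.v .cb = cb := (hF.v rfl).trans hb
      have e3 : τ₀.v .e = e := (hF.v rfl).trans he
      have e4 : τ₀.v .w = m := by simp [hτ₀]
      have e5 : τ₀.a = τ.a := rfl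
      obtain ⟨i1, i2⟩ := hI m
      simp only [lt_irrefl, false_and, if_false] at i1 i2
      obtain ⟨j1, j2⟩ := hI w
      by_cases hc : σ.a .CC m = ca
      · by_cases h0 : e = 0
        · have hx : (Cmd.eval I (.ite (.eq (rd .CC .w) (.var .ca))
            (.seq (.put .CC (.var .w) (.var .cb))
            (.ite (.var .e) (.put .PA (.var .w) (.lit 1 - rd .PA .w)) .skip)) .skip) τ₀) =
            τ₀.setA .CC m cb := by
            simp [e1, e2, e3, e4, e5, i1, hc, h0]
          rw [hx]
          simp only [St.setA_a, reduceCtorEq, false_and, if_false, true_and, e5, j1, j2, h0]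
          refine ⟨?_, by simp⟩
          by_cases hw : w = m
          · subst hw; simp [hc]
          · rw [if_neg hw]
            have : w < m ↔ w < m + 1 := by omega
            simp only [this]
        · have hx : (Cmd.eval I (.ite (.eq (rd .CC .w) (.var .ca))
            (.seq (.put .CC (.var .w) (.var .cb))
            (.ite (.var .e) (.put .PA (.var .w) (.lit 1 - rd .PA .w)) .skip)) .skip) τ₀) =
            (τ₀.setA .CC m cb).setA .PA m (1 - σ.a .PA m) := by
            simp [e1, e2, e3, e4, e5, i1, i2, hc, h0]
          rw [hx]
          simp only [St.setA_a, reduceCtorEq, false_and, if_false, true_and, e5, j1, j2]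
          by_cases hw : w = m
          · subst hw; simp [hc, h0]
          · have : w < m ↔ w < m + 1 := by omega
            simp only [this, hw, if_false, and_self]
      · have hx : (Cmd.eval I (.ite (.eq (rd .CC .w) (.var .ca))
            (.seq (.put .CC (.var .w) (.var .cb))
            (.ite (.var .e) (.put .PA (.var .w) (.lit 1 - rd .PA .w)) .skip)) .skip) τ₀) = τ₀ := by
            simp [e1, e2, e3, e4, e5, i1, hc]
        rw [hx, e5, j1, j2]
        by_cases hw : w = m
        · subst hw; simp [hc]
        · have : w < m ↔ w < m + 1 := by omega
          simp only [this, and_self])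
  rw [h.n] at key
  intro σ' w hw
  obtain ⟨k1, k2⟩ := key w
  simp only [hw, true_and] at k1 k2
  exact ⟨k1, k2⟩

/-- Components are merged edge by edge, and one side of a merged component is flipped if the new
edge would be monochromatic. Inside a component, `PA` distinguishes two vertices exactly if the
given proper coloring `f` does; therefore an edge within a component needs no check. -/
theorem bipartition_spec (h : Env P σ) {f : ℕ → ℕ} (hf : Proper (adj I P.n) f P.n) :
    Proper (adj I P.n) ((bipartition.eval I σ).a .PA) P.n := by
  simp only [bipartition, eval_block_cons, eval_block_nil]
  have n₁ : ((fill .CC .v .n (.var .v)).eval I σ).v .n = P.n :=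
    (h.eval (fill .CC .v .n (.var .v)) rfl).n
  set σ₁ := (fill .PA .v .n (.lit 0)).eval I ((fill .CC .v .n (.var .v)).eval I σ) with hσ₁
  have F₁ : Frame (.seq (fill .CC .v .n (.var .v)) (fill .PA .v .n (.lit 0))) σ σ₁ := Loop.frame I _ σ
  have h₁ := h.frame F₁ rfl
  have hCC : ∀ v < P.n, σ₁.a .CC v = v := by
    intro v hv
    rw [hσ₁, (Loop.frame I (fill .PA .v .n (.lit 0)) _).a rfl, eval_fill .CC .v .n (.var .v) _
      (fun v => v) (fun j _ τ h1 _ _ _ => h1), if_pos (by rwa [h.n])]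
  have hPA : ∀ v < P.n, σ₁.a .PA v = 0 := by
    intro v hv
    rw [hσ₁, eval_fill .PA .v .n (.lit 0) _ (fun _ => 0) (fun _ _ _ _ _ _ _ => rfl),
      if_pos (by rwa [n₁])]
  set c := Cmd.loop .w .n (.ite (.eq (rd .CC .w) (.var .ca))
        (.seq (.put .CC (.var .w) (.var .cb))
          (.ite (.var .e) (.put .PA (.var .w) (.lit 1 - rd .PA .w)) .skip)) .skip) with hc
  have key := loop_rule2 (I := I) σ₁ P.n h₁.n (x := .u) (y := .v)
    (p := .ite (adjE .u .v) (.ite (.eq (rd .CC .u) (rd .CC .v)) .skip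
    (.block [.set .ca (rd .CC .u), .set .cb (rd .CC .v), .set .e (.eq (rd .PA .u) (rd .PA .v)), c]))
      .skip) rfl rfl
    (fun i j τ => (∀ v < P.n, τ.a .PA v ≤ 1) ∧
      (∀ u < P.n, ∀ v < P.n, τ.a .CC u = τ.a .CC v → (τ.a .PA u = τ.a .PA v ↔ f u = f v)) ∧
      ∀ u v, before (adj I P.n) i j u v → τ.a .CC u = τ.a .CC v)
    (by
      refine ⟨fun v hv => by rw [hPA v hv]; omega, fun u hu v hv e => ?_, fun u v hh => ?_⟩
      · rw [hCC u hu, hCC v hv] at e; simp [e]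
      · simp [before_zero] at hh)
    (fun i j τ c h => h) (fun i j τ c h => h)
    (fun i hi τ h => by rwa [← before_next fun a b h => h.2.1])
    (by
      rintro i hi j hj τ hF hu hv ⟨i1, i2, i3⟩
      have hτ : Env P τ := h₁.frame hF rfl
      have hadj := hτ.adj (I := I) (x := .u) (y := .v) (by omega) (by omega)
      rw [hu, hv] at hadj
      rw [eval_ite]
      by_cases ha : adj I P.n i j
      · rw [if_pos (hadj.2 ha), eval_ite, before_succ_of_pos ha]
        by_cases he : τ.a .CC i = τ.a .CC j
        · rw [if_pos (by simp [hu, hv, he]), eval_skip]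
          refine ⟨i1, i2, fun u v hh => ?_⟩
          rcases hh with hh | ⟨rfl, rfl⟩
          · exact i3 u v hh
          · exact he
        · rw [if_neg (by simp [hu, hv, he])]
          simp only [eval_block_cons, eval_block_nil]
          set τ' := (Cmd.set .e (.eq (rd .PA .u) (rd .PA .v))).eval I
            ((Cmd.set .cb (rd .CC .v)).eval I ((Cmd.set .ca (rd .CC .u)).eval I τ)) with hτ'
          have F' : Frame (.seq (.seq (.set .ca (rd .CC .u)) (.set .cb (rd .CC .v)))
            (.set .e (.eq (rd .PA .u) (rd .PA .v)))) τ τ' := Loop.frame I _ τ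
          have s1 : τ'.a = τ.a := by simp [hτ']
          have s := join_spec (I := I) (hτ.frame F' rfl) (ca := τ.a .CC i) (cb := τ.a .CC j)
            (e := if τ.a .PA i = τ.a .PA j then 1 else 0) (by simp [hτ', hu]) (by simp [hτ', hv])
            (by simp [hτ', hu, hv])
          rw [s1, ← hc] at s
          have hne := hf.ne ha
          refine ⟨fun v hv => ?_, fun u hu v hv huv => ?_, fun u v hh => ?_⟩
          · rw [(s v hv).2]
            have := i1 v hv
            split_ifs <;> omega
          · rw [(s u hu).1, (s v hv).1] at huv
            rw [(s u hu).2, (s v hv).2]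
            have a1 := i1 u hu
            have a2 := i1 v hv
            have a3 := i1 i hi
            have a4 := i1 j hj
            have b1 := hf.le hu
            have b2 := hf.le hv
            have b3 := hf.le hi
            have b4 := hf.le hj
            have c1 := i2 u hu v hv
            have c2 := i2 u hu i hi
            have c3 := i2 u hu j hj
            have c4 := i2 v hv i hi
            have c5 := i2 v hv j hj
            by_cases d1 : τ.a .CC u = τ.a .CC i <;> by_cases d2 : τ.a .CC v = τ.a .CC i <;>
              by_cases d3 : τ.a .PA i = τ.a .PA j <;>
              simp only [d1, d2, d3, if_true, if_false, true_and, false_and, ne_eq, one_ne_zero,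
                not_false_eq_true, not_true_eq_false, forall_true_left] at huv c1 c2 c3 c4 c5 ⊢
            all_goals omega
          · rcases hh with hh | ⟨rfl, rfl⟩
            · rw [(s u hh.1.1).1, (s v hh.1.2.1).1, i3 u v hh]
            · rw [(s u hi).1, (s v hj).1, if_pos rfl, if_neg (Ne.symm he)]
      · rw [if_neg (mt hadj.1 ha), eval_skip, before_succ_of_neg ha]
        exact ⟨i1, i2, i3⟩)
  rw [before_end fun a b h => h.1] at key
  obtain ⟨k1, k2, k3⟩ := key
  exact ⟨fun hv => k1 _ hv, fun {u v} ha e => hf.ne ha ((k2 u ha.1 v ha.2.1 (k3 u v ha)).1 e)⟩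

/-! #### The final search -/

/-- The representatives of the classes. -/
def reprs (cl : ℕ → ℕ) (n : ℕ) : Finset ℕ := (range n).filter fun v => cl v = v

/-- The set of vertices whose class has the digit `1`. -/
noncomputable def cutOf (cl : ℕ → ℕ) (n : ℕ) (b : ℕ → ℕ) : Finset ℕ :=
  asSet n fun v => b (elems (reprs cl n) (cl v)).length

theorem getD_elems (R : Finset ℕ) (f : ℕ → ℕ) (m : ℕ) : ∀ v ∈ R, v < m →
    ((elems R m).map f).getD (elems R v).length 0 = f v := by
  induction m with
  | zero => simp
  | succ m ih =>
    intro v hv hvm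
    rw [elems_succ]
    have hle : ∀ {a b}, a ≤ b → (elems R a).length ≤ (elems R b).length := by
      intro a b hab
      induction b, hab using Nat.le_induction with
      | base => exact le_rfl
      | succ b _ ih => 
        rw [elems_succ]
        split_ifs
        · rw [List.length_append]; omega
        · exact ih
    rcases Nat.lt_succ_iff_lt_or_eq.1 hvm with h | rfl
    · have h1 : (elems R v).length < (elems R m).length := by
        have := hle (Nat.succ_le_of_lt h)
        rw [Nat.succ_eq_add_one, elems_succ, if_pos hv] at this
        simpa using this
      split_ifs
      · rw [List.map_append, List.getD_append _ _ _ _ (by simpa using h1)]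
        exact ih v hv h
      · exact ih v hv h
    · rw [if_pos hv, List.map_append, List.getD_append_right _ _ _ _ (by simp)]
      simp

/-- Read the membership of the representatives, in increasing order, as the digits of a number; a
closed set is determined by them. -/
theorem exists_cutOf (hr : Reps cl (range P.n)) (hc : cnum cl (range P.n) ≤ P.L) {X : Finset ℕ}
    (hX : Closed cl (range P.n) X) : ∃ g < 2 ^ P.L, cutOf cl P.n (digits P.L g) = X := by
  classical
  obtain ⟨g, hg, e⟩ := exists_digits (L := P.L)
    (A := (elems (reprs cl P.n) P.n).map fun v => if v ∈ X then 1 else 0) (by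
      rw [List.length_map]
      refine (length_elems_le _ _).trans (le_trans ?_ hc)
      rw [cnum_eq ⟨Subset.rfl, fun _ _ v hv _ => hv⟩ hr, reprs]) (by
      intro a ha
      obtain ⟨v, -, rfl⟩ := List.mem_map.1 ha
      split_ifs <;> omega)
  refine ⟨g, hg, ?_⟩
  ext v
  simp only [cutOf, mem_asSet, e]
  have key : ∀ hv : v < P.n, ((elems (reprs cl P.n) P.n).map fun v => if v ∈ X then 1 else 0).getD
      (elems (reprs cl P.n) (cl v)).length 0 = if v ∈ X then 1 else 0 := by
    intro hv
    obtain ⟨h1, h2⟩ := hr v (mem_range.2 hv)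
    rw [getD_elems (reprs cl P.n) _ _ _ (mem_filter.2 ⟨h1, h2⟩) (mem_range.1 h1)]
    congr 1
    rw [eq_iff_iff]
    exact ⟨fun h => hX.2 _ h v (mem_range.2 hv) h2, fun h => hX.2 _ h _ h1 h2.symm⟩
  constructor
  · rintro ⟨hv, h⟩
    by_contra hvX
    exact h (by rw [key hv, if_neg hvX])
  · intro hv
    have hvn := mem_range.1 (hX.1 hv)
    refine ⟨hvn, ?_⟩
    rw [key hvn, if_pos hv]; omega

/-- The terminals that have to be in the cut, if the sides of the bipartition are given by `pa`. -/
def termIn (I : ℕ → ℕ) (n : ℕ) (pa : ℕ → ℕ) : Finset ℕ :=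
  (range n).filter fun v => I v = 1 ∧ pa v = 1 ∨ I v = 2 ∧ pa v = 0

/-- The terminals that must not be in the cut. -/
def termOut (I : ℕ → ℕ) (n : ℕ) (pa : ℕ → ℕ) : Finset ℕ :=
  (range n).filter fun v => I v = 1 ∧ pa v = 0 ∨ I v = 2 ∧ pa v = 1

/-- The answer given by `found` and `OUT` is correct for the cuts in `S`. -/
def Answer (I : ℕ → ℕ) (P : Pars) (pa : ℕ → ℕ) (S : Finset ℕ → Prop) (found : ℕ) (OUT : ℕ → ℕ) : Prop :=
  (found = 0 ∧ ∀ X, S X → ¬ Sol (adj I P.n) P.n P.k (termIn I P.n pa) (termOut I P.n pa) X) ∨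
    (found = 1 ∧ ∃ X, Sol (adj I P.n) P.n P.k (termIn I P.n pa) (termOut I P.n pa) X ∧
      ∀ v < P.n, OUT v = if (v ∈ X ↔ pa v = 1) then 1 else 2)

theorem check_spec (c : Exp) {x : ℕ} (hc : c.eval I τ = x) (hc' : ∀ y, c.eval I (τ.setV .ok y) = x) :
    ((Cmd.block [.ite (.and (.eq (.inp (.var .v)) (.lit 1)) c) (.set .ok (.lit 0)) .skip,
      .ite (.and (.eq (.inp (.var .v)) (.lit 2)) (.eq c (.lit 0))) (.set .ok (.lit 0)) .skip]).eval I
        τ).v .ok ≠ 0 ↔ τ.v .ok ≠ 0 ∧ (I (τ.v .v) = 1 → x = 0) ∧ (I (τ.v .v) = 2 → x ≠ 0) := by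
  simp only [eval_block_cons, eval_block_nil, eval_ite, eval_set, eval_skip]
  by_cases h0 : x = 0
  · by_cases i1 : I (τ.v .v) = 1
    · simp [hc, h0, i1]
    · by_cases i2 : I (τ.v .v) = 2 <;> simp [hc, h0, i1, i2]
  · by_cases i1 : I (τ.v .v) = 1
    · simp [hc, hc', h0, i1]
    · by_cases i2 : I (τ.v .v) = 2 <;> simp [hc, h0, i1, i2]

/-- The comparison of `RE` with `PA` has values in `{0, 1}` on both sides, so the color of `v` is
`1` exactly if membership in the cut agrees with `pa v = 1`. A successful guess overwrites an
earlier answer by another valid one. -/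
theorem tryGuess_spec (h : Ctx P cl (range P.n) T σ) (hr : Reps cl (range P.n)) {pa : ℕ → ℕ}
    (hpa : σ.a .PA = pa) (hpa1 : ∀ v < P.n, pa v ≤ 1) {b : ℕ → ℕ} (hb : σ.a .G = b)
    (hb1 : ∀ i, b i ≤ 1) {S : Finset ℕ → Prop} (hS : Answer I P pa S (σ.v .found) (σ.a .OUT)) :
    Answer I P pa (fun X => S X ∨ X = cutOf cl P.n b) ((tryGuess.eval I σ).v .found)
      ((tryGuess.eval I σ).a .OUT) := by
  set σ' := tryGuess.eval I σ with hσ'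
  clear_value σ'
  simp only [tryGuess, eval_block_cons, eval_block_nil] at hσ'
  set E := adj I P.n
  set R := reprs cl P.n with hR
  set σ₁ := (Cmd.set .gp (.lit 0)).eval I σ with hσ₁
  have F₁ := Loop.frame I (Cmd.set .gp (.lit 0)) σ
  have h₁ := h.frame F₁ rfl rfl
  have key₁ := loop_rule I (x := .v) (b := .n) (p := .ite (.eq (rd .CL .v) (.var .v))
    (.seq (.put .Y (.var .v) (.get .G (.var .gp))) (incr .gp)) .skip) σ₁
    (fun m τ => τ.v .gp = (elems R m).length ∧
      ∀ v ∈ R, v < m → τ.a .Y v = b (elems R v).length) (by simp [hσ₁, elems]) (by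
      rintro m hm τ hF ⟨i1, i2⟩
      rw [h₁.env.n] at hm
      have e1 : (τ.setV .v m).a .CL = cl := (hF.a rfl).trans h₁.cls
      have e2 : (τ.setV .v m).a .G = b := (hF.a rfl).trans ((F₁.a rfl).trans hb)
      have hc : (Exp.eq (rd .CL .v) (.var .v)).eval I (τ.setV .v m) ≠ 0 ↔ m ∈ R := by
        rw [hR, reprs, mem_filter, mem_range]
        simp only [Exp.eval, rd, e1, St.setV_v, if_true]
        simp [hm]
      rw [eval_ite, elems_succ]
      by_cases hm' : m ∈ R
      · rw [if_pos (hc.2 hm'), if_pos hm']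
        have e3 : (Cmd.eval I (.seq (.put .Y (.var .v) (.get .G (.var .gp))) (incr .gp))
            (τ.setV .v m)).a .Y = Function.update (τ.a .Y) m (b (elems R m).length) := by
          funext i
          rw [St.setV_a] at e2
          simp [e2, Function.update_apply, i1]
        rw [e3]
        refine ⟨by simp [i1], fun v hv hvm => ?_⟩
        by_cases e : v = m
        · subst e; rw [Function.update_self]
        · rw [Function.update_of_ne e]; exact i2 v hv (by omega)
      · rw [if_neg (mt hc.1 hm'), if_neg hm', eval_skip]
        refine ⟨by simp [i1], fun v hv hvm => i2 v hv ?_⟩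
        have : v ≠ m := by rintro rfl; exact hm' hv
        omega)
  rw [h₁.env.n] at key₁
  set c₂ := Cmd.loop .v .n (.ite (.eq (rd .CL .v) (.var .v))
    (.seq (.put .Y (.var .v) (.get .G (.var .gp))) (incr .gp)) .skip)
  have F₂ := Loop.frame I c₂ σ₁
  set σ₂ := c₂.eval I σ₁
  have h₂ := h₁.frame F₂ rfl rfl
  have hRE : ∀ v < P.n, ((fill .RE .v .n (.get .Y (rd .CL .v))).eval I σ₂).a .RE v =
      b (elems R (cl v)).length := by
    intro v hv
    rw [eval_fill .RE .v .n (.get .Y (rd .CL .v)) σ₂ (fun v => σ₂.a .Y (cl v))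
      (fun j _ τ e1 _ e2 _ => by
        simp only [Exp.eval, rd, e1, e2 .Y (by decide), e2 .CL (by decide), h₂.cls]),
      if_pos (by rwa [h₂.env.n])]
    obtain ⟨r1, r2⟩ := hr v (mem_range.2 hv)
    exact key₁.2 _ (mem_filter.2 ⟨r1, r2⟩) (mem_range.1 r1)
  have F₃ := Loop.frame I (fill .RE .v .n (.get .Y (rd .CL .v))) σ₂
  set σ₃ := (fill .RE .v .n (.get .Y (rd .CL .v))).eval I σ₂
  have h₃ := h₂.frame F₃ rfl rfl
  set X := cutOf cl P.n b with hX
  have hXm : ∀ v < P.n, v ∈ X ↔ σ₃.a .RE v ≠ 0 := fun v hv => by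
    rw [hX, cutOf, mem_asSet, hRE v hv]; exact ⟨fun h => h.2, fun h => ⟨hv, h⟩⟩
  have hXn : X ⊆ range P.n := asSet_sub _ _
  obtain ⟨rk1, -⟩ := rank_spec (I := I) h₃.env (range P.n) X h₃.part (by
    ext v
    rw [mem_inter, mem_range, mem_asSet]
    exact ⟨fun hv => ⟨mem_range.1 (hXn hv), mem_range.1 (hXn hv), (hXm v (mem_range.1 (hXn hv))).1 hv⟩,
      fun hv => (hXm v hv.1).2 hv.2.2⟩)
  change _ = rk P.n (CutRel E (range P.n) X) at rk1
  have F₄ := Loop.frame I rank σ₃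
  set σ₄ := rank.eval I σ₃
  have h₄ := h₃.frame F₄ rfl rfl
  have F₅ := Loop.frame I (.set .ok (.eq (.lt (.var .k) (.var .rk)) (.lit 0))) σ₄
  have ok₅ : ((Cmd.set .ok (.eq (.lt (.var .k) (.var .rk)) (.lit 0))).eval I σ₄).v .ok =
      if rk P.n (CutRel E (range P.n) X) ≤ P.k then 1 else 0 := by
    rw [eval_set, St.setV_v, if_pos rfl]
    simp only [Exp.eval, h₄.env.k, rk1]
    by_cases hle : rk P.n (CutRel E (range P.n) X) ≤ P.k
    · simp [hle]
    · simp [hle, not_le.1 hle]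
  set σ₅ := (Cmd.set .ok (.eq (.lt (.var .k) (.var .rk)) (.lit 0))).eval I σ₄
  have h₅ := h₄.frame F₅ rfl rfl
  have g1 : σ₅.a .PA = pa := (F₅.a rfl).trans ((F₄.a rfl).trans ((F₃.a rfl).trans ((F₂.a rfl).trans
    ((F₁.a rfl).trans hpa))))
  have g2 : σ₅.a .RE = σ₃.a .RE := (F₅.a rfl).trans (F₄.a rfl)
  have hcol : ∀ (τ : St), τ.a .PA = σ₅.a .PA → τ.a .RE = σ₅.a .RE → ∀ v < P.n, τ.v .v = v →
      (col .v).eval I τ = if (v ∈ X ↔ pa v = 1) then 0 else 1 := by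
    intro τ e1 e2 v hv e3
    have h1 := hpa1 v hv
    have h2 := hb1 (elems R (cl v)).length
    simp only [col, Exp.eval, rd, e1, e2, e3, g1, g2, hXm v hv, hRE v hv]
    by_cases e : b (elems R (cl v)).length = pa v
    · rw [if_pos e, if_neg (by omega), if_pos (by omega)]
    · rw [if_neg e, if_pos (by omega), if_neg (by omega)]
  set c₆ := Cmd.loop .v .n (.block [
    .ite (.and (.eq (.inp (.var .v)) (.lit 1)) (col .v)) (.set .ok (.lit 0)) .skip,
    .ite (.and (.eq (.inp (.var .v)) (.lit 2)) (.eq (col .v) (.lit 0))) (.set .ok (.lit 0)) .skip]) with hc₆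
  have key₆ := loop_rule I (x := .v) (b := .n) (p := .block [
    .ite (.and (.eq (.inp (.var .v)) (.lit 1)) (col .v)) (.set .ok (.lit 0)) .skip,
    .ite (.and (.eq (.inp (.var .v)) (.lit 2)) (.eq (col .v) (.lit 0))) (.set .ok (.lit 0)) .skip]) σ₅
    (fun m τ => τ.v .ok ≠ 0 ↔ rk P.n (CutRel E (range P.n) X) ≤ P.k ∧
      ∀ v < m, (I v = 1 → (v ∈ X ↔ pa v = 1)) ∧ (I v = 2 → ¬ (v ∈ X ↔ pa v = 1)))
    (by rw [ok₅]; simp) (by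
      intro m hm τ hF hI
      rw [h₅.env.n] at hm
      set τ₀ := τ.setV .v m with hτ₀
      have e1 : τ₀.v .v = m := by simp [hτ₀]
      have e2 := hcol τ₀ (hF.a rfl) (hF.a rfl) m hm e1
      have e4 : τ₀.v .ok = τ.v .ok := by simp [hτ₀]
      have hres := check_spec (I := I) (τ := τ₀) (col .v) e2
        fun y => hcol (τ₀.setV .ok y) (hF.a rfl) (hF.a rfl) m hm (by rw [St.setV_v, if_neg (by decide), e1])
      rw [e1, e4] at hres
      have hx : ((I m = 1 → (if (m ∈ X ↔ pa m = 1) then 0 else 1) = 0) ∧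
          (I m = 2 → (if (m ∈ X ↔ pa m = 1) then 0 else 1) ≠ 0)) ↔
          (I m = 1 → (m ∈ X ↔ pa m = 1)) ∧ (I m = 2 → ¬ (m ∈ X ↔ pa m = 1)) := by
        by_cases hc : (m ∈ X ↔ pa m = 1) <;> simp [hc]
      rw [hx] at hres
      rw [hres, hI, and_assoc]
      refine and_congr_right fun _ => ⟨fun hh v hv => ?_, fun hh => ⟨fun v hv => hh v (by omega), hh m (by omega)⟩⟩
      rcases Nat.lt_succ_iff_lt_or_eq.1 hv with hv | rfl
      · exact hh.1 v hv
      · exact hh.2)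
  rw [← hc₆, h₅.env.n] at key₆
  have F₆ := Loop.frame I c₆ σ₅
  set σ₆ := c₆.eval I σ₅
  have h₆ := h₅.frame F₆ rfl rfl
  have hsol : σ₆.v .ok ≠ 0 ↔ Sol E P.n P.k (termIn I P.n pa) (termOut I P.n pa) X := by
    rw [key₆]
    constructor
    · rintro ⟨k1, k2⟩
      refine ⟨hXn, fun {v} hv => ?_, fun {v} hv => ?_, k1⟩
      · rw [termIn, mem_filter, mem_range] at hv
        obtain ⟨hvn, ⟨h1, h2⟩ | ⟨h1, h2⟩⟩ := hv
        · exact ((k2 v hvn).1 h1).2 h2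
        · have := (k2 v hvn).2 h1
          by_contra hvX
          exact this ⟨fun h => absurd h hvX, fun h => by omega⟩
      · rw [termOut, mem_filter, mem_range] at hv
        obtain ⟨hvn, ⟨h1, h2⟩ | ⟨h1, h2⟩⟩ := hv
        · intro hvX
          have := ((k2 v hvn).1 h1).1 hvX
          omega
        · intro hvX
          exact (k2 v hvn).2 h1 ⟨fun _ => h2, fun _ => hvX⟩
    · intro hs
      refine ⟨hs.rk_le, fun v hv => ⟨fun h1 => ⟨fun hvX => ?_, fun h2 => ?_⟩, fun h1 h2 => ?_⟩⟩
      · by_contra h2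
        have := hpa1 v hv
        exact hs.right (mem_filter.2 ⟨mem_range.2 hv, Or.inl ⟨h1, by omega⟩⟩) hvX
      · exact hs.left (mem_filter.2 ⟨mem_range.2 hv, Or.inl ⟨h1, h2⟩⟩)
      · have := hpa1 v hv
        by_cases h3 : pa v = 1
        · exact hs.right (mem_filter.2 ⟨mem_range.2 hv, Or.inr ⟨h1, h3⟩⟩) (h2.2 h3)
        · exact h3 (h2.1 (hs.left (mem_filter.2 ⟨mem_range.2 hv, Or.inr ⟨h1, by omega⟩⟩)))
  have o1 : σ₆.v .found = σ.v .found := (F₆.v rfl).trans ((F₅.v rfl).trans ((F₄.v rfl).trans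
    ((F₃.v rfl).trans ((F₂.v rfl).trans (F₁.v rfl)))))
  have o2 : σ₆.a .OUT = σ.a .OUT := (F₆.a rfl).trans ((F₅.a rfl).trans ((F₄.a rfl).trans
    ((F₃.a rfl).trans ((F₂.a rfl).trans (F₁.a rfl)))))
  rw [eval_ite] at hσ'
  change σ' = if σ₆.v .ok ≠ 0 then _ else _ at hσ'
  by_cases hok : σ₆.v .ok ≠ 0
  · rw [if_pos hok, eval_seq] at hσ'
    right
    have F₇ := Loop.frame I (Cmd.set .found (.lit 1)) σ₆
    set σ₇ := (Cmd.set .found (.lit 1)).eval I σ₆ with hσ₇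
    have h₇ := h₆.frame F₇ rfl rfl
    refine ⟨?_, X, hsol.1 hok, fun v hv => ?_⟩
    · rw [hσ', (Loop.frame I (fill .OUT .v .n (col .v + .lit 1)) σ₇).v rfl, hσ₇]; simp
    · rw [hσ', eval_fill .OUT .v .n (col .v + .lit 1) σ₇
        (fun v => if (v ∈ X ↔ pa v = 1) then 1 else 2)
        (fun j hj τ e1 _ e2 _ => by
          rw [h₇.env.n] at hj
          rw [eval_add, hcol τ ((e2 .PA (by decide)).trans ((F₇.a rfl).trans (F₆.a rfl)))
            ((e2 .RE (by decide)).trans ((F₇.a rfl).trans (F₆.a rfl))) j hj e1]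
          simp only [Exp.eval]
          split_ifs <;> rfl), if_pos (by rwa [h₇.env.n])]
  · rw [if_neg hok, eval_skip] at hσ'
    rw [hσ', o1, o2]
    rcases hS with ⟨s1, s2⟩ | hS
    · refine Or.inl ⟨s1, fun Z hZ => ?_⟩
      rcases hZ with hZ | rfl
      · exact s2 Z hZ
      · exact fun hs => hok (hsol.2 hs)
    · exact Or.inr hS

end Loop

/-! ### Assembly of the whole search -/

namespace Loop

open Cut Finset

variable {I : ℕ → ℕ} {P : Pars} {σ τ : St} {cl : ℕ → ℕ} {U T : Finset ℕ}

theorem MainInv.frame {A B : Finset ℕ} {m : ℕ} (h : MainInv I P A B m σ cl U T) {p : Cmd}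
    (hf : Frame p σ τ) (hp : p.keepsCtx = true) (h1 : p.setsA .LAB = false)
    (h2 : p.setsA .G = false) (h3 : p.setsA .SEEN = false) (h4 : p.setsV .stamp = false) :
    MainInv I P A B m τ cl U T :=
  ⟨h.ctx.frame hf hp h1, h.reps, h.piece, h.sol, by rw [hf.a h2]; exact h.digits,
    by rw [hf.a h3, hf.v h4]; exact h.stamps, h.progress⟩

/-- The state after the computation of the parameters. -/
structure Init (P : Pars) (σ : St) : Prop where
  n : σ.v .n = P.n
  k : σ.v .k = P.k
  K : σ.v .K = P.K
  q : σ.v .q = P.q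
  D : σ.v .D = P.D
  L : σ.v .L = P.L
  NG : σ.v .NG = P.NG
  K1 : σ.v .K1 = P.K + 1
  n1 : σ.v .n1 = P.n + 1
  zero : ∀ A i, σ.a A i = 0

theorem initRow_spec (h : Init P σ) : Env P (initRow.eval I σ) := by
  have F := Loop.frame I initRow σ
  refine ⟨(F.v rfl).trans h.n, (F.v rfl).trans h.k, (F.v rfl).trans h.K, (F.v rfl).trans h.q,
    (F.v rfl).trans h.D, (F.v rfl).trans h.L, (F.v rfl).trans h.NG, (F.v rfl).trans h.K1, ?_⟩
  have hn : ((Cmd.set .cnt (.lit 0)).eval I σ).v .n = P.n := by simp [h.n]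
  have key := loop_rule I (x := .u) (b := .n)
    (p := .seq (.put .ROW (.var .u) (.var .cnt)) (.set .cnt (.var .cnt + .var .n)))
    ((Cmd.set .cnt (.lit 0)).eval I σ)
    (fun m τ => τ.v .cnt = m * P.n ∧ ∀ u < m, τ.a .ROW u = u * P.n) (by simp) (by
      rintro m hm τ hF ⟨i1, i2⟩
      have e1 : τ.v .n = P.n := (by simpa using hF.v (y := .n) rfl : τ.v .n = σ.v .n).trans h.n
      refine ⟨by simp [i1, e1, add_mul], fun u hu => ?_⟩
      by_cases e : u = m
      · subst e; simp [i1]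
      · have := i2 u (by omega)
        simp [e, this])
  rw [hn] at key
  exact key.2

/-- The algorithm finds a cut of rank at most `k`, if there is one. -/
theorem solve_spec (hv : P.Valid) (h : Init P σ) (hE : IsGraph (adj I P.n) P.n) {f : ℕ → ℕ}
    (hf : Proper (adj I P.n) f P.n) (hI : (asSet P.n I).card ≤ P.tau) :
    ∃ pa, Proper (adj I P.n) pa P.n ∧
      Answer I P pa (fun _ => True) ((solve.eval I σ).v .found) ((solve.eval I σ).a .OUT) := by
  set σ' := solve.eval I σ with hσ'
  clear_value σ'
  simp only [solve, setup, eval_block_cons, eval_block_nil] at hσ'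
  have h₁ := initRow_spec (I := I) h
  have F₁ := Loop.frame I initRow σ
  set σ₁ := initRow.eval I σ
  have hpa := bipartition_spec h₁ hf
  have F₂ := Loop.frame I bipartition σ₁
  set σ₂ := bipartition.eval I σ₁
  have h₂ : Env P σ₂ := h₁.frame F₂ rfl
  have F₃ := Loop.frame I (fill .CL .v .n (.var .v)) σ₂
  have hCL : ∀ v < P.n, ((fill .CL .v .n (.var .v)).eval I σ₂).a .CL v = v := by
    intro v hv
    rw [eval_fill .CL .v .n (.var .v) σ₂ (fun v => v) (fun j _ τ h1 _ _ _ => h1), if_pos (by rwa [h₂.n])]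
  set σ₃ := (fill .CL .v .n (.var .v)).eval I σ₂
  have h₃ : Env P σ₃ := h₂.frame F₃ rfl
  have c₄ := resetPiece_spec (I := I) h₃ rfl (fun i _ => by
    rw [F₃.a rfl, F₂.a rfl, F₁.a rfl, h.zero])
  have F₄ := Loop.frame I resetPiece σ₃
  set σ₄ := resetPiece.eval I σ₃
  have F₅ := Loop.frame I (Cmd.set .stamp (.lit 0)) σ₄
  set σ₅ := (Cmd.set .stamp (.lit 0)).eval I σ₄
  have c₅ := c₄.frame F₅ rfl rfl
  set pa := σ₂.a .PA with hpadef
  set cl₀ := σ₃.a .CL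
  set A := termIn I P.n pa with hA
  set B := termOut I P.n pa with hB
  have hAI : A ⊆ asSet P.n I := fun v hv => by
    rw [hA, termIn, mem_filter, mem_range] at hv; rw [mem_asSet]; omega
  have hBI : B ⊆ asSet P.n I := fun v hv => by
    rw [hB, termOut, mem_filter, mem_range] at hv; rw [mem_asSet]; omega
  have hz : ∀ {C : Arr} (_ : setup.setsA C = false) (i : ℕ), σ₅.a C i = 0 := by
    intro C hC i
    rw [show σ₅ = setup.eval I σ from rfl, (Loop.frame I setup σ).a hC, h.zero]
  have inv₀ : MainInv I P A B 0 σ₅ cl₀ (range P.n) (asSet P.n I) := by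
    refine ⟨c₅, fun v hv => ?_, ⟨⟨Subset.rfl, fun _ _ v hv' _ => hv'⟩, asSet_sub _ _, hI,
      fun _ hv => hAI hv, fun _ hv => hBI hv,
      fun hu hv' he => absurd (mem_range.2 (hE.lt (hE.symm he))) hv', Or.inl rfl⟩, ?_, ?_, ?_, Or.inr ?_⟩
    · rw [mem_range] at hv
      rw [hCL v hv, hCL v hv]
      exact ⟨mem_range.2 hv, rfl⟩
    · rintro ⟨X, hX⟩
      refine ⟨X, hX, hX.sub, fun u hu v hv' e => ?_⟩
      rw [hCL u (mem_range.1 (hX.sub hu)), hCL v (mem_range.1 hv')] at e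
      exact e ▸ hu
    · intro i _; exact hz rfl i
    · intro s; rw [hz rfl s]; exact Nat.zero_le _
    · have := cnum_le (cl := cl₀) (n := P.n)
      have := Nat.mul_le_mul_right (P.n + 1) this
      omega
  have hn1 : σ₅.v .n1 = P.n + 1 := by
    rw [show σ₅ = setup.eval I σ from rfl, (Loop.frame I setup σ).v rfl, h.n1]
  -- The pair of loop variables is used only as a counter of `(n + 1)²` rounds.
  have key := loop_rule2 (I := I) σ₅ (P.n + 1) hn1 (x := .it) (y := .jt) (p := Loop.refine) rfl rfl
    (fun i j τ => ∃ cl U T, MainInv I P A B (i * (P.n + 1) + j) τ cl U T)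
    ⟨_, _, _, by simpa using inv₀⟩
    (fun i j τ c ⟨cl, U, T, h⟩ => ⟨cl, U, T, h.frame (Loop.frame I (.set .it (.lit c)) τ) rfl rfl rfl rfl rfl⟩)
    (fun i j τ c ⟨cl, U, T, h⟩ => ⟨cl, U, T, h.frame (Loop.frame I (.set .jt (.lit c)) τ) rfl rfl rfl rfl rfl⟩)
    (fun i hi τ ⟨cl, U, T, h⟩ => ⟨cl, U, T, by rw [add_mul, one_mul, add_zero]; exact h⟩)
    (fun i hi j hj τ hF hu hv' ⟨cl, U, T, h⟩ => refine_spec hv hE hAI hBI hI h)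
  obtain ⟨cl, U, T, inv⟩ := key
  have F₆ := Loop.frame I (.loop .it .n1 (.loop .jt .n1 Loop.refine)) σ₅
  set σ₆ := (Cmd.loop .it .n1 (.loop .jt .n1 Loop.refine)).eval I σ₅
  have c₇ := resetPiece_spec (I := I) inv.ctx.env inv.ctx.cls inv.ctx.clean
  have F₇ := Loop.frame I resetPiece σ₆
  set σ₇ := resetPiece.eval I σ₆
  have F₈ := Loop.frame I (Cmd.set .found (.lit 0)) σ₇
  have hfound : ((Cmd.set .found (.lit 0)).eval I σ₇).v .found = 0 := by simp
  set σ₈ := (Cmd.set .found (.lit 0)).eval I σ₇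
  have c₈ := c₇.frame F₈ rfl rfl
  have hPA : σ₈.a .PA = pa := (F₈.a rfl).trans ((F₇.a rfl).trans ((F₆.a rfl).trans
    ((F₅.a rfl).trans ((F₄.a rfl).trans (F₃.a rfl)))))
  have hG : ∀ i, P.L ≤ i → σ₈.a .G i = 0 := by
    rw [F₈.a rfl, F₇.a rfl]; exact inv.digits
  have main := (forGuesses_rule (I := I) (σ := σ₈) (p := tryGuess) (L := P.L) c₈.env.L
    (by rw [c₈.env.NG, hv.NG]) hG rfl rfl
    (fun m τ => Answer I P pa (fun X => ∃ g < m, X = cutOf cl P.n (digits P.L g)) (τ.v .found) (τ.a .OUT))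
    (Or.inl ⟨hfound, fun X ⟨g, hg, _⟩ => absurd hg (Nat.not_lt_zero g)⟩)
    (fun m τ τ' hF hI => by
      rw [hF.v (y := .found) rfl, hF.a (B := .OUT) rfl]; exact hI)
    (by
      intro g hg τ hF hGτ hI
      have hT := tryGuess_spec (I := I) (c₈.frame hF rfl rfl) inv.reps ((hF.a rfl).trans hPA)
        (fun v hv => hpa.le hv) hGτ (fun i => by
          rw [digits]; split_ifs
          · omega
          · omega) hI
      rcases hT with ⟨t1, t2⟩ | hT
      · refine Or.inl ⟨t1, fun X ⟨g', hg', e⟩ => t2 X ?_⟩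
        rcases Nat.lt_succ_iff_lt_or_eq.1 hg' with hg' | rfl
        · exact Or.inl ⟨g', hg', e⟩
        · exact Or.inr e
      · exact Or.inr hT)).1
  rw [← hσ'] at main
  refine ⟨pa, hpa, ?_⟩
  rcases main with ⟨m1, m2⟩ | m
  · refine Or.inl ⟨m1, fun X _ hX => ?_⟩
    -- Any solution can be traded for one that splits no class. The measure starts at no more than
    -- `n * (n + 1) + n`, less than the number of rounds, so at most `q ≤ L` classes remain and the
    -- guesses cover this solution.
    obtain ⟨X', hX', hc⟩ := inv.sol ⟨X, hX⟩
    have hq : cnum cl (range P.n) ≤ P.q := by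
      rcases inv.progress with h | h
      · exact h
      · have : (P.n + 1) * (P.n + 1) = P.n * (P.n + 1) + P.n + 1 := by ring
        omega
    have hqL : P.q ≤ P.L := by
      rw [hv.L, hv.D]
      nlinarith [Nat.zero_le ((P.K + 1) * (P.q + 2) * (P.q + P.K))]
    obtain ⟨g, hg, e⟩ := exists_cutOf inv.reps (hq.trans hqL) hc
    exact m2 X' ⟨g, hg, e.symm⟩ hX'
  · exact Or.inr m

end Loop

namespace Loop

variable {I : ℕ → ℕ} {σ : St}

/-! #### The parameters and the running time -/

/-- The parameters of the algorithm for given `n`, `k` and `t`. -/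
def pars (n k t : ℕ) : Pars :=
  let K := 4 * (k * k)
  let tau := t + 2 * K
  let q := 2 ^ 2 ^ (tau + k + tau * tau)
  let D := (K + 1) * (q + 2) + 1
  let L := tau + D * (q + K)
  ⟨n, k, K, tau, q, D, L, 2 ^ L⟩

theorem pars_valid (n k t : ℕ) : (pars n k t).Valid :=
  ⟨rfl, Nat.le_add_left _ _, rfl, rfl, rfl, rfl⟩

theorem eval_add_loop {x y b i : Var} (h1 : x ≠ i) (h2 : x ≠ y) (h3 : y ≠ i) :
    ((Cmd.loop i b (.set x (.var x + .var y))).eval I σ).v x = σ.v x + σ.v b * σ.v y := by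
  refine (loop_rule I σ (fun m τ => τ.v x = σ.v x + m * σ.v y ∧ τ.v y = σ.v y) (by simp) ?_).1
  rintro m - τ - ⟨i1, i2⟩
  simp [h1, h3, Ne.symm h2, i1, i2]
  ring

theorem eval_double_loop {x b i : Var} (h1 : x ≠ i) :
    ((Cmd.loop i b (.set x (.var x + .var x))).eval I σ).v x = σ.v x * 2 ^ σ.v b := by
  refine loop_rule I σ (fun m τ => τ.v x = σ.v x * 2 ^ m) (by simp) ?_
  rintro m - τ - i1
  simp [h1, i1, pow_succ]
  ring

/-- `p` takes at most `c * B ^ d` steps, where `c` depends only on `p`. -/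
def Cheap (I : ℕ → ℕ) (B d : ℕ) (p : Cmd) (σ : St) : Prop := p.cost I σ ≤ p.coef * B ^ d

section Cheap

variable {B d : ℕ} {p q : Cmd}

theorem Cheap.seq (hB : 1 ≤ B) (hp : Cheap I B d p σ) (hq : Cheap I B d q (p.eval I σ)) :
    Cheap I B d (.seq p q) σ := by
  have := Nat.one_le_pow d B hB
  simp only [Cheap, Cmd.cost, Cmd.coef, add_mul] at *
  omega

theorem Cheap.of_bounds (hB : 1 ≤ B) (P : Var → Bool) (hd : p.depth ≤ d) (h1 : p.bounds P = true)
    (h2 : ∀ y, P y = true → p.setsV y = false) (h3 : ∀ y, P y = true → σ.v y ≤ B) :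
    Cheap I B d p σ :=
  (cost_le I P B hB p σ h1 h2 h3).trans (Nat.mul_le_mul_left _ (Nat.pow_le_pow_right hB hd))

theorem Cheap.set (hB : 1 ≤ B) (x : Var) (e : Exp) : Cheap I B d (.set x e) σ := by
  have := Nat.one_le_pow d B hB
  simp only [Cheap, Cmd.cost, Cmd.coef]
  exact Nat.le_mul_of_pos_right _ this

theorem Cheap.loop_set (hB : 1 ≤ B) (hd : 1 ≤ d) {i b x : Var} {e : Exp} (h1 : b ≠ i) (h2 : b ≠ x)
    (hb : σ.v b ≤ B) : Cheap I B d (.loop i b (.set x e)) σ :=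
  Cheap.of_bounds hB (fun y => y = b) hd (by simp [Cmd.bounds])
    (fun y hy => by rw [decide_eq_true_eq] at hy; subst hy; simp [Cmd.setsV, h1, h2])
    (fun y hy => by rw [decide_eq_true_eq] at hy; subst hy; exact hb)

end Cheap

/-- The whole algorithm. -/
def algorithm : Cmd := .block [paramK, paramTau, paramNs, paramQ, paramD, paramL, paramNG, solve]

/-- The variables that bound the loops of `solve`. -/
def isBound : Var → Bool
  | .n | .n1 | .k | .K1 | .D | .L | .NG => true
  | _ => false

theorem eval_paramK : (paramK.eval I σ).v .K = 4 * (σ.v .k * σ.v .k) := by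
  have inner : ∀ τ : St, ((Cmd.loop .u .k (.set .K (.var .K + .lit 4))).eval I τ).v .K =
      τ.v .K + 4 * τ.v .k := fun τ => loop_rule I τ (fun m τ' => τ'.v .K = τ.v .K + 4 * m) (by simp)
    (by rintro m - τ' - i1; simp [i1]; ring)
  have h1 : ((Cmd.set .K (.lit 0)).eval I σ).v .k = σ.v .k := by simp
  have := loop_rule I (x := .i) (b := .k) (p := .loop .u .k (.set .K (.var .K + .lit 4)))
    ((Cmd.set .K (.lit 0)).eval I σ) (fun m τ => τ.v .K = 4 * (m * σ.v .k)) (by simp) (by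
      rintro m - τ hF i1
      have h2 : (τ.setV .i m).v .k = σ.v .k := (hF.v rfl).trans h1
      rw [inner, h2]
      simp [i1]
      ring)
  rw [h1] at this
  exact this

/-- All loop bounds are below `B`: by the chain `2 ^ sb < q ≤ D ≤ L < NG` the parameters are bounded
by `NG`, and `n + 1` is bounded because of the factor `max n 1`. The exponent is at least `2` on
account of the nested loop in `paramK`. -/
theorem algorithm_spec {P : Pars} (hv : P.Valid) {n k t : ℕ} (hPn : P.n = n) (hPk : P.k = k)
    (hPtau : P.tau = t + (P.K + P.K)) (hn : σ.v .n = n) (hk : σ.v .k = k) (ht : σ.v .t = t)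
    (h0 : ∀ A i, σ.a A i = 0) {B : ℕ} (hB : (P.NG + 2) * max n 1 ≤ B) :
    (∃ σ', Init P σ' ∧ algorithm.eval I σ = solve.eval I σ') ∧
      Cheap I B (max 2 solve.depth) algorithm σ := by
  have p1 : 1 ≤ max n 1 := le_max_right _ _
  have hNB : P.NG + 2 ≤ B := (Nat.le_mul_of_pos_right _ p1).trans hB
  have hB1 : 1 ≤ B := by omega
  have hd : 1 ≤ max 2 solve.depth := le_trans (by omega) (le_max_left _ _)
  set d := max 2 solve.depth with hdd
  set sb := P.tau + P.k + P.tau * P.tau with hsb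
  have b1 : sb < 2 ^ sb := Nat.lt_two_pow_self
  have b2 : 2 ^ sb < P.q := by rw [hv.q]; exact Nat.lt_two_pow_self
  have b3 : P.L < P.NG := by rw [hv.NG]; exact Nat.lt_two_pow_self
  have b4 : P.D ≤ P.L := by
    rw [hv.L]
    exact le_trans (Nat.le_mul_of_pos_right _ (by omega)) (Nat.le_add_left _ _)
  have b5 : P.K + 1 ≤ P.D ∧ P.q ≤ P.D := by
    rw [hv.D]
    constructor <;> nlinarith [Nat.zero_le (P.K * P.q)]
  have b6 : P.tau ≤ sb ∧ P.k ≤ sb := by omega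
  have b7 : n + 1 ≤ B := by
    have : 2 * max n 1 ≤ (P.NG + 2) * max n 1 := Nat.mul_le_mul_right _ (by omega)
    have := le_max_left n 1
    omega
  simp only [algorithm, eval_block_cons, eval_block_nil]
  have F₁ := Loop.frame I paramK σ
  have v₁ := eval_paramK (I := I) (σ := σ)
  have c₁ : Cheap I B d paramK σ := Cheap.of_bounds hB1 (fun y => y = .k) (by
    exact le_max_left _ _) rfl (fun y hy => by rw [decide_eq_true_eq] at hy; subst hy; rfl)
    (fun y hy => by rw [decide_eq_true_eq] at hy; subst hy; omega)
  have e₁ : algorithm = .seq paramK (.block [paramTau, paramNs, paramQ, paramD, paramL, paramNG, solve]) := rfl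
  set σ₁ := paramK.eval I σ
  have K₁ : σ₁.v .K = P.K := by rw [v₁, hk, hv.K, hPk]
  have F₂ := Loop.frame I paramTau σ₁
  have v₂ : (paramTau.eval I σ₁).v .tau = P.tau ∧ (paramTau.eval I σ₁).v .sb = sb ∧
      Cheap I B d paramTau σ₁ := by
    simp only [paramTau, eval_block_cons, eval_block_nil]
    set s := (Cmd.set .sb (.var .tau + .var .k)).eval I
      ((Cmd.set .tau (.var .t + (.var .K + .var .K))).eval I σ₁) with hs
    have s1 : s.v .tau = P.tau := by
      rw [hPtau]; simp [hs, K₁]; rw [F₁.v rfl, ht]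
    have s2 : s.v .sb = P.tau + P.k := by
      rw [hPtau, hPk]; simp [hs, K₁]; rw [F₁.v rfl, ht, F₁.v rfl, hk]
    refine ⟨?_, ?_, ?_⟩
    · rw [(Loop.frame I (.loop .i .tau (.set .sb (.var .sb + .var .tau))) s).v rfl, s1]
    · rw [eval_add_loop (x := .sb) (y := .tau) (b := .tau) (i := .i) (by decide) (by decide) (by decide),
        s1, s2]
    · exact (Cheap.set hB1 _ _).seq hB1 ((Cheap.set hB1 _ _).seq hB1
        (Cheap.loop_set hB1 hd (by decide) (by decide) (by change s.v .tau ≤ B; omega)))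
  obtain ⟨tau₂, sb₂, c₂⟩ := v₂
  set σ₂ := paramTau.eval I σ₁
  have F₃ := Loop.frame I paramNs σ₂
  have ns₃ : (paramNs.eval I σ₂).v .ns = 2 ^ sb := by
    rw [paramNs, eval_seq, eval_double_loop (x := .ns) (b := .sb) (i := .i) (by decide)]; simp [sb₂]
  have c₃ : Cheap I B d paramNs σ₂ := (Cheap.set hB1 _ _).seq hB1
    (Cheap.loop_set hB1 hd (by decide) (by decide) (by simp [sb₂]; omega))
  set σ₃ := paramNs.eval I σ₂
  have F₄ := Loop.frame I paramQ σ₃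
  have q₄ : (paramQ.eval I σ₃).v .q = P.q := by
    rw [paramQ, eval_seq, eval_double_loop (x := .q) (b := .ns) (i := .i) (by decide), hv.q]
    simp [ns₃, hsb]
  have c₄ : Cheap I B d paramQ σ₃ := (Cheap.set hB1 _ _).seq hB1
    (Cheap.loop_set hB1 hd (by decide) (by decide) (by simp [ns₃]; omega))
  set σ₄ := paramQ.eval I σ₃
  have K₄ : σ₄.v .K = P.K := (F₄.v rfl).trans ((F₃.v rfl).trans ((F₂.v rfl).trans K₁))
  have tau₄ : σ₄.v .tau = P.tau := (F₄.v rfl).trans ((F₃.v rfl).trans tau₂)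
  have F₅ := Loop.frame I paramD σ₄
  have v₅ : (paramD.eval I σ₄).v .D = P.D ∧ (paramD.eval I σ₄).v .K1 = P.K + 1 ∧
      Cheap I B d paramD σ₄ := by
    simp only [paramD, eval_block_cons, eval_block_nil]
    set s := (Cmd.set .D (.lit 1)).eval I ((Cmd.set .q2 (.var .q + .lit 2)).eval I
      ((Cmd.set .K1 (.var .K + .lit 1)).eval I σ₄)) with hs
    have s1 : s.v .K1 = P.K + 1 := by simp [hs, K₄]
    have s2 : s.v .q2 = P.q + 2 := by simp [hs, q₄]
    have s3 : s.v .D = 1 := by simp [hs]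
    refine ⟨?_, ?_, ?_⟩
    · rw [eval_add_loop (x := .D) (y := .q2) (b := .K1) (i := .i) (by decide) (by decide) (by decide),
        s1, s2, s3, hv.D, add_comm]
    · rw [(Loop.frame I (.loop .i .K1 (.set .D (.var .D + .var .q2))) s).v rfl, s1]
    · exact (Cheap.set hB1 _ _).seq hB1 ((Cheap.set hB1 _ _).seq hB1 ((Cheap.set hB1 _ _).seq hB1
        (Cheap.loop_set hB1 hd (by decide) (by decide) (by change s.v .K1 ≤ B; omega))))
  obtain ⟨D₅, K1₅, c₅⟩ := v₅
  set σ₅ := paramD.eval I σ₄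
  have K₅ : σ₅.v .K = P.K := (F₅.v rfl).trans K₄
  have tau₅ : σ₅.v .tau = P.tau := (F₅.v rfl).trans tau₄
  have q₅ : σ₅.v .q = P.q := (F₅.v rfl).trans q₄
  have F₆ := Loop.frame I paramL σ₅
  have v₆ : (paramL.eval I σ₅).v .L = P.L ∧ Cheap I B d paramL σ₅ := by
    simp only [paramL, eval_block_cons, eval_block_nil]
    set s := (Cmd.set .L (.var .tau)).eval I ((Cmd.set .qK (.var .q + .var .K)).eval I σ₅) with hs
    have s1 : s.v .D = P.D := by simp [hs, D₅]
    have s2 : s.v .qK = P.q + P.K := by simp [hs, q₅, K₅]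
    have s3 : s.v .L = P.tau := by simp [hs, tau₅]
    refine ⟨?_, ?_⟩
    · rw [eval_add_loop (x := .L) (y := .qK) (b := .D) (i := .i) (by decide) (by decide) (by decide),
        s1, s2, s3, hv.L]
    · exact (Cheap.set hB1 _ _).seq hB1 ((Cheap.set hB1 _ _).seq hB1
        (Cheap.loop_set hB1 hd (by decide) (by decide) (by change s.v .D ≤ B; omega)))
  obtain ⟨L₆, c₆⟩ := v₆
  set σ₆ := paramL.eval I σ₅
  have n₆ : σ₆.v .n = P.n := (F₆.v rfl).trans ((F₅.v rfl).trans ((F₄.v rfl).trans ((F₃.v rfl).trans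
    ((F₂.v rfl).trans ((F₁.v rfl).trans (hn.trans hPn.symm))))))
  have k₆ : σ₆.v .k = P.k := (F₆.v rfl).trans ((F₅.v rfl).trans ((F₄.v rfl).trans ((F₃.v rfl).trans
    ((F₂.v rfl).trans ((F₁.v rfl).trans (hk.trans hPk.symm))))))
  have F₇ := Loop.frame I paramNG σ₆
  have v₇ : (paramNG.eval I σ₆).v .NG = P.NG ∧ (paramNG.eval I σ₆).v .n1 = P.n + 1 ∧
      Cheap I B d paramNG σ₆ := by
    simp only [paramNG, eval_block_cons, eval_block_nil]
    set s := (Cmd.set .NG (.lit 1)).eval I σ₆ with hs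
    have s1 : s.v .L = P.L := by simp [hs, L₆]
    have s2 : s.v .NG = 1 := by simp [hs]
    have s3 : s.v .n = P.n := by simp [hs, n₆]
    have Fs := Loop.frame I (.loop .i .L (.set .NG (.var .NG + .var .NG))) s
    refine ⟨?_, ?_, ?_⟩
    · rw [eval_set, St.setV_v, if_neg (by decide),
        eval_double_loop (x := .NG) (b := .L) (i := .i) (by decide), s1, s2, hv.NG, one_mul]
    · rw [eval_set, St.setV_v, if_pos rfl, eval_add, Exp.eval, Exp.eval, Fs.v rfl, s3]
    · exact (Cheap.set hB1 _ _).seq hB1 ((Cheap.loop_set hB1 hd (by decide) (by decide)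
        (by change s.v .L ≤ B; omega)).seq hB1 (Cheap.set hB1 _ _))
  obtain ⟨NG₇, n1₇, c₇⟩ := v₇
  set σ₇ := paramNG.eval I σ₆
  have hInit : Init P σ₇ := ⟨(F₇.v rfl).trans n₆, (F₇.v rfl).trans k₆,
    (F₇.v rfl).trans ((F₆.v rfl).trans K₅), (F₇.v rfl).trans ((F₆.v rfl).trans q₅),
    (F₇.v rfl).trans ((F₆.v rfl).trans D₅), (F₇.v rfl).trans L₆, NG₇,
    (F₇.v rfl).trans ((F₆.v rfl).trans K1₅), n1₇, fun A i => by
      rw [F₇.a rfl, F₆.a rfl, F₅.a rfl, F₄.a rfl, F₃.a rfl, F₂.a rfl, F₁.a rfl, h0]⟩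
  have c₈ : Cheap I B d solve σ₇ := Cheap.of_bounds hB1 isBound (le_max_right _ _) rfl
    (fun y hy => by cases y <;> first | rfl | exact absurd hy (by decide))
    (fun y hy => by
      cases y <;> first
        | (exfalso; revert hy; decide)
        | (rw [hInit.n, hPn]; omega)
        | (rw [hInit.k]; omega)
        | (rw [hInit.D]; omega)
        | (rw [hInit.L]; omega)
        | (rw [hInit.NG]; omega)
        | (rw [hInit.K1]; omega)
        | (rw [hInit.n1, hPn]; omega))
  exact ⟨⟨σ₇, hInit, rfl⟩, c₁.seq hB1 (c₂.seq hB1 (c₃.seq hB1 (c₄.seq hB1 (c₅.seq hB1 (c₆.seq hB1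
    (c₇.seq hB1 c₈))))))⟩

end Loop

namespace Loop

open RAM

/-! #### The machine program -/

theorem Exec.count {r c : ℕ} {p : Stmt} (Inv : ℕ → (ℕ → ℕ) → (ℕ → ℕ) → Prop)
    (hs : ∀ j R M, Inv (j + 1) R M → R r = j + 1 →
      ∃ T ≤ c, ∃ R' M', Exec p R M R' M' T ∧ R' r = j ∧ Inv j R' M') :
    ∀ m R M, Inv m R M → R r = m →
      ∃ T ≤ (c + 1) * m + 1, ∃ R' M', Exec (.loop r p) R M R' M' T ∧ Inv 0 R' M' := by
  intro m
  induction m with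
  | zero => intro R M h h0; exact ⟨1, by omega, R, M, Exec.loop_zero h0, h⟩
  | succ m ih =>
    intro R M h h0
    obtain ⟨t₁, l₁, R₁, M₁, e₁, r₁, i₁⟩ := hs m R M h h0
    obtain ⟨t₂, l₂, R₂, M₂, e₂, i₂⟩ := ih R₁ M₁ i₁ r₁
    refine ⟨_, ?_, R₂, M₂, Exec.loop_succ (by omega) e₁ e₂, i₂⟩
    rw [mul_add]
    omega

theorem Sim.self {R M : ℕ → ℕ} {b : ℕ} (h1 : R 1 = b) (h4 : R 4 = 1) :
    Sim (fun i => if i < b then M i else 0) b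
      ⟨fun x => R (reg x), fun A i => M (b + 32 * i + A.ctorIdx)⟩ R M :=
  ⟨fun _ => rfl, h1, h4, fun _ _ => rfl, fun _ h => by simp [h]⟩

/-- Moves the input to its registers and computes the size of the input. -/
def prelude : Stmt :=
  -- Registers `0`, `3` and `6` belong to `n`, `k` and `t`. The value `k` has to leave register `1`
  -- before that register starts to accumulate `n + n²`, the end of the input.
  .seq (.copy 6 2) (.seq (.copy 3 1) (.seq (.const 4 1) (.seq (.copy 1 0) (.seq (.copy 5 0)
    (.loop 5 (.seq (.add 1 1 0) (.sub 5 5 4)))))))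

theorem prelude_spec {R : ℕ → ℕ} {n k t : ℕ} (M : ℕ → ℕ) (h0 : R 0 = n) (h1 : R 1 = k) (h2 : R 2 = t) :
    ∃ T ≤ 4 * n + 11, ∃ R', Exec prelude R M R' M T ∧ R' 0 = n ∧ R' 3 = k ∧ R' 6 = t ∧ R' 4 = 1 ∧
      R' 1 = n + n * n := by
  obtain ⟨T, hT, R', M', e, i1, i2, i3, i4, i5, i6⟩ := Exec.count (r := 5) (c := 3)
    (p := .seq (.add 1 1 0) (.sub 5 5 4)) (fun j R' M' => M' = M ∧ R' 0 = n ∧ R' 3 = k ∧ R' 6 = t ∧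
      R' 4 = 1 ∧ R' 1 + j * n = n + n * n) (by
      rintro j R' M' ⟨rfl, i2, i3, i4, i5, i6⟩ h5
      refine ⟨_, le_rfl, _, _, (Exec.add _ _ _).seq (Exec.sub _ _ _), ?_⟩
      simp only [Function.update_apply]
      refine ⟨by simp [h5, i5], trivial, by simpa, by simpa, by simpa, by simpa, ?_⟩
      simp [i2, ← i6]; ring) n
    (Function.update (Function.update (Function.update (Function.update (Function.update R 6 (R 2)) 3
      (R 1)) 4 1) 1 (R 0)) 5 (R 0)) M (by simp [Function.update_apply, h0, h1, h2])
    (by simp [h0])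
  subst i1
  exact ⟨1 + (1 + (1 + (1 + (1 + T + 1) + 1) + 1) + 1) + 1, by omega, R',
    (Exec.copy _ _).seq ((Exec.copy _ _).seq ((Exec.const _ _).seq ((Exec.copy _ _).seq
      ((Exec.copy _ _).seq (by simpa [Function.update_apply] using e))))), i2, i3, i4, i5,
    by simpa using i6⟩

/-- Moves the output to the beginning of the memory. -/
def postlude : Stmt :=
  .seq (.copy 5 0) (.seq (.loop 5 (.seq (.sub 5 5 4) (.seq (.copy (reg .v) 5)
    (.seq ((Exp.get .OUT (.var .v)).compile 0) (.store (reg .v) (tmp 0))))))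
    (.copy 0 (reg .found)))

/-- The copy loop writes only below `n ≤ b`, whereas the array `OUT` lies from `b` on, so no output
is overwritten before it is read. Register `0` serves as the loop bound and receives the answer only
afterwards. -/
theorem postlude_spec {R M : ℕ → ℕ} {n b : ℕ} (h0 : R 0 = n) (h1 : R 1 = b) (h4 : R 4 = 1)
    (hb : n ≤ b) :
    ∃ T ≤ 28 * n + 5, ∃ R' M', Exec postlude R M R' M' T ∧ R' 0 = R (reg .found) ∧
      ∀ v < n, M' v = M (b + 32 * v + Arr.OUT.ctorIdx) := by
  obtain ⟨T, hT, R', M', e, i1, i2, i3, i4, i5, i6⟩ := Exec.count (r := 5) (c := 27)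
    (p := .seq (.sub 5 5 4) (.seq (.copy (reg .v) 5)
      (.seq ((Exp.get .OUT (.var .v)).compile 0) (.store (reg .v) (tmp 0)))))
    (fun j R' M' => j ≤ n ∧ R' 1 = b ∧ R' 4 = 1 ∧ R' (reg .found) = R (reg .found) ∧
      (∀ v, j ≤ v → v < n → M' v = M (b + 32 * v + Arr.OUT.ctorIdx)) ∧
      ∀ v, M' (b + 32 * v + Arr.OUT.ctorIdx) = M (b + 32 * v + Arr.OUT.ctorIdx)) (by
      rintro j R' M' ⟨i1, i2, i3, i4, i5, i6⟩ h5
      set R₁ := Function.update (Function.update R' 5 j) (reg .v) j with hR₁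
      have g1 : R₁ 1 = b := by
        rw [hR₁, Function.update_of_ne (by decide), Function.update_of_ne (by decide), i2]
      have g4 : R₁ 4 = 1 := by
        rw [hR₁, Function.update_of_ne (by decide), Function.update_of_ne (by decide), i3]
      obtain ⟨t, ht, R₂, e₂, v₂, k₂⟩ := (Exp.get .OUT (.var .v)).compile_spec (b := b)
        (I := fun i => if i < b then M' i else 0) (fun i hi => if_neg (by omega)) 0 _ R₁ M'
        (Sim.self g1 g4)
      have hv : R₁ (reg .v) = j := by simp [hR₁]
      have hv₂ : R₂ (reg .v) = j := by rw [k₂ _ (Or.inl (by simp [reg])), hv]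
      simp only [Exp.eval, hv, i6] at v₂
      refine ⟨1 + (1 + (t + 1 + 1) + 1) + 1, ?_, R₂, Function.update M' j (R₂ (tmp 0)), ?_, ?_, ?_⟩
      · simp only [Exp.cost] at ht; omega
      · have a1 := Exec.sub (R := R') (M := M') 5 5 4
        rw [h5, i3, Nat.add_sub_cancel] at a1
        have a2 := Exec.copy (R := Function.update R' 5 j) (M := M') (reg .v) 5
        rw [Function.update_self] at a2
        have a3 := Exec.store (R := R₂) (M := M') (reg .v) (tmp 0)
        rw [hv₂] at a3
        exact a1.seq (a2.seq (e₂.seq a3))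
      · rw [k₂ _ (by omega), hR₁, Function.update_of_ne (by decide), Function.update_self]
      · refine ⟨by omega, ?_, ?_, ?_, fun v h hv => ?_, fun v => ?_⟩
        · rw [k₂ _ (by simp only [tmp]; omega), g1]
        · rw [k₂ _ (by simp only [tmp]; omega), g4]
        · rw [k₂ _ (Or.inl (by simp [reg])), hR₁, Function.update_of_ne (by decide),
            Function.update_of_ne (by decide), i4]
        · rw [Function.update_apply, v₂]
          split_ifs with hj
          · rw [hj]
          · exact i5 v (by omega) hv
        · rw [Function.update_of_ne (by omega), i6]) n
    (Function.update R 5 n) M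
    ⟨le_rfl, by simpa, by simpa, Function.update_of_ne (by decide) _ _,
      fun v h h' => by omega, fun _ => rfl⟩ (by simp)
  refine ⟨1 + (T + 1 + 1) + 1, by omega, Function.update R' 0 (R' (reg .found)), M', ?_, ?_,
    fun v hv => i5 v (by omega) hv⟩
  · have a1 := Exec.copy (R := R) (M := M) 5 0
    rw [h0] at a1
    exact a1.seq (e.seq (Exec.copy _ _))
  · simp [i4]

/-- The program of the machine. -/
def program : Program := ⟨.seq prelude (.seq (algorithm.compile 0) postlude), []⟩

/-- A halted configuration does not change, so a bound on the running time may replace its exact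
value. -/
theorem run_eq_of_exec {P : Program} {R M R' M' : ℕ → ℕ} {T T' : ℕ} (h : Exec P.main R M R' M' T)
    (hT : T ≤ T') : run P R M T' = ⟨[], R', M'⟩ := by
  obtain ⟨c, rfl⟩ := Nat.exists_eq_add_of_le hT
  rw [run, add_comm, Function.iterate_add_apply, h P []]
  exact Function.iterate_fixed rfl c

theorem program_spec {R M : ℕ → ℕ} {n k t : ℕ} (h0 : R 0 = n) (h1 : R 1 = k) (h2 : R 2 = t)
    (hM : ∀ i, n + n * n ≤ i → M i = 0) :
    ∃ σ : St, σ.v .n = n ∧ σ.v .k = k ∧ σ.v .t = t ∧ (∀ A i, σ.a A i = 0) ∧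
      ∃ T ≤ algorithm.cost M σ + 32 * n + 18, ∃ R' M', Exec program.main R M R' M' T ∧
        R' 0 = (algorithm.eval M σ).v .found ∧
        ∀ v < n, M' v = (algorithm.eval M σ).a .OUT v := by
  obtain ⟨t₁, l₁, R₁, e₁, i0, i3, i6, i4, i1⟩ := prelude_spec M h0 h1 h2
  set b := n + n * n with hb
  let σ : St := ⟨fun x => R₁ (reg x), fun A i => M (b + 32 * i + A.ctorIdx)⟩
  have hs : Sim M b σ R₁ M := ⟨fun _ => rfl, i1, i4, fun _ _ => rfl, fun _ _ => rfl⟩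
  obtain ⟨t₂, l₂, R₂, M₂, e₂, s₂, -⟩ := algorithm.compile_spec hM 0 σ R₁ M hs
  have hn : R₂ 0 = n := by
    have := s₂.var .n
    rw [(Loop.frame M algorithm σ).v rfl] at this
    exact this.trans i0
  obtain ⟨t₃, l₃, R₃, M₃, e₃, f₃, o₃⟩ := postlude_spec (M := M₂) hn s₂.base s₂.one (by omega)
  refine ⟨σ, i0, i3, i6, fun A i => hM _ (by omega), _, ?_, R₃, M₃, e₁.seq (e₂.seq e₃), ?_,
    fun v hv => ?_⟩
  · omega
  · rw [f₃, s₂.var]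
  · rw [o₃ v hv, s₂.arr]

end Loop

namespace Cut

open Relation

/-- Needed because `CutRel` is directed out of the cut while `Mono` is symmetric: the two generate
the same equivalence without being equal. -/
theorem rk_le_rk_of_eqvGen {n : ℕ} {R R' : ℕ → ℕ → Prop} (h : ∀ u v, R u v → EqvGen R' u v) :
    rk n R ≤ rk n R' :=
  Nat.sub_le_sub_left (card_image_le_of_imp fun u _ v _ e => least_eq_iff.2 (by
    have e' := least_eq_iff.1 e
    clear * - e' h
    induction e' with
    | rel a b hab => exact h a b hab
    | refl a => exact .refl a
    | symm a b _ ih => exact .symm _ _ ih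
    | trans a b c _ _ ih₁ ih₂ => exact .trans _ _ _ ih₁ ih₂)) n

end Cut

namespace Loop

open Cut Finset Relation

/-! #### The input -/

section Input

variable (I : CheapColoringExtension)

theorem mul_add_lt {n u v : ℕ} (hu : u < n) (hv : v < n) : u * n + v < n * n :=
  calc u * n + v < u * n + n := by omega
    _ = (u + 1) * n := by ring
    _ ≤ n * n := Nat.mul_le_mul_right _ hu

theorem inputMem_of_le {a : ℕ} (h : I.n + I.n * I.n ≤ a) : I.inputMem a = 0 := by
  rw [CheapColoringExtension.inputMem, if_neg, if_neg, if_neg]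
  · rintro ⟨u, v, rfl, -⟩
    have := mul_add_lt u.2 v.2
    omega
  · rintro ⟨v, -, rfl⟩
    have := v.2
    omega
  · rintro ⟨v, -, rfl⟩
    have := v.2
    omega

theorem inputMem_of_lt (v : Fin I.n) :
    I.inputMem v = if v ∈ I.T₁ then 1 else if v ∈ I.T₂ then 2 else 0 := by
  have key : ∀ T : Finset (Fin I.n), (∃ w ∈ T, v.1 = w.1) ↔ v ∈ T := fun T =>
    ⟨by rintro ⟨w, hw, e⟩; rwa [Fin.ext e], fun h => ⟨v, h, rfl⟩⟩
  rw [CheapColoringExtension.inputMem]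
  simp only [key]
  rw [if_neg (c := ∃ u w : Fin I.n, _)]
  rintro ⟨u, w, e, -⟩
  have := v.2
  rw [e] at this
  have := Nat.le_add_right I.n (u.1 * I.n)
  omega

theorem inputMem_adj (u v : Fin I.n) : I.inputMem (I.n + (u.1 * I.n + v.1)) ≠ 0 ↔ I.G.Adj u v := by
  have hn : 0 < I.n := u.pos
  have key : (∃ u' v' : Fin I.n, I.n + (u.1 * I.n + v.1) = I.n + u'.1 * I.n + v'.1 ∧ I.G.Adj u' v') ↔
      I.G.Adj u v := by
    constructor
    · rintro ⟨u', v', e, h⟩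
      have e' : v.1 + I.n * u.1 = v'.1 + I.n * u'.1 := by
        rw [mul_comm I.n, mul_comm I.n]; omega
      have e1 := congrArg (· / I.n) e'
      have e2 := congrArg (· % I.n) e'
      simp only [Nat.add_mul_div_left _ _ hn, Nat.div_eq_of_lt v.2, Nat.div_eq_of_lt v'.2, zero_add,
        Nat.add_mul_mod_self_left, Nat.mod_eq_of_lt v.2, Nat.mod_eq_of_lt v'.2] at e1 e2
      rwa [Fin.ext e1, Fin.ext e2]
    · intro h
      exact ⟨u, v, by ring, h⟩
  rw [CheapColoringExtension.inputMem, if_neg, if_neg]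
  · by_cases h : I.G.Adj u v
    · rw [if_pos (key.2 h)]
      simp [h]
    · rw [if_neg (mt key.1 h)]
      simp [h]
  · rintro ⟨w, -, e⟩
    have := w.2
    omega
  · rintro ⟨w, -, e⟩
    have := w.2
    omega

theorem adj_iff {u v : ℕ} : adj I.inputMem I.n u v ↔
    ∃ (hu : u < I.n) (hv : v < I.n), I.G.Adj ⟨u, hu⟩ ⟨v, hv⟩ :=
  ⟨fun ⟨hu, hv, h⟩ => ⟨hu, hv, (inputMem_adj I ⟨u, hu⟩ ⟨v, hv⟩).1 h⟩,
    fun ⟨hu, hv, h⟩ => ⟨hu, hv, (inputMem_adj I ⟨u, hu⟩ ⟨v, hv⟩).2 h⟩⟩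

theorem isGraph : IsGraph (adj I.inputMem I.n) I.n where
  symm h := by
    obtain ⟨hu, hv, h⟩ := (adj_iff I).1 h
    exact (adj_iff I).2 ⟨hv, hu, h.symm⟩
  lt h := h.1
  ne h := by
    obtain ⟨hu, hv, h⟩ := (adj_iff I).1 h
    exact fun e => h.ne (Fin.ext e)

theorem exists_proper : ∃ f, Proper (adj I.inputMem I.n) f I.n := by
  obtain ⟨c⟩ := I.bipartite
  refine ⟨fun v => if h : v < I.n then (c ⟨v, h⟩).val else 0, fun {v} hv => ?_, fun {u v} h => ?_⟩
  · simp only [dif_pos hv]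
    omega
  · obtain ⟨hu, hv, h⟩ := (adj_iff I).1 h
    simp only [dif_pos hu, dif_pos hv]
    exact fun e => c.valid h (Fin.ext e)

theorem card_asSet_le : (asSet I.n I.inputMem).card ≤ I.t := by
  classical
  refine le_trans ?_ I.card_le
  refine le_trans (card_le_card (t := (I.T₁ ∪ I.T₂).image Fin.val) fun v hv => ?_)
    (card_image_le.trans (card_union_le _ _))
  obtain ⟨h, hv⟩ := mem_asSet.1 hv
  rw [inputMem_of_lt I ⟨v, h⟩] at hv
  refine mem_image.2 ⟨⟨v, h⟩, ?_, rfl⟩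
  rw [mem_union]
  split_ifs at hv with h1 h2
  · exact Or.inl h1
  · exact Or.inr h2
  · exact absurd rfl hv

variable {I}

/-- The ends of an edge have different values of `pa`, so they get the same color exactly if one of
them lies in `X`. Thus the monochromatic edges are the cut edges without their direction, and the
prescribed colors become prescribed sides. -/
theorem sol_iff {pa : ℕ → ℕ} (hp : Proper (adj I.inputMem I.n) pa I.n) {X : Finset ℕ}
    (hX : X ⊆ range I.n) {φ : TwoColoring (Fin I.n)} (hφ : ∀ v, φ v = 0 ↔ (v.1 ∈ X ↔ pa v = 1)) :
    Sol (adj I.inputMem I.n) I.n I.k (termIn I.inputMem I.n pa) (termOut I.inputMem I.n pa) X ↔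
      I.IsSolution φ := by
  have h01 : ∀ v : Fin I.n, φ v = 1 ↔ ¬ φ v = 0 := fun v => by
    have := (φ v).2
    simp only [Fin.ext_iff, Fin.val_zero, Fin.val_one]
    omega
  have hpa : ∀ v : Fin I.n, pa v = 0 ↔ ¬ pa v = 1 := fun v => by have := hp.le v.2; omega
  have hin : ∀ v : Fin I.n, v.1 ∈ termIn I.inputMem I.n pa ↔
      v ∈ I.T₁ ∧ pa v = 1 ∨ v ∈ I.T₂ ∧ pa v = 0 := fun v => by
    have : v ∈ I.T₁ → v ∉ I.T₂ := fun h => Finset.disjoint_left.1 I.disjoint h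
    simp only [termIn, mem_filter, mem_range, v.2, true_and, inputMem_of_lt]
    split_ifs <;> simp_all
  have hout : ∀ v : Fin I.n, v.1 ∈ termOut I.inputMem I.n pa ↔
      v ∈ I.T₁ ∧ pa v = 0 ∨ v ∈ I.T₂ ∧ pa v = 1 := fun v => by
    have : v ∈ I.T₁ → v ∉ I.T₂ := fun h => Finset.disjoint_left.1 I.disjoint h
    simp only [termOut, mem_filter, mem_range, v.2, true_and, inputMem_of_lt]
    split_ifs <;> simp_all
  have hrk : rk I.n (CutRel (adj I.inputMem I.n) (range I.n) X) = φ.cost I.G := by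
    rw [cost_eq_rk]
    have hφ' : ∀ u v : Fin I.n, pa u ≠ pa v → (φ u = φ v ↔ ¬ (u.1 ∈ X ↔ v.1 ∈ X)) := by
      intro u v huv
      have e : φ u = φ v ↔ (φ u = 0 ↔ φ v = 0) := by
        by_cases h1 : φ u = 0 <;> by_cases h2 : φ v = 0
        · simp [h1, h2]
        · simp [h1, h2, (h01 v).2 h2]
        · simp [h1, h2, (h01 u).2 h1]
        · simp [(h01 v).2 h2, (h01 u).2 h1]
      have l1 := hp.le u.2
      have l2 := hp.le v.2
      rw [e, hφ, hφ]
      have : pa v = 1 ↔ ¬ pa u = 1 := by omega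
      rw [this]
      tauto
    -- Every directed cut edge is monochromatic; conversely a monochromatic edge is a cut edge in
    -- one of its two directions.
    refine le_antisymm (rk_mono fun u v h => ?_) (rk_le_rk_of_eqvGen fun u v h => ?_)
    · obtain ⟨h1, h2, h3, h4⟩ := mem_bd.1 h
      obtain ⟨hu, hv, h5⟩ := (adj_iff I).1 h4
      exact ⟨hu, hv, h5, (hφ' ⟨u, hu⟩ ⟨v, hv⟩ (hp.ne h4)).2 (by simp [h1, h3])⟩
    · obtain ⟨hu, hv, h5, h6⟩ := h
      have h4 := (adj_iff I).2 ⟨hu, hv, h5⟩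
      rw [hφ' _ _ (hp.ne h4)] at h6
      by_cases h1 : u ∈ X
      · exact .rel _ _ (mem_bd.2 ⟨h1, mem_range.2 hv, by simpa [h1] using h6, h4⟩)
      · exact .symm _ _ (.rel _ _ (mem_bd.2 ⟨by simpa [h1] using h6, mem_range.2 hu, h1,
          (isGraph I).symm h4⟩))
  constructor
  · intro h
    refine ⟨⟨fun v hv => ?_, fun v hv => ?_⟩, hrk ▸ h.rk_le⟩
    · rw [hφ]
      by_cases h1 : pa v = 1
      · exact iff_of_true (h.left ((hin v).2 (Or.inl ⟨hv, h1⟩))) h1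
      · exact iff_of_false (h.right ((hout v).2 (Or.inl ⟨hv, (hpa v).2 h1⟩))) h1
    · rw [h01, hφ]
      by_cases h1 : pa v = 1
      · have := h.right ((hout v).2 (Or.inr ⟨hv, h1⟩))
        tauto
      · have := h.left ((hin v).2 (Or.inr ⟨hv, (hpa v).2 h1⟩))
        tauto
  · rintro ⟨⟨h1, h2⟩, h3⟩
    refine ⟨hX, fun {v} hv => ?_, fun {v} hv => ?_, hrk ▸ h3⟩
    · have hn : v < I.n := mem_range.1 (mem_filter.1 hv).1
      rcases (hin ⟨v, hn⟩).1 hv with ⟨a, b⟩ | ⟨a, b⟩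
      · exact ((hφ _).1 (h1 _ a)).2 b
      · have := (h01 _).1 (h2 _ a)
        rw [hφ] at this
        have := (hpa _).1 b
        tauto
    · have hn : v < I.n := mem_range.1 (mem_filter.1 hv).1
      rcases (hout ⟨v, hn⟩).1 hv with ⟨a, b⟩ | ⟨a, b⟩
      · exact fun h => (hpa _).1 b (((hφ _).1 (h1 _ a)).1 h)
      · have := (h01 _).1 (h2 _ a)
        rw [hφ] at this
        tauto

theorem exists_sol {pa : ℕ → ℕ} (hp : Proper (adj I.inputMem I.n) pa I.n)
    {φ : TwoColoring (Fin I.n)} (h : I.IsSolution φ) :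
    ∃ X, Sol (adj I.inputMem I.n) I.n I.k (termIn I.inputMem I.n pa) (termOut I.inputMem I.n pa) X := by
  classical
  refine ⟨(univ.filter fun v : Fin I.n => φ v = 0 ↔ pa v = 1).image Fin.val,
    (sol_iff hp (fun v hv => ?_) fun v => ?_).2 h⟩
  · obtain ⟨w, -, rfl⟩ := mem_image.1 hv
    exact mem_range.2 w.2
  · have : v.1 ∈ (univ.filter fun v : Fin I.n => φ v = 0 ↔ pa v = 1).image Fin.val ↔
        (φ v = 0 ↔ pa v = 1) := by
      constructor
      · intro hv
        obtain ⟨w, hw, e⟩ := mem_image.1 hv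
        rw [← Fin.ext e]
        exact (mem_filter.1 hw).2
      · exact fun hv => mem_image_of_mem _ (mem_filter.2 ⟨mem_univ _, hv⟩)
    rw [this]
    tauto

theorem isCorrectOutput {P : Pars} (hPn : P.n = I.n) (hPk : P.k = I.k) {pa : ℕ → ℕ}
    (hp : Proper (adj I.inputMem I.n) pa I.n) {found : ℕ} {OUT : ℕ → ℕ}
    (h : Answer I.inputMem P pa (fun _ => True) found OUT) {C : RAM.Config} (h0 : C.reg 0 = found)
    (hC : ∀ v < I.n, C.mem v = OUT v) : I.IsCorrectOutput C := by
  rw [Answer, hPn, hPk] at h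
  rcases h with ⟨hf, h⟩ | ⟨hf, X, hX, h⟩
  · refine Or.inr ⟨h0.trans hf, ?_⟩
    rintro ⟨φ, hφ⟩
    obtain ⟨X, hX⟩ := exists_sol hp hφ
    exact h X trivial hX
  · classical
    refine Or.inl ⟨h0.trans hf, fun v => if (v.1 ∈ X ↔ pa v = 1) then 0 else 1,
      (sol_iff hp hX.sub fun v => ?_).1 hX, fun v => ?_⟩
    · split_ifs with hv <;> simp [hv]
    · rw [hC v v.2, h v v.2]
      by_cases hv : v.1 ∈ X ↔ pa v = 1 <;> simp [hv]

end Input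

/-! #### The running time -/

theorem primrec_pow : Primrec₂ ((· ^ ·) : ℕ → ℕ → ℕ) := Primrec₂.unpaired'.1 Nat.Primrec.pow

/-- The dependence of the running time on `k` and `t`. -/
def time (k t : ℕ) : ℕ := (algorithm.coef + 50) * ((pars 0 k t).NG + 2) ^ max 2 solve.depth

/-- The bound is a composition of sums, products and powers, hence primitive recursive; the number
`NG` of guesses does not depend on `n`. -/
theorem computable_time : Computable₂ time := by
  have k : Primrec fun p : ℕ × ℕ => p.1 := Primrec.fst
  have t : Primrec fun p : ℕ × ℕ => p.2 := Primrec.snd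
  have c : ∀ m : ℕ, Primrec fun _ : ℕ × ℕ => m := fun m => Primrec.const m
  have K := Primrec.nat_mul.comp (c 4) (Primrec.nat_mul.comp k k)
  have tau := Primrec.nat_add.comp t (Primrec.nat_mul.comp (c 2) K)
  have q := primrec_pow.comp (c 2) (primrec_pow.comp (c 2)
    (Primrec.nat_add.comp (Primrec.nat_add.comp tau k) (Primrec.nat_mul.comp tau tau)))
  have D := Primrec.nat_add.comp (Primrec.nat_mul.comp (Primrec.nat_add.comp K (c 1))
    (Primrec.nat_add.comp q (c 2))) (c 1)
  have L := Primrec.nat_add.comp tau (Primrec.nat_mul.comp D (Primrec.nat_add.comp q K))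
  have f := Primrec.nat_mul.comp (c (algorithm.coef + 50)) (primrec_pow.comp
    (Primrec.nat_add.comp (primrec_pow.comp (c 2) L) (c 2)) (c (max 2 solve.depth)))
  exact f.to_comp

theorem program_solvesWithin (I : CheapColoringExtension) :
    program.SolvesWithin I (time I.k I.t * max I.n 1 ^ max 2 solve.depth) := by
  obtain ⟨σ, hn, hk, ht, h0, T, hT, R', M', hrun, hf, hout⟩ :=
    program_spec (R := I.inputReg) (M := I.inputMem) (n := I.n) (k := I.k) (t := I.t) rfl rfl rfl
      fun i hi => inputMem_of_le I hi
  have hv := pars_valid I.n I.k I.t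
  have htau : (pars I.n I.k I.t).tau =
      I.t + ((pars I.n I.k I.t).K + (pars I.n I.k I.t).K) := by rw [← two_mul]; rfl
  have hNG : (pars I.n I.k I.t).NG = (pars 0 I.k I.t).NG := rfl
  have hPn : (pars I.n I.k I.t).n = I.n := rfl
  have hPk : (pars I.n I.k I.t).k = I.k := rfl
  rw [time, ← hNG]
  generalize pars I.n I.k I.t = P at *
  set d := max 2 solve.depth with hd
  set B := (P.NG + 2) * max I.n 1 with hB
  obtain ⟨⟨σ', hσ', e⟩, hc⟩ :=
    algorithm_spec (I := I.inputMem) hv hPn hPk htau hn hk ht h0 hB.ge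
  obtain ⟨f, hfp⟩ := exists_proper I
  obtain ⟨pa, hp, ha⟩ := solve_spec hv hσ' (by rw [hPn]; exact isGraph I) (f := f)
    (by rwa [hPn]) (by rw [hPn]; exact (card_asSet_le I).trans (by omega))
  rw [hPn] at hp
  rw [← e] at ha
  -- The summand `50` absorbs the linear cost `32 * n + 18` of moving the input and the output.
  have hTB : T ≤ (algorithm.coef + 50) * (P.NG + 2) ^ d * max I.n 1 ^ d := by
    rw [mul_assoc, ← mul_pow, ← hB, add_mul]
    have h1 : max I.n 1 ≤ B := Nat.le_mul_of_pos_left _ (by omega)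
    have h2 : B ≤ B ^ d := Nat.le_self_pow (by omega) B
    have h3 := le_max_left I.n 1
    have h4 := le_max_right I.n 1
    simp only [Cheap, ← hd] at hc
    omega
  have hr := run_eq_of_exec hrun hTB
  refine ⟨by rw [hr], isCorrectOutput hPn hPk hp ha ?_ fun v hv => ?_⟩
  · rw [hr]
    exact hf
  · rw [hr]
    exact hout v hv

end Loop

theorem mainTheorem2 :
    ∃ (P : RAM.Program) (f : ℕ → ℕ → ℕ) (c : ℕ), Computable₂ f ∧
      ∀ I : CheapColoringExtension, P.SolvesWithin I (f I.k I.t * (max I.n 1) ^ c) :=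
  ⟨Loop.program, Loop.time, _, Loop.computable_time, Loop.program_solvesWithin⟩
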